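/- **Setting.** Let $d\ge 0$, let $A_1,\dots,A_d$ and $V$ be real-valued smooth functions on $\mathbb R^d$, and put $B_{jk}=\partial_{x_j}A_k-\partial_{x_k}A_j$. Assume that all $B_{jk}$ and $V$ are bounded together with all their derivatives of arbitrary order. Let $\varphi\in\mathcal S(\mathbb R)$. For $x_0\in\mathbb R^d$ let $$A^{(x_0)}_j(x_0+Z)=\sum_{k=1}^d\Big(\int_0^1 B_{kj}(x_0+\tau Z)\,\tau\,d\tau\Big)Z_k ,\qquad Z\in\mathbb R^d,$$ be the magnetic potential of $B$ in the radial gauge at $x_0$. For $t>0$ put $$\nabla_{t,j}=\frac1i\frac{\partial}{\partial Z_j}-\frac1t A^{(x_0)}_j(x_0+tZ),\qquad \mathcal H_t=\sum_{j=1}^d\nabla_{t,j}^2+V(x_0+tZ).$$ This is the operator $\hbar^{-1}\big(\sum_j(\frac{\hbar}{i}\partial_{x_j}-A^{(x_0)}_j(x))^2+\hbar V(x)\big)$ with $\hbar=t^2$, written in the rescaled variable $Z=(x-x_0)/t$. It is essentially self-adjoint in $L^2(\mathbb R^d)$ on $C_c^\infty(\mathbb R^d)$; $\mathcal H_t$ also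 denotes its closure, and $\varphi(\mathcal H_t)$ is defined by the spectral theorem. For an integer $m\ge 0$ let $$\|u\|_{t,m}^2=\sum_{\ell=0}^m\ \sum_{j_1,\dots,j_\ell=1}^d\|\nabla_{t,j_1}\cdots\nabla_{t,j_\ell}u\|_{L^2}^2$$ (with weak derivatives). For an integer $m<0$ let $\|\cdot\|_{t,m}$ be the norm dual to $\|\cdot\|_{t,-m}$ with respect to the $L^2$ inner product. For $m\in\mathbb Z$, $M,N\in\mathbb Z_+$ and $W\in\mathbb R^d$ let $$\|u\|_{t,m,M,N,W}=\sum_{|\alpha|\le M,\ |\beta|\le N}\big\|Z^\alpha (Z-W)^\beta u\big\|_{t,m}.$$ **Theorem 8.** For every $x_0\in\mathbb R^d$ and $u\in C_c^\infty(\mathbb R^d)$ the function $t\mapsto\varphi(\mathcal H_t)u$ from $(0,\infty)$ to $L^2(\mathbb R^d)$ is infinitely differentiable. Moreover, for any $t_0>0$, any integer $r\ge 0$, any $m,m'\in\mathbb Z$ and any $M,N\in\mathbb Z_+$ there exists $C>0$ such that, for all $x_0\in\mathbb R^d$, $t\in(0,t_0]$ and $W\in\mathbb R^d$, $$\Big\|\frac{\partial^r}{\partial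 t^r}\varphi(\mathcal H_t)u\Big\|_{t,m,M,N,W}\le C\,\|u\|_{t,m',M+2r,N,W},\qquad u\in C_c^\infty(\mathbb R^d).$$ -/

import Mathlib

open MeasureTheory Set
open scoped ContDiff SchwartzMap ENNReal ComplexConjugate

namespace MagneticSchrodinger

noncomputable section

/-! ### Functional calculus of an unbounded self-adjoint operator -/

section FunctionalCalculus

variable {H : Type*} [NormedAddCommGroup H] [InnerProductSpace ℂ H] [CompleteSpace H]

/-- `R` is the bounded everywhere defined inverse of `T - z`. -/
def IsResolvent (T : H →ₗ.[ℂ] H) (z : ℂ) (R : H →L[ℂ] H) : Prop :=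
  (∀ x : H, ∃ h : R x ∈ T.domain, T ⟨R x, h⟩ - z • R x = x) ∧
    ∀ y : T.domain, R (T y - z • (y : H)) = y

open Classical in
/-- The resolvent `(T - z)⁻¹` (it is unique when it exists; `0` if `z` is in the spectrum). -/
def resolvent (T : H →ₗ.[ℂ] H) (z : ℂ) : H →L[ℂ] H :=
  if h : ∃ R : H →L[ℂ] H, IsResolvent T z R then h.choose else 0

/-- The operator `φ(T)` for a self-adjoint, possibly unbounded, operator `T` and a function `φ`
on the line that is continuous and vanishes at infinity. The bounded operator `(T + i)⁻¹` is
normal and corresponds to the function `λ ↦ w = (λ + i)⁻¹` on the spectrum of `T`, so that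
`λ = Re (1 / w)`, while `w = 0` corresponds to `λ = ∞`. Hence `φ(T)` is the function
`w ↦ φ (Re (1 / w))`, `0 ↦ 0`, of the bounded normal operator `(T + i)⁻¹`. -/
def functionOf (φ : ℝ → ℂ) (T : H →ₗ.[ℂ] H) : H →L[ℂ] H :=
  cfc (fun w : ℂ => if w = 0 then 0 else φ (w⁻¹).re) (resolvent T (-Complex.I))

end FunctionalCalculus

/-! ### Function spaces and differential expressions on `ℝ^d` -/

/-- The Euclidean space `ℝ^d`. -/
abbrev Space (d : ℕ) : Type := EuclideanSpace ℝ (Fin d)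

/-- The Hilbert space `L²(ℝ^d)` of complex functions, with Lebesgue measure. -/
abbrev L2 (d : ℕ) : Type := Lp ℂ 2 (volume : Measure (Space d))

variable {d : ℕ}

/-- Smooth functions that are bounded along with all their derivatives: `C_b^∞(ℝ^d)`. -/
def IsCbInfty (f : Space d → ℝ) : Prop :=
  ContDiff ℝ ∞ f ∧ ∀ n : ℕ, ∃ C : ℝ, ∀ x, ‖iteratedFDeriv ℝ n f x‖ ≤ C

/-- Test functions: `C_c^∞(ℝ^d)`. -/
def IsTest (u : Space d → ℂ) : Prop :=
  ContDiff ℝ ∞ u ∧ HasCompactSupport u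

theorem IsTest.memLp {u : Space d → ℂ} (hu : IsTest u) :
    MemLp u 2 (volume : Measure (Space d)) :=
  hu.1.continuous.memLp_of_hasCompactSupport hu.2

/-- A test function as an element of `L²(ℝ^d)`. -/
def IsTest.toL2 {u : Space d → ℂ} (hu : IsTest u) : L2 d :=
  hu.memLp.toLp u

/-- The partial derivative `∂f/∂x_j`. -/
def partialDeriv {F : Type*} [NormedAddCommGroup F] [NormedSpace ℝ F]
    (j : Fin d) (f : Space d → F) (x : Space d) : F :=
  fderiv ℝ f x (EuclideanSpace.single j 1)

/-- The magnetic field `B_{jk} = ∂A_k/∂x_j - ∂A_j/∂x_k` of the potential `A`. -/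
def magneticField (A : Fin d → Space d → ℝ) (j k : Fin d) (x : Space d) : ℝ :=
  partialDeriv j (A k) x - partialDeriv k (A j) x

/-- The potential of the magnetic field of `A` in the radial gauge at `x₀`, as a function of
`Z = x - x₀`:  `A^{(x₀)}_j(x₀ + Z) = ∑_k (∫₀¹ B_{kj}(x₀ + τ Z) τ dτ) Z_k`. -/
def radialPotential (A : Fin d → Space d → ℝ) (x₀ : Space d) (j : Fin d) (Z : Space d) : ℝ :=
  ∑ k : Fin d, (∫ τ in (0 : ℝ)..1, magneticField A k j (x₀ + τ • Z) * τ) * Z k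

/-- The rescaled potential `t⁻¹ A^{(x₀)}_j(x₀ + t Z)`. -/
def rescaledPotential (A : Fin d → Space d → ℝ) (x₀ : Space d) (t : ℝ)
    (j : Fin d) (Z : Space d) : ℝ :=
  t⁻¹ * radialPotential A x₀ j (t • Z)

/-- The covariant derivative `∇_j = (1/i) ∂/∂Z_j - a_j(Z)` with potential `a`. -/
def nabla (a : Fin d → Space d → ℝ) (j : Fin d) (u : Space d → ℂ) (Z : Space d) : ℂ :=
  (1 / Complex.I) * partialDeriv j u Z - (a j Z : ℂ) * u Z

/-- The iterated derivative `∇_{j₁} ⋯ ∇_{j_ℓ} u`, for `J = [j₁, …, j_ℓ]`. -/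
def nablaList (a : Fin d → Space d → ℝ) (J : List (Fin d)) (u : Space d → ℂ) : Space d → ℂ :=
  J.foldr (nabla a) u

/-! ### The magnetic Schrödinger operator -/

/-- The differential expression `∑_j ∇_j² u + v u`. -/
def schrodingerExpr (a : Fin d → Space d → ℝ) (v : Space d → ℝ) (u : Space d → ℂ)
    (Z : Space d) : ℂ :=
  ∑ j : Fin d, nabla a j (nabla a j u) Z + (v Z : ℂ) * u Z

/-- The graph of the operator `∑_j ∇_j² + v` in `L²(ℝ^d)` with domain `C_c^∞(ℝ^d)`. -/
def testGraph (a : Fin d → Space d → ℝ) (v : Space d → ℝ) : Set (L2 d × L2 d) :=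
  {p | ∃ u : Space d → ℂ, IsTest u ∧ p.1 =ᵐ[volume] u ∧ p.2 =ᵐ[volume] schrodingerExpr a v u}

/-- The closure in `L²(ℝ^d)` of the operator `∑_j ∇_j² + v` with initial domain `C_c^∞(ℝ^d)`.
For smooth coefficients `testGraph a v` is already a linear subspace and the span does not
change it. For an essentially self-adjoint operator the closure is the unique self-adjoint
extension. -/
def schrodingerOp (a : Fin d → Space d → ℝ) (v : Space d → ℝ) : L2 d →ₗ.[ℂ] L2 d :=
  (Submodule.span ℂ (testGraph a v)).toLinearPMap.closure

/-- The rescaled operator `∑_j ∇_{t,j}² + V(x₀ + t Z)`, where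
`∇_{t,j} = (1/i) ∂/∂Z_j - t⁻¹ A^{(x₀)}_j(x₀ + t Z)`. -/
def rescaledOp (A : Fin d → Space d → ℝ) (V : Space d → ℝ) (x₀ : Space d) (t : ℝ) :
    L2 d →ₗ.[ℂ] L2 d :=
  schrodingerOp (rescaledPotential A x₀ t) (fun Z => V (x₀ + t • Z))

/-! ### Weighted magnetic Sobolev norms -/

/-- `w ∈ L²(ℝ^d)` is the weak derivative `∇_{j₁} ⋯ ∇_{j_ℓ} f`. Each `∇_j` is formally symmetric
(the potential is real), so it is moved to the test function in the reverse order. -/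
def IsWeakNabla (a : Fin d → Space d → ℝ) (J : List (Fin d)) (f : Space d → ℂ) (w : L2 d) :
    Prop :=
  ∀ v : Space d → ℂ, IsTest v →
    ∫ Z, f Z * conj (nablaList a J.reverse v Z) = ∫ Z, w Z * conj (v Z)

/-- The `L²` norm of the weak derivative `∇_{j₁} ⋯ ∇_{j_ℓ} f` of a locally integrable function;
it is `∞` if this derivative is not in `L²`. (The weak derivative is unique.) -/
def nablaNorm (a : Fin d → Space d → ℝ) (J : List (Fin d)) (f : Space d → ℂ) : ℝ≥0∞ :=
  ⨅ (w : L2 d) (_ : IsWeakNabla a J f w), ‖w‖ₑ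

/-- The magnetic Sobolev norm of order `m ≥ 0`:
`(∑_{ℓ ≤ m} ∑_{j₁, …, j_ℓ} ‖∇_{j₁} ⋯ ∇_{j_ℓ} f‖²)^{1/2}`. -/
def sobolevNormNat (a : Fin d → Space d → ℝ) (m : ℕ) (f : Space d → ℂ) : ℝ≥0∞ :=
  (∑ ℓ ∈ Finset.range (m + 1), ∑ J : Fin ℓ → Fin d, nablaNorm a (List.ofFn J) f ^ 2)
    ^ (1 / 2 : ℝ)

/-- The magnetic Sobolev norm of integer order; for a negative order it is the norm dual, with
respect to the inner product of `L²(ℝ^d)`, to the norm of the opposite order. -/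
def sobolevNorm (a : Fin d → Space d → ℝ) : ℤ → (Space d → ℂ) → ℝ≥0∞
  | Int.ofNat m, f => sobolevNormNat a m f
  | Int.negSucc m, f =>
      ⨆ (v : Space d → ℂ) (_ : IsTest v),
        ‖∫ Z, f Z * conj (v Z)‖ₑ / sobolevNormNat a (m + 1) v

/-- The multi-indices `α ∈ ℤ_+^d` with `|α| ≤ M`. -/
def multiIndices (d M : ℕ) : Finset (Fin d → ℕ) :=
  (Fintype.piFinset fun _ => Finset.range (M + 1)).filter fun α => ∑ i, α i ≤ M

/-- The monomial `Z^α = Z_1^{α_1} ⋯ Z_d^{α_d}`. -/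
def monomial (α : Fin d → ℕ) (Z : Space d) : ℝ :=
  ∏ i, Z i ^ α i

/-- The weighted magnetic Sobolev norm
`∑_{|α| ≤ M, |β| ≤ N} ‖Z^α (Z - W)^β f‖_m`. -/
def weightedNorm (a : Fin d → Space d → ℝ) (m : ℤ) (M N : ℕ) (W : Space d)
    (f : Space d → ℂ) : ℝ≥0∞ :=
  ∑ α ∈ multiIndices d M, ∑ β ∈ multiIndices d N,
    sobolevNorm a m (fun Z => (monomial α Z : ℂ) * (monomial β (Z - W) : ℂ) * f Z)

end

end MagneticSchrodinger

/-! The proof expands `φ(H)` in powers of the Cayley transform. With `λ = -cot (θ/2)` one has `(λ -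
i)/(λ + i) = e^{iθ}`, and for a Schwartz function `φ` the Fourier coefficients `c_n` of `(λ + i)^p
φ(λ)` in the variable `θ` decay faster than every power of `n`. Hence `φ(H) = ∑ c_n U^n R^p` over `n
∈ ℤ`, where `R = (H + i)⁻¹` and `U = 1 - 2iR` is unitary (`hasSum_functionOf`). It remains to bound
the `t`-derivatives of `U^n R^p`, multiplied by weights and covariant derivatives, by polynomials in
`n`, uniformly in `x₀`, `W` and bounded `t`. The exponent `p` is free and is adapted to `m` and
`m'`.

Polynomial growth in `n` comes from the generating series `G = ∑ U^n X^n = (1 - XU)⁻¹` over `n ≥ 0`,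
together with the analogous series for the inverse of `U`. A derivative or a commutator of an
inverse is again a product containing inverses, and Cauchy products preserve polynomial growth of
coefficients (`SerBdd.mul`). So one considers the algebra `C` generated by bounded multiplications,
`R`, `∇R`, `R∇`, `∇R∇`, `G` and `X`, with both resolvents `(H ± i)⁻¹` in the role of `R`. Its
elements have polynomially bounded coefficients in `L²` (`FieldData.serBdd`). Commutators with `Z_j`
and `∇_j` preserve it (`Good.ad_mem`), because the commutator of two covariant derivatives is the
magnetic field, which is bounded although the potential is not. The `t`-derivative maps `C` into
polynomials of degree 2 in `Z` with coefficients in `C` (`FieldData.exists_hasDSer`), because the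
`t`-derivative of the rescaled radial potential is quadratic in `Z` with bounded coefficients. This
is the origin of `M + 2r`.

Resolvents can be moved through `C`, so `R^p` absorbs the covariant derivatives on the left and
still leaves `R^k` next to `u`, with `k = max (-m') 0`. The weights are commuted to the right onto
`u`, and the constant `W` drops out of every commutator (`FieldData.wordBdd`). Finally `‖R^k g‖` is
bounded by the norm of order `m'` of `g`, by duality when `m' < 0`
(`FieldData.exists_resFam_le_sobolevNorm`).

These computations take place in the ring of linear operators on the Schwartz space, so `H ± i` must
be bijective there (`surjective_hamOp`). A priori estimates in norms defined by words are obtained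
by commutation. Solvability follows from the Fourier transform for the free operator, from a
continuity method for bounded potentials, and from a truncation with uniform bounds on the field for
potentials of linear growth. Cutoffs then show that the closure from `C_c^∞` has the same resolvent
(`graph_schrodingerOp`). -/

namespace MagneticSchrodinger

noncomputable section

variable {d : ℕ}

open LineDeriv

/-! ### Multiplications and derivatives on the Schwartz space. -/

/-- The Schwartz space of complex functions on `ℝ^d`. -/
abbrev SpaceS (d : ℕ) : Type := 𝓢(Space d, ℂ)

/-- Linear operators on the Schwartz space. -/
abbrev Op (d : ℕ) : Type := Module.End ℂ (SpaceS d)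

/-- The inclusion of the Schwartz space into `L²`. -/
def toL2 : SpaceS d →L[ℂ] L2 d := SchwartzMap.toLpCLM ℂ ℂ 2 volume

/-- Multiplication by a function of temperate growth. -/
def mulOp (g : Space d → ℂ) : Op d := (SchwartzMap.smulLeftCLM ℂ g).toLinearMap

/-- The operator `(1/i) ∂/∂x_j`. -/
def dOp (j : Fin d) : Op d :=
  (1 / Complex.I) • (lineDerivOpCLM ℂ (SpaceS d) (EuclideanSpace.single j (1 : ℝ))).toLinearMap

/-- The coordinate function `x_j`. -/
def coord (j : Fin d) (x : Space d) : ℂ := (x j : ℂ)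

/-- Multiplication by the coordinate `x_j`. -/
def zOp (j : Fin d) : Op d := mulOp (coord j)

theorem coord_hasTemperateGrowth (j : Fin d) :
    Function.HasTemperateGrowth (coord (d := d) j) := by
  have h1 : Function.HasTemperateGrowth (fun x : Space d => x j) :=
    (EuclideanSpace.proj (𝕜 := ℝ) j).hasTemperateGrowth
  exact Function.HasTemperateGrowth.comp Complex.ofRealCLM.hasTemperateGrowth h1

theorem mulOp_apply {g : Space d → ℂ} (hg : g.HasTemperateGrowth) (u : SpaceS d) (x : Space d) :
    mulOp g u x = g x * u x := by
  simp [mulOp, SchwartzMap.smulLeftCLM_apply_apply hg]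

theorem continuous_mulOp (g : Space d → ℂ) : Continuous (mulOp g : SpaceS d → SpaceS d) :=
  (SchwartzMap.smulLeftCLM ℂ g).continuous

theorem dOp_apply (j : Fin d) (u : SpaceS d) (x : Space d) :
    dOp j u x = (1 / Complex.I) * partialDeriv j u x := by
  simp [dOp, partialDeriv, SchwartzMap.lineDerivOp_apply_eq_fderiv]

theorem continuous_dOp (j : Fin d) : Continuous (dOp j : SpaceS d → SpaceS d) :=
  ((1 / Complex.I) • (lineDerivOpCLM ℂ (SpaceS d) (EuclideanSpace.single j (1 : ℝ)))).continuous

theorem op_ext {S T : Op d} (h : ∀ u x, S u x = T u x) : S = T :=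
  LinearMap.ext fun u => SchwartzMap.ext fun x => h u x

theorem mulOp_mul {f g : Space d → ℂ} (hf : f.HasTemperateGrowth) (hg : g.HasTemperateGrowth) :
    mulOp f * mulOp g = mulOp (fun x => f x * g x) :=
  op_ext fun u x => by
    rw [Module.End.mul_apply, mulOp_apply hf, mulOp_apply hg,
      mulOp_apply (g := fun x => f x * g x) (hf.mul hg)]; ring

theorem mulOp_add {f g : Space d → ℂ} (hf : f.HasTemperateGrowth) (hg : g.HasTemperateGrowth) :
    mulOp f + mulOp g = mulOp (fun x => f x + g x) :=
  op_ext fun u x => by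
    have h : (fun x => f x + g x).HasTemperateGrowth := hf.add hg
    rw [LinearMap.add_apply, _root_.add_apply, mulOp_apply hf, mulOp_apply hg,
      mulOp_apply h]; ring

theorem mulOp_sub {f g : Space d → ℂ} (hf : f.HasTemperateGrowth) (hg : g.HasTemperateGrowth) :
    mulOp f - mulOp g = mulOp (fun x => f x - g x) :=
  op_ext fun u x => by
    have h : (fun x => f x - g x).HasTemperateGrowth := hf.sub hg
    rw [LinearMap.sub_apply, _root_.sub_apply, mulOp_apply hf, mulOp_apply hg,
      mulOp_apply h]; ring

theorem mulOp_smul {f : Space d → ℂ} (c : ℂ) (hf : f.HasTemperateGrowth) :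
    c • mulOp f = mulOp (fun x => c * f x) :=
  op_ext fun u x => by
    have h : (fun x => c * f x).HasTemperateGrowth := (Function.HasTemperateGrowth.const c).mul hf
    rw [LinearMap.smul_apply, _root_.smul_apply, mulOp_apply hf, mulOp_apply h, smul_eq_mul]
    ring

theorem mulOp_const (c : ℂ) : mulOp (fun _ : Space d => c) = c • (1 : Op d) :=
  op_ext fun u x => by
    rw [mulOp_apply (Function.HasTemperateGrowth.const c), LinearMap.smul_apply,
      _root_.smul_apply, Module.End.one_apply, smul_eq_mul]

theorem mulOp_sum {κ : Type*} (s : Finset κ) {f : κ → Space d → ℂ}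
    (hf : ∀ k ∈ s, (f k).HasTemperateGrowth) :
    ∑ k ∈ s, mulOp (f k) = mulOp (fun x => ∑ k ∈ s, f k x) := by
  have h : (fun x => ∑ k ∈ s, f k x).HasTemperateGrowth := Function.HasTemperateGrowth.sum hf
  refine op_ext fun u x => ?_
  rw [mulOp_apply h, LinearMap.sum_apply, _root_.sum_apply, Finset.sum_mul]
  exact Finset.sum_congr rfl fun k hk => mulOp_apply (hf k hk) u x

theorem partialDeriv_mul {f g : Space d → ℂ} {x : Space d} (j : Fin d)
    (hf : DifferentiableAt ℝ f x) (hg : DifferentiableAt ℝ g x) :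
    partialDeriv j (fun y => f y * g y) x = f x * partialDeriv j g x + partialDeriv j f x * g x := by
  simp [partialDeriv, fderiv_fun_mul hf hg, mul_comm]

theorem _root_.Function.HasTemperateGrowth.partialDeriv {g : Space d → ℂ}
    (hg : g.HasTemperateGrowth) (j : Fin d) : (partialDeriv j g).HasTemperateGrowth := by
  have h : (fderiv ℝ g).HasTemperateGrowth :=
    ⟨hg.1.fderiv_right (by simp), fun n => by
      obtain ⟨k, C, h⟩ := hg.2 (n + 1)
      exact ⟨k, C, fun x => by rw [norm_iteratedFDeriv_fderiv]; exact h x⟩⟩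
  exact ((ContinuousLinearMap.apply ℝ ℂ (EuclideanSpace.single j (1 : ℝ))).hasTemperateGrowth).comp h

theorem dOp_mul_mulOp {g : Space d → ℂ} (hg : g.HasTemperateGrowth) (j : Fin d) :
    dOp j * mulOp g = mulOp g * dOp j + mulOp (fun x => (1 / Complex.I) * partialDeriv j g x) := by
  have h : (fun x => (1 / Complex.I) * partialDeriv j g x).HasTemperateGrowth :=
    (Function.HasTemperateGrowth.const _).mul (hg.partialDeriv j)
  refine op_ext fun u x => ?_
  have e : (mulOp g u : Space d → ℂ) = fun y => g y * u y := funext fun y => mulOp_apply hg u y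
  rw [Module.End.mul_apply, LinearMap.add_apply, _root_.add_apply, Module.End.mul_apply,
    dOp_apply, mulOp_apply hg, mulOp_apply h, dOp_apply, e,
    partialDeriv_mul j (hg.1.differentiable (by simp) x) u.differentiableAt]
  ring

theorem partialDeriv_coord (i j : Fin d) (x : Space d) :
    partialDeriv i (coord j) x = if i = j then 1 else 0 := by
  have h : HasFDerivAt (coord (d := d) j)
      (Complex.ofRealCLM.comp (EuclideanSpace.proj (𝕜 := ℝ) j : Space d →L[ℝ] ℝ)) x :=
    (Complex.ofRealCLM.comp (EuclideanSpace.proj (𝕜 := ℝ) j : Space d →L[ℝ] ℝ)).hasFDerivAt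
  rw [partialDeriv, h.fderiv]
  by_cases hij : i = j <;> simp [hij, eq_comm]

theorem dOp_comm (i j : Fin d) : dOp i * dOp j = dOp j * dOp (d := d) i := by
  refine op_ext fun u x => ?_
  have e : ∀ k, (dOp k u : Space d → ℂ) = fun y => (1 / Complex.I) * partialDeriv k u y :=
    fun k => funext fun y => dOp_apply k u y
  have h2 : ContDiff ℝ 2 u := u.smooth 2
  have hd : ∀ k : Fin d, Differentiable ℝ (fun y => partialDeriv k u y) := fun k =>
    (h2.fderiv_right (m := 1) (by norm_num)).differentiable (by simp) |>.clm_apply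
      (differentiable_const _)
  have key : ∀ k l : Fin d, partialDeriv k (fun y => (1 / Complex.I) * partialDeriv l u y) x
      = (1 / Complex.I) * fderiv ℝ (fderiv ℝ u) x (EuclideanSpace.single k 1)
        (EuclideanSpace.single l 1) := by
    intro k l
    rw [partialDeriv, fderiv_const_mul (hd l x)]
    have := ((h2.fderiv_right (m := 1) (by norm_num)).differentiable (by simp) x)
    simp only [partialDeriv]
    rw [fderiv_clm_apply this (differentiableAt_const _)]
    simp
  rw [Module.End.mul_apply, Module.End.mul_apply, dOp_apply, dOp_apply, e, e, key, key]
  have hs : IsSymmSndFDerivAt ℝ u x := h2.contDiffAt.isSymmSndFDerivAt (by simp)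
  rw [hs.eq]

/-! ### The inner product of `L²` on Schwartz functions -/

theorem inner_toL2 (u v : SpaceS d) :
    inner ℂ (toL2 u) (toL2 v) = ∫ x, conj (u x) * v x := by
  have := SchwartzMap.inner_toL2_toL2_eq u v volume
  simp only [toL2, SchwartzMap.toLpCLM_apply]
  rw [this]
  simp [mul_comm]

theorem inner_mulOp {g : Space d → ℂ} (hg : g.HasTemperateGrowth) (u v : SpaceS d) :
    inner ℂ (toL2 (mulOp g u)) (toL2 v) = inner ℂ (toL2 u) (toL2 (mulOp (fun x => conj (g x)) v)) := by
  have hg' : (fun x => conj (g x)).HasTemperateGrowth :=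
    (Complex.conjCLE.toContinuousLinearMap.hasTemperateGrowth).comp hg
  rw [inner_toL2, inner_toL2]
  congr 1; ext x
  rw [mulOp_apply hg, mulOp_apply hg', map_mul]; ring

theorem inner_mulOp_real {g : Space d → ℂ} (hg : g.HasTemperateGrowth) (hr : ∀ x, conj (g x) = g x)
    (u v : SpaceS d) :
    inner ℂ (toL2 (mulOp g u)) (toL2 v) = inner ℂ (toL2 u) (toL2 (mulOp g v)) := by
  rw [inner_mulOp hg]; simp only [hr]

theorem inner_dOp (j : Fin d) (u v : SpaceS d) :
    inner ℂ (toL2 (dOp j u)) (toL2 v) = inner ℂ (toL2 u) (toL2 (dOp j v)) := by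
  rw [inner_toL2, inner_toL2]
  have h := SchwartzMap.integral_bilinear_lineDerivOp_right_eq_neg_left (μ := volume) u v
    ((ContinuousLinearMap.mul ℝ ℂ).comp Complex.conjCLE.toContinuousLinearMap)
    (EuclideanSpace.single j (1 : ℝ))
  simp only [ContinuousLinearMap.comp_apply, ContinuousLinearMap.mul_apply',
    SchwartzMap.lineDerivOp_apply_eq_fderiv] at h
  have e1 : ∀ x, conj (u x) * dOp j v x
      = (1 / Complex.I) * (conj (u x) * fderiv ℝ v x (EuclideanSpace.single j (1 : ℝ))) := by
    intro x; rw [dOp_apply, partialDeriv]; ring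
  have e2 : ∀ x, conj (dOp j u x) * v x
      = -(1 / Complex.I) * (conj (fderiv ℝ u x (EuclideanSpace.single j (1 : ℝ))) * v x) := by
    intro x; rw [dOp_apply, partialDeriv]; simp; ring
  simp only [e1, e2, integral_const_mul]
  erw [h]
  simp

theorem norm_toL2_mulOp_le {g : Space d → ℂ} (hg : g.HasTemperateGrowth) {C : ℝ}
    (hC : ∀ x, ‖g x‖ ≤ C) (u : SpaceS d) : ‖toL2 (mulOp g u)‖ ≤ C * ‖toL2 u‖ := by
  have h0 : 0 ≤ C := (norm_nonneg _).trans (hC 0)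
  refine Lp.norm_le_mul_norm_of_ae_le_mul ?_
  have h1 := (mulOp g u).coeFn_toLp 2 volume
  have h2 := u.coeFn_toLp 2 volume
  filter_upwards [h1, h2] with x hx1 hx2
  simp only [toL2, SchwartzMap.toLpCLM_apply]
  rw [hx1, hx2, mulOp_apply hg, norm_mul]
  exact mul_le_mul_of_nonneg_right (hC x) (norm_nonneg _)

theorem denseRange_toL2 : DenseRange (toL2 (d := d)) :=
  SchwartzMap.denseRange_toLpCLM (by simp)

theorem toL2_injective : Function.Injective (toL2 (d := d)) :=
  SchwartzMap.injective_toLp 2 volume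

end

end MagneticSchrodinger

namespace MagneticSchrodinger

noncomputable section

variable {d : ℕ}

/-! ### Families of smooth functions with uniformly bounded derivatives -/

theorem clm_apply_eq_sum {F : Type*} [NormedAddCommGroup F] [NormedSpace ℝ F]
    (L : Space d →L[ℝ] F) (y : Space d) :
    L y = ∑ j, y j • L (EuclideanSpace.single j (1 : ℝ)) := by
  conv_lhs => rw [← (EuclideanSpace.basisFun (Fin d) ℝ).sum_repr y]
  simp [map_sum]

/-- Complex functions that are bounded along with all their derivatives. -/
def IsCbComplex (G : Space d → ℂ) : Prop :=
  ContDiff ℝ ∞ G ∧ ∀ n : ℕ, ∃ C : ℝ, ∀ x, ‖iteratedFDeriv ℝ n G x‖ ≤ C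

/-- A family of functions of temperate growth, the derivatives of which are bounded uniformly
for the parameters in `P`. -/
structure UCb {ι : Type*} (P : Set ι) (g : ι → Space d → ℂ) : Prop where
  temperate : ∀ i, (g i).HasTemperateGrowth
  bdd : ∀ n : ℕ, ∃ C : ℝ, ∀ i ∈ P, ∀ x, ‖iteratedFDeriv ℝ n (g i) x‖ ≤ C

theorem IsCbComplex.hasTemperateGrowth {G : Space d → ℂ} (hG : IsCbComplex G) :
    G.HasTemperateGrowth :=
  ⟨hG.1, fun n => by
    obtain ⟨C, hC⟩ := hG.2 n
    exact ⟨0, C, fun x => by simpa using hC x⟩⟩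

theorem IsCbComplex.bound {G : Space d → ℂ} (hG : IsCbComplex G) : ∃ C : ℝ, ∀ x, ‖G x‖ ≤ C := by
  obtain ⟨C, hC⟩ := hG.2 0
  exact ⟨C, fun x => by simpa using hC x⟩

theorem norm_iteratedFDeriv_partialDeriv_le {g : Space d → ℂ} (hg : ContDiff ℝ ∞ g) (j : Fin d)
    (n : ℕ) (x : Space d) :
    ‖iteratedFDeriv ℝ n (partialDeriv j g) x‖ ≤ ‖iteratedFDeriv ℝ (n + 1) g x‖ := by
  set L := ContinuousLinearMap.apply ℝ ℂ (EuclideanSpace.single j (1 : ℝ)) with hL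
  have hLn : ‖L‖ ≤ 1 := by
    refine ContinuousLinearMap.opNorm_le_bound _ zero_le_one fun T => ?_
    simpa [hL, mul_comm] using T.le_opNorm (EuclideanSpace.single j (1 : ℝ))
  have h1 : ContDiff ℝ n (fderiv ℝ g) := hg.fderiv_right (by exact_mod_cast le_top)
  have := L.norm_iteratedFDeriv_comp_left (x := x) (f := fderiv ℝ g) (n := n) h1.contDiffAt le_rfl
  rw [norm_iteratedFDeriv_fderiv] at this
  refine this.trans ?_
  calc ‖L‖ * _ ≤ 1 * ‖iteratedFDeriv ℝ (n + 1) g x‖ := by gcongr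
    _ = _ := one_mul _

theorem IsCbComplex.partialDeriv {G : Space d → ℂ} (hG : IsCbComplex G) (j : Fin d) :
    IsCbComplex (partialDeriv j G) := by
  refine ⟨(hG.hasTemperateGrowth.partialDeriv j).1, fun n => ?_⟩
  obtain ⟨C, hC⟩ := hG.2 (n + 1)
  exact ⟨C, fun x => (norm_iteratedFDeriv_partialDeriv_le hG.1 j n x).trans (hC x)⟩

theorem IsCbInfty.complex {f : Space d → ℝ} (hf : IsCbInfty f) :
    IsCbComplex (fun x => (f x : ℂ)) := by
  refine ⟨Complex.ofRealCLM.contDiff.comp hf.1, fun n => ?_⟩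
  obtain ⟨C, hC⟩ := hf.2 n
  refine ⟨C, fun x => ?_⟩
  have h1 : ContDiff ℝ n f := hf.1.of_le (by exact_mod_cast le_top)
  have := Complex.ofRealCLM.norm_iteratedFDeriv_comp_left (x := x) (f := f) (n := n) h1.contDiffAt
    le_rfl
  simp only [Complex.ofRealCLM_norm, one_mul] at this
  exact this.trans (hC x)

section UCb

variable {ι : Type*} {P : Set ι} {f g : ι → Space d → ℂ}

theorem UCb.bound (hg : UCb P g) : ∃ C : ℝ, 0 ≤ C ∧ ∀ i ∈ P, ∀ x, ‖g i x‖ ≤ C := by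
  obtain ⟨C, hC⟩ := hg.bdd 0
  exact ⟨|C|, abs_nonneg _, fun i hi x => (by simpa using hC i hi x : ‖g i x‖ ≤ C).trans
    (le_abs_self C)⟩

theorem UCb.const {c : ι → ℂ} (hc : ∃ C : ℝ, ∀ i ∈ P, ‖c i‖ ≤ C) :
    UCb P (fun i (_ : Space d) => c i) := by
  refine ⟨fun i => Function.HasTemperateGrowth.const _, fun n => ?_⟩
  obtain ⟨C, hC⟩ := hc
  rcases n with _ | n
  · exact ⟨C, fun i hi x => by simpa using hC i hi⟩
  · exact ⟨0, fun i hi x => by rw [iteratedFDeriv_const_of_ne (Nat.succ_ne_zero n)]; simp⟩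

theorem UCb.mul (hf : UCb P f) (hg : UCb P g) : UCb P (fun i x => f i x * g i x) := by
  refine ⟨fun i => (hf.temperate i).mul (hg.temperate i), fun n => ?_⟩
  choose A hA using hf.bdd
  choose B hB using hg.bdd
  refine ⟨∑ k ∈ Finset.range (n + 1), (n.choose k : ℝ) * |A k| * |B (n - k)|, fun i hi x => ?_⟩
  refine (norm_iteratedFDeriv_mul_le ((hf.temperate i).1) ((hg.temperate i).1) x
    (n := n) (by exact_mod_cast le_top)).trans ?_
  gcongr with k hk
  · exact (hA k i hi x).trans (le_abs_self _)
  · exact (hB (n - k) i hi x).trans (le_abs_self _)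

theorem UCb.add (hf : UCb P f) (hg : UCb P g) : UCb P (fun i x => f i x + g i x) := by
  refine ⟨fun i => (hf.temperate i).add (hg.temperate i), fun n => ?_⟩
  obtain ⟨A, hA⟩ := hf.bdd n
  obtain ⟨B, hB⟩ := hg.bdd n
  refine ⟨A + B, fun i hi x => ?_⟩
  have h1 : ContDiff ℝ n (f i) := (hf.temperate i).1.of_le (by exact_mod_cast le_top)
  have h2 : ContDiff ℝ n (g i) := (hg.temperate i).1.of_le (by exact_mod_cast le_top)
  have : iteratedFDeriv ℝ n (fun x => f i x + g i x) x
      = iteratedFDeriv ℝ n (f i) x + iteratedFDeriv ℝ n (g i) x :=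
    iteratedFDeriv_add_apply h1.contDiffAt h2.contDiffAt
  rw [this]
  exact (norm_add_le _ _).trans (add_le_add (hA i hi x) (hB i hi x))

theorem UCb.const_mul (hg : UCb P g) {c : ι → ℂ} (hc : ∃ C : ℝ, ∀ i ∈ P, ‖c i‖ ≤ C) :
    UCb P (fun i x => c i * g i x) := (UCb.const hc).mul hg

theorem UCb.sum {κ : Type*} {s : Finset κ} {f : κ → ι → Space d → ℂ} (hf : ∀ k ∈ s, UCb P (f k)) :
    UCb P (fun i x => ∑ k ∈ s, f k i x) := by
  classical
  induction s using Finset.induction_on with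
  | empty => simpa using UCb.const (P := P) (c := fun _ => 0) ⟨0, by simp⟩
  | insert a s ha ih =>
    simp only [Finset.sum_insert ha]
    exact (hf a (by simp)).add (ih fun k hk => hf k (by simp [hk]))

theorem UCb.partialDeriv (hg : UCb P g) (j : Fin d) : UCb P (fun i => partialDeriv j (g i)) := by
  refine ⟨fun i => (hg.temperate i).partialDeriv j, fun n => ?_⟩
  obtain ⟨C, hC⟩ := hg.bdd (n + 1)
  exact ⟨C, fun i hi x => (norm_iteratedFDeriv_partialDeriv_le (hg.temperate i).1 j n x).trans
    (hC i hi x)⟩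

theorem UCb.comp {κ : Type*} {Q : Set κ} (hg : UCb P g) (r : κ → ι) (hr : ∀ k ∈ Q, r k ∈ P) :
    UCb Q (fun k => g (r k)) :=
  ⟨fun k => hg.temperate _, fun n => by
    obtain ⟨C, hC⟩ := hg.bdd n
    exact ⟨C, fun k hk x => hC _ (hr k hk) x⟩⟩

theorem IsCbComplex.uCb {G : Space d → ℂ} (hG : IsCbComplex G) : UCb P (fun _ => G) :=
  ⟨fun _ => hG.hasTemperateGrowth, fun n => by
    obtain ⟨C, hC⟩ := hG.2 n
    exact ⟨C, fun _ _ x => hC x⟩⟩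

theorem UCb.isCbComplex (hg : UCb P g) {i : ι} (hi : i ∈ P) : IsCbComplex (g i) :=
  ⟨(hg.temperate i).1, fun n => by
    obtain ⟨C, hC⟩ := hg.bdd n
    exact ⟨C, fun x => hC i hi x⟩⟩

/-- The total derivative is `∑ ∂_j g` times the `j`-th coordinate projection, and multiplication by
a projection has norm at most one. Bounds on all iterated derivatives can thus be obtained from
partial derivatives alone. -/
theorem norm_iteratedFDeriv_succ_le_sum {g : Space d → ℂ} {n : ℕ}
    (hd : Differentiable ℝ g) (h : ∀ j, ContDiff ℝ n (partialDeriv j g)) :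
    ContDiff ℝ (n + 1 : ℕ) g ∧ ∀ x, ‖iteratedFDeriv ℝ (n + 1) g x‖
      ≤ ∑ j, ‖iteratedFDeriv ℝ n (partialDeriv j g) x‖ := by
  have e : fderiv ℝ g = fun x => ∑ j, (ContinuousLinearMap.smulRightL ℝ (Space d) ℂ
      (EuclideanSpace.proj j)) (partialDeriv j g x) := by
    ext x y
    rw [clm_apply_eq_sum (fderiv ℝ g x) y]
    simp [partialDeriv]
  have hc : ∀ j, ContDiff ℝ n (fun x => (ContinuousLinearMap.smulRightL ℝ (Space d) ℂ
      (EuclideanSpace.proj j)) (partialDeriv j g x)) :=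
    fun j => (ContinuousLinearMap.contDiff _).comp (h j)
  have hcd : ContDiff ℝ n (fderiv ℝ g) := by
    rw [e]; exact ContDiff.sum fun j _ => hc j
  refine ⟨?_, fun x => ?_⟩
  · push_cast
    exact contDiff_succ_iff_fderiv.2 ⟨hd, by simp, hcd⟩
  · rw [← norm_iteratedFDeriv_fderiv, e, iteratedFDeriv_fun_sum_apply fun j _ => (hc j).contDiffAt]
    refine (norm_sum_le _ _).trans (Finset.sum_le_sum fun j _ => ?_)
    refine (ContinuousLinearMap.norm_iteratedFDeriv_comp_left _ (f := partialDeriv j g)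
      (h j).contDiffAt le_rfl).trans ?_
    have : ‖ContinuousLinearMap.smulRightL ℝ (Space d) ℂ (EuclideanSpace.proj j)‖ ≤ 1 := by
      refine ContinuousLinearMap.opNorm_le_bound _ zero_le_one fun c => ?_
      refine ContinuousLinearMap.opNorm_le_bound _ (by positivity) fun y => ?_
      have h2 : ‖y j‖ ≤ ‖y‖ := PiLp.norm_apply_le y j
      simp only [ContinuousLinearMap.smulRightL_apply_apply, ContinuousLinearMap.smulRight_apply,
        norm_smul, one_mul]
      rw [mul_comm]
      exact mul_le_mul_of_nonneg_left h2 (norm_nonneg c)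
    calc _ ≤ 1 * ‖iteratedFDeriv ℝ n (partialDeriv j g) x‖ := by gcongr
      _ = _ := one_mul _

/-- A set of families of bounded functions that is closed under partial derivatives consists of
families with uniformly bounded derivatives. -/
theorem UCb.of_closed {𝒢 : Set (ι → Space d → ℂ)}
    (hd : ∀ g ∈ 𝒢, ∀ i, Differentiable ℝ (g i))
    (hb : ∀ g ∈ 𝒢, ∀ i, ∃ C : ℝ, ∀ x, ‖g i x‖ ≤ C)
    (hP : ∀ g ∈ 𝒢, ∃ C : ℝ, ∀ i ∈ P, ∀ x, ‖g i x‖ ≤ C)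
    (hc : ∀ g ∈ 𝒢, ∀ j, (fun i => MagneticSchrodinger.partialDeriv j (g i)) ∈ 𝒢)
    (hg : g ∈ 𝒢) : UCb P g := by
  -- The parameter set `Q` is kept free because the induction is used twice: with `P` for the
  -- uniform bounds, and with singletons for temperate growth at every parameter, including those
  -- outside `P`.
  have key : ∀ Q : Set ι, (∀ g ∈ 𝒢, ∃ C : ℝ, ∀ i ∈ Q, ∀ x, ‖g i x‖ ≤ C) →
      ∀ n : ℕ, ∀ g ∈ 𝒢, (∀ i, ContDiff ℝ n (g i)) ∧
        ∃ C : ℝ, ∀ i ∈ Q, ∀ x, ‖iteratedFDeriv ℝ n (g i) x‖ ≤ C := by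
    intro Q hQ n
    induction n with
    | zero =>
      intro g hg
      refine ⟨fun i => contDiff_zero.2 (hd g hg i).continuous, ?_⟩
      simpa using hQ g hg
    | succ n ih =>
      intro g hg
      refine ⟨fun i => (norm_iteratedFDeriv_succ_le_sum (hd g hg i)
        fun j => (ih _ (hc g hg j)).1 i).1, ?_⟩
      choose C hC using fun j => (ih _ (hc g hg j)).2
      refine ⟨∑ j, C j, fun i hi x => ?_⟩
      refine ((norm_iteratedFDeriv_succ_le_sum (hd g hg i)
        fun j => (ih _ (hc g hg j)).1 i).2 x).trans ?_
      exact Finset.sum_le_sum fun j _ => hC j i hi x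
  refine ⟨fun i => ⟨contDiff_infty.2 fun n => (key P hP n g hg).1 i, fun n => ?_⟩,
    fun n => (key P hP n g hg).2⟩
  obtain ⟨C, hC⟩ := (key {i} (fun g hg => by
    obtain ⟨C, hC⟩ := hb g hg i
    exact ⟨C, fun k hk x => by rw [mem_singleton_iff.1 hk]; exact hC x⟩) n g hg).2
  exact ⟨0, C, fun x => by simpa using hC i rfl x⟩

end UCb

/-! ### Averages along rays -/

/-- The average `∫ τ^p G(x₀ + τ y) dμ(τ)`. -/
def radialAvg (μ : Measure ℝ) (p : ℕ) (G : Space d → ℂ) (x₀ y : Space d) : ℂ :=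
  ∫ τ, ((τ ^ p : ℝ) : ℂ) * G (x₀ + τ • y) ∂μ

section radialAvg

variable {μ : Measure ℝ} [IsFiniteMeasure μ] {G : Space d → ℂ}

theorem radialAvg_integrable (hμ : ∀ᵐ τ ∂μ, τ ∈ Icc (0 : ℝ) 1) (hG : IsCbComplex G) (p : ℕ)
    (x₀ y : Space d) : Integrable (fun τ : ℝ => ((τ ^ p : ℝ) : ℂ) * G (x₀ + τ • y)) μ := by
  obtain ⟨C, hC⟩ := hG.bound
  have hcont : Continuous G := hG.1.continuous
  refine Integrable.of_bound (by fun_prop) C ?_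
  filter_upwards [hμ] with τ hτ
  rw [norm_mul, Complex.norm_real, Real.norm_of_nonneg (pow_nonneg hτ.1 p)]
  calc τ ^ p * ‖G (x₀ + τ • y)‖ ≤ 1 * C := by
        gcongr
        · exact pow_le_one₀ hτ.1 hτ.2
        · exact hC _
    _ = C := one_mul C

theorem norm_radialAvg_le (hμ : ∀ᵐ τ ∂μ, τ ∈ Icc (0 : ℝ) 1) (hG : IsCbComplex G) (p : ℕ) :
    ∃ C : ℝ, ∀ x₀ y, ‖radialAvg μ p G x₀ y‖ ≤ C := by
  obtain ⟨C, hC⟩ := hG.bound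
  refine ⟨C * μ.real univ, fun x₀ y => norm_integral_le_of_norm_le_const ?_⟩
  filter_upwards [hμ] with τ hτ
  rw [norm_mul, Complex.norm_real, Real.norm_of_nonneg (pow_nonneg hτ.1 p)]
  calc τ ^ p * ‖G (x₀ + τ • y)‖ ≤ 1 * C := by
        gcongr
        · exact pow_le_one₀ hτ.1 hτ.2
        · exact hC _
    _ = C := one_mul C

/-- The chain rule under the integral brings out a factor `τ`, which raises `p` by one. The measure
stays general because two are needed: Lebesgue measure on the unit interval for the radial
potential, and the Dirac mass at `1` for the pullback `G(x₀ + tZ)`. -/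
theorem hasFDerivAt_radialAvg (hμ : ∀ᵐ τ ∂μ, τ ∈ Icc (0 : ℝ) 1) (hG : IsCbComplex G) (p : ℕ)
    (x₀ y : Space d) :
    HasFDerivAt (radialAvg μ p G x₀)
      (∫ τ, (τ ^ (p + 1) : ℝ) • fderiv ℝ G (x₀ + τ • y) ∂μ) y := by
  obtain ⟨C, hC⟩ := hG.2 1
  have hcont : Continuous G := hG.1.continuous
  have hcd : Continuous (fderiv ℝ G) := hG.1.continuous_fderiv (by simp)
  refine hasFDerivAt_integral_of_dominated_of_fderiv_le (bound := fun _ => C)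
    (F := fun y (τ : ℝ) => ((τ ^ p : ℝ) : ℂ) * G (x₀ + τ • y))
    (F' := fun y (τ : ℝ) => (τ ^ (p + 1) : ℝ) • fderiv ℝ G (x₀ + τ • y))
    Filter.univ_mem ?_ (radialAvg_integrable hμ hG p x₀ y) ?_ ?_ (integrable_const C) ?_
  · exact Filter.Eventually.of_forall fun z => (radialAvg_integrable hμ hG p x₀ z).1
  · exact Continuous.aestronglyMeasurable (by fun_prop)
  · filter_upwards [hμ] with τ hτ z _
    rw [norm_smul, Real.norm_of_nonneg (pow_nonneg hτ.1 _)]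
    have h1 := hC (x₀ + τ • z)
    rw [← norm_iteratedFDeriv_fderiv, norm_iteratedFDeriv_zero] at h1
    calc τ ^ (p + 1) * ‖fderiv ℝ G (x₀ + τ • z)‖ ≤ 1 * C := by
          gcongr
          exact pow_le_one₀ hτ.1 hτ.2
      _ = C := one_mul C
  · filter_upwards with τ z _
    have h1 : HasFDerivAt G (fderiv ℝ G (x₀ + τ • z)) (x₀ + τ • z) :=
      (hG.1.differentiable (by simp) _).hasFDerivAt
    have h2 : HasFDerivAt (fun z : Space d => x₀ + τ • z) (τ • ContinuousLinearMap.id ℝ _) z :=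
      ((hasFDerivAt_id z).const_smul τ).const_add x₀
    have h3 := (h1.comp z h2).const_mul ((τ ^ p : ℝ) : ℂ)
    refine h3.congr_fderiv ?_
    ext w
    simp [pow_succ]
    ring

theorem partialDeriv_radialAvg (hμ : ∀ᵐ τ ∂μ, τ ∈ Icc (0 : ℝ) 1) (hG : IsCbComplex G) (p : ℕ)
    (x₀ y : Space d) (j : Fin d) :
    partialDeriv j (radialAvg μ p G x₀) y = radialAvg μ (p + 1) (partialDeriv j G) x₀ y := by
  obtain ⟨C, hC⟩ := hG.2 1
  have hcd : Continuous (fderiv ℝ G) := hG.1.continuous_fderiv (by simp)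
  rw [partialDeriv, (hasFDerivAt_radialAvg hμ hG p x₀ y).fderiv]
  have hint : Integrable (fun τ : ℝ => (τ ^ (p + 1) : ℝ) • fderiv ℝ G (x₀ + τ • y)) μ := by
    refine Integrable.of_bound (Continuous.aestronglyMeasurable (by fun_prop)) C ?_
    filter_upwards [hμ] with τ hτ
    rw [norm_smul, Real.norm_of_nonneg (pow_nonneg hτ.1 _)]
    have h1 := hC (x₀ + τ • y)
    rw [← norm_iteratedFDeriv_fderiv, norm_iteratedFDeriv_zero] at h1
    calc τ ^ (p + 1) * ‖fderiv ℝ G (x₀ + τ • y)‖ ≤ 1 * C := by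
          gcongr
          exact pow_le_one₀ hτ.1 hτ.2
      _ = C := one_mul C
  refine (ContinuousLinearMap.integral_apply hint _).trans ?_
  simp [radialAvg, partialDeriv]

theorem partialDeriv_comp_smul {h : Space d → ℂ} (hh : Differentiable ℝ h) (t : ℝ) (j : Fin d)
    (Z : Space d) :
    partialDeriv j (fun Z => h (t • Z)) Z = (t : ℂ) * partialDeriv j h (t • Z) := by
  have h2 : HasFDerivAt (fun z : Space d => t • z) (t • ContinuousLinearMap.id ℝ _) Z :=
    (hasFDerivAt_id Z).const_smul t
  have h3 : HasFDerivAt (fun Z : Space d => h (t • Z)) _ Z := (hh (t • Z)).hasFDerivAt.comp Z h2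
  rw [partialDeriv, h3.fderiv]
  simp [partialDeriv]

theorem differentiable_radialAvg (hμ : ∀ᵐ τ ∂μ, τ ∈ Icc (0 : ℝ) 1) (hG : IsCbComplex G) (p : ℕ)
    (x₀ : Space d) : Differentiable ℝ (radialAvg μ p G x₀) :=
  fun y => (hasFDerivAt_radialAvg hμ hG p x₀ y).differentiableAt

/-- The family `Z ↦ t^q ∫ τ^p G(x₀ + τ t Z) dμ(τ)` with parameters `(x₀, t)`. -/
def rayFun (μ : Measure ℝ) (q p : ℕ) (G : Space d → ℂ) (i : Space d × ℝ) (Z : Space d) : ℂ :=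
  (i.2 : ℂ) ^ q * radialAvg μ p G i.1 (i.2 • Z)

/-- The inner derivative `tτ` is absorbed by the exponents `q` and `p`, so ray functions with `G`
ranging over `C_b^∞` form a class closed under partial derivatives. Bounds on the functions alone
then give bounds on all derivatives, uniform in `x₀` and locally uniform in `t`. -/
theorem partialDeriv_rayFun (hμ : ∀ᵐ τ ∂μ, τ ∈ Icc (0 : ℝ) 1) (hG : IsCbComplex G) (q p : ℕ)
    (i : Space d × ℝ) (j : Fin d) :
    partialDeriv j (rayFun μ q p G i) = rayFun μ (q + 1) (p + 1) (partialDeriv j G) i := by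
  ext Z
  have hd := differentiable_radialAvg hμ hG p i.1
  have hd' : Differentiable ℝ (fun Z => radialAvg μ p G i.1 (i.2 • Z)) :=
    hd.comp (differentiable_id.const_smul i.2)
  have e : partialDeriv j (rayFun μ q p G i) Z
      = (i.2 : ℂ) ^ q * partialDeriv j (fun Z => radialAvg μ p G i.1 (i.2 • Z)) Z := by
    unfold rayFun
    rw [partialDeriv, fderiv_const_mul (hd' Z)]
    simp [partialDeriv]
  rw [e, partialDeriv_comp_smul hd, partialDeriv_radialAvg hμ hG, rayFun]
  ring

theorem rayFun_uCb (hμ : ∀ᵐ τ ∂μ, τ ∈ Icc (0 : ℝ) 1) (hG : IsCbComplex G) (q p : ℕ) (T : ℝ) :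
    UCb {i : Space d × ℝ | |i.2| ≤ T} (rayFun μ q p G) := by
  have key : ∀ g ∈ {g : Space d × ℝ → Space d → ℂ | ∃ q p G, IsCbComplex G ∧ g = rayFun μ q p G},
      ∀ T : ℝ, ∃ C : ℝ, ∀ i : Space d × ℝ, |i.2| ≤ T → ∀ x, ‖g i x‖ ≤ C := by
    rintro g ⟨q, p, G, hG, rfl⟩ T
    obtain ⟨C, hC⟩ := norm_radialAvg_le hμ hG p
    refine ⟨T ^ q * C, fun i hi Z => ?_⟩
    rw [rayFun, norm_mul, norm_pow, Complex.norm_real, Real.norm_eq_abs]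
    have : 0 ≤ T := (abs_nonneg _).trans hi
    gcongr
    exact hC _ _
  refine UCb.of_closed (𝒢 := {g | ∃ q p G, IsCbComplex G ∧ g = rayFun μ q p G}) ?_ ?_ ?_ ?_
    ⟨q, p, G, hG, rfl⟩
  · rintro g ⟨q, p, G, hG, rfl⟩ i
    exact ((differentiable_radialAvg hμ hG p i.1).comp
      (differentiable_id.const_smul i.2)).const_mul _
  · intro g hg i
    obtain ⟨C, hC⟩ := key g hg |i.2|
    exact ⟨C, hC i le_rfl⟩
  · intro g hg
    obtain ⟨C, hC⟩ := key g hg T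
    exact ⟨C, fun i hi x => hC i hi x⟩
  · rintro g ⟨q, p, G, hG, rfl⟩ j
    exact ⟨q + 1, p + 1, _, hG.partialDeriv j, funext fun i => partialDeriv_rayFun hμ hG q p i j⟩

/-- The argument `x₀ + τtZ` has `t`-derivative `τZ`, so one differentiation in `t` costs one power
of `Z` while the coefficients remain ray functions. For `q = 0` the truncated exponent `q - 1` is
harmless, since its term carries the factor `q`. -/
theorem hasDerivAt_rayFun (hμ : ∀ᵐ τ ∂μ, τ ∈ Icc (0 : ℝ) 1) (hG : IsCbComplex G) (q p : ℕ)
    (x₀ : Space d) (t : ℝ) (Z : Space d) :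
    HasDerivAt (fun s => rayFun μ q p G (x₀, s) Z)
      (q * rayFun μ (q - 1) p G (x₀, t) Z
        + ∑ j, coord j Z * rayFun μ q (p + 1) (partialDeriv j G) (x₀, t) Z) t := by
  have h1 : HasDerivAt (fun s : ℝ => ((s : ℝ) : ℂ) ^ q) (q * (t : ℂ) ^ (q - 1)) t := by
    have := (hasDerivAt_pow q (t : ℂ)).comp_ofReal
    simpa using this
  have h2 : HasDerivAt (fun s : ℝ => s • Z) Z t := by
    simpa using (hasDerivAt_id t).smul_const Z
  have hd := (differentiable_radialAvg hμ hG p x₀ (t • Z)).hasFDerivAt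
  have h3 := hd.comp_hasDerivAt t h2
  have h4 := h1.mul h3
  refine h4.congr_deriv ?_
  rw [clm_apply_eq_sum (fderiv ℝ (radialAvg μ p G x₀) (t • Z)) Z]
  simp only [rayFun, Function.comp_apply, coord]
  rw [Finset.mul_sum]
  congr 1
  · ring
  · refine Finset.sum_congr rfl fun j _ => ?_
    have := partialDeriv_radialAvg hμ hG p x₀ (t • Z) j
    rw [partialDeriv] at this
    rw [this, Complex.real_smul]
    ring

end radialAvg

end

end MagneticSchrodinger

namespace MagneticSchrodinger

noncomputable section

variable {d : ℕ}

/-! ### Magnetic operators on the Schwartz space -/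

/-- The covariant derivative `(1/i) ∂_j - a_j`. -/
def nabOp (a : Fin d → Space d → ℂ) (j : Fin d) : Op d := dOp j - mulOp (a j)

/-- The magnetic Schrödinger operator `∑_j ∇_j² + v`. -/
def hamOp (a : Fin d → Space d → ℂ) (v : Space d → ℂ) : Op d :=
  ∑ j, nabOp a j * nabOp a j + mulOp v

/-- The function is real valued. -/
def IsRealFun (g : Space d → ℂ) : Prop := ∀ x, conj (g x) = g x

section single

variable {a : Fin d → Space d → ℂ} {v : Space d → ℂ}

theorem inner_nabOp (ha : ∀ j, (a j).HasTemperateGrowth) (hr : ∀ j, IsRealFun (a j)) (j : Fin d)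
    (u w : SpaceS d) :
    inner ℂ (toL2 (nabOp a j u)) (toL2 w) = inner ℂ (toL2 u) (toL2 (nabOp a j w)) := by
  simp only [nabOp, LinearMap.sub_apply, map_sub, inner_sub_left, inner_sub_right, inner_dOp,
    inner_mulOp_real (ha j) (hr j)]

theorem inner_hamOp (ha : ∀ j, (a j).HasTemperateGrowth) (hr : ∀ j, IsRealFun (a j))
    (hv : v.HasTemperateGrowth) (hvr : IsRealFun v) (u w : SpaceS d) :
    inner ℂ (toL2 (hamOp a v u)) (toL2 w) = inner ℂ (toL2 u) (toL2 (hamOp a v w)) := by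
  simp only [hamOp, LinearMap.add_apply, LinearMap.sum_apply, map_add, map_sum, inner_add_left,
    inner_add_right, sum_inner, inner_sum, Module.End.mul_apply, inner_nabOp ha hr,
    inner_mulOp_real hv hvr]

theorem nabOp_mul_mulOp (ha : ∀ j, (a j).HasTemperateGrowth) {f : Space d → ℂ}
    (hf : f.HasTemperateGrowth) (j : Fin d) :
    nabOp a j * mulOp f
      = mulOp f * nabOp a j + mulOp (fun x => (1 / Complex.I) * partialDeriv j f x) := by
  have h : mulOp (a j) * mulOp f = mulOp f * mulOp (a j) := by
    rw [mulOp_mul (ha j) hf, mulOp_mul hf (ha j)]; simp only [mul_comm]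
  rw [nabOp, sub_mul, mul_sub, dOp_mul_mulOp hf, h]; abel

/-- The commutator of covariant derivatives involves the potential only through its field. This is
why estimates for unbounded potentials can be made to depend on bounds for the field alone. -/
theorem nabOp_mul_nabOp (ha : ∀ j, (a j).HasTemperateGrowth) (i j : Fin d) :
    nabOp a i * nabOp a j = nabOp a j * nabOp a i
      + mulOp (fun x => -(1 / Complex.I) * (partialDeriv i (a j) x - partialDeriv j (a i) x)) := by
  have h : mulOp (a i) * mulOp (a j) = mulOp (a j) * mulOp (a i) := by
    rw [mulOp_mul (ha i) (ha j), mulOp_mul (ha j) (ha i)]; simp only [mul_comm]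
  have hc : ∀ k l, (fun x => (1 / Complex.I) * partialDeriv k (a l) x).HasTemperateGrowth :=
    fun k l => (Function.HasTemperateGrowth.const _).mul ((ha l).partialDeriv k)
  have e : mulOp (fun x => -(1 / Complex.I) * (partialDeriv i (a j) x - partialDeriv j (a i) x))
      = mulOp (fun x => (1 / Complex.I) * partialDeriv j (a i) x)
        - mulOp (fun x => (1 / Complex.I) * partialDeriv i (a j) x) := by
    rw [mulOp_sub (hc _ _) (hc _ _)]; congr 1; ext x; ring
  rw [e]
  simp only [nabOp, sub_mul, mul_sub, dOp_mul_mulOp (ha _), h, dOp_comm i j]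
  abel

theorem nabOp_mul_zOp (ha : ∀ j, (a j).HasTemperateGrowth) (i j : Fin d) :
    nabOp a i * zOp j = zOp j * nabOp a i + mulOp (fun _ => if i = j then (1 / Complex.I) else 0) := by
  rw [zOp, nabOp_mul_mulOp ha (coord_hasTemperateGrowth j)]
  congr 2
  ext x
  rw [partialDeriv_coord]
  split_ifs <;> simp

theorem hamOp_commutator (X : Op d) :
    hamOp a v * X - X * hamOp a v
      = ∑ j, (nabOp a j * (nabOp a j * X - X * nabOp a j)
          + (nabOp a j * X - X * nabOp a j) * nabOp a j) + (mulOp v * X - X * mulOp v) := by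
  rw [hamOp, add_mul, mul_add, Finset.sum_mul, Finset.mul_sum, add_sub_add_comm,
    ← Finset.sum_sub_distrib]
  congr 1
  exact Finset.sum_congr rfl fun j _ => by noncomm_ring

/-- The inner product of `(H + σ) u` with `u`. -/
theorem inner_self_hamOp_add (ha : ∀ j, (a j).HasTemperateGrowth) (hr : ∀ j, IsRealFun (a j))
    (σ : ℂ) (u : SpaceS d) :
    inner ℂ (toL2 u) (toL2 (hamOp a v u + σ • u))
      = (∑ j, ‖toL2 (nabOp a j u)‖ ^ 2 : ℝ) + inner ℂ (toL2 u) (toL2 (mulOp v u))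
        + σ * (‖toL2 u‖ ^ 2 : ℝ) := by
  have h : ∀ j, inner ℂ (toL2 u) (toL2 (nabOp a j (nabOp a j u)))
      = ((‖toL2 (nabOp a j u)‖ ^ 2 : ℝ) : ℂ) := fun j => by
    rw [← inner_nabOp ha hr, inner_self_eq_norm_sq_to_K]; norm_cast
  simp only [hamOp, LinearMap.add_apply, LinearMap.sum_apply, map_add, map_sum, map_smul,
    inner_add_right, inner_sum, inner_smul_right, Module.End.mul_apply, h,
    inner_self_eq_norm_sq_to_K]
  push_cast
  rfl

theorem inner_self_mulOp_im (hv : v.HasTemperateGrowth) (hvr : IsRealFun v) (u : SpaceS d) :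
    (inner ℂ (toL2 u) (toL2 (mulOp v u))).im = 0 := by
  have h := inner_mulOp_real hv hvr u u
  have h2 : conj (inner ℂ (toL2 u) (toL2 (mulOp v u))) = inner ℂ (toL2 u) (toL2 (mulOp v u)) := by
    rw [inner_conj_symm, h]
  exact Complex.conj_eq_iff_im.1 h2

/-- The operator is symmetric, so the imaginary part of `⟨u, (H + σ)u⟩` is `Im σ ‖u‖²`. The
Cauchy–Schwarz inequality finishes the argument. -/
theorem norm_le_norm_hamOp_add (ha : ∀ j, (a j).HasTemperateGrowth) (hr : ∀ j, IsRealFun (a j))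
    (hv : v.HasTemperateGrowth) (hvr : IsRealFun v) {σ : ℂ} (hσ : |σ.im| = 1) (u : SpaceS d) :
    ‖toL2 u‖ ≤ ‖toL2 (hamOp a v u + σ • u)‖ := by
  have h := congrArg Complex.im (inner_self_hamOp_add (v := v) ha hr σ u)
  have h2 : (inner ℂ (toL2 u) (toL2 (hamOp a v u + σ • u))).im = σ.im * ‖toL2 u‖ ^ 2 := by
    rw [h]
    simp only [Complex.add_im, Complex.ofReal_im, inner_self_mulOp_im hv hvr, zero_add,
      Complex.mul_im, mul_zero, Complex.ofReal_re]
  have h3 : ‖toL2 u‖ ^ 2 ≤ ‖toL2 u‖ * ‖toL2 (hamOp a v u + σ • u)‖ := by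
    calc ‖toL2 u‖ ^ 2 = |σ.im * ‖toL2 u‖ ^ 2| := by rw [abs_mul, hσ]; simp
      _ ≤ ‖inner ℂ (toL2 u) (toL2 (hamOp a v u + σ • u))‖ := by
        rw [← h2]; exact Complex.abs_im_le_norm _
      _ ≤ _ := norm_inner_le_norm _ _
  rcases (norm_nonneg (toL2 u)).eq_or_lt with h0 | h0
  · rw [← h0]; exact norm_nonneg _
  · nlinarith

/-- This is the energy identity: for imaginary `σ` the real part of `⟨u, (H + σ)u⟩` is `∑ ‖∇_j u‖² +
⟨u, v u⟩`. -/
theorem sum_norm_nabOp_sq_le (ha : ∀ j, (a j).HasTemperateGrowth) (hr : ∀ j, IsRealFun (a j))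
    (hv : v.HasTemperateGrowth) {C : ℝ} (hC : ∀ x, ‖v x‖ ≤ C) {σ : ℂ}
    (hσ : σ.re = 0) (u : SpaceS d) :
    ∑ j, ‖toL2 (nabOp a j u)‖ ^ 2
      ≤ (inner ℂ (toL2 u) (toL2 (hamOp a v u + σ • u))).re + C * ‖toL2 u‖ ^ 2 := by
  have h := congrArg Complex.re (inner_self_hamOp_add (v := v) ha hr σ u)
  simp only [Complex.add_re, Complex.ofReal_re, Complex.mul_re, hσ, Complex.ofReal_im, zero_mul,
    mul_zero, sub_zero, add_zero] at h
  have h2 : -(inner ℂ (toL2 u) (toL2 (mulOp v u))).re ≤ C * ‖toL2 u‖ ^ 2 := by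
    calc -(inner ℂ (toL2 u) (toL2 (mulOp v u))).re ≤ ‖inner ℂ (toL2 u) (toL2 (mulOp v u))‖ :=
          (neg_le_abs _).trans (Complex.abs_re_le_norm _)
      _ ≤ ‖toL2 u‖ * ‖toL2 (mulOp v u)‖ := norm_inner_le_norm _ _
      _ ≤ ‖toL2 u‖ * (C * ‖toL2 u‖) := by gcongr; exact norm_toL2_mulOp_le hv hC u
      _ = _ := by ring
  linarith

/-- With `l = ‖(H + σ)u‖`, the energy estimate and `‖u‖ ≤ l` give `‖∇_j u‖² ≤ l² + C l² ≤ ((1 + C)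
l)²`. -/
theorem norm_nabOp_le (ha : ∀ j, (a j).HasTemperateGrowth) (hr : ∀ j, IsRealFun (a j))
    (hv : v.HasTemperateGrowth) (hvr : IsRealFun v) {C : ℝ} (hC : ∀ x, ‖v x‖ ≤ C) {σ : ℂ}
    (hσ : σ.re = 0) (hσ' : |σ.im| = 1) (j : Fin d) (u : SpaceS d) :
    ‖toL2 (nabOp a j u)‖ ≤ (1 + C) * ‖toL2 (hamOp a v u + σ • u)‖ := by
  have h0 : 0 ≤ C := (norm_nonneg _).trans (hC 0)
  have h1 := sum_norm_nabOp_sq_le ha hr hv hC hσ u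
  have h2 := norm_le_norm_hamOp_add ha hr hv hvr hσ' u
  set l := ‖toL2 (hamOp a v u + σ • u)‖ with hl
  have h3 : ‖toL2 (nabOp a j u)‖ ^ 2 ≤ ∑ j, ‖toL2 (nabOp a j u)‖ ^ 2 :=
    Finset.single_le_sum (f := fun j => ‖toL2 (nabOp a j u)‖ ^ 2) (fun _ _ => by positivity)
      (Finset.mem_univ j)
  have h4 : (inner ℂ (toL2 u) (toL2 (hamOp a v u + σ • u))).re ≤ ‖toL2 u‖ * l :=
    ((le_abs_self _).trans (Complex.abs_re_le_norm _)).trans (norm_inner_le_norm _ _)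
  have hn := norm_nonneg (toL2 u)
  refine abs_le_of_sq_le_sq' ?_ (by positivity) |>.2
  have h5 : ‖toL2 u‖ * l ≤ l * l := by gcongr
  have h6 : C * ‖toL2 u‖ ^ 2 ≤ C * l ^ 2 := by gcongr
  have hl0 : 0 ≤ l := norm_nonneg _
  nlinarith [mul_nonneg h0 (sq_nonneg l), mul_nonneg (mul_nonneg h0 h0) (sq_nonneg l)]

end single

/-! ### Seminorms defined by words, and a priori estimates -/

section words

variable {ι κ : Type*} [Fintype κ]

/-- The sum of the `L²` norms of all words of length at most `k` in the operators `X`. -/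
def wordNorm (X : κ → Op d) : ℕ → Seminorm ℂ (SpaceS d)
  | 0 => (normSeminorm ℂ (L2 d)).comp (toL2 (d := d)).toLinearMap
  | k + 1 => wordNorm X k + ∑ c, (wordNorm X k).comp (X c)

theorem wordNorm_zero (X : κ → Op d) (u : SpaceS d) : wordNorm X 0 u = ‖toL2 u‖ := rfl

theorem wordNorm_succ (X : κ → Op d) (k : ℕ) (u : SpaceS d) :
    wordNorm X (k + 1) u = wordNorm X k u + ∑ c, wordNorm X k (X c u) := by
  simp [wordNorm]

theorem wordNorm_le_succ (X : κ → Op d) (k : ℕ) (u : SpaceS d) :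
    wordNorm X k u ≤ wordNorm X (k + 1) u := by
  rw [wordNorm_succ]
  exact le_add_of_nonneg_right (Finset.sum_nonneg fun c _ => apply_nonneg _ _)

theorem wordNorm_apply_le_succ (X : κ → Op d) (k : ℕ) (c : κ) (u : SpaceS d) :
    wordNorm X k (X c u) ≤ wordNorm X (k + 1) u := by
  rw [wordNorm_succ]
  exact (Finset.single_le_sum (f := fun c => wordNorm X k (X c u))
    (fun c _ => apply_nonneg _ _) (Finset.mem_univ c)).trans
    (le_add_of_nonneg_left (apply_nonneg _ _))

theorem wordNorm_mono (X : κ → Op d) {k l : ℕ} (h : k ≤ l) (u : SpaceS d) :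
    wordNorm X k u ≤ wordNorm X l u :=
  monotone_nat_of_le_succ (f := fun k => wordNorm X k u) (fun k => wordNorm_le_succ X k u) h

/-- A family of operators is bounded in `L²` uniformly for the parameters in `P`. -/
def UBdd (P : Set ι) (T : ι → Op d) : Prop :=
  ∃ C : ℝ, 0 ≤ C ∧ ∀ i ∈ P, ∀ u, ‖toL2 (T i u)‖ ≤ C * ‖toL2 u‖

variable {P : Set ι} {X : κ → ι → Op d}

/-- Writing `X f = f X + [X, f]`, the commutator lies again in the family, so an induction on the
word length shows that a family stable under commutators is bounded in every word norm without loss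
of letters. -/
theorem wordNorm_le_of_stable {𝓕 : Set (ι → Op d)} (hb : ∀ f ∈ 𝓕, UBdd P f)
    (hc : ∀ f ∈ 𝓕, ∀ c, (fun i => X c i * f i - f i * X c i) ∈ 𝓕) (k : ℕ) :
    ∀ f ∈ 𝓕, ∃ C : ℝ, 0 ≤ C ∧ ∀ i ∈ P, ∀ u,
      wordNorm (fun c => X c i) k (f i u) ≤ C * wordNorm (fun c => X c i) k u := by
  induction k with
  | zero => exact hb
  | succ k ih =>
    intro f hf
    obtain ⟨C, hC0, hC⟩ := ih f hf
    choose B hB0 hB using fun c => ih _ (hc f hf c)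
    refine ⟨C + ∑ c, B c, add_nonneg hC0 (Finset.sum_nonneg fun c _ => hB0 c), fun i hi u => ?_⟩
    rw [wordNorm_succ, wordNorm_succ]
    have h1 : ∀ c, wordNorm (fun c => X c i) k (X c i (f i u))
        ≤ C * wordNorm (fun c => X c i) k (X c i u) + B c * wordNorm (fun c => X c i) k u := by
      intro c
      have e : X c i (f i u) = f i (X c i u) + (X c i * f i - f i * X c i) u := by
        simp [LinearMap.sub_apply, Module.End.mul_apply]
      rw [e]
      exact (map_add_le_add _ _ _).trans (add_le_add (hC i hi _) (hB c i hi u))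
    have h2 := Finset.sum_le_sum fun c (_ : c ∈ Finset.univ) => h1 c
    rw [Finset.sum_add_distrib, ← Finset.mul_sum, ← Finset.sum_mul] at h2
    have h3 := hC i hi u
    have h4 : 0 ≤ (∑ c, B c) * ∑ c, wordNorm (fun c => X c i) k (X c i u) :=
      mul_nonneg (Finset.sum_nonneg fun c _ => hB0 c)
        (Finset.sum_nonneg fun c _ => apply_nonneg _ _)
    nlinarith

/-- A priori estimates for `L` in the norms defined by words. -/
theorem wordNorm_a_priori {𝓕 : Set (ι → Op d)} (hb : ∀ f ∈ 𝓕, UBdd P f)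
    (hc : ∀ f ∈ 𝓕, ∀ c, (fun i => X c i * f i - f i * X c i) ∈ 𝓕)
    {Y : Fin d → ι → Op d} {L : ι → Op d}
    (h0 : ∃ C : ℝ, 0 ≤ C ∧ ∀ i ∈ P, ∀ u, ‖toL2 u‖ + ∑ j, ‖toL2 (Y j i u)‖ ≤ C * ‖toL2 (L i u)‖)
    (h1 : ∀ c j, (fun i => X c i * Y j i - Y j i * X c i) ∈ 𝓕)
    (h2 : ∀ c, ∃ f : Fin d → ι → Op d, ∃ g : ι → Op d, (∀ j, f j ∈ 𝓕) ∧ g ∈ 𝓕 ∧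
      ∀ i, L i * X c i - X c i * L i = ∑ j, f j i * Y j i + g i) (k : ℕ) :
    ∃ C : ℝ, 0 ≤ C ∧ ∀ i ∈ P, ∀ u, wordNorm (fun c => X c i) k u
      + ∑ j, wordNorm (fun c => X c i) k (Y j i u) ≤ C * wordNorm (fun c => X c i) k (L i u) := by
  induction k with
  | zero => exact h0
  | succ k ih =>
    obtain ⟨A, hA0, hA⟩ := ih
    have stab := wordNorm_le_of_stable (X := X) hb hc k
    choose f g hf hg hfg using h2
    choose B hB0 hB using fun c j => stab _ (h1 c j)
    choose Cf hCf0 hCf using fun c j => stab _ (hf c j)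
    choose Cg hCg0 hCg using fun c => stab _ (hg c)
    set D := ∑ c, (∑ j, Cf c j + Cg c) with hD
    set E := ∑ j, ∑ c, B c j with hE
    have hD0 : 0 ≤ D := Finset.sum_nonneg fun c _ =>
      add_nonneg (Finset.sum_nonneg fun j _ => hCf0 c j) (hCg0 c)
    have hE0 : 0 ≤ E := Finset.sum_nonneg fun j _ => Finset.sum_nonneg fun c _ => hB0 c j
    refine ⟨A + A + A * D * A + E * A, by positivity, fun i hi u => ?_⟩
    set q := wordNorm (fun c => X c i) k with hq
    have hu := hA i hi u
    have hYu : ∀ j, q (Y j i u) ≤ A * q (L i u) := fun j =>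
      (Finset.single_le_sum (f := fun j => q (Y j i u)) (fun _ _ => apply_nonneg _ _)
        (Finset.mem_univ j)).trans ((le_add_of_nonneg_left (apply_nonneg _ _)).trans hu)
    have hu' : q u ≤ A * q (L i u) :=
      (le_add_of_nonneg_right (Finset.sum_nonneg fun _ _ => apply_nonneg _ _)).trans hu
    -- The commutator of `L` with a letter is of first order in the `Y_j`, and the inductive
    -- estimate already bounds `q u` and `q (Y_j u)` by `q (L u)`. Hence the error contains no
    -- letter more than the right-hand side.
    have hLX : ∀ c, q (L i (X c i u)) ≤ q (X c i (L i u)) + (∑ j, Cf c j + Cg c) * (A * q (L i u)) := by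
      intro c
      have e : L i (X c i u) = X c i (L i u) + (∑ j, f c j i (Y j i u) + g c i u) := by
        have := congrArg (fun T : Op d => T u) (hfg c i)
        simp only [LinearMap.sub_apply, Module.End.mul_apply, LinearMap.add_apply,
          LinearMap.sum_apply] at this
        rw [← this]; abel
      rw [e]
      refine (map_add_le_add _ _ _).trans (add_le_add le_rfl ((map_add_le_add _ _ _).trans ?_))
      rw [add_mul, Finset.sum_mul]
      refine add_le_add ?_ ?_
      · refine (Finset.le_sum_of_subadditive q (map_zero q).le (map_add_le_add q) _ _).trans (Finset.sum_le_sum fun j _ => ?_)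
        exact (hCf c j i hi _).trans (mul_le_mul_of_nonneg_left (hYu j) (hCf0 c j))
      · exact (hCg c i hi _).trans (mul_le_mul_of_nonneg_left hu' (hCg0 c))
    have hX : ∀ c, q (X c i u) + ∑ j, q (Y j i (X c i u))
        ≤ A * q (X c i (L i u)) + A * (∑ j, Cf c j + Cg c) * A * q (L i u) := by
      intro c
      refine (hA i hi (X c i u)).trans ?_
      have := mul_le_mul_of_nonneg_left (hLX c) hA0
      linarith
    have hXY : ∀ j c, q (X c i (Y j i u)) ≤ q (Y j i (X c i u)) + B c j * A * q (L i u) := by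
      intro j c
      have e : X c i (Y j i u) = Y j i (X c i u) + (X c i * Y j i - Y j i * X c i) u := by
        simp [LinearMap.sub_apply, Module.End.mul_apply]
      rw [e]
      refine (map_add_le_add _ _ _).trans (add_le_add le_rfl ((hB c j i hi u).trans ?_))
      rw [mul_assoc]
      exact mul_le_mul_of_nonneg_left hu' (hB0 c j)
    simp only [wordNorm_succ]
    rw [← hq]
    have s1 : ∑ c, (q (X c i u) + ∑ j, q (Y j i (X c i u)))
        ≤ ∑ c, (A * q (X c i (L i u)) + A * (∑ j, Cf c j + Cg c) * A * q (L i u)) :=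
      Finset.sum_le_sum fun c _ => hX c
    have s2 : ∑ j, ∑ c, q (X c i (Y j i u))
        ≤ ∑ j, ∑ c, (q (Y j i (X c i u)) + B c j * A * q (L i u)) :=
      Finset.sum_le_sum fun j _ => Finset.sum_le_sum fun c _ => hXY j c
    have e1 : ∑ c, (A * q (X c i (L i u)) + A * (∑ j, Cf c j + Cg c) * A * q (L i u))
        = A * ∑ c, q (X c i (L i u)) + A * D * A * q (L i u) := by
      rw [Finset.sum_add_distrib, ← Finset.mul_sum, hD]
      simp only [← Finset.sum_mul, ← Finset.mul_sum]
    have e2 : ∑ j, ∑ c, (q (Y j i (X c i u)) + B c j * A * q (L i u))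
        = ∑ c, ∑ j, q (Y j i (X c i u)) + E * A * q (L i u) := by
      simp only [Finset.sum_add_distrib, ← Finset.sum_mul]
      rw [Finset.sum_comm, hE]
    rw [e1, Finset.sum_add_distrib] at s1
    rw [e2] at s2
    rw [Finset.sum_add_distrib]
    have n1 : 0 ≤ q (L i u) := apply_nonneg _ _
    have n2 : 0 ≤ ∑ c, q (X c i (L i u)) := Finset.sum_nonneg fun c _ => apply_nonneg _ _
    nlinarith [mul_nonneg hA0 n2, mul_nonneg (mul_nonneg hE0 hA0) n2,
      mul_nonneg (mul_nonneg (mul_nonneg hA0 hD0) hA0) n2, mul_nonneg hA0 n1]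

end words

end

end MagneticSchrodinger

/-! ### Uniform families of multiplications, a priori estimates for magnetic Schrödinger operators,
tame families. -/

namespace MagneticSchrodinger

noncomputable section

variable {d : ℕ}

section families

variable {ι κ : Type*} {P : Set ι}

/-- Families of multiplications by functions with uniformly bounded derivatives. -/
def multFam (P : Set ι) : Set (ι → Op d) := {T | ∃ g, UCb P g ∧ T = fun i => mulOp (g i)}

theorem mulOp_mem_multFam {g : ι → Space d → ℂ} (hg : UCb P g) :
    (fun i => mulOp (g i)) ∈ multFam P := ⟨g, hg, rfl⟩

theorem multFam_uBdd {T : ι → Op d} (hT : T ∈ multFam P) : UBdd P T := by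
  obtain ⟨g, hg, rfl⟩ := hT
  obtain ⟨C, hC0, hC⟩ := hg.bound
  exact ⟨C, hC0, fun i hi u => norm_toL2_mulOp_le (hg.temperate i) (hC i hi) u⟩

theorem multFam_add {S T : ι → Op d} (hS : S ∈ multFam P) (hT : T ∈ multFam P) :
    (fun i => S i + T i) ∈ multFam P := by
  obtain ⟨f, hf, rfl⟩ := hS
  obtain ⟨g, hg, rfl⟩ := hT
  exact ⟨_, hf.add hg, funext fun i => mulOp_add (hf.temperate i) (hg.temperate i)⟩

theorem multFam_smul {T : ι → Op d} (hT : T ∈ multFam P) {c : ι → ℂ}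
    (hc : ∃ C : ℝ, ∀ i ∈ P, ‖c i‖ ≤ C) : (fun i => c i • T i) ∈ multFam P := by
  obtain ⟨g, hg, rfl⟩ := hT
  exact ⟨_, hg.const_mul hc, funext fun i => mulOp_smul _ (hg.temperate i)⟩

theorem multFam_const_smul {T : ι → Op d} (hT : T ∈ multFam P) (c : ℂ) :
    (fun i => c • T i) ∈ multFam P :=
  multFam_smul hT ⟨‖c‖, fun _ _ => le_rfl⟩

theorem multFam_zero : (fun _ => 0 : ι → Op d) ∈ multFam P :=
  ⟨fun _ _ => 0, UCb.const ⟨0, by simp⟩, funext fun _ => by rw [mulOp_const, zero_smul]⟩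

theorem multFam_neg {T : ι → Op d} (hT : T ∈ multFam P) : (fun i => -T i) ∈ multFam P := by
  simpa using multFam_const_smul hT (-1)

theorem multFam_sum {α : Type*} {s : Finset α} {T : α → ι → Op d}
    (hT : ∀ k ∈ s, T k ∈ multFam P) : (fun i => ∑ k ∈ s, T k i) ∈ multFam P := by
  classical
  induction s using Finset.induction_on with
  | empty => simpa using multFam_zero
  | insert a s ha ih =>
    simp only [Finset.sum_insert ha]
    exact multFam_add (hT a (by simp)) (ih fun k hk => hT k (by simp [hk]))

theorem nabOp_commutator_multFam {a : ι → Fin d → Space d → ℂ}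
    (ha : ∀ i j, (a i j).HasTemperateGrowth) {T : ι → Op d} (hT : T ∈ multFam P) (j : Fin d) :
    (fun i => nabOp (a i) j * T i - T i * nabOp (a i) j) ∈ multFam P := by
  obtain ⟨g, hg, rfl⟩ := hT
  refine ⟨_, (hg.partialDeriv j).const_mul (c := fun _ => 1 / Complex.I) ⟨_, fun _ _ => le_rfl⟩,
    funext fun i => ?_⟩
  rw [nabOp_mul_mulOp (ha i) (hg.temperate i), add_sub_cancel_left]

theorem zOp_mul_mulOp {f : Space d → ℂ} (hf : f.HasTemperateGrowth) (j : Fin d) :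
    zOp j * mulOp f = mulOp f * zOp j := by
  rw [zOp, mulOp_mul (coord_hasTemperateGrowth j) hf, mulOp_mul hf (coord_hasTemperateGrowth j)]
  simp only [mul_comm]

theorem zOp_commutator_multFam {T : ι → Op d} (hT : T ∈ multFam P) (j : Fin d) :
    (fun i => zOp j * T i - T i * zOp j) ∈ multFam P := by
  obtain ⟨g, hg, rfl⟩ := hT
  simp only [zOp_mul_mulOp (hg.temperate _), sub_self]
  exact multFam_zero

theorem dOp_eq_nabOp_zero (j : Fin d) : dOp j = nabOp (fun _ _ => 0) j := by
  rw [nabOp, mulOp_const, zero_smul, sub_zero]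

theorem dOp_commutator_multFam {T : ι → Op d} (hT : T ∈ multFam P) (j : Fin d) :
    (fun i => dOp j * T i - T i * dOp j) ∈ multFam P := by
  simp only [dOp_eq_nabOp_zero]
  exact nabOp_commutator_multFam (a := fun _ _ _ => 0)
    (fun _ _ => Function.HasTemperateGrowth.const _) hT j

variable [Fintype κ] {a : ι → Fin d → Space d → ℂ} {v : ι → Space d → ℂ} {X : κ → ι → Op d}

/-- A priori estimates for a family of magnetic Schrödinger operators. -/
theorem wordNorm_hamOp_a_priori (ha : ∀ i j, (a i j).HasTemperateGrowth)
    (har : ∀ i j, IsRealFun (a i j)) (hv : UCb P v) (hvr : ∀ i, IsRealFun (v i))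
    {σ : ℂ} (hσ : σ.re = 0) (hσ' : |σ.im| = 1)
    (hXf : ∀ f ∈ multFam P, ∀ c, (fun i => X c i * f i - f i * X c i) ∈ multFam P)
    (hXn : ∀ c j, (fun i => X c i * nabOp (a i) j - nabOp (a i) j * X c i) ∈ multFam P) (k : ℕ) :
    ∃ C : ℝ, 0 ≤ C ∧ ∀ i ∈ P, ∀ u, wordNorm (fun c => X c i) k u
      + ∑ j, wordNorm (fun c => X c i) k (nabOp (a i) j u)
        ≤ C * wordNorm (fun c => X c i) k (hamOp (a i) (v i) u + σ • u) := by
  refine wordNorm_a_priori (𝓕 := multFam P) (Y := fun j i => nabOp (a i) j)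
    (L := fun i => hamOp (a i) (v i) + σ • 1) (fun f hf => multFam_uBdd hf) hXf ?_ hXn ?_ k
  · obtain ⟨C, hC0, hC⟩ := hv.bound
    refine ⟨1 + ∑ _j : Fin d, (1 + C), by positivity, fun i hi u => ?_⟩
    rw [add_mul, one_mul, Finset.sum_mul]
    refine add_le_add ?_ (Finset.sum_le_sum fun j _ => ?_)
    · exact norm_le_norm_hamOp_add (ha i) (har i) (hv.temperate i) (hvr i) hσ' u
    · exact norm_nabOp_le (ha i) (har i) (hv.temperate i) (hvr i) (hC i hi) hσ hσ' j u
  · intro c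
    have hc : ∀ j, (fun i => nabOp (a i) j * X c i - X c i * nabOp (a i) j) ∈ multFam P := fun j => by
      simpa using multFam_neg (hXn c j)
    have hvX : (fun i => mulOp (v i) * X c i - X c i * mulOp (v i)) ∈ multFam P := by
      simpa using multFam_neg (hXf _ (mulOp_mem_multFam hv) c)
    -- Both covariant derivatives are moved to the right: `∇[∇, X] + [∇, X]∇ = 2[∇, X]∇ + [∇, [∇,
    -- X]]`. The double commutator is again a multiplication and goes into the term of order zero.
    refine ⟨fun j i => (2 : ℂ) • (nabOp (a i) j * X c i - X c i * nabOp (a i) j),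
      fun i => ∑ j, (nabOp (a i) j * (nabOp (a i) j * X c i - X c i * nabOp (a i) j)
        - (nabOp (a i) j * X c i - X c i * nabOp (a i) j) * nabOp (a i) j)
        + (mulOp (v i) * X c i - X c i * mulOp (v i)), fun j => multFam_const_smul (hc j) 2,
      multFam_add (multFam_sum fun j _ => nabOp_commutator_multFam ha (hc j) j) hvX, fun i => ?_⟩
    have e : (hamOp (a i) (v i) + σ • 1) * X c i - X c i * (hamOp (a i) (v i) + σ • 1)
        = hamOp (a i) (v i) * X c i - X c i * hamOp (a i) (v i) := by
      simp [add_mul, mul_add]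
    rw [e, hamOp_commutator, ← add_assoc, ← Finset.sum_add_distrib]
    congr 1
    refine Finset.sum_congr rfl fun j _ => ?_
    simp only [two_smul]
    noncomm_ring

/-- The position and momentum operators. -/
def posMom (c : Fin d ⊕ Fin d) : Op d := Sum.elim zOp dOp c

/-- The position operators and the covariant derivatives. -/
def posNab (a : Fin d → Space d → ℂ) (c : Fin d ⊕ Fin d) : Op d := Sum.elim zOp (nabOp a) c

theorem zOp_commutator_nabOp (ha : ∀ i j, (a i j).HasTemperateGrowth) (l j : Fin d) :
    (fun i => zOp l * nabOp (a i) j - nabOp (a i) j * zOp l) ∈ multFam P := by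
  refine ⟨fun _ _ => -(if j = l then (1 / Complex.I) else 0), UCb.const ⟨_, fun _ _ => le_rfl⟩,
    funext fun i => ?_⟩
  rw [nabOp_mul_zOp (ha i), mulOp_const, mulOp_const, neg_smul]
  abel

/-- Here the letters are positions and plain derivatives. Since `[D_c, ∇_j]` is multiplication by a
derivative of the potential, the potential itself is required to have bounded derivatives. -/
theorem wordNorm_posMom_a_priori (ha : ∀ j, UCb P (fun i => a i j))
    (har : ∀ i j, IsRealFun (a i j)) (hv : UCb P v) (hvr : ∀ i, IsRealFun (v i))
    {σ : ℂ} (hσ : σ.re = 0) (hσ' : |σ.im| = 1) (k : ℕ) :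
    ∃ C : ℝ, 0 ≤ C ∧ ∀ i ∈ P, ∀ u, wordNorm posMom k u
      + ∑ j, wordNorm posMom k (nabOp (a i) j u)
        ≤ C * wordNorm posMom k (hamOp (a i) (v i) u + σ • u) := by
  have hat : ∀ i j, (a i j).HasTemperateGrowth := fun i j => (ha j).temperate i
  refine wordNorm_hamOp_a_priori (X := fun c _ => posMom c) hat har hv hvr hσ hσ' ?_ ?_ k
  · rintro f hf (c | c)
    · exact zOp_commutator_multFam hf c
    · exact dOp_commutator_multFam hf c
  · rintro (c | c) j
    · exact zOp_commutator_nabOp hat c j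
    · have h := multFam_neg (dOp_commutator_multFam (mulOp_mem_multFam (ha j)) c)
      convert h using 2 with i
      simp only [posMom, Sum.elim_inr, nabOp, mul_sub, sub_mul, dOp_comm c j]
      abel

/-- The components of the magnetic field are bounded along with all their derivatives. -/
def HasUCbField (P : Set ι) (a : ι → Fin d → Space d → ℂ) : Prop :=
  ∀ k l, UCb P (fun i x => partialDeriv k (a i l) x - partialDeriv l (a i k) x)

theorem nabOp_commutator_nabOp (ha : ∀ i j, (a i j).HasTemperateGrowth) (hb : HasUCbField P a)
    (k l : Fin d) :
    (fun i => nabOp (a i) k * nabOp (a i) l - nabOp (a i) l * nabOp (a i) k) ∈ multFam P := by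
  refine ⟨_, (hb k l).const_mul (c := fun _ => -(1 / Complex.I)) ⟨_, fun _ _ => le_rfl⟩,
    funext fun i => ?_⟩
  rw [nabOp_mul_nabOp (ha i) k l, add_sub_cancel_left]

/-- With covariant derivatives as letters only the field enters the commutators, so the estimate is
uniform for potentials that are not bounded. -/
theorem wordNorm_posNab_a_priori (ha : ∀ i j, (a i j).HasTemperateGrowth) (hb : HasUCbField P a)
    (har : ∀ i j, IsRealFun (a i j)) (hv : UCb P v) (hvr : ∀ i, IsRealFun (v i))
    {σ : ℂ} (hσ : σ.re = 0) (hσ' : |σ.im| = 1) (k : ℕ) :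
    ∃ C : ℝ, 0 ≤ C ∧ ∀ i ∈ P, ∀ u, wordNorm (posNab (a i)) k u
      + ∑ j, wordNorm (posNab (a i)) k (nabOp (a i) j u)
        ≤ C * wordNorm (posNab (a i)) k (hamOp (a i) (v i) u + σ • u) := by
  refine wordNorm_hamOp_a_priori (X := fun c i => posNab (a i) c) ha har hv hvr hσ hσ' ?_ ?_ k
  · rintro f hf (c | c)
    · exact zOp_commutator_multFam hf c
    · exact nabOp_commutator_multFam ha hf c
  · rintro (c | c) j
    · exact zOp_commutator_nabOp ha c j
    · exact nabOp_commutator_nabOp ha hb c j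

/-! ### Tame families of operators -/

/-- A family of operators is tame with respect to the norms defined by words in `X`. -/
def Tame (P : Set ι) (X : κ → ι → Op d) (T : ι → Op d) : Prop :=
  ∀ k, ∃ l, ∃ C : ℝ, 0 ≤ C ∧ ∀ i ∈ P, ∀ u,
    wordNorm (fun c => X c i) k (T i u) ≤ C * wordNorm (fun c => X c i) l u

theorem Tame.add {S T : ι → Op d} (hS : Tame P X S) (hT : Tame P X T) :
    Tame P X (fun i => S i + T i) := by
  intro k
  obtain ⟨l, C, hC0, hC⟩ := hS k
  obtain ⟨m, D, hD0, hD⟩ := hT k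
  refine ⟨max l m, C + D, by positivity, fun i hi u => ?_⟩
  rw [LinearMap.add_apply, add_mul]
  refine (map_add_le_add _ _ _).trans (add_le_add ?_ ?_)
  · exact (hC i hi u).trans (mul_le_mul_of_nonneg_left (wordNorm_mono _ (le_max_left _ _) _) hC0)
  · exact (hD i hi u).trans (mul_le_mul_of_nonneg_left (wordNorm_mono _ (le_max_right _ _) _) hD0)

theorem Tame.mul {S T : ι → Op d} (hS : Tame P X S) (hT : Tame P X T) :
    Tame P X (fun i => S i * T i) := by
  intro k
  obtain ⟨l, C, hC0, hC⟩ := hS k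
  obtain ⟨m, D, hD0, hD⟩ := hT l
  refine ⟨m, C * D, by positivity, fun i hi u => ?_⟩
  rw [mul_assoc]
  exact (hC i hi _).trans (mul_le_mul_of_nonneg_left (hD i hi u) hC0)

theorem Tame.smul {T : ι → Op d} (hT : Tame P X T) {c : ι → ℂ}
    (hc : ∃ C : ℝ, ∀ i ∈ P, ‖c i‖ ≤ C) : Tame P X (fun i => c i • T i) := by
  intro k
  obtain ⟨l, C, hC0, hC⟩ := hT k
  obtain ⟨D, hD⟩ := hc
  refine ⟨l, |D| * C, by positivity, fun i hi u => ?_⟩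
  rw [LinearMap.smul_apply, map_smul_eq_mul, mul_assoc]
  exact mul_le_mul ((hD i hi).trans (le_abs_self D)) (hC i hi u) (apply_nonneg _ _) (abs_nonneg _)

theorem Tame.word (c : κ) : Tame P X (X c) := fun k =>
  ⟨k + 1, 1, zero_le_one, fun i _ u => by
    rw [one_mul]; exact wordNorm_apply_le_succ (fun c => X c i) k c u⟩

theorem Tame.of_stable (hXf : ∀ f ∈ multFam P, ∀ c, (fun i => X c i * f i - f i * X c i) ∈ multFam P)
    {T : ι → Op d} (hT : T ∈ multFam P) : Tame P X T := fun k =>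
  ⟨k, wordNorm_le_of_stable (fun _ hf => multFam_uBdd hf) hXf k T hT⟩

theorem Tame.zero : Tame P X (fun _ => 0) := fun k => ⟨k, 0, le_rfl, fun i _ u => by simp⟩

theorem Tame.sum {α : Type*} {s : Finset α} {T : α → ι → Op d} (hT : ∀ k ∈ s, Tame P X (T k)) :
    Tame P X (fun i => ∑ k ∈ s, T k i) := by
  classical
  induction s using Finset.induction_on with
  | empty => simpa using Tame.zero
  | insert a s ha ih =>
    simp only [Finset.sum_insert ha]
    exact (hT a (by simp)).add (ih fun k hk => hT k (by simp [hk]))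

theorem Tame.neg {T : ι → Op d} (hT : Tame P X T) : Tame P X (fun i => -T i) := by
  simpa using hT.smul (c := fun _ => -1) ⟨1, by simp⟩

theorem Tame.sub {S T : ι → Op d} (hS : Tame P X S) (hT : Tame P X T) :
    Tame P X (fun i => S i - T i) := by
  simpa [sub_eq_add_neg] using hS.add hT.neg

/-- Comparison of the norms defined by words in two systems of operators. -/
theorem wordNorm_le_of_tame {κ' : Type*} [Fintype κ'] {Y : κ' → ι → Op d}
    (hY : ∀ c, Tame P X (Y c)) (k : ℕ) :
    ∃ l, ∃ C : ℝ, 0 ≤ C ∧ ∀ i ∈ P, ∀ u,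
      wordNorm (fun c => Y c i) k u ≤ C * wordNorm (fun c => X c i) l u := by
  induction k with
  | zero => exact ⟨0, 1, zero_le_one, fun i _ u => by simp [wordNorm_zero]⟩
  | succ k ih =>
    obtain ⟨l, C, hC0, hC⟩ := ih
    choose m D hD0 hD using fun c => hY c l
    refine ⟨max l (Finset.univ.sup m), C + ∑ c, C * D c,
      add_nonneg hC0 (Finset.sum_nonneg fun c _ => mul_nonneg hC0 (hD0 c)), fun i hi u => ?_⟩
    rw [wordNorm_succ, add_mul, Finset.sum_mul]
    refine add_le_add ((hC i hi u).trans (mul_le_mul_of_nonneg_left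
      (wordNorm_mono _ (le_max_left _ _) _) hC0)) (Finset.sum_le_sum fun c _ => ?_)
    refine (hC i hi _).trans ?_
    rw [mul_assoc]
    refine mul_le_mul_of_nonneg_left ((hD c i hi u).trans (mul_le_mul_of_nonneg_left
      (wordNorm_mono _ ?_ _) (hD0 c))) hC0
    exact (Finset.le_sup (f := m) (Finset.mem_univ c)).trans (le_max_right _ _)

end families

end

end MagneticSchrodinger

namespace MagneticSchrodinger

noncomputable section

variable {d : ℕ}

open scoped FourierTransform
open LineDeriv

/-! ### The norms defined by words in position and momentum generate the Schwartz topology -/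

/-- The operator `1 + ∑_j D_j²`. -/
def besselOp : Op d := 1 + ∑ j, dOp j * dOp j

theorem fourier_dOp (j : Fin d) (u : SpaceS d) (ξ : Space d) :
    (𝓕 (dOp j u)) ξ = (2 * Real.pi) * (ξ j : ℂ) * (𝓕 u) ξ := by
  have h : (inner ℝ · (EuclideanSpace.single j (1 : ℝ)) : Space d → ℝ).HasTemperateGrowth := by
    fun_prop
  have e : dOp j u = (1 / Complex.I) • ∂_{EuclideanSpace.single j (1 : ℝ)} u := rfl
  rw [e, FourierTransform.fourier_smul, SchwartzMap.fourier_lineDerivOp_eq]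
  simp only [_root_.smul_apply, SchwartzMap.smulLeftCLM_apply_apply h, smul_eq_mul]
  have e2 : (inner ℝ ξ (EuclideanSpace.single j (1 : ℝ)) : ℝ) = ξ j := by
    simp [EuclideanSpace.inner_single_right]
  rw [e2, Complex.real_smul]
  field_simp

theorem fourier_besselOp (u : SpaceS d) (ξ : Space d) :
    (𝓕 (besselOp u)) ξ = ((1 + (2 * Real.pi) ^ 2 * ‖ξ‖ ^ 2 : ℝ) : ℂ) * (𝓕 u) ξ := by
  have e : besselOp u = u + ∑ j, dOp j (dOp j u) := by
    simp [besselOp, LinearMap.add_apply, LinearMap.sum_apply, Module.End.mul_apply]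
  have e2 : 𝓕 (besselOp u) = 𝓕 u + ∑ j, 𝓕 (dOp j (dOp j u)) := by
    have h := fun x => (SchwartzMap.fourierTransformCLM_apply (𝕜 := ℂ) (x : SpaceS d)).symm
    rw [e, h, map_add, map_sum]
    simp only [← h]
  rw [e2, _root_.add_apply, _root_.sum_apply]
  simp only [fourier_dOp]
  rw [EuclideanSpace.norm_sq_eq]
  push_cast
  simp only [Real.norm_eq_abs]
  rw [add_mul, one_mul, Finset.mul_sum, Finset.sum_mul]
  congr 1
  refine Finset.sum_congr rfl fun j _ => ?_
  have h : ((|ξ j| : ℝ) : ℂ) ^ 2 = (ξ j : ℂ) ^ 2 := by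
    rw [← Complex.ofReal_pow, sq_abs, Complex.ofReal_pow]
  rw [h]
  ring

theorem fourier_besselOp_pow (n : ℕ) (u : SpaceS d) (ξ : Space d) :
    (𝓕 ((besselOp ^ n) u)) ξ
      = ((1 + (2 * Real.pi) ^ 2 * ‖ξ‖ ^ 2 : ℝ) : ℂ) ^ n * (𝓕 u) ξ := by
  induction n with
  | zero => simp
  | succ n ih =>
    rw [pow_succ' besselOp, Module.End.mul_apply, fourier_besselOp, ih]
    ring

theorem memLp_inv_bessel : ∃ n : ℕ, MemLp
    (fun ξ : Space d => (((1 + (2 * Real.pi) ^ 2 * ‖ξ‖ ^ 2 : ℝ) : ℂ) ^ n)⁻¹) 2 volume := by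
  obtain ⟨n, hn⟩ : ∃ n : ℕ, (Module.finrank ℝ (Space d) : ℝ) < n := exists_nat_gt _
  have h1 := integrable_one_add_norm (E := Space d) (μ := volume) hn
  have hp : ∀ ξ : Space d, (0 : ℝ) < 1 + (2 * Real.pi) ^ 2 * ‖ξ‖ ^ 2 := fun ξ => by positivity
  have hcont : Continuous fun ξ : Space d =>
      (((1 + (2 * Real.pi) ^ 2 * ‖ξ‖ ^ 2 : ℝ) : ℂ) ^ n)⁻¹ := by
    refine Continuous.inv₀ (by fun_prop) fun ξ => pow_ne_zero _ ?_
    exact_mod_cast (hp ξ).ne'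
  refine ⟨n, (memLp_two_iff_integrable_sq_norm hcont.aestronglyMeasurable).2 ?_⟩
  refine (h1.const_mul (2 ^ n)).mono' (by fun_prop) (Filter.Eventually.of_forall fun ξ => ?_)
  rw [Real.rpow_neg (by positivity), Real.rpow_natCast, norm_pow, norm_norm, norm_inv, norm_pow,
    Complex.norm_real, Real.norm_of_nonneg (hp ξ).le, ← div_eq_mul_inv,
    inv_pow, ← pow_mul, mul_comm n 2, pow_mul, inv_le_comm₀ (by have := hp ξ; positivity)
      (by positivity), inv_div, div_le_iff₀ (by positivity), ← mul_pow]
  refine pow_le_pow_left₀ (by positivity) ?_ n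
  have hpi : (1 : ℝ) ≤ (2 * Real.pi) ^ 2 := by nlinarith [Real.pi_gt_three]
  have h2 : 1 + ‖ξ‖ ^ 2 ≤ 1 + (2 * Real.pi) ^ 2 * ‖ξ‖ ^ 2 := by nlinarith [sq_nonneg ‖ξ‖]
  have h3 : 1 + ‖ξ‖ ≤ 2 * (1 + ‖ξ‖ ^ 2) := by nlinarith [sq_nonneg (‖ξ‖ - 1), sq_nonneg ‖ξ‖]
  have h4 : 0 ≤ ‖ξ‖ ^ 2 := by positivity
  nlinarith

/-- A Sobolev inequality on the Schwartz space. -/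
theorem exists_norm_apply_le_besselOp : ∃ (n : ℕ) (C : ℝ), 0 ≤ C ∧ ∀ (u : SpaceS d) (x : Space d),
    ‖u x‖ ≤ C * ‖toL2 ((besselOp ^ n) u)‖ := by
  obtain ⟨n, hn⟩ := memLp_inv_bessel (d := d)
  set w : Space d → ℂ := fun ξ => (((1 + (2 * Real.pi) ^ 2 * ‖ξ‖ ^ 2 : ℝ) : ℂ) ^ n)⁻¹ with hw
  refine ⟨n, ‖hn.toLp w‖, norm_nonneg _, fun u x => ?_⟩
  have hp : ∀ ξ : Space d, ((1 + (2 * Real.pi) ^ 2 * ‖ξ‖ ^ 2 : ℝ) : ℂ) ^ n ≠ 0 := fun ξ => by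
    refine pow_ne_zero _ ?_
    have : (0 : ℝ) < 1 + (2 * Real.pi) ^ 2 * ‖ξ‖ ^ 2 := by positivity
    exact_mod_cast this.ne'
  -- The Fourier transform of `u` is an `L²` function times the transform of `(1 + ∑ D_j²)^n u`. By
  -- Cauchy–Schwarz it is integrable, and Plancherel turns the second factor into the `L²` norm in
  -- the statement.
  have e1 : ∀ ξ, (𝓕 u) ξ = w ξ * (𝓕 ((besselOp ^ n) u)) ξ := fun ξ => by
    rw [fourier_besselOp_pow, hw]
    simp only
    rw [inv_mul_cancel_left₀ (hp ξ)]
  have e2 : u x = ∫ ξ, Real.fourierChar (inner ℝ ξ x) • (𝓕 u) ξ := by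
    have h : 𝓕⁻ (𝓕 u : SpaceS d) = u := FourierTransform.fourierInv_fourier_eq u
    conv_lhs => rw [← h]
    rw [SchwartzMap.fourierInv_coe, Real.fourierInv_eq]
  rw [e2]
  refine (norm_integral_le_integral_norm _).trans ?_
  simp only [Circle.norm_smul]
  set g := 𝓕 ((besselOp ^ n) u) with hg
  have hgn : ‖toL2 g‖ = ‖toL2 ((besselOp ^ n) u)‖ := SchwartzMap.norm_fourier_toL2_eq _
  rw [← hgn]
  have hg2 : MemLp (g : Space d → ℂ) 2 volume := g.memLp 2
  have h3 : ∫ ξ, ‖(𝓕 u) ξ‖ = ∫ ξ, ‖w ξ‖ * ‖g ξ‖ := by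
    congr 1; ext ξ; rw [e1 ξ, norm_mul]
  rw [h3]
  have h4 := integral_mul_norm_le_Lp_mul_Lq (μ := (volume : Measure (Space d))) (f := w) (g := g)
    Real.HolderConjugate.two_two (by simpa using hn) (by simpa using hg2)
  refine h4.trans (le_of_eq ?_)
  congr 1
  · rw [Lp.norm_toLp, hn.eLpNorm_eq_integral_rpow_norm (by simp) (by simp), ENNReal.toReal_ofReal
      (by positivity)]
    simp
  · have : ‖toL2 g‖ = (eLpNorm g 2 volume).toReal := SchwartzMap.norm_toLp
    rw [this, hg2.eLpNorm_eq_integral_rpow_norm (by simp) (by simp), ENNReal.toReal_ofReal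
      (by positivity)]
    simp

theorem tame_posMom (c : Fin d ⊕ Fin d) :
    Tame (univ : Set Unit) (fun c _ => posMom (d := d) c) (fun _ => posMom c) :=
  Tame.word (P := (univ : Set Unit)) (X := fun c _ => posMom (d := d) c) c

theorem exists_norm_apply_le_wordNorm : ∃ (k : ℕ) (C : ℝ), 0 ≤ C ∧ ∀ (u : SpaceS d) (x : Space d),
    ‖u x‖ ≤ C * wordNorm posMom k u := by
  obtain ⟨n, C, hC0, hC⟩ := exists_norm_apply_le_besselOp (d := d)
  have h1 : Tame (univ : Set Unit) (fun c _ => posMom (d := d) c) (fun _ => 1) :=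
    fun k => ⟨k, 1, zero_le_one, fun i _ u => by simp⟩
  have h2 : Tame (univ : Set Unit) (fun c _ => posMom (d := d) c) (fun _ => besselOp) :=
    h1.add (Tame.sum fun j _ => (tame_posMom (Sum.inr j)).mul (tame_posMom (Sum.inr j)))
  have h3 : ∀ n, Tame (univ : Set Unit) (fun c _ => posMom (d := d) c) (fun _ => besselOp ^ n) := by
    intro n
    induction n with
    | zero => simpa using h1
    | succ n ih => simpa [pow_succ] using ih.mul h2
  obtain ⟨l, D, hD0, hD⟩ := h3 n 0
  refine ⟨l, C * D, by positivity, fun u x => (hC u x).trans ?_⟩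
  rw [mul_assoc]
  exact mul_le_mul_of_nonneg_left (hD () trivial u) hC0

theorem norm_le_sum_norm_coord (x : Space d) : ‖x‖ ≤ ∑ j, ‖coord j x‖ := by
  conv_lhs => rw [← (EuclideanSpace.basisFun (Fin d) ℝ).sum_repr x]
  refine (norm_sum_le _ _).trans (Finset.sum_le_sum fun j _ => ?_)
  simp [norm_smul, coord]

theorem partialDeriv_eq_dOp (j : Fin d) (u : SpaceS d) :
    partialDeriv j u = fun x => Complex.I * dOp j u x := by
  ext x
  rw [dOp_apply, ← mul_assoc]
  simp

/-- The Schwartz seminorms are bounded by the norms defined by words. -/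
theorem exists_pow_mul_norm_iteratedFDeriv_le (n k : ℕ) :
    ∃ (l : ℕ) (C : ℝ), 0 ≤ C ∧ ∀ (u : SpaceS d) (x : Space d),
      ‖x‖ ^ k * ‖iteratedFDeriv ℝ n u x‖ ≤ C * wordNorm posMom l u := by
  induction n with
  | zero =>
    induction k with
    | zero =>
      obtain ⟨l, C, hC0, hC⟩ := exists_norm_apply_le_wordNorm (d := d)
      exact ⟨l, C, hC0, fun u x => by simpa using hC u x⟩
    | succ k ih =>
      obtain ⟨l, C, hC0, hC⟩ := ih
      refine ⟨l + 1, ∑ _j : Fin d, C, Finset.sum_nonneg fun _ _ => hC0, fun u x => ?_⟩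
      rw [norm_iteratedFDeriv_zero, pow_succ]
      have h : ‖x‖ ^ k * ‖x‖ * ‖u x‖ ≤ ∑ j, ‖x‖ ^ k * ‖zOp j u x‖ := by
        rw [← Finset.mul_sum, mul_assoc]
        refine mul_le_mul_of_nonneg_left ?_ (by positivity)
        simp only [zOp, mulOp_apply (coord_hasTemperateGrowth _), norm_mul, ← Finset.sum_mul]
        exact mul_le_mul_of_nonneg_right (norm_le_sum_norm_coord x) (norm_nonneg _)
      refine h.trans ?_
      rw [Finset.sum_mul]
      refine Finset.sum_le_sum fun j _ => ?_
      have h2 := hC (zOp j u) x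
      rw [norm_iteratedFDeriv_zero] at h2
      exact h2.trans (mul_le_mul_of_nonneg_left
        (wordNorm_apply_le_succ posMom l (Sum.inl j) u) hC0)
  | succ n ih =>
    obtain ⟨l, C, hC0, hC⟩ := ih
    refine ⟨l + 1, ∑ _j : Fin d, C, Finset.sum_nonneg fun _ _ => hC0, fun u x => ?_⟩
    have hsm : ∀ j, ContDiff ℝ n (partialDeriv j u) := fun j => by
      rw [partialDeriv_eq_dOp]; exact contDiff_const.mul ((dOp j u).smooth n)
    have h := (norm_iteratedFDeriv_succ_le_sum u.differentiable hsm).2 x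
    rw [Finset.sum_mul]
    refine (mul_le_mul_of_nonneg_left h (by positivity)).trans ?_
    rw [Finset.mul_sum]
    refine Finset.sum_le_sum fun j _ => ?_
    have e : ‖iteratedFDeriv ℝ n (partialDeriv j u) x‖ = ‖iteratedFDeriv ℝ n (dOp j u) x‖ := by
      have h1 : partialDeriv j u = Complex.I • (dOp j u : Space d → ℂ) := by
        rw [partialDeriv_eq_dOp]; rfl
      rw [h1, iteratedFDeriv_const_smul_apply ((dOp j u).smooth n).contDiffAt, norm_smul,
        Complex.norm_I, one_mul]
    rw [e]
    exact (hC (dOp j u) x).trans (mul_le_mul_of_nonneg_left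
      (wordNorm_apply_le_succ posMom l (Sum.inr j) u) hC0)

/-- A series of Schwartz functions converges if it converges absolutely for all seminorms. -/
theorem exists_hasSum_of_summable_seminorm (f : ℕ → SpaceS d)
    (hf : ∀ k n : ℕ, Summable fun i => SchwartzMap.seminorm ℝ k n (f i)) :
    ∃ g : SpaceS d, Filter.Tendsto (fun N => ∑ i ∈ Finset.range N, f i) Filter.atTop (nhds g) := by
  have hb : ∀ (n i : ℕ) (x : Space d), ‖iteratedFDeriv ℝ n (f i) x‖
      ≤ SchwartzMap.seminorm ℝ 0 n (f i) := fun n i x => by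
    simpa using SchwartzMap.le_seminorm ℝ 0 n (f i) x
  have hsm : ∀ (M : ℕ), ContDiff ℝ (⊤ : ℕ∞) fun x => ∑' i, f (i + M) x := fun M =>
    contDiff_tsum (N := ⊤) (fun i => (f (i + M)).smooth ⊤)
      (fun k _ => (summable_nat_add_iff M).2 (hf 0 k)) fun k i x _ => hb k (i + M) x
  have hder : ∀ (M n : ℕ) (x : Space d), iteratedFDeriv ℝ n (fun x => ∑' i, f (i + M) x) x
      = ∑' i, iteratedFDeriv ℝ n (f (i + M)) x := fun M n x =>
    iteratedFDeriv_tsum_apply (N := ⊤) (fun i => (f (i + M)).smooth ⊤)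
      (fun k _ => (summable_nat_add_iff M).2 (hf 0 k)) (fun k i x _ => hb k (i + M) x)
      (by exact_mod_cast le_top) x
  have hdecay : ∀ (M k n : ℕ) (x : Space d),
      ‖x‖ ^ k * ‖iteratedFDeriv ℝ n (fun x => ∑' i, f (i + M) x) x‖
        ≤ ∑' i, SchwartzMap.seminorm ℝ k n (f (i + M)) := fun M k n x => by
    rw [hder, ← Real.norm_of_nonneg (pow_nonneg (norm_nonneg x) k), ← norm_smul,
      ← tsum_const_smul'' (‖x‖ ^ k)]
    refine tsum_of_norm_bounded ((summable_nat_add_iff M).2 (hf k n)).hasSum fun i => ?_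
    rw [norm_smul, Real.norm_of_nonneg (pow_nonneg (norm_nonneg x) k)]
    exact SchwartzMap.le_seminorm ℝ k n (f (i + M)) x
  let g : ℕ → SpaceS d := fun M =>
    { toFun := fun x => ∑' i, f (i + M) x
      smooth' := hsm M
      decay' := fun k n => ⟨_, hdecay M k n⟩ }
  have hsum : ∀ x, Summable fun i => f i x := fun x =>
    Summable.of_norm_bounded (hf 0 0) fun i => by simpa using hb 0 i x
  have hg : ∀ M, g 0 - ∑ i ∈ Finset.range M, f i = g M := fun M => by
    ext x
    rw [_root_.sub_apply, _root_.sum_apply, sub_eq_iff_eq_add']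
    exact ((hsum x).sum_add_tsum_nat_add M).symm
  refine ⟨g 0, ((schwartz_withSeminorms ℝ (Space d) ℂ).tendsto_nhds _ _).2 fun p ε hε => ?_⟩
  have h0 := tendsto_sum_nat_add fun i => SchwartzMap.seminorm ℝ p.1 p.2 (f i)
  filter_upwards [h0.eventually_lt_const hε] with M hM
  rw [map_sub_rev, hg]
  exact lt_of_le_of_lt (SchwartzMap.seminorm_le_bound ℝ p.1 p.2 (g M)
    (tsum_nonneg fun i => apply_nonneg _ _) (hdecay M p.1 p.2)) hM

/-- A sequence of Schwartz functions converges if it is Cauchy for all norms defined by words. -/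
theorem exists_tendsto_of_cauchy_wordNorm (f : ℕ → SpaceS d)
    (hf : ∀ k, ∀ ε : ℝ, 0 < ε → ∃ N, ∀ m ≥ N, ∀ n ≥ N, wordNorm posMom k (f m - f n) ≤ ε) :
    ∃ (r : ℕ → ℕ) (g : SpaceS d), Filter.Tendsto r Filter.atTop Filter.atTop ∧
      Filter.Tendsto (fun n => f (r n)) Filter.atTop (nhds g) := by
  choose N hN using fun k : ℕ => hf k ((1 / 2) ^ k) (by positivity)
  -- The sum makes `r` monotone with `r k ≥ N k`, and each added `1` forces `r k ≥ k`. Consecutive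
  -- differences along `r` are at most `2^{-k}` in the `k`-th norm. As the word norms increase with
  -- `k`, the differences are summable in each fixed norm.
  set r : ℕ → ℕ := fun k => ∑ i ∈ Finset.range (k + 1), (N i + 1) with hr
  have hrN : ∀ k, N k ≤ r k := fun k => by
    have := Finset.single_le_sum (f := fun i => N i + 1) (fun _ _ => Nat.zero_le _)
      (Finset.self_mem_range_succ k)
    exact (Nat.le_succ _).trans this
  have hmono : ∀ k, r k ≤ r (k + 1) := fun k => by
    rw [hr]; simp only; rw [Finset.sum_range_succ _ (k + 1)]; exact Nat.le_add_right _ _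
  have hrk : ∀ k, k ≤ r k := fun k => by
    have : ∑ i ∈ Finset.range (k + 1), 1 ≤ r k := Finset.sum_le_sum fun i _ => by omega
    simp at this
    omega
  have hw : ∀ k, wordNorm posMom k (f (r (k + 1)) - f (r k)) ≤ (1 / 2) ^ k := fun k =>
    hN k _ ((hrN k).trans (hmono k)) _ (hrN k)
  have hs : ∀ k n : ℕ, Summable fun i => SchwartzMap.seminorm ℝ k n (f (r (i + 1)) - f (r i)) := by
    intro k n
    obtain ⟨l, C, hC0, hC⟩ := exists_pow_mul_norm_iteratedFDeriv_le (d := d) n k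
    rw [← summable_nat_add_iff l]
    refine Summable.of_nonneg_of_le (fun i => apply_nonneg _ _) (fun i => ?_)
      (((summable_geometric_of_lt_one (by norm_num) (by norm_num : (1 / 2 : ℝ) < 1)).mul_left C))
    refine SchwartzMap.seminorm_le_bound ℝ k n _ (by positivity) fun x => (hC _ x).trans ?_
    refine mul_le_mul_of_nonneg_left ?_ hC0
    refine (wordNorm_mono posMom (Nat.le_add_left l i) _).trans ((hw (i + l)).trans ?_)
    exact pow_le_pow_of_le_one (by norm_num) (by norm_num) (Nat.le_add_right i l)
  obtain ⟨g, hg⟩ := exists_hasSum_of_summable_seminorm _ hs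
  refine ⟨r, g + f (r 0), Filter.tendsto_atTop_mono hrk Filter.tendsto_id, ?_⟩
  have := hg.add_const (f (r 0))
  refine this.congr fun n => ?_
  rw [Finset.sum_range_sub (fun i => f (r i)), sub_add_cancel]

end

end MagneticSchrodinger

namespace MagneticSchrodinger

noncomputable section

variable {d : ℕ}

/-! ### Solvability for bounded potentials -/

theorem hamOp_sub_hamOp {a a' : Fin d → Space d → ℂ} {v v' : Space d → ℂ} {K : Fin d → Op d}
    (h : ∀ j, nabOp a' j = nabOp a j - K j) :
    hamOp a' v' - hamOp a v
      = ∑ j, (K j * K j - nabOp a j * K j - K j * nabOp a j) + (mulOp v' - mulOp v) := by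
  simp only [hamOp, h]
  rw [add_sub_add_comm, ← Finset.sum_sub_distrib]
  congr 1
  exact Finset.sum_congr rfl fun j _ => by noncomm_ring

theorem continuous_nabOp (a : Fin d → Space d → ℂ) (j : Fin d) :
    Continuous (nabOp a j : SpaceS d → SpaceS d) := by
  have : (nabOp a j : SpaceS d → SpaceS d) = fun u => dOp j u - mulOp (a j) u := rfl
  rw [this]
  exact (continuous_dOp j).sub (continuous_mulOp _)

theorem continuous_hamOp (a : Fin d → Space d → ℂ) (v : Space d → ℂ) :
    Continuous (hamOp a v : SpaceS d → SpaceS d) := by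
  have : (hamOp a v : SpaceS d → SpaceS d)
      = fun u => ∑ j, nabOp a j (nabOp a j u) + mulOp v u := by
    ext1 u
    simp [hamOp, LinearMap.add_apply, LinearMap.sum_apply, Module.End.mul_apply]
  rw [this]
  exact (continuous_finsetSum _ fun j _ =>
    (continuous_nabOp a j).comp (continuous_nabOp a j)).add (continuous_mulOp _)

theorem continuous_posMom (c : Fin d ⊕ Fin d) : Continuous (posMom c : SpaceS d → SpaceS d) := by
  rcases c with c | c
  · exact continuous_mulOp _
  · exact continuous_dOp _

theorem continuous_wordNorm_posMom (k : ℕ) : Continuous (wordNorm (d := d) posMom k) := by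
  induction k with
  | zero => exact continuous_norm.comp (toL2 (d := d)).continuous
  | succ k ih =>
    have : (wordNorm (d := d) posMom (k + 1) : SpaceS d → ℝ)
        = fun u => wordNorm posMom k u + ∑ c, wordNorm posMom k (posMom c u) := by
      ext1 u; exact wordNorm_succ _ _ _
    rw [this]
    exact ih.add (continuous_finsetSum _ fun c _ => ih.comp (continuous_posMom c))

/-- A continuous operator with a priori estimates is surjective if it has dense range in the sense
of approximate solutions. -/
theorem surjective_of_a_priori {L : Op d} (hL : Continuous (L : SpaceS d → SpaceS d))
    (hap : ∀ k, ∃ l, ∃ C : ℝ, 0 ≤ C ∧ ∀ u, wordNorm posMom k u ≤ C * wordNorm posMom l (L u))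
    (happ : ∀ f, ∃ u : ℕ → SpaceS d, ∀ k, Filter.Tendsto
      (fun n => wordNorm posMom k (L (u n) - f)) Filter.atTop (nhds 0)) :
    Function.Surjective L := by
  intro f
  obtain ⟨u, hu⟩ := happ f
  have hC : ∀ k, ∀ ε : ℝ, 0 < ε → ∃ N, ∀ m ≥ N, ∀ n ≥ N, wordNorm posMom k (u m - u n) ≤ ε := by
    intro k ε hε
    obtain ⟨l, C, hC0, hC⟩ := hap k
    have h1 := (hu l).const_mul (2 * C)
    rw [mul_zero] at h1
    obtain ⟨N, hN⟩ := Filter.eventually_atTop.1 (h1.eventually_lt_const hε)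
    refine ⟨N, fun m hm n hn => (hC _).trans ?_⟩
    have e : L (u m - u n) = (L (u m) - f) - (L (u n) - f) := by rw [map_sub]; abel
    rw [e]
    have h2 := map_sub_le_add (wordNorm posMom l) (L (u m) - f) (L (u n) - f)
    have h3 := mul_le_mul_of_nonneg_left h2 hC0
    have := hN m hm
    have := hN n hn
    linarith
  obtain ⟨r, g, hr, hg⟩ := exists_tendsto_of_cauchy_wordNorm u hC
  refine ⟨g, ?_⟩
  have h1 : Filter.Tendsto (fun n => wordNorm posMom 0 (L (u (r n)) - f)) Filter.atTop
      (nhds (wordNorm posMom 0 (L g - f))) :=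
    ((continuous_wordNorm_posMom 0).tendsto _).comp
      (((hL.tendsto g).comp hg).sub_const f)
  have h2 := tendsto_nhds_unique h1 ((hu 0).comp hr)
  rw [wordNorm_zero, norm_eq_zero] at h2
  exact sub_eq_zero.1 (toL2_injective (h2.trans (map_zero _).symm))

/-- The range of a small perturbation is dense. -/
theorem dense_range_of_perturbation {A B : Op d} {p : Seminorm ℂ (SpaceS d)}
    (h : ∀ u, p (B u - A u) ≤ 1 / 2 * p (A u))
    (hA : ∀ f, ∀ δ : ℝ, 0 < δ → ∃ u, p (A u - f) ≤ δ) (f : SpaceS d) (δ : ℝ) (hδ : 0 < δ) :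
    ∃ u, p (B u - f) ≤ δ := by
  have key : ∀ n : ℕ, ∃ u, p (B u - f) ≤ (1 / 2) ^ n * p f + δ / 2 := by
    intro n
    induction n with
    | zero => exact ⟨0, by simp; positivity⟩
    | succ n ih =>
      obtain ⟨u, hu⟩ := ih
      -- A Neumann step: `w` nearly solves `A w = f - B u`, so the new residual is `(B - A) w` plus
      -- at most `δ/6`. It is at most half of the old residual plus `(3/2)(δ/6) = δ/4`, and this
      -- reproduces the constant term `δ/2`.
      obtain ⟨w, hw⟩ := hA (f - B u) (δ / 6) (by positivity)
      refine ⟨u + w, ?_⟩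
      have e : B (u + w) - f = (B w - A w) + (A w - (f - B u)) := by rw [map_add]; abel
      have h1 := map_add_le_add p (B w - A w) (A w - (f - B u))
      have h2 : p (A w) ≤ δ / 6 + p (B u - f) := by
        have := map_add_le_add p (A w - (f - B u)) (f - B u)
        rw [sub_add_cancel, map_sub_rev p f] at this
        linarith
      have := h w
      rw [e, pow_succ]
      linarith
  obtain ⟨n, hn⟩ := exists_pow_lt_of_lt_one (show (0 : ℝ) < δ / 2 / (p f + 1) by positivity)
    (by norm_num : (1 / 2 : ℝ) < 1)
  obtain ⟨u, hu⟩ := key n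
  refine ⟨u, hu.trans ?_⟩
  rw [lt_div_iff₀ (by positivity)] at hn
  have : (0 : ℝ) < (1 / 2) ^ n := by positivity
  linarith

/-- When `σ² = -1` this function is the reciprocal of `4π²|ξ|² + σ`, written with a real
denominator. It is the Fourier multiplier that inverts the free operator `∑ D_j² + σ`. -/
theorem hasTemperateGrowth_symbol {σ : ℂ} :
    (fun ξ : Space d => (((2 * Real.pi) ^ 2 * ‖ξ‖ ^ 2 : ℝ) - σ)
      * (((1 + ((2 * Real.pi) ^ 2 * ‖ξ‖ ^ 2) ^ 2)⁻¹ : ℝ) : ℂ)).HasTemperateGrowth := by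
  have h1 : (fun ξ : Space d => (2 * Real.pi) ^ 2 * ‖ξ‖ ^ 2).HasTemperateGrowth :=
    (Function.HasTemperateGrowth.const _).mul (Function.hasTemperateGrowth_norm_sq _)
  have h2 : (fun x : ℝ => (1 + x ^ 2)⁻¹).HasTemperateGrowth := by
    have := Function.hasTemperateGrowth_one_add_norm_sq_rpow ℝ (-1)
    simpa [Real.rpow_neg_one] using this
  exact ((Complex.ofRealCLM.hasTemperateGrowth.comp h1).sub (Function.HasTemperateGrowth.const _)).mul
    (Complex.ofRealCLM.hasTemperateGrowth.comp (h2.comp h1))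

section

open scoped FourierTransform

/-- The free Schrödinger operator is surjective on the Schwartz space. -/
theorem surjective_free {σ : ℂ} (hσ : σ * σ = -1) :
    Function.Surjective ((besselOp + (σ - 1) • (1 : Op d) : Op d) : SpaceS d → SpaceS d) := by
  intro f
  set m := fun ξ : Space d => (((2 * Real.pi) ^ 2 * ‖ξ‖ ^ 2 : ℝ) - σ)
      * (((1 + ((2 * Real.pi) ^ 2 * ‖ξ‖ ^ 2) ^ 2)⁻¹ : ℝ) : ℂ) with hm
  set u : SpaceS d := 𝓕⁻ (mulOp m (𝓕 f)) with hu
  have hu2 : 𝓕 u = mulOp m (𝓕 f) := FourierTransform.fourier_fourierInv_eq (mulOp m (𝓕 f))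
  refine ⟨u, ?_⟩
  set B : Op d := besselOp + (σ - 1) • (1 : Op d) with hB
  have h3 : 𝓕 (B u) = 𝓕 f := by
    have e : 𝓕 (B u) = 𝓕 (besselOp u) + (σ - 1) • 𝓕 u := by
      have h := fun x => (SchwartzMap.fourierTransformCLM_apply (𝕜 := ℂ) (x : SpaceS d)).symm
      rw [hB, LinearMap.add_apply, LinearMap.smul_apply, Module.End.one_apply, h, h, h, map_add,
        map_smul]
    rw [e]
    ext ξ
    rw [_root_.add_apply, _root_.smul_apply, fourier_besselOp, hu2,
      mulOp_apply hasTemperateGrowth_symbol, smul_eq_mul]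
    set X := (2 * Real.pi) ^ 2 * ‖ξ‖ ^ 2
    have hX : ((1 + X ^ 2 : ℝ) : ℂ) ≠ 0 := by
      have : (0 : ℝ) < 1 + X ^ 2 := by positivity
      exact_mod_cast this.ne'
    push_cast at hX ⊢
    field_simp
    linear_combination (-(𝓕 f) ξ) * hσ
  have h4 := congrArg (fun w : SpaceS d => (𝓕⁻ w : SpaceS d)) h3
  have h5 := fun w : SpaceS d => (FourierTransform.fourierInv_fourier_eq w : 𝓕⁻ (𝓕 w : SpaceS d) = w)
  simpa only [h5] using h4

end

theorem nabOp_smul {a : Fin d → Space d → ℂ} (ha : ∀ j, (a j).HasTemperateGrowth) (s : ℝ)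
    (j : Fin d) : nabOp (fun j x => (s : ℂ) * a j x) j = dOp j - (s : ℂ) • mulOp (a j) := by
  rw [nabOp, mulOp_smul (s : ℂ) (ha j)]

/-- The difference of the members of the family interpolating to the free operator. -/
theorem wordNorm_interpolation_le {a : Fin d → Space d → ℂ} {v : Space d → ℂ}
    (ha : ∀ j, IsCbComplex (a j)) (hv : IsCbComplex v) (k : ℕ) :
    ∃ C : ℝ, 0 ≤ C ∧ ∀ s s' : ℝ, |s' - s| ≤ 1 → ∀ u : SpaceS d,
      wordNorm posMom k (hamOp (fun j x => (s' : ℂ) * a j x) (fun x => (s' : ℂ) * v x) u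
          - hamOp (fun j x => (s : ℂ) * a j x) (fun x => (s : ℂ) * v x) u)
        ≤ |s' - s| * C * (wordNorm posMom k u
          + ∑ j, wordNorm posMom k (nabOp (fun j x => (s : ℂ) * a j x) j u)) := by
  have hat := fun j => (ha j).hasTemperateGrowth
  have hvt := hv.hasTemperateGrowth
  have hmul : ∀ g : Space d → ℂ, IsCbComplex g → ∃ C : ℝ, 0 ≤ C ∧ ∀ u : SpaceS d,
      wordNorm posMom k (mulOp g u) ≤ C * wordNorm posMom k u := by
    intro g hg
    obtain ⟨C, hC0, hC⟩ := wordNorm_le_of_stable (P := (univ : Set Unit))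
      (X := fun c _ => posMom (d := d) c) (𝓕 := multFam univ) (fun _ hf => multFam_uBdd hf)
      (by
        rintro f hf (c | c)
        · exact zOp_commutator_multFam hf c
        · exact dOp_commutator_multFam hf c) k _ (mulOp_mem_multFam hg.uCb)
    exact ⟨C, hC0, fun u => hC () trivial u⟩
  have hp : ∀ j, IsCbComplex (fun x => (1 / Complex.I) * partialDeriv j (a j) x) := fun j =>
    (((ha j).partialDeriv j).uCb.const_mul (P := (univ : Set Unit)) (c := fun _ => 1 / Complex.I)
      ⟨_, fun _ _ => le_rfl⟩).isCbComplex (i := ()) trivial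
  choose A hA0 hA using fun j => hmul (a j) (ha j)
  choose B hB0 hB using fun j => hmul _ (hp j)
  obtain ⟨V, hV0, hV⟩ := hmul v hv
  -- In the square of `∇_j - h a_j` the term `h² a_j²` gives `A_j²`, the two mixed terms give `2
  -- A_j` and, after commuting, the derivative of `a_j` with bound `B_j`. The electric term gives
  -- `V`. The assumption `|h| ≤ 1` reduces `h²` to `|h|`.
  refine ⟨∑ j, (A j * A j + 2 * A j + B j) + V, ?_, fun s s' hs u => ?_⟩
  · exact add_nonneg (Finset.sum_nonneg fun j _ => by
      have := hA0 j; have := hB0 j; positivity) hV0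
  set q := wordNorm (d := d) posMom k with hq
  set a' := fun j x => (s : ℂ) * a j x with ha'
  have ha't : ∀ j, (a' j).HasTemperateGrowth := fun j =>
    (Function.HasTemperateGrowth.const _).mul (hat j)
  set h : ℝ := s' - s with hh
  have hK : ∀ j, nabOp (fun j x => (s' : ℂ) * a j x) j = nabOp a' j - (h : ℂ) • mulOp (a j) := by
    intro j
    rw [nabOp_smul hat, ha', nabOp_smul hat, sub_sub, ← add_smul, hh]
    push_cast
    congr 2; ring
  have hd := hamOp_sub_hamOp (v := fun x => (s : ℂ) * v x) (v' := fun x => (s' : ℂ) * v x) hK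
  have hd2 := congrArg (fun T : Op d => T u) hd
  simp only [LinearMap.sub_apply, LinearMap.add_apply, LinearMap.sum_apply, Module.End.mul_apply,
    LinearMap.smul_apply, map_smul] at hd2
  have hvs : ∀ r : ℝ, mulOp (fun x => (r : ℂ) * v x) = (r : ℂ) • mulOp v := fun r =>
    (mulOp_smul _ hvt).symm
  have hna : ∀ j, nabOp a' j (mulOp (a j) u) = mulOp (a j) (nabOp a' j u)
      + mulOp (fun x => (1 / Complex.I) * partialDeriv j (a j) x) u := fun j => by
    have := congrArg (fun T : Op d => T u) (nabOp_mul_mulOp ha't (hat j) j)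
    simpa [Module.End.mul_apply, LinearMap.add_apply] using this
  rw [hd2, hvs, hvs, LinearMap.smul_apply, LinearMap.smul_apply, ← sub_smul]
  have hn : ∀ (c : ℂ) w, q (c • w) = ‖c‖ * q w := fun c w => map_smul_eq_mul q c w
  have hhn : ‖(h : ℂ)‖ = |h| := by rw [Complex.norm_real, Real.norm_eq_abs]
  have hq0 : 0 ≤ q u := apply_nonneg _ _
  have hY0 : 0 ≤ ∑ j, q (nabOp a' j u) := Finset.sum_nonneg fun _ _ => apply_nonneg _ _
  obtain ⟨Y, hY⟩ : ∃ Y, Y = q u + ∑ j, q (nabOp a' j u) := ⟨_, rfl⟩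
  rw [← hY]
  have hYj : ∀ j, q (nabOp a' j u) ≤ Y := fun j =>
    (Finset.single_le_sum (f := fun j => q (nabOp a' j u)) (fun _ _ => apply_nonneg _ _)
      (Finset.mem_univ j)).trans (hY ▸ le_add_of_nonneg_left hq0)
  have hYu : q u ≤ Y := hY ▸ le_add_of_nonneg_right hY0
  have hY' : 0 ≤ Y := hq0.trans hYu
  refine (map_add_le_add q _ _).trans ?_
  rw [mul_add |h|, add_mul]
  refine add_le_add ?_ ?_
  · refine (Finset.le_sum_of_subadditive q (map_zero q).le (map_add_le_add q) _ _).trans ?_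
    rw [Finset.mul_sum, Finset.sum_mul]
    refine Finset.sum_le_sum fun j _ => ?_
    rw [hna]
    have h1 : q ((h : ℂ) • (h : ℂ) • mulOp (a j) (mulOp (a j) u)) ≤ |h| * (A j * A j * Y) := by
      rw [hn, hn, hhn]
      have h2 := (hA j _).trans (mul_le_mul_of_nonneg_left (hA j u) (hA0 j))
      have h3 : q (mulOp (a j) (mulOp (a j) u)) ≤ A j * A j * Y := by
        refine h2.trans ?_
        rw [mul_assoc]
        have := hA0 j
        gcongr
      have h4 : 0 ≤ q (mulOp (a j) (mulOp (a j) u)) := apply_nonneg _ _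
      have := abs_nonneg h
      calc |h| * (|h| * q (mulOp (a j) (mulOp (a j) u)))
          ≤ |h| * (1 * q (mulOp (a j) (mulOp (a j) u))) := by gcongr
        _ ≤ _ := by rw [one_mul]; gcongr
    have h2 : q (mulOp (a j) (nabOp a' j u)) ≤ A j * Y :=
      (hA j _).trans (mul_le_mul_of_nonneg_left (hYj j) (hA0 j))
    have h3 : q (mulOp (fun x => (1 / Complex.I) * partialDeriv j (a j) x) u) ≤ B j * Y :=
      (hB j _).trans (mul_le_mul_of_nonneg_left hYu (hB0 j))
    have h4 : q ((h : ℂ) • (mulOp (a j) (nabOp a' j u)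
        + mulOp (fun x => (1 / Complex.I) * partialDeriv j (a j) x) u))
        ≤ |h| * (A j * Y + B j * Y) := by
      rw [hn, hhn]
      exact mul_le_mul_of_nonneg_left ((map_add_le_add q _ _).trans (add_le_add h2 h3))
        (abs_nonneg _)
    have h5 : q ((h : ℂ) • mulOp (a j) (nabOp a' j u)) ≤ |h| * (A j * Y) := by
      rw [hn, hhn]
      exact mul_le_mul_of_nonneg_left h2 (abs_nonneg _)
    refine (map_sub_le_add q _ _).trans ?_
    refine (add_le_add_left (map_sub_le_add q _ _) _).trans ?_
    linarith
  · have e : (s' : ℂ) - (s : ℂ) = (h : ℂ) := by rw [hh]; push_cast; ring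
    rw [e, hn, hhn, mul_assoc]
    exact mul_le_mul_of_nonneg_left ((hV u).trans (mul_le_mul_of_nonneg_left hYu hV0))
      (abs_nonneg _)

/-- Magnetic Schrödinger operators with bounded potential are surjective on the Schwartz space. -/
theorem surjective_hamOp_of_bounded {a : Fin d → Space d → ℂ} {v : Space d → ℂ}
    (ha : ∀ j, IsCbComplex (a j)) (hv : IsCbComplex v)
    (har : ∀ j, IsRealFun (a j)) (hvr : IsRealFun v) {σ : ℂ} (hσ : σ.re = 0)
    (hσ' : |σ.im| = 1) : Function.Surjective fun u => hamOp a v u + σ • u := by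
  set P : Set ℝ := Icc 0 1 with hP
  set as : ℝ → Fin d → Space d → ℂ := fun s j x => (s : ℂ) * a j x with has
  set vs : ℝ → Space d → ℂ := fun s x => (s : ℂ) * v x with hvs
  have hbs : ∃ C : ℝ, ∀ s ∈ P, ‖(s : ℂ)‖ ≤ C := ⟨1, fun s hs => by
    rw [Complex.norm_real, Real.norm_of_nonneg hs.1]; exact hs.2⟩
  have hasU : ∀ j, UCb P (fun s => as s j) := fun j => (ha j).uCb.const_mul hbs
  have hvsU : UCb P vs := hv.uCb.const_mul hbs
  have hasr : ∀ s j, IsRealFun (as s j) := fun s j x => by simp [has, har j x]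
  have hvsr : ∀ s, IsRealFun (vs s) := fun s x => by simp [hvs, hvr x]
  set L : ℝ → Op d := fun s => hamOp (as s) (vs s) + σ • 1 with hLdef
  have hLa : ∀ s u, L s u = hamOp (as s) (vs s) u + σ • u := fun s u => rfl
  have hap := fun k => wordNorm_posMom_a_priori hasU hasr hvsU hvsr hσ hσ' k
  have hσ2 : σ * σ = -1 := by
    have : σ.im * σ.im = 1 := by
      rw [← abs_mul_abs_self, hσ', one_mul]
    apply Complex.ext <;> simp [hσ, this]
  have h0 : ∀ f, ∃ u, L 0 u = f := by
    intro f
    obtain ⟨u, hu⟩ := surjective_free (d := d) hσ2 f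
    refine ⟨u, hu ▸ ?_⟩
    have e1 : ∀ j, nabOp (as 0) j = dOp j := fun j => by
      rw [has, nabOp_smul fun j => (ha j).hasTemperateGrowth]; simp
    have e2 : mulOp (vs 0) = 0 := by
      simp only [hvs]
      rw [← mulOp_smul _ hv.hasTemperateGrowth]; simp
    simp only [hLdef, hamOp, e1, e2, besselOp, sub_smul, one_smul]
    congr 1
    abel
  have hdense : ∀ k f, ∀ δ : ℝ, 0 < δ → ∃ u, wordNorm posMom k (L 1 u - f) ≤ δ := by
    intro k
    obtain ⟨A, hA0, hA⟩ := hap k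
    obtain ⟨C, hC0, hC⟩ := wordNorm_interpolation_le ha hv k
    -- This many steps make `C A / n ≤ 1/2`, so neighbouring operators differ by at most half of the
    -- first one in the `k`-th norm. The number of steps depends on `k`, so the method produces only
    -- approximate solutions in each norm separately.
    obtain ⟨n, hn⟩ := exists_nat_gt (2 * (C * A) + 1)
    have hn0 : (0 : ℝ) < n := by nlinarith
    have step : ∀ i : ℕ, i ≤ n → ∀ f, ∀ δ : ℝ, 0 < δ →
        ∃ u, wordNorm posMom k (L (i / n : ℝ) u - f) ≤ δ := by
      intro i
      induction i with
      | zero =>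
        intro _ f δ hδ
        obtain ⟨u, hu⟩ := h0 f
        refine ⟨u, ?_⟩
        have : ((0 : ℕ) / n : ℝ) = 0 := by simp
        rw [this, hu, sub_self, map_zero]
        exact hδ.le
      | succ i ih =>
        intro hi
        have hmem : (i / n : ℝ) ∈ P := by
          refine ⟨by positivity, (div_le_one hn0).2 ?_⟩
          exact_mod_cast (Nat.le_succ i).trans hi
        refine dense_range_of_perturbation (A := L (i / n : ℝ)) (fun u => ?_)
          (ih ((Nat.le_succ i).trans hi))
        have e : L ((i + 1 : ℕ) / n : ℝ) u - L (i / n : ℝ) u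
            = hamOp (as ((i + 1 : ℕ) / n : ℝ)) (vs ((i + 1 : ℕ) / n : ℝ)) u
              - hamOp (as (i / n : ℝ)) (vs (i / n : ℝ)) u := by
          simp only [hLa]; abel
        have hdiff : |((i + 1 : ℕ) / n : ℝ) - (i / n : ℝ)| = 1 / n := by
          rw [← sub_div]
          push_cast
          rw [add_sub_cancel_left, abs_of_pos (by positivity)]
        have h1n : (1 / n : ℝ) ≤ 1 := by
          rw [div_le_one hn0]; nlinarith [mul_nonneg hC0 hA0]
        rw [e]
        refine (hC _ _ (hdiff.trans_le h1n) u).trans ?_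
        rw [hdiff]
        have h2 := mul_le_mul_of_nonneg_left (hA _ hmem u)
          (mul_nonneg (by positivity : (0 : ℝ) ≤ 1 / n) hC0)
        refine h2.trans ?_
        rw [← hLa, ← mul_assoc]
        refine mul_le_mul_of_nonneg_right ?_ (apply_nonneg _ _)
        rw [mul_assoc, one_div, inv_mul_le_iff₀ hn0]
        linarith
    have := step n le_rfl
    rwa [div_self hn0.ne'] at this
  have h1 : (1 : ℝ) ∈ P := ⟨zero_le_one, le_rfl⟩
  have hcont : Continuous (L 1 : SpaceS d → SpaceS d) :=
    (continuous_hamOp _ _).add (continuous_const_smul σ)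
  have hsurj := surjective_of_a_priori hcont (fun k => by
      obtain ⟨C, hC0, hC⟩ := hap k
      exact ⟨k, C, hC0, fun u => (le_add_of_nonneg_right
        (Finset.sum_nonneg fun _ _ => apply_nonneg _ _)).trans (hC 1 h1 u)⟩) (fun f => by
      -- Diagonal choice: the `n`-th approximate solution has error `1/(n+1)` in the `n`-th norm,
      -- hence in every lower norm.
      choose u hu using fun n : ℕ => hdense n f (1 / (n + 1)) (by positivity)
      refine ⟨u, fun k => squeeze_zero' (Filter.Eventually.of_forall fun n => apply_nonneg _ _)
        ?_ tendsto_one_div_add_atTop_nhds_zero_nat⟩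
      filter_upwards [Filter.eventually_ge_atTop k] with n hn
      exact (wordNorm_mono posMom hn _).trans (hu n))
  have e : (fun u => hamOp a v u + σ • u) = L 1 := by
    ext1 u
    simp [hLa, has, hvs]
  rw [e]
  exact hsurj

end

end MagneticSchrodinger

namespace MagneticSchrodinger

noncomputable section

variable {d : ℕ}

/-! ### Solvability for potentials of linear growth -/

/-- Dilations are the ray functions with base point `0`, the Dirac mass at `1` and zero exponents.
-/
theorem IsCbComplex.uCb_scale {G : Space d → ℂ} (hG : IsCbComplex G) :
    UCb {ε : ℝ | |ε| ≤ 1} (fun (ε : ℝ) Z => G (ε • Z)) := by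
  have h1 : ∀ᵐ τ ∂(Measure.dirac (1 : ℝ)), τ ∈ Icc (0 : ℝ) 1 :=
    (ae_dirac_iff (p := fun τ => τ ∈ Icc (0 : ℝ) 1) measurableSet_Icc).2 (by simp)
  have h := (rayFun_uCb h1 hG 0 0 1).comp (Q := {ε : ℝ | |ε| ≤ 1}) (fun ε => ((0 : Space d), ε))
    fun ε hε => hε
  convert h using 3 with ε Z
  simp [rayFun, radialAvg]

/-- The function `1 / (1 + |y|²)`. -/
def bracketInv (y : Space d) : ℂ := (((1 + ‖y‖ ^ 2)⁻¹ : ℝ) : ℂ)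

theorem hasFDerivAt_bracketInv (y : Space d) : HasFDerivAt (bracketInv (d := d))
    (Complex.ofRealCLM.comp (-((1 + ‖y‖ ^ 2) ^ 2)⁻¹ • ((2 : ℝ) • innerSL ℝ y))) y := by
  have h1 : HasFDerivAt (fun y : Space d => 1 + ‖y‖ ^ 2) ((2 : ℝ) • innerSL ℝ y) y := by
    have := ((hasStrictFDerivAt_norm_sq y).hasFDerivAt).const_add 1
    refine this.congr_fderiv ?_
    ext z; simp [two_mul]
  have h2 : HasDerivAt (fun x : ℝ => x⁻¹) (-((1 + ‖y‖ ^ 2) ^ 2)⁻¹) (1 + ‖y‖ ^ 2) :=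
    hasDerivAt_inv (by positivity)
  exact Complex.ofRealCLM.hasFDerivAt.comp y (h2.comp_hasFDerivAt y h1)

theorem partialDeriv_bracketInv (j : Fin d) (y : Space d) :
    partialDeriv j bracketInv y = -2 * (coord j y * bracketInv y) * bracketInv y := by
  rw [partialDeriv, (hasFDerivAt_bracketInv y).fderiv]
  simp only [ContinuousLinearMap.comp_apply, _root_.smul_apply, innerSL_apply_apply,
    EuclideanSpace.inner_single_right, bracketInv, coord, Complex.ofRealCLM_apply, ← inv_pow]
  simp only [smul_eq_mul, conj_trivial, one_mul]
  push_cast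
  ring

theorem norm_bracketInv_le (y : Space d) : ‖bracketInv y‖ ≤ 1 := by
  rw [bracketInv, Complex.norm_real, Real.norm_of_nonneg (by positivity)]
  exact inv_le_one_of_one_le₀ (by nlinarith [sq_nonneg ‖y‖])

theorem norm_coord_mul_bracketInv_le (k : Fin d) (y : Space d) :
    ‖coord k y * bracketInv y‖ ≤ 1 := by
  have h : |y k| ≤ ‖y‖ := by simpa using PiLp.norm_apply_le y k
  rw [bracketInv, coord, norm_mul, Complex.norm_real, Complex.norm_real,
    Real.norm_of_nonneg (show 0 ≤ (1 + ‖y‖ ^ 2)⁻¹ by positivity), ← div_eq_mul_inv,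
    div_le_one (by positivity)]
  exact h.trans (by nlinarith [sq_nonneg (‖y‖ - 1)])

theorem differentiable_coord (k : Fin d) : Differentiable ℝ (coord k) :=
  (coord_hasTemperateGrowth k).1.differentiable (by simp)

/-- Let `ρ = 1/(1 + |y|²)`. The algebra generated by `ρ` and the functions `y_k ρ` consists of
bounded functions and is closed under `∂_j`, because `∂_j ρ = -2 (y_j ρ) ρ` and `∂_j (y_k ρ) =
δ_{jk} ρ - 2 (y_j ρ)(y_k ρ)`. No higher derivative has to be estimated directly. -/
theorem isCbComplex_bracketInv_aux {g : Space d → ℂ}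
    (hg : g ∈ Algebra.adjoin ℂ (insert (bracketInv (d := d))
      (range fun k y => coord k y * bracketInv y))) : IsCbComplex g := by
  set 𝒜 := Algebra.adjoin ℂ (insert (bracketInv (d := d))
    (range fun k y => coord k y * bracketInv y)) with h𝒜
  have hρ : bracketInv ∈ 𝒜 := Algebra.subset_adjoin (mem_insert _ _)
  have hκ : ∀ k, (fun y => coord k y * bracketInv y) ∈ 𝒜 := fun k =>
    Algebra.subset_adjoin (mem_insert_of_mem _ (mem_range_self k))
  have hρd : Differentiable ℝ (bracketInv (d := d)) := fun y =>
    (hasFDerivAt_bracketInv y).differentiableAt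
  have hρ' : ∀ j, partialDeriv j bracketInv ∈ 𝒜 := fun j => by
    have e : partialDeriv j bracketInv
        = (-2 : ℂ) • ((fun y => coord j y * bracketInv y) * bracketInv) := by
      ext y; rw [partialDeriv_bracketInv]; simp; ring
    rw [e]
    exact 𝒜.smul_mem (𝒜.mul_mem (hκ j) hρ) _
  have key : ∀ g ∈ 𝒜, Differentiable ℝ g ∧ (∃ C : ℝ, ∀ x, ‖g x‖ ≤ C) ∧
      ∀ j, partialDeriv j g ∈ 𝒜 := by
    intro g hg
    induction hg using Algebra.adjoin_induction with
    | mem g hg =>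
      rcases hg with rfl | ⟨k, rfl⟩
      · exact ⟨hρd, ⟨1, norm_bracketInv_le⟩, hρ'⟩
      · refine ⟨(differentiable_coord k).mul hρd, ⟨1, norm_coord_mul_bracketInv_le k⟩, fun j => ?_⟩
        have e : partialDeriv j (fun y => coord k y * bracketInv y)
            = (if j = k then (1 : ℂ) else 0) • bracketInv
              + (-2 : ℂ) • ((fun y => coord j y * bracketInv y)
                * (fun y => coord k y * bracketInv y)) := by
          ext y
          rw [partialDeriv_mul j (differentiable_coord k y) (hρd y), partialDeriv_coord,
            partialDeriv_bracketInv]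
          simp only [Pi.add_apply, Pi.smul_apply, Pi.mul_apply, smul_eq_mul]
          ring
        rw [e]
        exact 𝒜.add_mem (𝒜.smul_mem hρ _) (𝒜.smul_mem (𝒜.mul_mem (hκ j) (hκ k)) _)
    | algebraMap r =>
      refine ⟨differentiable_const r, ⟨‖r‖, fun x => le_rfl⟩, fun j => ?_⟩
      have e : partialDeriv j (algebraMap ℂ (Space d → ℂ) r) = 0 := by
        ext x
        have : algebraMap ℂ (Space d → ℂ) r = fun _ => r := rfl
        simp [partialDeriv, this]
      rw [e]; exact 𝒜.zero_mem
    | add f g hf hg ihf ihg =>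
      obtain ⟨C, hC⟩ := ihf.2.1
      obtain ⟨D, hD⟩ := ihg.2.1
      refine ⟨ihf.1.add ihg.1, ⟨C + D, fun x => (norm_add_le _ _).trans (add_le_add (hC x) (hD x))⟩,
        fun j => ?_⟩
      have e : partialDeriv j (f + g) = partialDeriv j f + partialDeriv j g := by
        ext x
        simp [partialDeriv, fderiv_add (ihf.1 x) (ihg.1 x)]
      rw [e]; exact 𝒜.add_mem (ihf.2.2 j) (ihg.2.2 j)
    | mul f g hf hg ihf ihg =>
      obtain ⟨C, hC⟩ := ihf.2.1
      obtain ⟨D, hD⟩ := ihg.2.1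
      refine ⟨ihf.1.mul ihg.1, ⟨C * D, fun x => ?_⟩, fun j => ?_⟩
      · rw [Pi.mul_apply, norm_mul]
        exact mul_le_mul (hC x) (hD x) (norm_nonneg _) ((norm_nonneg _).trans (hC x))
      · have e : partialDeriv j (f * g) = partialDeriv j f * g + f * partialDeriv j g := by
          ext x
          have := partialDeriv_mul j (ihf.1 x) (ihg.1 x)
          exact this.trans (by simp [add_comm])
        rw [e]
        exact 𝒜.add_mem (𝒜.mul_mem (ihf.2.2 j) hg) (𝒜.mul_mem hf (ihg.2.2 j))
  have := UCb.of_closed (P := (univ : Set Unit)) (g := fun _ => g)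
    (𝒢 := {h | ∃ g ∈ 𝒜, h = fun _ => g}) (by rintro _ ⟨g, hg, rfl⟩ i; exact (key g hg).1)
    (by rintro _ ⟨g, hg, rfl⟩ i; exact (key g hg).2.1)
    (by rintro _ ⟨g, hg, rfl⟩; obtain ⟨C, hC⟩ := (key g hg).2.1; exact ⟨C, fun _ _ => hC⟩)
    (by rintro _ ⟨g, hg, rfl⟩ j; exact ⟨_, (key g hg).2.2 j, rfl⟩) ⟨g, hg, rfl⟩
  exact this.isCbComplex (i := ()) trivial

theorem isCbComplex_bracketInv : IsCbComplex (bracketInv (d := d)) :=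
  isCbComplex_bracketInv_aux (Algebra.subset_adjoin (mem_insert _ _))

theorem isCbComplex_coord_mul_bracketInv (k : Fin d) :
    IsCbComplex (fun y => coord k y * bracketInv y) :=
  isCbComplex_bracketInv_aux (Algebra.subset_adjoin (mem_insert_of_mem _ (mem_range_self k)))

/-- The data of a magnetic Schrödinger operator: a real potential of linear growth with a bounded
field, and a bounded electric potential. -/
structure Admissible (a : Fin d → Space d → ℂ) (v : Space d → ℂ) : Prop where
  linear : ∃ β : Fin d → Fin d → Space d → ℂ, (∀ k j, IsCbComplex (β k j)) ∧
    ∀ j x, a j x = ∑ k, β k j x * coord k x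
  real : ∀ j, IsRealFun (a j)
  field : ∀ k l, IsCbComplex (fun x => partialDeriv k (a l) x - partialDeriv l (a k) x)
  elec : IsCbComplex v
  elec_real : IsRealFun v

theorem Admissible.temperate {a : Fin d → Space d → ℂ} {v : Space d → ℂ} (h : Admissible a v)
    (j : Fin d) : (a j).HasTemperateGrowth := by
  obtain ⟨β, hβ, e⟩ := h.linear
  have : a j = fun x => ∑ k, β k j x * coord k x := funext (e j)
  rw [this]
  exact Function.HasTemperateGrowth.sum fun k _ =>
    (hβ k j).hasTemperateGrowth.mul (coord_hasTemperateGrowth k)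

/-- The potential is replaced by `b_ε = ρ_ε a` with `ρ_ε(x) = 1/(1 + ε²|x|²)`, which is bounded for
`ε ≠ 0`. Differentiating `ρ_ε` gains the decay that compensates the linear growth of `a`, so the
fields of `b_ε` are bounded uniformly for `|ε| ≤ 1` and so are the a priori constants. Since `1 -
ρ_ε = ε²|x|² ρ_ε`, the solutions for `b_ε` solve the original equation up to `ε²` times a tame
operator. -/
theorem surjective_hamOp {a : Fin d → Space d → ℂ} {v : Space d → ℂ} (h : Admissible a v)
    {σ : ℂ} (hσ : σ.re = 0) (hσ' : |σ.im| = 1) :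
    Function.Surjective fun u => hamOp a v u + σ • u := by
  have hat := h.temperate
  obtain ⟨β, hβ, hae⟩ := h.linear
  set P : Set ℝ := {ε : ℝ | |ε| ≤ 1} with hP
  set ρ : ℝ → Space d → ℂ := fun ε x => bracketInv (ε • x) with hρdef
  set κ : Fin d → ℝ → Space d → ℂ := fun k ε x => coord k (ε • x) * bracketInv (ε • x) with hκdef
  have hρ : UCb P ρ := isCbComplex_bracketInv.uCb_scale
  have hκ : ∀ k, UCb P (κ k) := fun k => (isCbComplex_coord_mul_bracketInv k).uCb_scale
  have hρr : ∀ ε, IsRealFun (ρ ε) := fun ε x => Complex.conj_ofReal _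
  set b : ℝ → Fin d → Space d → ℂ := fun ε j x => ρ ε x * a j x with hb
  have hbt : ∀ ε j, (b ε j).HasTemperateGrowth := fun ε j => (hρ.temperate ε).mul (hat j)
  have hbr : ∀ ε j, IsRealFun (b ε j) := fun ε j x => by
    simp only [hb]; rw [map_mul, hρr ε x, h.real j x]
  have hcs : ∀ (ε : ℝ) k (x : Space d), coord k (ε • x) = (ε : ℂ) * coord k x := fun ε k x => by
    simp [coord]
  have hvU : UCb P (fun _ : ℝ => v) := h.elec.uCb
  have hβU : ∀ k j, UCb P (fun ε x => ρ ε x * β k j x) := fun k j => hρ.mul (hβ k j).uCb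
  -- the field of the truncated potentials
  have hdρ : ∀ ε i x, partialDeriv i (ρ ε) x = -2 * (ε : ℂ) * κ i ε x * ρ ε x := fun ε i x => by
    have := partialDeriv_comp_smul (h := bracketInv) (fun y : Space d =>
      (hasFDerivAt_bracketInv y).differentiableAt) ε i x
    simp only [hρdef, hκdef]
    rw [this, partialDeriv_bracketInv]; ring
  have hdb : ∀ ε i j x, partialDeriv i (b ε j) x = ρ ε x * partialDeriv i (a j) x
      + -2 * (κ i ε x * ∑ k, β k j x * κ k ε x) := fun ε i j x => by
    have h1 := partialDeriv_mul i ((hρ.temperate ε).1.differentiable (by simp) x)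
      ((hat j).1.differentiable (by simp) x)
    simp only [hb]
    rw [h1, hdρ, hae j x]
    congr 1
    simp only [Finset.mul_sum]
    refine Finset.sum_congr rfl fun k _ => ?_
    simp only [hκdef, hρdef, hcs]
    ring
  have hfield : HasUCbField P b := by
    intro k l
    have hs : ∀ i j : Fin d, UCb P (fun ε x => -2 * (κ i ε x * ∑ k : Fin d, β k j x * κ k ε x)) := fun i j =>
      ((hκ i).mul (UCb.sum (s := Finset.univ) (f := fun k ε x => β k j x * κ k ε x)
        fun k _ => (hβ k j).uCb.mul (hκ k))).const_mul (c := fun _ => -2)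
        ⟨_, fun _ _ => le_rfl⟩
    have h2 := (hρ.mul (h.field k l).uCb).add ((hs k l).add ((hs l k).const_mul (c := fun _ => -1)
        ⟨_, fun _ _ => le_rfl⟩))
    convert h2 using 3 with ε x
    rw [hdb, hdb]; ring
  -- comparison of the norms
  have hstabM : ∀ f ∈ multFam (d := d) P, ∀ c : Fin d ⊕ Fin d,
      (fun i => posMom c * f i - f i * posMom c) ∈ multFam P := by
    rintro f hf (c | c)
    · exact zOp_commutator_multFam hf c
    · exact dOp_commutator_multFam hf c
  have hstabN : ∀ f ∈ multFam (d := d) P, ∀ c : Fin d ⊕ Fin d,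
      (fun i => posNab (b i) c * f i - f i * posNab (b i) c) ∈ multFam P := by
    rintro f hf (c | c)
    · exact zOp_commutator_multFam hf c
    · exact nabOp_commutator_multFam hbt hf c
  have hmb : ∀ ε j, mulOp (b ε j) = ∑ k, zOp k * mulOp (fun x => ρ ε x * β k j x) := fun ε j => by
    refine op_ext fun u x => ?_
    rw [mulOp_apply (hbt ε j), LinearMap.sum_apply, _root_.sum_apply]
    simp only [Module.End.mul_apply, zOp, mulOp_apply (coord_hasTemperateGrowth _),
      mulOp_apply ((hβU _ _).temperate _), hb]
    rw [hae j x, Finset.mul_sum, Finset.sum_mul]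
    exact Finset.sum_congr rfl fun k _ => by ring
  have tZM : ∀ k, Tame P (fun c (_ : ℝ) => posMom (d := d) c) (fun _ => zOp k) := fun k =>
    Tame.word (P := P) (X := fun c (_ : ℝ) => posMom (d := d) c) (Sum.inl k)
  have tDM : ∀ k, Tame P (fun c (_ : ℝ) => posMom (d := d) c) (fun _ => dOp k) := fun k =>
    Tame.word (P := P) (X := fun c (_ : ℝ) => posMom (d := d) c) (Sum.inr k)
  have tZN : ∀ k, Tame P (fun c ε => posNab (b ε) c) (fun _ => zOp k) := fun k =>
    Tame.word (P := P) (X := fun c ε => posNab (b ε) c) (Sum.inl k)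
  have tNN : ∀ k, Tame P (fun c ε => posNab (b ε) c) (fun ε => nabOp (b ε) k) := fun k =>
    Tame.word (P := P) (X := fun c ε => posNab (b ε) c) (Sum.inr k)
  have tβM : ∀ k j, Tame P (fun c (_ : ℝ) => posMom (d := d) c)
      (fun ε => mulOp (fun x => ρ ε x * β k j x)) := fun k j =>
    Tame.of_stable hstabM (mulOp_mem_multFam (hβU k j))
  have tNM : ∀ j, Tame P (fun c (_ : ℝ) => posMom (d := d) c) (fun ε => nabOp (b ε) j) := fun j => by
    simp only [nabOp, hmb]
    exact (tDM j).sub (Tame.sum fun k _ => (tZM k).mul (tβM k j))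
  have tDN : ∀ j, Tame P (fun c ε => posNab (b ε) c) (fun _ => dOp j) := fun j => by
    have e : (fun _ : ℝ => dOp j) = fun ε => nabOp (b ε) j
        + ∑ k, zOp k * mulOp (fun x => ρ ε x * β k j x) := by
      ext1 ε; rw [← hmb, nabOp, sub_add_cancel]
    rw [e]
    exact (tNN j).add (Tame.sum fun k _ => (tZN k).mul
      (Tame.of_stable hstabN (mulOp_mem_multFam (hβU k j))))
  -- The estimate in words of positions and covariant derivatives loses nothing, but it has to be
  -- translated from and back to positions and plain derivatives. Each translation is tame because
  -- `b_ε` has linear growth uniformly in `ε`, and this lengthens the words.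
  have hap : ∀ k, ∃ l, ∃ C : ℝ, 0 ≤ C ∧ ∀ ε ∈ P, ∀ u, wordNorm posMom k u
      ≤ C * wordNorm posMom l (hamOp (b ε) v u + σ • u) := by
    intro k
    obtain ⟨l, C, hC0, hC⟩ := wordNorm_le_of_tame (P := P) (X := fun c ε => posNab (b ε) c)
      (Y := fun c (_ : ℝ) => posMom (d := d) c)
      (fun c => by rcases c with c | c; exacts [tZN c, tDN c]) k
    obtain ⟨D, hD0, hD⟩ := wordNorm_posNab_a_priori hbt hfield hbr hvU (fun _ => h.elec_real)
      hσ hσ' l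
    obtain ⟨m, E, hE0, hE⟩ := wordNorm_le_of_tame (P := P) (X := fun c (_ : ℝ) => posMom (d := d) c)
      (Y := fun c ε => posNab (b ε) c)
      (fun c => by rcases c with c | c; exacts [tZM c, tNM c]) l
    refine ⟨m, C * (D * E), by positivity, fun ε hε u => (hC ε hε u).trans ?_⟩
    rw [mul_assoc, mul_assoc]
    refine mul_le_mul_of_nonneg_left ?_ hC0
    exact ((le_add_of_nonneg_right (Finset.sum_nonneg fun _ _ => apply_nonneg _ _)).trans
      (hD ε hε u)).trans (mul_le_mul_of_nonneg_left (hE ε hε _) hD0)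
  -- the difference of the operators
  set K : ℝ → Fin d → Op d := fun ε j =>
    ∑ l, ∑ k, zOp l * (zOp l * (zOp k * mulOp (fun x => ρ ε x * β k j x))) with hK
  have tK : ∀ j, Tame P (fun c (_ : ℝ) => posMom (d := d) c) (fun ε => K ε j) := fun j =>
    Tame.sum fun l _ => Tame.sum fun k _ => (tZM l).mul ((tZM l).mul ((tZM k).mul (tβM k j)))
  have hKn : ∀ ε j, nabOp a j = nabOp (b ε) j - ((ε : ℂ) ^ 2) • K ε j := fun ε j => by
    rw [nabOp, nabOp, sub_sub]
    congr 1
    refine op_ext fun u x => ?_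
    simp only [LinearMap.add_apply, LinearMap.smul_apply, _root_.add_apply, _root_.smul_apply, hK,
      LinearMap.sum_apply, _root_.sum_apply, Module.End.mul_apply, zOp,
      mulOp_apply (coord_hasTemperateGrowth _), mulOp_apply ((hβU _ _).temperate _),
      mulOp_apply (hat j), mulOp_apply (hbt ε j), smul_eq_mul]
    have e1 : ∑ l, ∑ k, coord l x * (coord l x * (coord k x * (ρ ε x * β k j x * u x)))
        = (∑ l, coord l x * coord l x) * ρ ε x * a j x * u x := by
      rw [Finset.sum_mul, Finset.sum_mul, Finset.sum_mul]
      refine Finset.sum_congr rfl fun l _ => ?_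
      rw [hae j x, Finset.mul_sum, Finset.sum_mul]
      exact Finset.sum_congr rfl fun k _ => by ring
    have e2 : ∑ l, coord l x * coord l x = ((‖x‖ ^ 2 : ℝ) : ℂ) := by
      rw [EuclideanSpace.norm_sq_eq]
      push_cast
      refine Finset.sum_congr rfl fun l _ => ?_
      rw [coord, ← Complex.ofReal_pow, Real.norm_eq_abs, sq_abs]
      push_cast; ring
    have e3 : ρ ε x + (ε : ℂ) ^ 2 * ((‖x‖ ^ 2 : ℝ) : ℂ) * ρ ε x = 1 := by
      have e4 : ‖ε • x‖ ^ 2 = ε ^ 2 * ‖x‖ ^ 2 := by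
        rw [norm_smul, mul_pow, Real.norm_eq_abs, sq_abs]
      have e5 : (1 + ε ^ 2 * ‖x‖ ^ 2 : ℝ) ≠ 0 := by positivity
      simp only [hρdef, bracketInv, e4]
      rw [← one_add_mul]
      exact_mod_cast mul_inv_cancel₀ e5
    rw [e1, e2]
    simp only [hb]
    linear_combination (-(a j x * u x)) * e3
  set T : ℝ → Op d := fun ε => ∑ j, (((ε : ℂ) ^ 2) • (K ε j * K ε j) - nabOp (b ε) j * K ε j
    - K ε j * nabOp (b ε) j) with hT
  have tT : Tame P (fun c (_ : ℝ) => posMom (d := d) c) T :=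
    Tame.sum fun j _ => ((((tK j).mul (tK j)).smul (c := fun ε : ℝ => (ε : ℂ) ^ 2) ⟨1, fun ε hε => by
      rw [norm_pow, Complex.norm_real, Real.norm_eq_abs]
      exact pow_le_one₀ (abs_nonneg _) hε⟩).sub ((tNM j).mul (tK j))).sub ((tK j).mul (tNM j))
  have hdiff : ∀ ε, hamOp a v = hamOp (b ε) v + ((ε : ℂ) ^ 2) • T ε := fun ε => by
    rw [← sub_eq_iff_eq_add', hamOp_sub_hamOp (hKn ε), sub_self, add_zero, hT, Finset.smul_sum]
    refine Finset.sum_congr rfl fun j _ => ?_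
    simp only [smul_sub, smul_mul_assoc, mul_smul_comm]
  set L : Op d := hamOp a v + σ • 1 with hL
  have hcont : Continuous (L : SpaceS d → SpaceS d) :=
    (continuous_hamOp _ _).add (continuous_const_smul σ)
  have h0P : (0 : ℝ) ∈ P := by simp [hP]
  have hb0 : b 0 = a := by
    ext j x; simp [hb, hρdef, bracketInv]
  -- For `ε ≠ 0` one has `b_ε = ε⁻¹ ∑ β_k κ_k`, a combination of bounded functions. The bound blows
  -- up as `ε → 0`, but only solvability is used here; the uniform estimates come from `hap`.
  have hsol : ∀ ε : ℝ, ε ≠ 0 → ε ∈ P → Function.Surjective fun u => hamOp (b ε) v u + σ • u := by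
    intro ε hε hεP
    refine surjective_hamOp_of_bounded (fun j => ?_) h.elec (hbr ε) h.elec_real hσ hσ'
    have h1 : UCb P (fun ε x => ∑ k, β k j x * κ k ε x) :=
      UCb.sum fun k _ => (hβ k j).uCb.mul (hκ k)
    have h2 := (h1.isCbComplex hεP).uCb.const_mul (P := (univ : Set Unit))
      (c := fun _ => (ε : ℂ)⁻¹) ⟨_, fun _ _ => le_rfl⟩
    have h3 := h2.isCbComplex (i := ()) trivial
    convert h3 using 2 with x
    simp only [hb]
    rw [hae j x, Finset.mul_sum, Finset.mul_sum]
    refine Finset.sum_congr rfl fun k _ => ?_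
    simp only [hκdef, hρdef, hcs]
    have : (ε : ℂ) ≠ 0 := by exact_mod_cast hε
    field_simp
  have hε : ∀ n : ℕ, (1 / ((n : ℝ) + 1)) ∈ P := fun n => by
    have h1 : (0 : ℝ) < (n : ℝ) + 1 := by positivity
    rw [hP, mem_ofPred_eq, abs_of_pos (by positivity), div_le_one h1]
    linarith [Nat.cast_nonneg (α := ℝ) n]
  refine surjective_of_a_priori hcont (fun k => ?_) fun f => ?_
  · obtain ⟨l, C, hC0, hC⟩ := hap k
    refine ⟨l, C, hC0, fun u => ?_⟩
    have := hC 0 h0P u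
    rwa [hb0] at this
  · choose u hu using fun n : ℕ => hsol (1 / ((n : ℝ) + 1)) (by positivity) (hε n) f
    refine ⟨u, fun k => ?_⟩
    obtain ⟨l, C, hC0, hC⟩ := tT k
    obtain ⟨m, D, hD0, hD⟩ := hap l
    have hz : Filter.Tendsto (fun n : ℕ => 1 / ((n : ℝ) + 1) * (C * (D * wordNorm posMom m f)))
        Filter.atTop (nhds 0) := by
      simpa using tendsto_one_div_add_atTop_nhds_zero_nat.mul_const
        (C * (D * wordNorm posMom m f))
    refine squeeze_zero (fun n => apply_nonneg _ _) (fun n => ?_) hz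
    set ε : ℝ := 1 / ((n : ℝ) + 1) with hεd
    have hε0 : 0 ≤ ε := by positivity
    have e : L (u n) - f = ((ε : ℂ) ^ 2) • T ε (u n) := by
      have h1 : L (u n) = (hamOp (b ε) v (u n) + σ • u n) + ((ε : ℂ) ^ 2) • T ε (u n) := by
        simp only [hL, hdiff ε, LinearMap.add_apply, LinearMap.smul_apply, Module.End.one_apply]
        abel
      rw [h1]
      have h2 : hamOp (b ε) v (u n) + σ • u n = f := hu n
      rw [h2, add_sub_cancel_left]
    have hle : ε ≤ 1 := (le_abs_self ε).trans (hε n)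
    have h3 := hD ε (hε n) (u n)
    have h2 : hamOp (b ε) v (u n) + σ • u n = f := hu n
    rw [h2] at h3
    rw [e, map_smul_eq_mul, norm_pow, Complex.norm_real, Real.norm_of_nonneg hε0]
    refine mul_le_mul (by nlinarith) ?_ (apply_nonneg _ _) hε0
    exact (hC ε (hε n) _).trans (mul_le_mul_of_nonneg_left h3 hC0)

end

end MagneticSchrodinger

namespace MagneticSchrodinger

noncomputable section

variable {d : ℕ}

/-! ### Resolvents on the Schwartz space -/

section resOp

variable {a : Fin d → Space d → ℂ} {v : Space d → ℂ} {σ τ : ℂ}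

theorem bijective_hamOp (h : Admissible a v) (hσ : σ.re = 0) (hσ' : |σ.im| = 1) :
    Function.Bijective (hamOp a v + σ • (1 : Op d) : Op d) := by
  refine ⟨(injective_iff_map_eq_zero _).2 fun u hu => ?_, surjective_hamOp h hσ hσ'⟩
  have h1 := norm_le_norm_hamOp_add h.temperate h.real h.elec.hasTemperateGrowth h.elec_real hσ' u
  have h2 : hamOp a v u + σ • u = 0 := hu
  rw [h2, map_zero, norm_zero, norm_le_zero_iff] at h1
  exact toL2_injective (h1.trans (map_zero _).symm)

open Classical in
/-- The inverse of `H + σ` on the Schwartz space. -/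
def resOp (a : Fin d → Space d → ℂ) (v : Space d → ℂ) (σ : ℂ) : Op d :=
  if h : Function.Bijective (hamOp a v + σ • (1 : Op d) : Op d) then
    (LinearEquiv.ofBijective (hamOp a v + σ • (1 : Op d) : Op d) h).symm.toLinearMap else 0

theorem hamOp_mul_resOp (h : Admissible a v) (hσ : σ.re = 0) (hσ' : |σ.im| = 1) :
    (hamOp a v + σ • 1) * resOp a v σ = 1 := by
  rw [resOp, dif_pos (bijective_hamOp h hσ hσ')]
  ext1 u
  exact (LinearEquiv.ofBijective _ (bijective_hamOp h hσ hσ')).apply_symm_apply u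

theorem resOp_mul_hamOp (h : Admissible a v) (hσ : σ.re = 0) (hσ' : |σ.im| = 1) :
    resOp a v σ * (hamOp a v + σ • 1) = 1 := by
  rw [resOp, dif_pos (bijective_hamOp h hσ hσ')]
  ext1 u
  exact (LinearEquiv.ofBijective _ (bijective_hamOp h hσ hσ')).symm_apply_apply u

theorem hamOp_resOp_apply (h : Admissible a v) (hσ : σ.re = 0) (hσ' : |σ.im| = 1) (u : SpaceS d) :
    hamOp a v (resOp a v σ u) + σ • resOp a v σ u = u :=
  congrArg (fun T : Op d => T u) (hamOp_mul_resOp h hσ hσ')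

theorem norm_resOp_le (h : Admissible a v) (hσ : σ.re = 0) (hσ' : |σ.im| = 1) (u : SpaceS d) :
    ‖toL2 (resOp a v σ u)‖ ≤ 1 * ‖toL2 u‖ := by
  have h1 := norm_le_norm_hamOp_add h.temperate h.real h.elec.hasTemperateGrowth h.elec_real hσ'
    (resOp a v σ u)
  rwa [hamOp_resOp_apply h hσ hσ', ← one_mul ‖toL2 u‖] at h1

theorem inner_resOp (h : Admissible a v) (hσ : σ.re = 0) (hσ' : |σ.im| = 1) (u w : SpaceS d) :
    inner ℂ (toL2 (resOp a v σ u)) (toL2 w) = inner ℂ (toL2 u) (toL2 (resOp a v (-σ) w)) := by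
  have hm : (-σ).re = 0 := by simp [hσ]
  have hm' : |(-σ).im| = 1 := by simpa using hσ'
  conv_lhs => rw [← hamOp_resOp_apply h hm hm' w]
  conv_rhs => rw [← hamOp_resOp_apply h hσ hσ' u]
  have hc : conj σ = -σ := by
    apply Complex.ext <;> simp [hσ]
  rw [map_add, map_add, inner_add_left, inner_add_right, inner_hamOp h.temperate h.real
    h.elec.hasTemperateGrowth h.elec_real, map_smul, map_smul, inner_smul_left, inner_smul_right, hc]

/-- The resolvent identity. -/
theorem resOp_sub_resOp (h : Admissible a v) (hσ : σ.re = 0) (hσ' : |σ.im| = 1) (hτ : τ.re = 0)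
    (hτ' : |τ.im| = 1) :
    resOp a v σ - resOp a v τ = (τ - σ) • (resOp a v σ * resOp a v τ) := by
  have e : (τ - σ) • (1 : Op d) = (hamOp a v + τ • 1) - (hamOp a v + σ • 1) := by
    rw [sub_smul]; abel
  calc resOp a v σ - resOp a v τ
      = resOp a v σ * ((hamOp a v + τ • 1) - (hamOp a v + σ • 1)) * resOp a v τ := by
        rw [mul_sub, sub_mul, mul_assoc, hamOp_mul_resOp h hτ hτ', resOp_mul_hamOp h hσ hσ',
          mul_one, one_mul]
    _ = _ := by rw [← e, mul_smul_comm, mul_one, smul_mul_assoc]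

theorem resOp_commute (h : Admissible a v) (hσ : σ.re = 0) (hσ' : |σ.im| = 1) (hτ : τ.re = 0)
    (hτ' : |τ.im| = 1) : Commute (resOp a v σ) (resOp a v τ) := by
  by_cases hne : τ = σ
  · rw [hne]
  have h1 := resOp_sub_resOp h hσ hσ' hτ hτ'
  have h2 := resOp_sub_resOp h hτ hτ' hσ hσ'
  have h3 : (τ - σ) • (resOp a v σ * resOp a v τ) = (τ - σ) • (resOp a v τ * resOp a v σ) := by
    rw [← h1, ← neg_sub (resOp a v τ), h2, ← neg_smul, neg_sub]
  exact smul_right_injective _ (sub_ne_zero.2 hne) h3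

end resOp

/-! ### Extension of operators to `L²` -/

/-- The extension to `L²` of an operator that is bounded in `L²`. -/
def extL2 (T : Op d) : L2 d →L[ℂ] L2 d :=
  ((toL2 (d := d)).toLinearMap ∘ₗ T).extendOfNorm (toL2 (d := d)).toLinearMap

theorem extL2_toL2 {T : Op d} {C : ℝ} (hT : ∀ u, ‖toL2 (T u)‖ ≤ C * ‖toL2 u‖) (u : SpaceS d) :
    extL2 T (toL2 u) = toL2 (T u) :=
  LinearMap.extendOfNorm_eq (f := (toL2 (d := d)).toLinearMap ∘ₗ T)
    (e := (toL2 (d := d)).toLinearMap) denseRange_toL2 ⟨C, hT⟩ u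

theorem clm_ext_toL2 {S T : L2 d →L[ℂ] L2 d} (h : ∀ u : SpaceS d, S (toL2 u) = T (toL2 u)) :
    S = T :=
  ContinuousLinearMap.ext fun x =>
    congrFun (denseRange_toL2.equalizer S.continuous T.continuous (funext h)) x

theorem norm_toL2_le_of_le {f g : SpaceS d} {c : ℝ} (h : ∀ x, ‖f x‖ ≤ c * ‖g x‖) :
    ‖toL2 f‖ ≤ c * ‖toL2 g‖ := by
  refine Lp.norm_le_mul_norm_of_ae_le_mul ?_
  filter_upwards [f.coeFn_toLp 2 volume, g.coeFn_toLp 2 volume] with x hf hg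
  have e1 : (toL2 f : Space d → ℂ) x = f x := hf
  have e2 : (toL2 g : Space d → ℂ) x = g x := hg
  rw [e1, e2]
  exact h x

/-! ### Cutoff functions -/

/-- The cutoff function that is `1` for `|ε Z| ≤ 1`. -/
def cutoff (ε : ℝ) (Z : Space d) : ℂ :=
  ((⟨1, 2, zero_lt_one, one_lt_two⟩ : ContDiffBump (0 : Space d)) (ε • Z) : ℝ)

theorem isCbComplex_of_hasCompactSupport {f : Space d → ℂ} (hf : ContDiff ℝ ∞ f)
    (hs : HasCompactSupport f) : IsCbComplex f :=
  ⟨hf, fun n => (hs.iteratedFDeriv n).exists_bound_of_continuous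
    (hf.continuous_iteratedFDeriv (by exact_mod_cast le_top))⟩

theorem contDiff_cutoff (ε : ℝ) : ContDiff ℝ ∞ (cutoff (d := d) ε) :=
  Complex.ofRealCLM.contDiff.comp ((ContDiffBump.contDiff _).comp (contDiff_const_smul ε))

theorem hasCompactSupport_cutoff {ε : ℝ} (hε : ε ≠ 0) : HasCompactSupport (cutoff (d := d) ε) := by
  have h := (⟨1, 2, zero_lt_one, one_lt_two⟩ : ContDiffBump (0 : Space d)).hasCompactSupport
  exact (h.comp_smul hε).comp_left Complex.ofReal_zero

theorem cutoff_one_smul (ε : ℝ) : (fun Z : Space d => cutoff 1 (ε • Z)) = cutoff ε := by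
  ext Z
  simp [cutoff]

theorem cutoff_uCb : UCb {ε : ℝ | |ε| ≤ 1} (cutoff (d := d)) := by
  have h : IsCbComplex (cutoff (d := d) 1) :=
    isCbComplex_of_hasCompactSupport (contDiff_cutoff 1) (hasCompactSupport_cutoff one_ne_zero)
  have := h.uCb_scale
  rwa [show (fun (ε : ℝ) (Z : Space d) => cutoff 1 (ε • Z)) = cutoff from
    funext cutoff_one_smul] at this

theorem cutoff_eq_one {ε : ℝ} {Z : Space d} (h : ‖ε • Z‖ ≤ 1) : cutoff ε Z = 1 := by
  rw [cutoff, ContDiffBump.one_of_mem_closedBall _ (by simpa using h), Complex.ofReal_one]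

theorem isTest_cutoff_mul {ε : ℝ} (hε : ε ≠ 0) {u : Space d → ℂ} (hu : ContDiff ℝ ∞ u) :
    IsTest (fun x => cutoff ε x * u x) :=
  ⟨(contDiff_cutoff ε).mul hu, (hasCompactSupport_cutoff hε).mul_right⟩

/-- The left side vanishes for `|εZ| ≤ 1`, and elsewhere it is at most `1 ≤ |εZ|²`. Applied to
Schwartz functions this gives convergence at the explicit rate `ε²`. -/
theorem norm_one_sub_cutoff_le (ε : ℝ) (Z : Space d) :
    ‖1 - cutoff ε Z‖ ≤ ε ^ 2 * ‖((‖Z‖ ^ 2 : ℝ) : ℂ)‖ := by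
  rw [Complex.norm_real, Real.norm_of_nonneg (by positivity), ← sq_abs ε, ← mul_pow,
    ← Real.norm_eq_abs, ← norm_smul]
  by_cases h : ‖ε • Z‖ ≤ 1
  · rw [cutoff_eq_one h]; simp
  · have h0 := (⟨1, 2, zero_lt_one, one_lt_two⟩ : ContDiffBump (0 : Space d)).nonneg' (ε • Z)
    have h1 := (⟨1, 2, zero_lt_one, one_lt_two⟩ : ContDiffBump (0 : Space d)).le_one (x := ε • Z)
    rw [cutoff, ← Complex.ofReal_one, ← Complex.ofReal_sub, Complex.norm_real, Real.norm_of_nonneg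
      (by linarith)]
    nlinarith

theorem tendsto_cutoff (w : SpaceS d) : Filter.Tendsto (fun ε => toL2 (mulOp (cutoff ε) w))
    (nhds 0) (nhds (toL2 w)) := by
  have ht : (fun Z : Space d => ((‖Z‖ ^ 2 : ℝ) : ℂ)).HasTemperateGrowth :=
    Complex.ofRealCLM.hasTemperateGrowth.comp (Function.hasTemperateGrowth_norm_sq _)
  refine tendsto_iff_norm_sub_tendsto_zero.2 ?_
  have hz : Filter.Tendsto (fun ε : ℝ => ε ^ 2 * ‖toL2 (mulOp (fun Z : Space d => ((‖Z‖ ^ 2 : ℝ) : ℂ)) w)‖)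
      (nhds 0) (nhds 0) := by
    have : Continuous (fun ε : ℝ => ε ^ 2
      * ‖toL2 (mulOp (fun Z : Space d => ((‖Z‖ ^ 2 : ℝ) : ℂ)) w)‖) := by fun_prop
    simpa using this.tendsto 0
  refine squeeze_zero (fun _ => norm_nonneg _) (fun ε => ?_) hz
  rw [← map_sub]
  refine norm_toL2_le_of_le fun x => ?_
  rw [_root_.sub_apply, mulOp_apply (cutoff_uCb.temperate ε), mulOp_apply ht, norm_mul, ← mul_assoc,
    ← sub_one_mul, norm_mul, norm_sub_rev]
  exact mul_le_mul_of_nonneg_right (norm_one_sub_cutoff_le ε x) (norm_nonneg _)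

theorem tendsto_smul_mulOp_of_uCb {g : ℝ → Space d → ℂ} (hg : UCb {ε : ℝ | |ε| ≤ 1} g)
    (w : SpaceS d) : Filter.Tendsto (fun ε : ℝ => toL2 ((ε : ℂ) • mulOp (g ε) w)) (nhds 0)
      (nhds 0) := by
  obtain ⟨C, hC0, hC⟩ := hg.bound
  have hz : Filter.Tendsto (fun ε : ℝ => |ε| * (C * ‖toL2 w‖)) (nhds 0) (nhds 0) := by
    have : Continuous (fun ε : ℝ => |ε| * (C * ‖toL2 w‖)) := by fun_prop
    simpa using this.tendsto 0
  refine squeeze_zero_norm' ?_ hz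
  filter_upwards [Metric.closedBall_mem_nhds (0 : ℝ) one_pos] with ε hε
  have hε' : |ε| ≤ 1 := by simpa using hε
  rw [map_smul, norm_smul, Complex.norm_real, Real.norm_eq_abs]
  exact mul_le_mul_of_nonneg_left (norm_toL2_mulOp_le (hg.temperate ε) (hC ε hε') w) (abs_nonneg _)

/-- Each derivative of a dilated function produces a factor `ε` and a dilate of a fixed `C_b^∞`
function. Two levels are recorded because the Schrödinger operator has order two. -/
theorem exists_partialDeriv_cutoff (j : Fin d) : ∃ g : ℝ → Space d → ℂ,
    UCb {ε : ℝ | |ε| ≤ 1} g ∧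
    (∀ ε, mulOp (fun x => (1 / Complex.I) * partialDeriv j (cutoff ε) x) = (ε : ℂ) • mulOp (g ε)) ∧
    ∃ g' : ℝ → Space d → ℂ, UCb {ε : ℝ | |ε| ≤ 1} g' ∧
    ∀ ε, mulOp (fun x => (1 / Complex.I) * partialDeriv j (g ε) x) = (ε : ℂ) • mulOp (g' ε) := by
  have key : ∀ f : Space d → ℂ, IsCbComplex f → ∃ h : Space d → ℂ, IsCbComplex h ∧ ∀ ε : ℝ,
      mulOp (fun x => (1 / Complex.I) * partialDeriv j (fun Z => f (ε • Z)) x)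
        = (ε : ℂ) • mulOp (fun Z => h (ε • Z)) := by
    intro f hf
    have hh : IsCbComplex (fun x => (1 / Complex.I) * partialDeriv j f x) :=
      ((hf.partialDeriv j).uCb.const_mul (P := (univ : Set Unit)) (c := fun _ => 1 / Complex.I)
        ⟨_, fun _ _ => le_rfl⟩).isCbComplex (i := ()) trivial
    refine ⟨_, hh, fun ε => ?_⟩
    rw [mulOp_smul _ (hh.uCb_scale.temperate ε)]
    congr 1
    ext x
    rw [partialDeriv_comp_smul (hf.1.differentiable (by simp)) ε j x]
    ring
  have h1 : IsCbComplex (cutoff (d := d) 1) :=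
    isCbComplex_of_hasCompactSupport (contDiff_cutoff 1) (hasCompactSupport_cutoff one_ne_zero)
  obtain ⟨h, hh, he⟩ := key _ h1
  obtain ⟨h', hh', he'⟩ := key _ hh
  refine ⟨_, hh.uCb_scale, fun ε => ?_, _, hh'.uCb_scale, he'⟩
  rw [← he ε, cutoff_one_smul]

/-- The commutator of `H` with the cutoff has size `O(ε)` on a fixed Schwartz function. Together
with `tendsto_cutoff`, this approximates Schwartz functions by test functions in the graph norm. -/
theorem tendsto_hamOp_cutoff {a : Fin d → Space d → ℂ} {v : Space d → ℂ}
    (ha : ∀ j, (a j).HasTemperateGrowth) (hv : v.HasTemperateGrowth) (w : SpaceS d) :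
    Filter.Tendsto (fun ε => toL2 (hamOp a v (mulOp (cutoff ε) w))) (nhds 0)
      (nhds (toL2 (hamOp a v w))) := by
  choose g hg hge g' hg' hge' using exists_partialDeriv_cutoff (d := d)
  have hn : ∀ (j : Fin d) {f : Space d → ℂ}, f.HasTemperateGrowth → ∀ u : SpaceS d,
      nabOp a j (mulOp f u) = mulOp f (nabOp a j u)
        + mulOp (fun x => (1 / Complex.I) * partialDeriv j f x) u := fun j f hf u => by
    have := congrArg (fun T : Op d => T u) (nabOp_mul_mulOp ha hf j)
    simpa [Module.End.mul_apply, LinearMap.add_apply] using this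
  have e : ∀ ε : ℝ, toL2 (hamOp a v (mulOp (cutoff ε) w))
      = ∑ j, (toL2 (mulOp (cutoff ε) (nabOp a j (nabOp a j w)))
        + (2 : ℂ) • toL2 ((ε : ℂ) • mulOp (g j ε) (nabOp a j w))
        + (ε : ℂ) • toL2 ((ε : ℂ) • mulOp (g' j ε) w))
        + toL2 (mulOp (cutoff ε) (mulOp v w)) := by
    intro ε
    have hc : mulOp v (mulOp (cutoff ε) w) = mulOp (cutoff ε) (mulOp v w) := by
      have : mulOp v * mulOp (cutoff ε) = mulOp (cutoff ε) * mulOp v := by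
        rw [mulOp_mul hv (cutoff_uCb.temperate ε), mulOp_mul (cutoff_uCb.temperate ε) hv]
        simp only [mul_comm]
      exact congrArg (fun T : Op d => T w) this
    simp only [hamOp, LinearMap.add_apply, LinearMap.sum_apply, Module.End.mul_apply, map_add,
      map_sum, hn _ (cutoff_uCb.temperate ε), hge, LinearMap.smul_apply, map_smul,
      hn _ ((hg _).temperate ε), hge', hc, smul_add]
    congr 1
    refine Finset.sum_congr rfl fun j _ => ?_
    rw [two_smul]
    abel
  have e2 : toL2 (hamOp a v w) = ∑ j, (toL2 (nabOp a j (nabOp a j w)) + (2 : ℂ) • 0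
      + ((0 : ℝ) : ℂ) • (0 : L2 d)) + toL2 (mulOp v w) := by
    simp only [hamOp, LinearMap.add_apply, LinearMap.sum_apply, Module.End.mul_apply, map_add,
      map_sum, smul_zero, add_zero]
  simp only [e]
  rw [e2]
  refine (tendsto_finsetSum _ fun j _ => ?_).add (tendsto_cutoff _)
  refine ((tendsto_cutoff _).add ((tendsto_smul_mulOp_of_uCb (hg j) _).const_smul _)).add ?_
  exact (Complex.continuous_ofReal.tendsto 0).smul (tendsto_smul_mulOp_of_uCb (hg' j) _)

end

end MagneticSchrodinger

namespace MagneticSchrodinger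

noncomputable section

variable {d : ℕ}

/-! ### The resolvent of the magnetic Schrödinger operator in `L²` -/

section resCLM

variable {a : Fin d → Space d → ℂ} {v : Space d → ℂ} {σ τ : ℂ}

/-- The extension of the resolvent to `L²`. -/
def resCLM (a : Fin d → Space d → ℂ) (v : Space d → ℂ) (σ : ℂ) : L2 d →L[ℂ] L2 d :=
  extL2 (resOp a v σ)

theorem resCLM_toL2 (h : Admissible a v) (hσ : σ.re = 0) (hσ' : |σ.im| = 1) (u : SpaceS d) :
    resCLM a v σ (toL2 u) = toL2 (resOp a v σ u) :=
  extL2_toL2 (norm_resOp_le h hσ hσ') u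

theorem adjoint_resCLM (h : Admissible a v) (hσ : σ.re = 0) (hσ' : |σ.im| = 1) :
    ContinuousLinearMap.adjoint (resCLM a v σ) = resCLM a v (-σ) := by
  symm
  rw [ContinuousLinearMap.eq_adjoint_iff]
  have hm : (-σ).re = 0 := by simp [hσ]
  have hm' : |(-σ).im| = 1 := by simpa using hσ'
  intro x y
  refine denseRange_toL2.induction_on₂ (p := fun x y => inner ℂ (resCLM a v (-σ) x) y
    = inner ℂ x (resCLM a v σ y)) (isClosed_eq (by fun_prop) (by fun_prop)) (fun u w => ?_) x y
  rw [resCLM_toL2 h hm hm', resCLM_toL2 h hσ hσ', inner_resOp h hm hm', neg_neg]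

theorem resCLM_commute (h : Admissible a v) (hσ : σ.re = 0) (hσ' : |σ.im| = 1) (hτ : τ.re = 0)
    (hτ' : |τ.im| = 1) : Commute (resCLM a v σ) (resCLM a v τ) := by
  refine clm_ext_toL2 fun u => ?_
  simp only [mul_apply_eq_comp, resCLM_toL2 h hσ hσ', resCLM_toL2 h hτ hτ']
  exact congrArg (fun T : Op d => toL2 (T u)) (resOp_commute h hσ hσ' hτ hτ')

theorem resCLM_sub_resCLM (h : Admissible a v) (hσ : σ.re = 0) (hσ' : |σ.im| = 1) (hτ : τ.re = 0)
    (hτ' : |τ.im| = 1) :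
    resCLM a v σ - resCLM a v τ = (τ - σ) • (resCLM a v σ * resCLM a v τ) := by
  refine clm_ext_toL2 fun u => ?_
  rw [_root_.sub_apply, _root_.smul_apply, mul_apply_eq_comp, resCLM_toL2 h hτ hτ',
    resCLM_toL2 h hσ hσ', resCLM_toL2 h hσ hσ', ← map_sub, ← map_smul]
  exact congrArg (fun T : Op d => toL2 (T u)) (resOp_sub_resOp h hσ hσ' hτ hτ')

theorem isStarNormal_resCLM (h : Admissible a v) (hσ : σ.re = 0) (hσ' : |σ.im| = 1) :
    IsStarNormal (resCLM a v σ) := by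
  refine ⟨?_⟩
  rw [ContinuousLinearMap.star_eq_adjoint, adjoint_resCLM h hσ hσ']
  exact resCLM_commute h (by simp [hσ]) (by simpa using hσ') hσ hσ'

/-- A vector in the kernel is orthogonal to the range of the adjoint, the resolvent at `-σ`. That
range contains all Schwartz functions, which are dense. -/
theorem resCLM_injective (h : Admissible a v) (hσ : σ.re = 0) (hσ' : |σ.im| = 1) (x : L2 d)
    (hx : resCLM a v σ x = 0) : x = 0 := by
  have hm : (-σ).re = 0 := by simp [hσ]
  have hm' : |(-σ).im| = 1 := by simpa using hσ'
  have key : ∀ u : SpaceS d, inner ℂ (toL2 u) x = 0 := fun u => by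
    set w := hamOp a v u + (-σ) • u with hw
    have hw2 : resOp a v (-σ) w = u := congrArg (fun T : Op d => T u) (resOp_mul_hamOp h hm hm')
    rw [← hw2, ← resCLM_toL2 h hm hm', ← adjoint_resCLM h hσ hσ',
      ContinuousLinearMap.adjoint_inner_left, hx, inner_zero_right]
  have h2 : inner ℂ x x = 0 := by
    refine denseRange_toL2.induction_on (p := fun y => inner ℂ y x = 0) x
      (isClosed_eq (by fun_prop) continuous_const) key
  exact inner_self_eq_zero.1 h2

end resCLM

/-! ### Identification of the closed operator and of its resolvent. -/

/-- A test function as a Schwartz function. -/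
def _root_.MagneticSchrodinger.IsTest.schwartz {u : Space d → ℂ} (hu : IsTest u) : SpaceS d :=
  hu.2.toSchwartzMap hu.1

theorem IsTest.coe_schwartz {u : Space d → ℂ} (hu : IsTest u) : (hu.schwartz : Space d → ℂ) = u :=
  rfl

theorem toL2_ae (u : SpaceS d) : toL2 u =ᵐ[volume] u := u.coeFn_toLp 2 volume

theorem toL2_schwartz {u : Space d → ℂ} (hu : IsTest u) : MagneticSchrodinger.toL2 hu.schwartz = hu.toL2 :=
  Lp.ext ((toL2_ae _).trans hu.memLp.coeFn_toLp.symm)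

section expr

variable {a : Fin d → Space d → ℝ} {v : Space d → ℝ}

/-- A real potential as a complex valued function. -/
def cxPot (a : Fin d → Space d → ℝ) (j : Fin d) (x : Space d) : ℂ := (a j x : ℂ)

/-- A real function as a complex valued function. -/
def cxFun (v : Space d → ℝ) (x : Space d) : ℂ := (v x : ℂ)

theorem nabOp_apply (ha : ∀ j, (cxPot a j).HasTemperateGrowth) (j : Fin d) (u : SpaceS d)
    (x : Space d) : nabOp (cxPot a) j u x = nabla a j u x := by
  rw [nabOp, LinearMap.sub_apply, _root_.sub_apply, mulOp_apply (ha j), dOp_apply]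
  rfl

theorem coe_nabOp (ha : ∀ j, (cxPot a j).HasTemperateGrowth) (j : Fin d) (u : SpaceS d) :
    (nabOp (cxPot a) j u : Space d → ℂ) = nabla a j u := funext (nabOp_apply ha j u)

theorem hamOp_apply (ha : ∀ j, (cxPot a j).HasTemperateGrowth)
    (hv : (cxFun v).HasTemperateGrowth) (u : SpaceS d) (x : Space d) :
    hamOp (cxPot a) (cxFun v) u x = schrodingerExpr a v u x := by
  rw [hamOp, LinearMap.add_apply, _root_.add_apply, mulOp_apply hv, LinearMap.sum_apply,
    _root_.sum_apply]
  simp only [Module.End.mul_apply, nabOp_apply ha, coe_nabOp ha, schrodingerExpr]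
  rfl

theorem mem_testGraph (ha : ∀ j, (cxPot a j).HasTemperateGrowth)
    (hv : (cxFun v).HasTemperateGrowth) {p : L2 d × L2 d} :
    p ∈ testGraph a v ↔ ∃ (u : Space d → ℂ) (hu : IsTest u),
      p = (toL2 hu.schwartz, toL2 (hamOp (cxPot a) (cxFun v) hu.schwartz)) := by
  have e : ∀ (u : Space d → ℂ) (hu : IsTest u),
      toL2 (hamOp (cxPot a) (cxFun v) hu.schwartz) =ᵐ[volume] schrodingerExpr a v u := fun u hu => by
    refine (toL2_ae _).trans (Filter.Eventually.of_forall fun x => ?_)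
    exact hamOp_apply ha hv hu.schwartz x
  constructor
  · rintro ⟨u, hu, h1, h2⟩
    refine ⟨u, hu, Prod.ext (Lp.ext (h1.trans ?_)) (Lp.ext (h2.trans (e u hu).symm))⟩
    exact (toL2_ae hu.schwartz).symm
  · rintro ⟨u, hu, rfl⟩
    exact ⟨u, hu, toL2_ae hu.schwartz, e u hu⟩

/-- The pairs with `R(y + ix) = x` form a closed subspace that contains the graph over test
functions, and it is the graph of an operator because `R` is injective. Conversely such a pair is
the image of `w = y + ix` under a continuous map. By density `w` may be taken Schwartz, hence `w =
(H + i)u` with `u` Schwartz, and `u` is approximated in graph norm by its cutoffs. This carries the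
content of essential self-adjointness. -/
theorem graph_schrodingerOp (h : Admissible (cxPot a) (cxFun v)) (p : L2 d × L2 d) :
    p ∈ (schrodingerOp a v).graph
      ↔ resCLM (cxPot a) (cxFun v) Complex.I (p.2 + Complex.I • p.1) = p.1 := by
  have hI : (Complex.I).re = 0 := Complex.I_re
  have hI' : |(Complex.I).im| = 1 := by simp
  have ha := h.temperate
  have hv := h.elec.hasTemperateGrowth
  set R := resCLM (cxPot a) (cxFun v) Complex.I with hR
  set Φ : (L2 d × L2 d) →L[ℂ] L2 d := R.comp (ContinuousLinearMap.snd ℂ _ _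
    + Complex.I • ContinuousLinearMap.fst ℂ _ _) - ContinuousLinearMap.fst ℂ _ _ with hΦ
  set G : Submodule ℂ (L2 d × L2 d) := LinearMap.ker Φ.toLinearMap with hG
  have hmem : ∀ p, p ∈ G ↔ R (p.2 + Complex.I • p.1) = p.1 := fun p => by
    rw [hG, LinearMap.mem_ker]
    simp [hΦ, sub_eq_zero]
  have hGc : IsClosed (G : Set (L2 d × L2 d)) := Φ.isClosed_ker
  have hGf : ∀ x ∈ G, x.1 = 0 → x.2 = 0 := fun x hx h0 => by
    have := (hmem x).1 hx
    rw [h0, smul_zero, add_zero] at this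
    exact resCLM_injective h hI hI' _ this
  have hRu : ∀ u : SpaceS d, R (toL2 (hamOp (cxPot a) (cxFun v) u) + Complex.I • toL2 u)
      = toL2 u := fun u => by
    rw [← map_smul, ← map_add, hR, resCLM_toL2 h hI hI']
    exact congrArg (fun T : Op d => toL2 (T u)) (resOp_mul_hamOp h hI hI')
  set S := Submodule.span ℂ (testGraph a v) with hS
  have hSG : S ≤ G := by
    refine Submodule.span_le.2 fun p hp => ?_
    obtain ⟨u, hu, rfl⟩ := (mem_testGraph ha hv).1 hp
    exact (hmem _).2 (hRu _)
  have hcG : S.topologicalClosure ≤ G := Submodule.topologicalClosure_minimal _ hSG hGc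
  have hSg : S.toLinearPMap.graph = S :=
    Submodule.toLinearPMap_graph_eq S fun x hx => hGf x (hSG hx)
  have hcg : S.topologicalClosure.toLinearPMap.graph = S.topologicalClosure :=
    Submodule.toLinearPMap_graph_eq _ fun x hx => hGf x (hcG hx)
  have hclos : S.toLinearPMap.IsClosable := ⟨S.topologicalClosure.toLinearPMap, by rw [hSg, hcg]⟩
  have hg : (schrodingerOp a v).graph = S.topologicalClosure := by
    rw [schrodingerOp, ← hclos.graph_closure_eq_closure_graph, hSg]
  rw [hg, ← hmem]
  refine ⟨fun hp => hcG hp, fun hp => ?_⟩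
  -- the graph contains the image of a dense set
  set Ψ : L2 d → L2 d × L2 d := fun w => (R w, w - Complex.I • R w) with hΨ
  have hΨc : Continuous Ψ := by fun_prop
  have hcl : IsClosed {w | Ψ w ∈ S.topologicalClosure} :=
    S.isClosed_topologicalClosure.preimage hΨc
  have hΨu : ∀ u : SpaceS d, Ψ (toL2 (hamOp (cxPot a) (cxFun v) u) + Complex.I • toL2 u)
      = (toL2 u, toL2 (hamOp (cxPot a) (cxFun v) u)) := fun u => by
    simp only [hΨ, hRu, add_sub_cancel_right]
  have hpΨ : Ψ (p.2 + Complex.I • p.1) = p := by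
    have := (hmem p).1 hp
    simp only [hΨ, this, add_sub_cancel_right]
  rw [← hpΨ]
  refine denseRange_toL2.induction_on (p := fun w => Ψ w ∈ S.topologicalClosure) _ hcl fun f => ?_
  obtain ⟨u, hu⟩ := (bijective_hamOp h hI hI').2 f
  have hu' : toL2 f = toL2 (hamOp (cxPot a) (cxFun v) u) + Complex.I • toL2 u := by
    rw [← hu, ← map_smul, ← map_add]; rfl
  rw [hu', hΨu]
  have hε : Filter.Tendsto (fun n : ℕ => 1 / ((n : ℝ) + 1)) Filter.atTop (nhds 0) :=
    tendsto_one_div_add_atTop_nhds_zero_nat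
  have hlim := ((tendsto_cutoff u).comp hε).prodMk_nhds ((tendsto_hamOp_cutoff ha hv u).comp hε)
  refine S.isClosed_topologicalClosure.mem_of_tendsto hlim (Filter.Eventually.of_forall fun n => ?_)
  refine S.le_topologicalClosure (Submodule.subset_span ((mem_testGraph ha hv).2 ?_))
  have hne : 1 / ((n : ℝ) + 1) ≠ 0 := by positivity
  have ht := isTest_cutoff_mul hne (contDiff_infty.2 fun n => u.smooth n)
  have e : ht.schwartz = mulOp (cutoff (1 / ((n : ℝ) + 1))) u := by
    ext x
    rw [mulOp_apply (cutoff_uCb.temperate _)]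
    rfl
  exact ⟨_, ht, by rw [e]; rfl⟩

theorem isResolvent_resCLM (h : Admissible (cxPot a) (cxFun v)) :
    IsResolvent (schrodingerOp a v) (-Complex.I) (resCLM (cxPot a) (cxFun v) Complex.I) := by
  set R := resCLM (cxPot a) (cxFun v) Complex.I with hR
  constructor
  · intro x
    have hx : (R x, x - Complex.I • R x) ∈ (schrodingerOp a v).graph :=
      (graph_schrodingerOp h _).2 (by simp [hR])
    obtain ⟨y, hy1, hy2⟩ := (LinearPMap.mem_graph_iff _).1 hx
    have hd : R x ∈ (schrodingerOp a v).domain := by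
      have := y.2
      rwa [hy1] at this
    refine ⟨hd, ?_⟩
    have : (⟨R x, hd⟩ : (schrodingerOp a v).domain) = y := Subtype.ext hy1.symm
    rw [this, hy2]
    simp
  · intro y
    have := (graph_schrodingerOp h _).1 ((schrodingerOp a v).mem_graph y)
    simpa using this

theorem resolvent_schrodingerOp (h : Admissible (cxPot a) (cxFun v)) :
    resolvent (schrodingerOp a v) (-Complex.I) = resCLM (cxPot a) (cxFun v) Complex.I := by
  have hex : ∃ R, IsResolvent (schrodingerOp a v) (-Complex.I) R := ⟨_, isResolvent_resCLM h⟩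
  rw [resolvent, dif_pos hex]
  ext1 x
  obtain ⟨hx, hx'⟩ := hex.choose_spec.1 x
  have h2 := (isResolvent_resCLM h).2 ⟨_, hx⟩
  rw [hx'] at h2
  exact h2.symm

end expr

end

end MagneticSchrodinger

namespace MagneticSchrodinger

noncomputable section

variable {d : ℕ}

/-! ### Schwartz functions of a real variable as Fourier series in the Cayley transform -/

section cayley

open Real in
/-- The function `ψ` in the angular variable of the Cayley transform, `λ = -cot (θ / 2)`. -/
def angular (ψ : 𝓢(ℝ, ℂ)) (θ : ℝ) : ℂ :=
  if sin (θ / 2) = 0 then 0 else ψ (-cos (θ / 2) / sin (θ / 2))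

/-- For `λ = -cot (θ/2)` one has `1 + λ² = 1/sin² (θ/2)`, so decay of `ψ` of order two at infinity
becomes quadratic vanishing at the angles that represent `λ = ∞`. This gives continuity there. -/
theorem norm_angular_le (ψ : 𝓢(ℝ, ℂ)) :
    ∃ C : ℝ, 0 ≤ C ∧ ∀ θ, ‖angular ψ θ‖ ≤ C * Real.sin (θ / 2) ^ 2 := by
  obtain ⟨C, hC⟩ := ψ.decay' 0 0
  obtain ⟨D, hD⟩ := ψ.decay' 2 0
  have hC' : ∀ x, ‖ψ x‖ ≤ C := fun x => by
    have := hC x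
    rwa [pow_zero, one_mul, norm_iteratedFDeriv_zero] at this
  have hD' : ∀ x, x ^ 2 * ‖ψ x‖ ≤ D := fun x => by
    have := hD x
    rwa [norm_iteratedFDeriv_zero, Real.norm_eq_abs, sq_abs] at this
  have h0 : 0 ≤ C + D := by
    have h1 := (norm_nonneg _).trans (hC' 0)
    have h2 := hD' 0
    simp at h2
    exact add_nonneg h1 h2
  refine ⟨C + D, h0, fun θ => ?_⟩
  rw [angular]
  split_ifs with hs
  · simp [hs]
  · set l := -Real.cos (θ / 2) / Real.sin (θ / 2) with hl
    have h1 : (1 + l ^ 2) * Real.sin (θ / 2) ^ 2 = 1 := by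
      rw [hl]; field_simp
      have := Real.sin_sq_add_cos_sq (θ / 2)
      linarith
    have h2 : (1 + l ^ 2) * ‖ψ l‖ ≤ C + D := by
      have := hC' l; have := hD' l; linarith
    calc ‖ψ l‖ = (1 + l ^ 2) * ‖ψ l‖ * Real.sin (θ / 2) ^ 2 := by
          rw [mul_right_comm, h1, one_mul]
      _ ≤ _ := mul_le_mul_of_nonneg_right h2 (sq_nonneg _)

/-- The operator `½ (1 + λ²) d/dλ`, which is `d/dθ` in the angular variable. -/
def angularDeriv (ψ : 𝓢(ℝ, ℂ)) : 𝓢(ℝ, ℂ) :=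
  SchwartzMap.smulLeftCLM ℂ (fun x : ℝ => (((1 + x ^ 2) / 2 : ℝ) : ℂ)) (SchwartzMap.derivCLM ℂ ℂ ψ)

theorem angularDeriv_apply (ψ : 𝓢(ℝ, ℂ)) (x : ℝ) :
    angularDeriv ψ x = (((1 + x ^ 2) / 2 : ℝ) : ℂ) * deriv ψ x := by
  have h : (fun x : ℝ => (((1 + x ^ 2) / 2 : ℝ) : ℂ)).HasTemperateGrowth := by
    have : (fun x : ℝ => (1 + x ^ 2) / 2).HasTemperateGrowth := by
      simp only [div_eq_mul_inv]
      fun_prop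
    exact Complex.ofRealCLM.hasTemperateGrowth.comp this
  rw [angularDeriv, SchwartzMap.smulLeftCLM_apply_apply h, smul_eq_mul, SchwartzMap.derivCLM_apply]

theorem hasDerivAt_angular (ψ : 𝓢(ℝ, ℂ)) {θ : ℝ} (hθ : Real.sin (θ / 2) ≠ 0) :
    HasDerivAt (angular ψ) (angular (angularDeriv ψ) θ) θ := by
  have h2 : HasDerivAt (fun θ : ℝ => θ / 2) (1 / 2) θ := (hasDerivAt_id θ).div_const 2
  have hl : HasDerivAt (fun θ : ℝ => -Real.cos (θ / 2) / Real.sin (θ / 2))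
      ((1 + (-Real.cos (θ / 2) / Real.sin (θ / 2)) ^ 2) / 2) θ := by
    have hn : HasDerivAt (fun θ : ℝ => -Real.cos (θ / 2)) (-(-Real.sin (θ / 2) * (1 / 2))) θ :=
      h2.cos.neg
    refine (hn.div h2.sin hθ).congr_deriv ?_
    field_simp
    ring
  have h3 := (ψ.differentiableAt (x := -Real.cos (θ / 2) / Real.sin (θ / 2))).hasDerivAt.scomp θ hl
  have h4 : angular ψ =ᶠ[nhds θ] fun θ => ψ (-Real.cos (θ / 2) / Real.sin (θ / 2)) := by
    have hc : Continuous fun θ : ℝ => Real.sin (θ / 2) := by fun_prop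
    filter_upwards [hc.continuousAt.eventually_ne hθ] with x hx
    rw [angular, if_neg hx]
  refine (h3.congr_of_eventuallyEq h4).congr_deriv ?_
  rw [angular, if_neg hθ, angularDeriv_apply, Complex.real_smul]

theorem continuous_angular (ψ : 𝓢(ℝ, ℂ)) : Continuous (angular ψ) := by
  refine continuous_iff_continuousAt.2 fun θ => ?_
  by_cases hθ : Real.sin (θ / 2) = 0
  · obtain ⟨C, hC0, hC⟩ := norm_angular_le ψ
    have h0 : angular ψ θ = 0 := by rw [angular, if_pos hθ]
    rw [ContinuousAt, h0]
    refine squeeze_zero_norm hC ?_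
    have hc : Continuous fun θ : ℝ => C * Real.sin (θ / 2) ^ 2 := by fun_prop
    simpa [hθ] using hc.tendsto θ
  · exact (hasDerivAt_angular ψ hθ).continuousAt

theorem two_pi_pos' : (0 : ℝ) < 0 + 2 * Real.pi := by
  rw [zero_add]; exact Real.two_pi_pos

/-- The Fourier coefficients in the angular variable. -/
def angularCoeff (ψ : 𝓢(ℝ, ℂ)) (n : ℤ) : ℂ := fourierCoeffOn two_pi_pos' (angular ψ) n

theorem angular_zero (ψ : 𝓢(ℝ, ℂ)) : angular ψ 0 = 0 := by simp [angular]

theorem angular_two_pi (ψ : 𝓢(ℝ, ℂ)) : angular ψ (2 * Real.pi) = 0 := by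
  simp [angular, mul_div_cancel_left₀]

/-- Integration by parts over a period; the boundary terms vanish because both endpoints represent
`λ = ∞`. Since `angularDeriv` maps Schwartz functions to Schwartz functions, this can be iterated
and gives decay of every order. -/
theorem angularCoeff_deriv (ψ : 𝓢(ℝ, ℂ)) {n : ℤ} (hn : n ≠ 0) :
    angularCoeff (angularDeriv ψ) n = Complex.I * n * angularCoeff ψ n := by
  have h := fourierCoeffOn_of_hasDerivAt_Ioo two_pi_pos' (f := angular ψ)
    (f' := angular (angularDeriv ψ)) hn (continuous_angular ψ).continuousOn (fun x hx => by
      rw [min_eq_left two_pi_pos'.le, max_eq_right two_pi_pos'.le, zero_add] at hx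
      refine hasDerivAt_angular ψ (Real.sin_pos_of_pos_of_lt_pi ?_ ?_).ne'
      · linarith [hx.1]
      · linarith [hx.2]) ((continuous_angular _).intervalIntegrable _ _)
  have e1 : angular ψ (0 + 2 * Real.pi) = 0 := by rw [zero_add, angular_two_pi]
  rw [e1, angular_zero, sub_self, mul_zero, zero_sub] at h
  have h' : angularCoeff ψ n = 1 / (-2 * Real.pi * Complex.I * n)
      * -(((2 * Real.pi : ℝ) : ℂ) * angularCoeff (angularDeriv ψ) n) := by
    have e2 : ((0 + 2 * Real.pi : ℝ) : ℂ) - ((0 : ℝ) : ℂ) = ((2 * Real.pi : ℝ) : ℂ) := by simp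
    rw [← e2]
    exact h
  rw [h']
  have : (n : ℂ) ≠ 0 := by exact_mod_cast hn
  have hpi : (Real.pi : ℂ) ≠ 0 := by exact_mod_cast Real.pi_ne_zero
  push_cast
  field_simp

theorem norm_angularCoeff_le (ψ : 𝓢(ℝ, ℂ)) : ∃ C : ℝ, ∀ n, ‖angularCoeff ψ n‖ ≤ C := by
  obtain ⟨C, hC0, hC⟩ := norm_angular_le ψ
  refine ⟨C, fun n => ?_⟩
  rw [angularCoeff, fourierCoeffOn_eq_integral, norm_smul]
  have h1 : ‖∫ x in (0 : ℝ)..(0 + 2 * Real.pi), fourier (-n) (x : AddCircle (0 + 2 * Real.pi - 0))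
      • angular ψ x‖ ≤ C * |0 + 2 * Real.pi - 0| := by
    refine intervalIntegral.norm_integral_le_of_norm_le_const fun x _ => ?_
    rw [norm_smul]
    have h2 : ‖fourier (-n) (x : AddCircle (0 + 2 * Real.pi - 0))‖ = 1 := Circle.norm_coe _
    rw [h2, one_mul]
    refine (hC x).trans (mul_le_of_le_one_right hC0 ?_)
    rw [sq_le_one_iff_abs_le_one]; exact Real.abs_sin_le_one _
  have hp := two_pi_pos'
  rw [zero_add, sub_zero] at h1 ⊢
  rw [Real.norm_of_nonneg (by positivity), one_div, inv_mul_le_iff₀ Real.two_pi_pos]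
  rw [abs_of_pos Real.two_pi_pos] at h1
  simpa [mul_comm] using h1

theorem pow_mul_norm_angularCoeff_le (k : ℕ) : ∀ ψ : 𝓢(ℝ, ℂ),
    ∃ C : ℝ, ∀ n : ℤ, |(n : ℝ)| ^ k * ‖angularCoeff ψ n‖ ≤ C := by
  induction k with
  | zero => intro ψ; simpa using norm_angularCoeff_le ψ
  | succ k ih =>
    intro ψ
    obtain ⟨C, hC⟩ := ih (angularDeriv ψ)
    refine ⟨max C 0, fun n => ?_⟩
    by_cases hn : n = 0
    · simp [hn]
    · refine le_trans (le_of_eq ?_) ((hC n).trans (le_max_left _ _))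
      rw [angularCoeff_deriv ψ hn, norm_mul, norm_mul, Complex.norm_I, one_mul, Complex.norm_intCast,
        pow_succ]
      ring

theorem summable_angularCoeff (ψ : 𝓢(ℝ, ℂ)) (k : ℕ) :
    Summable fun n : ℤ => (1 + |(n : ℝ)|) ^ k * ‖angularCoeff ψ n‖ := by
  -- The two additional powers of `|n|` leave the summable factor `1/n²`. The index `0` is excluded
  -- as a finite set.
  obtain ⟨C, hC⟩ := pow_mul_norm_angularCoeff_le (k + 2) ψ
  refine Summable.of_norm_bounded_eventually (g := fun n : ℤ => 2 ^ k * C * (1 / (n : ℝ) ^ 2))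
    ((Real.summable_one_div_int_pow.2 one_lt_two).mul_left _) ?_
  have : {(0 : ℤ)}ᶜ ∈ Filter.cofinite := (finite_singleton (0 : ℤ)).compl_mem_cofinite
  filter_upwards [this] with n hn
  have hn0 : n ≠ 0 := hn
  have h1 : (1 : ℝ) ≤ |(n : ℝ)| := by exact_mod_cast Int.one_le_abs hn0
  have h2 : (0 : ℝ) < (n : ℝ) ^ 2 := by
    rw [← sq_abs]; positivity
  rw [Real.norm_of_nonneg (by positivity), mul_one_div, le_div_iff₀ h2, ← sq_abs (n : ℝ)]
  calc (1 + |(n : ℝ)|) ^ k * ‖angularCoeff ψ n‖ * |(n : ℝ)| ^ 2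
      ≤ (2 * |(n : ℝ)|) ^ k * ‖angularCoeff ψ n‖ * |(n : ℝ)| ^ 2 := by gcongr; linarith
    _ = 2 ^ k * (|(n : ℝ)| ^ (k + 2) * ‖angularCoeff ψ n‖) := by rw [mul_pow, pow_add]; ring
    _ ≤ 2 ^ k * C := by gcongr; exact hC n

theorem hasSum_angularCoeff (ψ : 𝓢(ℝ, ℂ)) {θ : ℝ} (hθ : θ ∈ Ico 0 (2 * Real.pi)) :
    HasSum (fun n : ℤ => angularCoeff ψ n * Complex.exp (θ * Complex.I) ^ n) (angular ψ θ) := by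
  have : Fact ((0 : ℝ) < 2 * Real.pi) := ⟨Real.two_pi_pos⟩
  set f : C(AddCircle (2 * Real.pi), ℂ) := ⟨AddCircle.liftIco (2 * Real.pi) 0 (angular ψ),
    AddCircle.liftIco_zero_continuous (by rw [angular_zero, angular_two_pi])
      (continuous_angular ψ).continuousOn⟩ with hf
  have hc : ∀ n, fourierCoeff f n = angularCoeff ψ n := fun n =>
    fourierCoeff_liftIco_eq (angular ψ) n
  have hs : Summable (fourierCoeff f) := by
    refine Summable.of_norm ?_
    simp only [hc]
    simpa using summable_angularCoeff ψ 0
  have h := has_pointwise_sum_fourier_series_of_summable hs (θ : AddCircle (2 * Real.pi))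
  have e : f (θ : AddCircle (2 * Real.pi)) = angular ψ θ :=
    AddCircle.liftIco_zero_coe_apply (f := angular ψ) hθ
  rw [e] at h
  convert h using 2 with n
  rw [hc, smul_eq_mul, fourier_coe_apply, ← Complex.exp_int_mul]
  congr 2
  have hpi : (Real.pi : ℂ) ≠ 0 := by exact_mod_cast Real.pi_ne_zero
  push_cast
  field_simp

/-- The function `(λ + i)^p φ`. -/
def twist (p : ℕ) (φ : 𝓢(ℝ, ℂ)) : 𝓢(ℝ, ℂ) :=
  SchwartzMap.smulLeftCLM ℂ (fun x : ℝ => ((x : ℂ) + Complex.I) ^ p) φ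

theorem twist_apply (p : ℕ) (φ : 𝓢(ℝ, ℂ)) (x : ℝ) :
    twist p φ x = ((x : ℂ) + Complex.I) ^ p * φ x := by
  have h1 : (fun x : ℝ => (x : ℂ) + Complex.I).HasTemperateGrowth :=
    Complex.ofRealCLM.hasTemperateGrowth.add (Function.HasTemperateGrowth.const _)
  have h : (fun x : ℝ => ((x : ℂ) + Complex.I) ^ p).HasTemperateGrowth := by
    induction p with
    | zero => simp
    | succ p ih =>
      simp only [pow_succ]
      exact ih.mul h1
  rw [twist, SchwartzMap.smulLeftCLM_apply_apply h, smul_eq_mul]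

theorem exists_angle {z : ℂ} (hz : ‖z‖ = 1) :
    ∃ θ ∈ Ico 0 (2 * Real.pi), Complex.exp (θ * Complex.I) = z := by
  have h := Complex.norm_mul_exp_arg_mul_I z
  rw [hz, Complex.ofReal_one, one_mul] at h
  have hpi := Real.pi_pos
  rcases le_or_gt 0 z.arg with h0 | h0
  · exact ⟨z.arg, ⟨h0, by linarith [Complex.arg_le_pi z]⟩, h⟩
  · refine ⟨z.arg + 2 * Real.pi, ⟨by linarith [Complex.neg_pi_lt_arg z], by linarith⟩, ?_⟩
    push_cast
    rw [add_mul, Complex.exp_periodic, h]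

/-- A Schwartz function of `λ` as a series in the variable `w = (λ + i)⁻¹`. -/
theorem hasSum_cayley (φ : 𝓢(ℝ, ℂ)) (p : ℕ) {w : ℂ} (hw : ‖1 - 2 * Complex.I * w‖ = 1) :
    HasSum (fun n : ℤ => angularCoeff (twist p φ) n * ((1 - 2 * Complex.I * w) ^ n * w ^ p))
      (if w = 0 then 0 else φ (w⁻¹).re) := by
  obtain ⟨θ, hθ, hz⟩ := exists_angle hw
  have h := (hasSum_angularCoeff (twist p φ) hθ).mul_right (w ^ p)
  rw [hz] at h
  have h2 := Complex.exp_mul_I (θ : ℂ)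
  set s := Real.sin (θ / 2) with hs
  set c := Real.cos (θ / 2) with hc
  have hsc : (s : ℂ) ^ 2 + (c : ℂ) ^ 2 = 1 := by
    exact_mod_cast Real.sin_sq_add_cos_sq (θ / 2)
  have hcos : Complex.cos θ = 1 - 2 * (s : ℂ) ^ 2 := by
    have h3 : Real.cos θ = 1 - 2 * s ^ 2 := by
      have := Real.cos_sq (θ / 2)
      have h4 := Real.sin_sq_add_cos_sq (θ / 2)
      rw [mul_div_cancel₀ _ two_ne_zero] at this
      rw [hs]; linarith
    rw [← Complex.ofReal_cos, h3]; push_cast; ring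
  have hsin : Complex.sin θ = 2 * (s : ℂ) * c := by
    have h3 : Real.sin θ = 2 * s * c := by
      have := Real.sin_two_mul (θ / 2)
      rwa [mul_div_cancel₀ _ two_ne_zero] at this
    rw [← Complex.ofReal_sin, h3]; push_cast; ring
  -- Solving `1 - 2iw = e^{iθ}` gives `w = -sin (θ/2) e^{iθ/2}`. Hence `w = 0` exactly when `sin
  -- (θ/2) = 0`, and otherwise `1/w = -cot (θ/2) + i`.
  have hwe : w = -(s : ℂ) * (c + s * Complex.I) := by
    have h5 : 1 - 2 * Complex.I * w = 1 - 2 * (s : ℂ) ^ 2 + 2 * s * c * Complex.I := by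
      rw [← hz, h2, hcos, hsin]
    have hI := Complex.I_mul_I
    linear_combination (Complex.I / 2) * h5 + (w + s * c) * hI
  have e : angular (twist p φ) θ * w ^ p = if w = 0 then 0 else φ (w⁻¹).re := by
    by_cases hs0 : s = 0
    · have hw0 : w = 0 := by rw [hwe, hs0]; simp
      rw [angular, if_pos hs0, zero_mul, if_pos hw0]
    · have hsC : (s : ℂ) ≠ 0 := by exact_mod_cast hs0
      have hinv : w * (((-c / s : ℝ) : ℂ) + Complex.I) = 1 := by
        rw [hwe]; push_cast
        field_simp
        have hI := Complex.I_sq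
        linear_combination hsc - (s : ℂ) ^ 2 * hI
      have hw0 : w ≠ 0 := left_ne_zero_of_mul_eq_one hinv
      have hre : (w⁻¹).re = -c / s := by
        rw [← eq_inv_of_mul_eq_one_right hinv]; simp
      rw [angular, if_neg hs0, if_neg hw0, twist_apply, hre, mul_right_comm, ← mul_pow,
        mul_comm _ w, hinv, one_pow, one_mul]
  rw [← e]
  simpa only [mul_assoc] using h

end cayley

end

end MagneticSchrodinger

namespace MagneticSchrodinger

noncomputable section

variable {d : ℕ}

/-! ### Functions of the Schrödinger operator as series in the Cayley transform -/

section series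

variable {H : Type*} [NormedAddCommGroup H] [InnerProductSpace ℂ H] [CompleteSpace H]

/-- The factor with exponent `n` in the expansion in the Cayley transform of an operator with the
resolvents `R = (T + i)⁻¹` and `S = (T - i)⁻¹`. -/
def cayleyTerm {𝕜 : Type*} [Ring 𝕜] [Algebra ℂ 𝕜] (R S : 𝕜) : ℤ → 𝕜
  | Int.ofNat n => (1 - (2 * Complex.I) • R) ^ n
  | Int.negSucc n => (1 + (2 * Complex.I) • S) ^ (n + 1)

/-- The assumption on `R - R*` is the resolvent identity for the points `±i`. Together with
normality it says that `1 - 2iR` is unitary, and the claim follows by spectral mapping. -/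
theorem norm_one_sub_of_mem_spectrum {R : H →L[ℂ] H} [hR : IsStarNormal R]
    (hU : R - star R = (-2 * Complex.I) • (R * star R)) {w : ℂ} (hw : w ∈ spectrum ℂ R) :
    ‖1 - 2 * Complex.I * w‖ = 1 := by
  have hc : star R * R = R * star R := hR.star_comm_self
  have hs : star (2 * Complex.I) = -(2 * Complex.I) := by
    simp
  have hI : (2 * Complex.I) * (2 * Complex.I) = -4 := by
    linear_combination 4 * Complex.I_mul_I
  have hs2 : star (1 - (2 * Complex.I) • R) = 1 + (2 * Complex.I) • star R := by
    rw [star_sub, star_one, star_smul, hs, neg_smul, sub_neg_eq_add]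
  have e : (1 + (2 * Complex.I) • star R) * (1 - (2 * Complex.I) • R)
      = 1 - (2 * Complex.I) • (R - star R) + (4 : ℂ) • (R * star R) := by
    rw [add_mul, mul_sub, mul_sub, one_mul, one_mul, mul_one, smul_mul_smul_comm, hI, hc, smul_sub]
    module
  have e' : (1 - (2 * Complex.I) • R) * (1 + (2 * Complex.I) • star R)
      = 1 - (2 * Complex.I) • (R - star R) + (4 : ℂ) • (R * star R) := by
    rw [sub_mul, mul_add, mul_add, one_mul, one_mul, mul_one, smul_mul_smul_comm, hI, smul_sub]
    module
  have e2 : 1 - (2 * Complex.I) • (R - star R) + (4 : ℂ) • (R * star R) = 1 := by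
    rw [hU, smul_smul]
    have : 2 * Complex.I * (-2 * Complex.I) = 4 := by linear_combination -4 * Complex.I_mul_I
    rw [this, sub_add_cancel]
  have hu : (1 - (2 * Complex.I) • R) ∈ unitary (H →L[ℂ] H) := by
    rw [Unitary.mem_iff, hs2]
    exact ⟨e.trans e2, e'.trans e2⟩
  have h2I : (2 * Complex.I) ≠ 0 := by simp
  have hw2 : 1 - 2 * Complex.I * w ∈ spectrum ℂ (1 - (2 * Complex.I) • R) := by
    have h3 : (2 * Complex.I) * w ∈ spectrum ℂ ((2 * Complex.I) • R) := by
      have := (spectrum.smul_mem_smul_iff (a := R) (s := w) (r := Units.mk0 _ h2I)).2 hw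
      simpa [Units.smul_def] using this
    have h4 := spectrum.singleton_sub_eq (R := ℂ) ((2 * Complex.I) • R) (1 : ℂ)
    rw [map_one] at h4
    rw [← h4]
    exact Set.sub_mem_sub (mem_singleton _) h3
  simpa using spectrum.subset_circle_of_unitary hu hw2

theorem norm_le_one_of_norm_one_sub {w : ℂ} (hw : ‖1 - 2 * Complex.I * w‖ = 1) : ‖w‖ ≤ 1 := by
  have h1 : ‖2 * Complex.I * w‖ ≤ 2 := by
    calc ‖2 * Complex.I * w‖ = ‖1 - (1 - 2 * Complex.I * w)‖ := by congr 1; ring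
      _ ≤ ‖(1 : ℂ)‖ + ‖1 - 2 * Complex.I * w‖ := norm_sub_le _ _
      _ = 2 := by rw [hw, norm_one]; norm_num
  simp at h1
  linarith

/-- On the spectrum `|1 - 2iw| = 1` and `|w| ≤ 1`, so the scalar series is dominated by the summable
coefficients and converges uniformly there. The continuous functional calculus respects uniform
limits on the spectrum. -/
theorem hasSum_functionOf {R : H →L[ℂ] H} [hR : IsStarNormal R]
    (hU : R - star R = (-2 * Complex.I) • (R * star R)) (φ : 𝓢(ℝ, ℂ)) (p : ℕ) :
    HasSum (fun n : ℤ => angularCoeff (twist p φ) n • (cayleyTerm R (star R) n * R ^ p))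
      (cfc (fun w : ℂ => if w = 0 then 0 else φ (w⁻¹).re) R) := by
  set c := angularCoeff (twist p φ) with hc
  -- Negative powers are written with the conjugate of `w`, which equals the inverse power on the
  -- spectrum but is continuous on the whole plane. The functional calculus turns it into the
  -- adjoint of `R`.
  set g : ℤ → ℂ → ℂ := fun n w => match n with
    | Int.ofNat n => (1 - 2 * Complex.I * w) ^ n
    | Int.negSucc n => (1 + 2 * Complex.I * star w) ^ (n + 1) with hg
  have hgc : ∀ n, Continuous (g n) := fun n => by
    cases n <;> simp only [hg] <;> fun_prop
  have hgz : ∀ n, ∀ w ∈ spectrum ℂ R, g n w = (1 - 2 * Complex.I * w) ^ n := by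
    intro n w hw
    have h1 := norm_one_sub_of_mem_spectrum hU hw
    cases n with
    | ofNat n => simp [hg]
    | negSucc n =>
      have h2 : 1 + 2 * Complex.I * star w = (1 - 2 * Complex.I * w)⁻¹ := by
        rw [Complex.inv_def, Complex.normSq_eq_norm_sq, h1]
        simp [show (starRingEnd ℂ) 2 = 2 from Complex.conj_ofNat 2]
      simp only [hg]
      rw [h2, zpow_negSucc, inv_pow]
  have hgR : ∀ n, cfc (fun w => g n w * w ^ p) R = cayleyTerm R (star R) n * R ^ p := by
    intro n
    have hcR : cfc (fun w : ℂ => w) R = R := cfc_id' ℂ R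
    have h1 : cfc (g n) R = cayleyTerm R (star R) n := by
      cases n with
      | ofNat n =>
        simp only [hg, cayleyTerm]
        rw [cfc_pow (fun w => 1 - 2 * Complex.I * w) n R (by fun_prop),
          cfc_sub (fun _ => (1 : ℂ)) (fun w => 2 * Complex.I * w) R (by fun_prop) (by fun_prop),
          cfc_const_mul (2 * Complex.I) (fun w => w) R (by fun_prop), hcR, cfc_const_one ℂ R]
      | negSucc n =>
        simp only [hg, cayleyTerm]
        rw [cfc_pow (fun w => 1 + 2 * Complex.I * star w) (n + 1) R (by fun_prop),
          cfc_add R (fun _ => (1 : ℂ)) (fun w => 2 * Complex.I * star w) (by fun_prop)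
            (by fun_prop),
          cfc_const_mul (2 * Complex.I) (fun w => star w) R (by fun_prop), cfc_star (fun w => w) R,
          hcR, cfc_const_one ℂ R]
    rw [cfc_mul (g n) (fun w => w ^ p) R (hgc n).continuousOn (by fun_prop), h1,
      cfc_pow (fun w => w) p R (by fun_prop), hcR]
  have hsum : Summable fun n => ‖c n‖ := by simpa using summable_angularCoeff (twist p φ) 0
  have hunif : TendstoUniformlyOn (fun (s : Finset ℤ) w => ∑ n ∈ s, c n * (g n w * w ^ p))
      (fun w : ℂ => if w = 0 then 0 else φ (w⁻¹).re) Filter.atTop (spectrum ℂ R) := by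
    have h1 := tendstoUniformlyOn_tsum (f := fun n w => c n * (g n w * w ^ p)) hsum
      (s := spectrum ℂ R) (fun n w hw => by
        have h1 := norm_one_sub_of_mem_spectrum hU hw
        rw [hgz n w hw, norm_mul, norm_mul, norm_zpow, h1, one_zpow, one_mul, norm_pow]
        exact mul_le_of_le_one_right (norm_nonneg _)
          (pow_le_one₀ (norm_nonneg _) (norm_le_one_of_norm_one_sub h1)))
    refine h1.congr_right fun w hw => ?_
    have h2 := hasSum_cayley φ p (norm_one_sub_of_mem_spectrum hU hw)
    simp only [← hgz _ w hw] at h2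
    exact h2.tsum_eq
  have hlim := tendsto_cfc_fun hunif (Filter.Eventually.of_forall fun s => by
    have := hgc
    exact Continuous.continuousOn (by fun_prop))
  refine hlim.congr fun s => ?_
  have e : (fun w => ∑ n ∈ s, c n * (g n w * w ^ p)) = ∑ n ∈ s, fun w => c n * (g n w * w ^ p) := by
    ext w; rw [Finset.sum_apply]
  rw [e, cfc_sum (fun n w => c n * (g n w * w ^ p)) R s (fun n _ => by
    have := hgc n
    exact Continuous.continuousOn (by fun_prop))]
  refine Finset.sum_congr rfl fun n _ => ?_
  rw [cfc_const_mul (c n) (fun w => g n w * w ^ p) R (by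
    have := hgc n
    exact Continuous.continuousOn (by fun_prop)), hgR]

end series

section apply

variable {a : Fin d → Space d → ℝ} {v : Space d → ℝ}

theorem cayleyTerm_toL2 (h : Admissible (cxPot a) (cxFun v)) (n : ℤ) (u : SpaceS d) :
    cayleyTerm (resCLM (cxPot a) (cxFun v) Complex.I) (resCLM (cxPot a) (cxFun v) (-Complex.I)) n
        (toL2 u)
      = toL2 (cayleyTerm (resOp (cxPot a) (cxFun v) Complex.I)
        (resOp (cxPot a) (cxFun v) (-Complex.I)) n u) := by
  have key : ∀ (S : L2 d →L[ℂ] L2 d) (T : Op d), (∀ u, S (toL2 u) = toL2 (T u)) →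
      ∀ (n : ℕ) (u : SpaceS d), (S ^ n) (toL2 u) = toL2 ((T ^ n) u) := by
    intro S T hST n
    induction n with
    | zero => intro u; simp
    | succ n ih =>
      intro u
      rw [pow_succ, pow_succ, mul_apply_eq_comp, Module.End.mul_apply, hST, ih]
  have hp := resCLM_toL2 (σ := Complex.I) h Complex.I_re (by simp)
  have hm := resCLM_toL2 (σ := -Complex.I) h (by simp) (by simp)
  cases n with
  | ofNat n =>
    refine key _ _ (fun u => ?_) n u
    rw [_root_.sub_apply, _root_.smul_apply, hp, LinearMap.sub_apply, LinearMap.smul_apply, map_sub,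
      map_smul]
    rfl
  | negSucc n =>
    refine key _ _ (fun u => ?_) (n + 1) u
    rw [_root_.add_apply, _root_.smul_apply, hm, LinearMap.add_apply, LinearMap.smul_apply, map_add,
      map_smul]
    rfl

theorem hasSum_functionOf_schrodingerOp (h : Admissible (cxPot a) (cxFun v)) (φ : 𝓢(ℝ, ℂ)) (p : ℕ)
    (u : SpaceS d) :
    HasSum (fun n : ℤ => angularCoeff (twist p φ) n
        • toL2 (cayleyTerm (resOp (cxPot a) (cxFun v) Complex.I)
          (resOp (cxPot a) (cxFun v) (-Complex.I)) n (((resOp (cxPot a) (cxFun v) Complex.I) ^ p) u)))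
      (functionOf φ (schrodingerOp a v) (toL2 u)) := by
  have hI' : |(Complex.I).im| = 1 := by simp
  have hn := isStarNormal_resCLM h Complex.I_re hI'
  have hstar : star (resCLM (cxPot a) (cxFun v) Complex.I)
      = resCLM (cxPot a) (cxFun v) (-Complex.I) := by
    rw [ContinuousLinearMap.star_eq_adjoint, adjoint_resCLM h Complex.I_re hI']
  have hU : resCLM (cxPot a) (cxFun v) Complex.I - star (resCLM (cxPot a) (cxFun v) Complex.I)
      = (-2 * Complex.I) • (resCLM (cxPot a) (cxFun v) Complex.I
        * star (resCLM (cxPot a) (cxFun v) Complex.I)) := by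
    rw [hstar, resCLM_sub_resCLM h Complex.I_re hI' (by simp) (by simp)]
    congr 1; ring
  have h1 := hasSum_functionOf hU φ p
  rw [functionOf, resolvent_schrodingerOp h]
  refine ((ContinuousLinearMap.apply ℂ (L2 d) (toL2 u)).hasSum h1).congr_fun fun n => ?_
  simp only [ContinuousLinearMap.apply_apply]
  rw [_root_.smul_apply, mul_apply_eq_comp, hstar]
  congr 1
  rw [← cayleyTerm_toL2 h]
  congr 1
  generalize p = q
  induction q with
  | zero => simp
  | succ q ih =>
    rw [pow_succ', pow_succ', Module.End.mul_apply, mul_apply_eq_comp, ← ih,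
      resCLM_toL2 h Complex.I_re hI']

end apply

end

end MagneticSchrodinger

namespace MagneticSchrodinger

noncomputable section

variable {d : ℕ}

/-! ### The algebra generated by resolvents and covariant derivatives -/

section ad

variable {𝔸 : Type*} [Ring 𝔸]

/-- The commutator `[y, T]`. -/
def ad (y T : 𝔸) : 𝔸 := y * T - T * y

theorem ad_mul (y S T : 𝔸) : ad y (S * T) = ad y S * T + S * ad y T := by
  simp only [ad]; noncomm_ring

theorem ad_add (y S T : 𝔸) : ad y (S + T) = ad y S + ad y T := by
  simp only [ad]; noncomm_ring

theorem ad_sum {κ : Type*} (s : Finset κ) (y : 𝔸) (T : κ → 𝔸) :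
    ad y (∑ j ∈ s, T j) = ∑ j ∈ s, ad y (T j) := by
  simp only [ad, Finset.mul_sum, Finset.sum_mul, Finset.sum_sub_distrib]

theorem ad_neg (y T : 𝔸) : ad y (-T) = -ad y T := by
  simp only [ad]; noncomm_ring

theorem ad_swap (y T : 𝔸) : ad T y = -ad y T := by
  simp only [ad]; noncomm_ring

/-- The commutator with the inverse of `L`. -/
theorem ad_inverse {L r y : 𝔸} (h1 : L * r = 1) (h2 : r * L = 1) : ad y r = -(r * ad y L * r) := by
  have : r * ad y L * r = r * y * (L * r) - (r * L) * y * r := by simp only [ad]; noncomm_ring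
  rw [this, h1, h2, ad]; noncomm_ring

variable [Algebra ℂ 𝔸]

theorem ad_smul (y : 𝔸) (c : ℂ) (T : 𝔸) : ad y (c • T) = c • ad y T := by
  simp only [ad, mul_smul_comm, smul_mul_assoc, smul_sub]

theorem ad_algebraMap (y : 𝔸) (c : ℂ) : ad y (algebraMap ℂ 𝔸 c) = 0 := by
  rw [ad, Algebra.commutes, sub_self]

theorem ad_mem_adjoin {s : Set 𝔸} {y : 𝔸} (h : ∀ T ∈ s, ad y T ∈ Algebra.adjoin ℂ s) {T : 𝔸}
    (hT : T ∈ Algebra.adjoin ℂ s) : ad y T ∈ Algebra.adjoin ℂ s := by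
  induction hT using Algebra.adjoin_induction with
  | mem T hT => exact h T hT
  | algebraMap c => rw [ad_algebraMap]; exact Subalgebra.zero_mem _
  | add S T hS hT ihS ihT => rw [ad_add]; exact Subalgebra.add_mem _ ihS ihT
  | mul S T hS hT ihS ihT =>
    rw [ad_mul]
    exact Subalgebra.add_mem _ (Subalgebra.mul_mem _ ihS hT) (Subalgebra.mul_mem _ hS ihT)

end ad

/-- Covariant derivatives `n`, positions `z`, bounded functions `fn`, the resolvents
`r b = (∑ n_j² + v + σ b)⁻¹`, and the generating functions `g b` of the powers of the Cayley
transforms `1 - 2 σ b r b` in the central variable `x`. -/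
structure MagneticAlgebra (𝔸 : Type*) [Ring 𝔸] [Algebra ℂ 𝔸] (κ : Type*) [Fintype κ] where
  fn : Set 𝔸
  n : κ → 𝔸
  z : κ → 𝔸
  v : 𝔸
  σ : Bool → ℂ
  r : Bool → 𝔸
  x : 𝔸
  g : Bool → 𝔸
  v_mem : v ∈ fn
  ad_n_n : ∀ i j, ∃ c : ℂ, ∃ f ∈ fn, ad (n i) (n j) = c • f
  ad_n_fn : ∀ j, ∀ f ∈ fn, ∃ c : ℂ, ∃ f' ∈ fn, ad (n j) f = c • f'
  ad_n_z : ∀ i j, ∃ c : ℂ, ad (n i) (z j) = algebraMap ℂ 𝔸 c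
  ad_z_fn : ∀ j, ∀ f ∈ fn, ad (z j) f = 0
  ham_mul_r : ∀ b, (∑ j, n j * n j + v + algebraMap ℂ 𝔸 (σ b)) * r b = 1
  r_mul_ham : ∀ b, r b * (∑ j, n j * n j + v + algebraMap ℂ 𝔸 (σ b)) = 1
  x_comm : ∀ y, y * x = x * y
  cayley_mul_g : ∀ b, (1 - x * (1 - (2 * σ b) • r b)) * g b = 1
  g_mul_cayley : ∀ b, g b * (1 - x * (1 - (2 * σ b) • r b)) = 1

namespace MagneticAlgebra

variable {𝔸 : Type*} [Ring 𝔸] [Algebra ℂ 𝔸] {κ : Type*} [Fintype κ] (Q : MagneticAlgebra 𝔸 κ)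

/-- The generators of the algebra of bounded operators. -/
inductive Gen : 𝔸 → Prop
  | fn (f : 𝔸) : f ∈ Q.fn → Gen f
  | r (b : Bool) : Gen (Q.r b)
  | nr (i : κ) (b : Bool) : Gen (Q.n i * Q.r b)
  | rn (b : Bool) (j : κ) : Gen (Q.r b * Q.n j)
  | nrn (i : κ) (b : Bool) (j : κ) : Gen (Q.n i * Q.r b * Q.n j)
  | g (b : Bool) : Gen (Q.g b)
  | x : Gen Q.x

/-- The algebra of bounded operators generated by functions and resolvents. -/
def C : Subalgebra ℂ 𝔸 := Algebra.adjoin ℂ {T | Q.Gen T}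

variable {Q}

theorem gen_mem {T : 𝔸} (h : Q.Gen T) : T ∈ Q.C := Algebra.subset_adjoin h

theorem fn_mem {f : 𝔸} (h : f ∈ Q.fn) : f ∈ Q.C := gen_mem (Gen.fn f h)

theorem r_mem (b : Bool) : Q.r b ∈ Q.C := gen_mem (Gen.r b)

theorem nr_mem (i : κ) (b : Bool) : Q.n i * Q.r b ∈ Q.C := gen_mem (Gen.nr i b)

theorem rn_mem (b : Bool) (j : κ) : Q.r b * Q.n j ∈ Q.C := gen_mem (Gen.rn b j)

theorem nrn_mem (i : κ) (b : Bool) (j : κ) : Q.n i * Q.r b * Q.n j ∈ Q.C := gen_mem (Gen.nrn i b j)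

/-- The commutators of `y` with functions, covariant derivatives and the central variable. -/
structure Good (Q : MagneticAlgebra 𝔸 κ) (y : 𝔸) : Prop where
  fn : ∀ f ∈ Q.fn, ad y f ∈ Q.C
  n : ∀ j, ad y (Q.n j) ∈ Q.C
  nn : ∀ i j, ad (Q.n i) (ad y (Q.n j)) ∈ Q.C

/-- One covariant derivative survives and is placed on the left. Between two resolvents it joins the
left one as `r n`, a generator of `C`. -/
theorem ad_ham (y : 𝔸) (b : Bool) :
    ad y (∑ j, Q.n j * Q.n j + Q.v + algebraMap ℂ 𝔸 (Q.σ b))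
      = ∑ j, ((2 : ℂ) • (Q.n j * ad y (Q.n j)) - ad (Q.n j) (ad y (Q.n j))) + ad y Q.v := by
  rw [ad_add, ad_add, ad_algebraMap, add_zero, ad_sum]
  congr 1
  refine Finset.sum_congr rfl fun j _ => ?_
  rw [ad_mul, two_smul, ad, ad]
  noncomm_ring

/-- The commutator of `y` with a resolvent. -/
theorem Good.exists_ad_r {y : 𝔸} (hy : Q.Good y) (b : Bool) : ∃ (f : κ → 𝔸) (f₀ : 𝔸),
    (∀ j, f j ∈ Q.C) ∧ f₀ ∈ Q.C ∧ ad y (Q.r b) = (∑ j, Q.r b * Q.n j * f j + Q.r b * f₀) * Q.r b := by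
  refine ⟨fun j => -((2 : ℂ) • ad y (Q.n j)), ∑ j, ad (Q.n j) (ad y (Q.n j)) - ad y Q.v,
    fun j => Q.C.neg_mem (Q.C.smul_mem (hy.n j) _), Q.C.sub_mem (Q.C.sum_mem fun j _ => hy.nn j j)
      (hy.fn _ Q.v_mem), ?_⟩
  rw [ad_inverse (Q.ham_mul_r b) (Q.r_mul_ham b), ad_ham, ← neg_mul]
  congr 1
  rw [mul_add, mul_sub, Finset.mul_sum, Finset.mul_sum, ← sub_eq_zero]
  simp only [mul_sub, mul_smul_comm, mul_assoc, Finset.sum_sub_distrib, mul_neg,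
    Finset.sum_neg_distrib]
  abel

/-- A commutator is a derivation, so generators suffice. The commutator with `r` has the form `(∑ r
n_j f_j + r f₀) r`, with no covariant derivative left outside. One further `n` on either side is
therefore absorbed by `n r n` and `r n`. For `g`, the inverse of `1 - x(1 - 2σr)`, the commutator is
a multiple of `g x [y, r] g`. -/
theorem Good.ad_mem {y : 𝔸} (hy : Q.Good y) {T : 𝔸} (hT : T ∈ Q.C) : ad y T ∈ Q.C := by
  refine ad_mem_adjoin (fun T hT => ?_) hT
  have hr : ∀ b, ∃ E ∈ Q.C, (∀ i, Q.n i * E ∈ Q.C) ∧ (∀ j, E * Q.n j ∈ Q.C) ∧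
      (∀ i j, Q.n i * E * Q.n j ∈ Q.C) ∧ ad y (Q.r b) = E := fun b => by
    obtain ⟨f, f₀, hf, hf₀, e⟩ := hy.exists_ad_r b
    have h1 : ∑ j, Q.r b * Q.n j * f j + Q.r b * f₀ ∈ Q.C :=
      Q.C.add_mem (Q.C.sum_mem fun j _ => Q.C.mul_mem (rn_mem b j) (hf j))
        (Q.C.mul_mem (r_mem b) hf₀)
    have h2 : ∀ i, Q.n i * (∑ j, Q.r b * Q.n j * f j + Q.r b * f₀) ∈ Q.C := fun i => by
      rw [mul_add, Finset.mul_sum]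
      refine Q.C.add_mem (Q.C.sum_mem fun j _ => ?_) ?_
      · rw [← mul_assoc, ← mul_assoc]
        exact Q.C.mul_mem (nrn_mem i b j) (hf j)
      · rw [← mul_assoc]
        exact Q.C.mul_mem (nr_mem i b) hf₀
    refine ⟨_, ?_, fun i => ?_, fun j => ?_, fun i j => ?_, rfl⟩ <;> rw [e]
    · exact Q.C.mul_mem h1 (r_mem b)
    · rw [← mul_assoc]; exact Q.C.mul_mem (h2 i) (r_mem b)
    · rw [mul_assoc]; exact Q.C.mul_mem h1 (rn_mem b j)
    · rw [← mul_assoc, mul_assoc]; exact Q.C.mul_mem (h2 i) (rn_mem b j)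
  have hnr : ∀ i b, ad y (Q.n i * Q.r b) ∈ Q.C := fun i b => by
    obtain ⟨E, hE, h1, h2, h3, e⟩ := hr b
    rw [ad_mul, e]
    exact Q.C.add_mem (Q.C.mul_mem (hy.n i) (r_mem b)) (h1 i)
  have hx : ad y Q.x = 0 := by rw [ad, Q.x_comm, sub_self]
  rcases hT with f | b | ⟨i, b⟩ | ⟨b, j⟩ | ⟨i, b, j⟩ | b | _
  case fn h => exact hy.fn _ h
  · obtain ⟨E, hE, -, -, -, e⟩ := hr b
    rwa [e]
  · exact hnr i b
  · obtain ⟨E, hE, h1, h2, h3, e⟩ := hr b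
    rw [ad_mul, e]
    exact Q.C.add_mem (h2 j) (Q.C.mul_mem (r_mem b) (hy.n j))
  · obtain ⟨E, hE, h1, h2, h3, e⟩ := hr b
    rw [ad_mul, ad_mul, e, add_mul]
    refine Q.C.add_mem (Q.C.add_mem ?_ (h3 i j)) (Q.C.mul_mem (nr_mem i b) (hy.n j))
    rw [mul_assoc]
    exact Q.C.mul_mem (hy.n i) (rn_mem b j)
  · obtain ⟨E, hE, h1, h2, h3, e⟩ := hr b
    have h4 : ad y (1 - Q.x * (1 - (2 * Q.σ b) • Q.r b)) = (2 * Q.σ b) • (Q.x * E) := by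
      rw [sub_eq_add_neg, ad_add, ad_neg, ad_mul, hx, zero_mul, zero_add, sub_eq_add_neg, ad_add,
        ad_neg, ad_smul, e, ← map_one (algebraMap ℂ 𝔸), ad_algebraMap, zero_add, zero_add,
        mul_neg, neg_neg, mul_smul_comm]
    rw [ad_inverse (Q.cayley_mul_g b) (Q.g_mul_cayley b), h4]
    exact Q.C.neg_mem (Q.C.mul_mem (Q.C.mul_mem (gen_mem (Gen.g b)) (Q.C.smul_mem
      (Q.C.mul_mem (gen_mem Gen.x) hE) _)) (gen_mem (Gen.g b)))
  · rw [hx]; exact Q.C.zero_mem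

theorem good_z (j : κ) : Q.Good (Q.z j) where
  fn f hf := by rw [Q.ad_z_fn j f hf]; exact Q.C.zero_mem
  n i := by
    obtain ⟨c, hc⟩ := Q.ad_n_z i j
    rw [ad_swap, hc]; exact Q.C.neg_mem (Q.C.algebraMap_mem c)
  nn k i := by
    obtain ⟨c, hc⟩ := Q.ad_n_z i j
    rw [ad_swap (Q.n i), hc, ad_neg, ad_algebraMap, neg_zero]; exact Q.C.zero_mem

theorem good_n (j : κ) : Q.Good (Q.n j) where
  fn f hf := by
    obtain ⟨c, f', hf', e⟩ := Q.ad_n_fn j f hf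
    rw [e]; exact Q.C.smul_mem (fn_mem hf') c
  n i := by
    obtain ⟨c, f', hf', e⟩ := Q.ad_n_n j i
    rw [e]; exact Q.C.smul_mem (fn_mem hf') c
  nn k i := by
    obtain ⟨c, f, hf, e⟩ := Q.ad_n_n j i
    obtain ⟨c', f', hf', e'⟩ := Q.ad_n_fn k f hf
    rw [e, ad_smul, e']; exact Q.C.smul_mem (Q.C.smul_mem (fn_mem hf') c') c

/-- Operators of the form `S r^p` with a bounded operator `S`. -/
def Cp (Q : MagneticAlgebra 𝔸 κ) (p : ℕ) : Set 𝔸 := {T | ∃ S ∈ Q.C, T = S * Q.r true ^ p}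

theorem mem_Cp_zero {T : 𝔸} : T ∈ Q.Cp 0 ↔ T ∈ Q.C := by simp [Cp]

theorem Cp_zero_mem (p : ℕ) : (0 : 𝔸) ∈ Q.Cp p := ⟨0, Q.C.zero_mem, by simp⟩

theorem Cp_add {p : ℕ} {S T : 𝔸} (hS : S ∈ Q.Cp p) (hT : T ∈ Q.Cp p) : S + T ∈ Q.Cp p := by
  obtain ⟨S, hS, rfl⟩ := hS
  obtain ⟨T, hT, rfl⟩ := hT
  exact ⟨S + T, Q.C.add_mem hS hT, (add_mul _ _ _).symm⟩

theorem Cp_smul {p : ℕ} {T : 𝔸} (c : ℂ) (hT : T ∈ Q.Cp p) : c • T ∈ Q.Cp p := by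
  obtain ⟨T, hT, rfl⟩ := hT
  exact ⟨c • T, Q.C.smul_mem hT c, (smul_mul_assoc _ _ _).symm⟩

/-- Here `r S = S r - [S, r]`, and the commutator ends in a factor `r`. Its remaining factors
involve `[n, S]` and `[n, [n, S]]`, which lie in `C` by `Good.ad_mem`. Powers of the resolvent can
thus be collected on the right. -/
theorem exists_r_mul {S : 𝔸} (hS : S ∈ Q.C) (b : Bool) : ∃ S' ∈ Q.C, Q.r b * S = S' * Q.r b := by
  refine ⟨S + (∑ j, ((2 : ℂ) • (Q.r b * Q.n j * ad S (Q.n j))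
    - Q.r b * ad (Q.n j) (ad S (Q.n j))) + Q.r b * ad S Q.v), ?_, ?_⟩
  · have h1 : ∀ j, ad S (Q.n j) ∈ Q.C := fun j => by
      rw [ad_swap]; exact Q.C.neg_mem ((good_n j).ad_mem hS)
    refine Q.C.add_mem hS (Q.C.add_mem (Q.C.sum_mem fun j _ => Q.C.sub_mem (Q.C.smul_mem
      (Q.C.mul_mem (rn_mem b j) (h1 j)) _) (Q.C.mul_mem (r_mem b) ((good_n j).ad_mem (h1 j)))) ?_)
    exact Q.C.mul_mem (r_mem b) (Q.C.sub_mem (Q.C.mul_mem hS (fn_mem Q.v_mem))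
      (Q.C.mul_mem (fn_mem Q.v_mem) hS))
  · have h := ad_inverse (y := S) (Q.ham_mul_r b) (Q.r_mul_ham b)
    rw [ad_ham] at h
    have h2 : Q.r b * S = S * Q.r b - ad S (Q.r b) := by rw [ad]; noncomm_ring
    rw [h2, h, sub_neg_eq_add, add_mul]
    congr 2
    rw [mul_add, Finset.mul_sum]
    congr 1
    refine Finset.sum_congr rfl fun j _ => ?_
    rw [mul_sub, mul_smul_comm, mul_assoc]

theorem exists_r_pow_mul (p : ℕ) {S : 𝔸} (hS : S ∈ Q.C) (b : Bool) :
    ∃ S' ∈ Q.C, Q.r b ^ p * S = S' * Q.r b ^ p := by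
  induction p with
  | zero => exact ⟨S, hS, by simp⟩
  | succ p ih =>
    obtain ⟨S', hS', e⟩ := ih
    obtain ⟨S'', hS'', e'⟩ := exists_r_mul hS' b
    refine ⟨S'', hS'', ?_⟩
    rw [pow_succ', mul_assoc, e, ← mul_assoc, e', mul_assoc]

theorem Cp_mul {p q : ℕ} {S T : 𝔸} (hS : S ∈ Q.Cp p) (hT : T ∈ Q.Cp q) : S * T ∈ Q.Cp (p + q) := by
  obtain ⟨S, hS, rfl⟩ := hS
  obtain ⟨T, hT, rfl⟩ := hT
  obtain ⟨T', hT', e⟩ := exists_r_pow_mul p hT true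
  refine ⟨S * T', Q.C.mul_mem hS hT', ?_⟩
  rw [mul_assoc, ← mul_assoc _ T, e, pow_add]
  simp only [mul_assoc]

theorem r_mem_Cp : Q.r true ∈ Q.Cp 1 := ⟨1, Q.C.one_mem, by simp⟩

theorem r_pow_mem_Cp (p : ℕ) : Q.r true ^ p ∈ Q.Cp p := ⟨1, Q.C.one_mem, by simp⟩

theorem Good.ad_mem_Cp {y : 𝔸} (hy : Q.Good y) {p : ℕ} {T : 𝔸} (hT : T ∈ Q.Cp p) :
    ad y T ∈ Q.Cp p := by
  have h1 : ad y (Q.r true) ∈ Q.Cp 1 := by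
    obtain ⟨f, f₀, hf, hf₀, e⟩ := hy.exists_ad_r true
    exact ⟨_, Q.C.add_mem (Q.C.sum_mem fun j _ => Q.C.mul_mem (rn_mem true j) (hf j))
      (Q.C.mul_mem (r_mem true) hf₀), by rw [pow_one]; exact e⟩
  have h2 : ∀ p : ℕ, ad y (Q.r true ^ p) ∈ Q.Cp p := by
    intro p
    induction p with
    | zero =>
      rw [pow_zero, ← map_one (algebraMap ℂ 𝔸), ad_algebraMap]; exact Cp_zero_mem 0
    | succ p ih =>
      rw [pow_succ, ad_mul]
      exact Cp_add (Cp_mul ih r_mem_Cp) (Cp_mul (r_pow_mem_Cp p) h1)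
  obtain ⟨S, hS, rfl⟩ := hT
  rw [ad_mul]
  refine Cp_add ⟨_, hy.ad_mem hS, rfl⟩ ?_
  have := Cp_mul (mem_Cp_zero.2 hS) (h2 p)
  rwa [zero_add] at this

/-- A covariant derivative costs one resolvent. -/
theorem n_mul_mem_Cp {p : ℕ} {T : 𝔸} (hT : T ∈ Q.Cp (p + 1)) (j : κ) : Q.n j * T ∈ Q.Cp p := by
  obtain ⟨S, hS, rfl⟩ := hT
  refine ⟨S * (Q.n j * Q.r true) + ad (Q.n j) S * Q.r true, Q.C.add_mem
    (Q.C.mul_mem hS (nr_mem j true)) (Q.C.mul_mem ((good_n j).ad_mem hS) (r_mem true)), ?_⟩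
  rw [pow_succ', ad]
  noncomm_ring

/-! ### Polynomials in the positions -/

/-- Polynomials of degree at most `a` in the positions with coefficients in `P`. -/
def Wt (Q : MagneticAlgebra 𝔸 κ) (P : Set 𝔸) : ℕ → Set 𝔸
  | 0 => P
  | a + 1 => {T | ∃ T₀ ∈ Wt Q P a, ∃ T' : κ → 𝔸, (∀ j, T' j ∈ Wt Q P a) ∧
      T = T₀ + ∑ j, T' j * Q.z j}

variable {P P' P'' : Set 𝔸}

/-- Closure properties of polynomials in the positions reduce to an additive map being controlled on
the coefficients and on one product `T z_j`. -/
theorem Wt_map {F : 𝔸 → 𝔸} (hadd : ∀ S T, F (S + T) = F S + F T)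
    (hz : ∀ a, ∀ T ∈ Q.Wt P a, ∀ j, (∀ T ∈ Q.Wt P a, F T ∈ Q.Wt P' a) →
      F (T * Q.z j) ∈ Q.Wt P' (a + 1))
    (hadd' : ∀ a, ∀ S ∈ Q.Wt P' a, ∀ T ∈ Q.Wt P' a, S + T ∈ Q.Wt P' a)
    (hmono : ∀ a, ∀ T ∈ Q.Wt P' a, T ∈ Q.Wt P' (a + 1))
    (h0 : ∀ T ∈ P, F T ∈ P') (a : ℕ) : ∀ T ∈ Q.Wt P a, F T ∈ Q.Wt P' a := by
  induction a with
  | zero => exact h0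
  | succ a ih =>
    rintro T ⟨T₀, hT₀, T', hT', rfl⟩
    have hF0 : F 0 = 0 := by simpa using hadd 0 0
    have hsum : ∀ s : Finset κ, F (∑ j ∈ s, T' j * Q.z j) = ∑ j ∈ s, F (T' j * Q.z j) := by
      classical
      intro s
      induction s using Finset.induction_on with
      | empty => simpa using hF0
      | insert j s hj ihs => rw [Finset.sum_insert hj, Finset.sum_insert hj, hadd, ihs]
    have hs : ∀ s : Finset κ, F T₀ + ∑ j ∈ s, F (T' j * Q.z j) ∈ Q.Wt P' (a + 1) := by
      classical
      intro s
      induction s using Finset.induction_on with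
      | empty => simpa using hmono a _ (ih _ hT₀)
      | insert j s hj ihs =>
        rw [Finset.sum_insert hj, add_left_comm]
        exact hadd' _ _ (hz a _ (hT' j) j ih) _ ihs
    rw [hadd, hsum]
    exact hs _

/-- `P` is closed under linear combinations. -/
structure IsLin (P : Set 𝔸) : Prop where
  zero : (0 : 𝔸) ∈ P
  add : ∀ S ∈ P, ∀ T ∈ P, S + T ∈ P
  smul : ∀ (c : ℂ), ∀ T ∈ P, c • T ∈ P

theorem isLin_Cp (p : ℕ) : IsLin (Q.Cp p) :=
  ⟨Cp_zero_mem p, fun _ hS _ hT => Cp_add hS hT, fun c _ hT => Cp_smul c hT⟩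

theorem isLin_Wt (hP : IsLin P) (a : ℕ) : IsLin (Q.Wt P a) := by
  induction a with
  | zero => exact hP
  | succ a ih =>
    refine ⟨⟨0, ih.zero, fun _ => 0, fun _ => ih.zero, by simp⟩, ?_, ?_⟩
    · rintro _ ⟨S₀, hS₀, S', hS', rfl⟩ _ ⟨T₀, hT₀, T', hT', rfl⟩
      refine ⟨S₀ + T₀, ih.add _ hS₀ _ hT₀, fun j => S' j + T' j,
        fun j => ih.add _ (hS' j) _ (hT' j), ?_⟩
      simp only [add_mul, Finset.sum_add_distrib]
      abel
    · rintro c _ ⟨T₀, hT₀, T', hT', rfl⟩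
      refine ⟨c • T₀, ih.smul c _ hT₀, fun j => c • T' j, fun j => ih.smul c _ (hT' j), ?_⟩
      simp only [smul_add, Finset.smul_sum, smul_mul_assoc]

theorem IsLin.sum (hP : IsLin P) {α : Type*} (s : Finset α) {T : α → 𝔸} (hT : ∀ k ∈ s, T k ∈ P) :
    ∑ k ∈ s, T k ∈ P := by
  classical
  induction s using Finset.induction_on with
  | empty => simpa using hP.zero
  | insert k s hk ih =>
    rw [Finset.sum_insert hk]
    exact hP.add _ (hT k (by simp)) _ (ih fun l hl => hT l (by simp [hl]))

theorem IsLin.neg (hP : IsLin P) {T : 𝔸} (hT : T ∈ P) : -T ∈ P := by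
  simpa using hP.smul (-1) T hT

theorem Wt_succ (hP : IsLin P) {a : ℕ} {T : 𝔸} (hT : T ∈ Q.Wt P a) : T ∈ Q.Wt P (a + 1) :=
  ⟨T, hT, fun _ => 0, fun _ => (isLin_Wt hP a).zero, by simp⟩

theorem mul_z_mem_Wt (hP : IsLin P) {a : ℕ} {T : 𝔸} (hT : T ∈ Q.Wt P a) (j : κ) :
    T * Q.z j ∈ Q.Wt P (a + 1) := by
  classical
  refine ⟨0, (isLin_Wt hP a).zero, fun k => if k = j then T else 0, fun k => ?_, by simp⟩
  by_cases hk : k = j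
  · simpa [hk] using hT
  · simpa [hk] using (isLin_Wt hP a).zero

theorem Wt_map' (hP' : IsLin P') {F : 𝔸 → 𝔸} (hadd : ∀ S T, F (S + T) = F S + F T)
    (hz : ∀ a, ∀ T ∈ Q.Wt P a, ∀ j, (∀ T ∈ Q.Wt P a, F T ∈ Q.Wt P' a) →
      F (T * Q.z j) ∈ Q.Wt P' (a + 1))
    (h0 : ∀ T ∈ P, F T ∈ P') {a : ℕ} {T : 𝔸} (hT : T ∈ Q.Wt P a) : F T ∈ Q.Wt P' a :=
  Wt_map hadd hz (fun a => (isLin_Wt hP' a).add) (fun _ _ hT => Wt_succ hP' hT) h0 a T hT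

theorem mul_mem_Wt_left (hP' : IsLin P') {S : 𝔸} (h : ∀ T ∈ P, S * T ∈ P') {a : ℕ} {T : 𝔸}
    (hT : T ∈ Q.Wt P a) : S * T ∈ Q.Wt P' a :=
  Wt_map' hP' (F := fun T => S * T) (fun _ _ => mul_add _ _ _) (fun a T hT j ih => by
    rw [← mul_assoc]; exact mul_z_mem_Wt hP' (ih T hT) j) h hT

theorem ad_n_mem_Wt (hP : IsLin P) (k : κ) (h : ∀ T ∈ P, ad (Q.n k) T ∈ P) {a : ℕ} {T : 𝔸}
    (hT : T ∈ Q.Wt P a) : ad (Q.n k) T ∈ Q.Wt P a :=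
  Wt_map' hP (F := ad (Q.n k)) (ad_add _) (fun a T hT j ih => by
    obtain ⟨c, hc⟩ := Q.ad_n_z k j
    rw [ad_mul, hc, ← Algebra.commutes, ← Algebra.smul_def]
    exact (isLin_Wt hP (a + 1)).add _ (mul_z_mem_Wt hP (ih T hT) j) _
      (Wt_succ hP ((isLin_Wt hP a).smul c _ hT))) h hT

/-- The positions stand on the right of their coefficients and are moved past `T` by `z T = T z +
[z, T]`. The commutator has lower degree and stays in the coefficient set. -/
theorem mul_mem_Wt_right (hP'' : IsLin P'') (h : ∀ S ∈ P, ∀ T ∈ P', S * T ∈ P'')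
    (hz : ∀ j, ∀ T ∈ P', ad (Q.z j) T ∈ P') {a : ℕ} {S : 𝔸} (hS : S ∈ Q.Wt P a) :
    ∀ T ∈ P', S * T ∈ Q.Wt P'' a := by
  induction a generalizing S with
  | zero => exact h S hS
  | succ a ih =>
    intro T hT
    obtain ⟨S₀, hS₀, S', hS', rfl⟩ := hS
    have e : ∀ j, Q.z j * T = T * Q.z j + ad (Q.z j) T := fun j => by rw [ad]; noncomm_ring
    rw [add_mul, Finset.sum_mul]
    refine (isLin_Wt hP'' (a + 1)).add _ (Wt_succ hP'' (ih hS₀ T hT)) _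
      ((isLin_Wt hP'' (a + 1)).sum _ fun j _ => ?_)
    rw [mul_assoc, e, mul_add, ← mul_assoc]
    exact (isLin_Wt hP'' (a + 1)).add _ (mul_z_mem_Wt hP'' (ih (hS' j) T hT) j) _
      (Wt_succ hP'' (ih (hS' j) _ (hz j T hT)))

theorem Wt_Cp_mul {a p q : ℕ} {S T : 𝔸} (hS : S ∈ Q.Wt (Q.Cp p) a) (hT : T ∈ Q.Cp q) :
    S * T ∈ Q.Wt (Q.Cp (p + q)) a :=
  mul_mem_Wt_right (isLin_Cp _) (fun _ hS _ hT => Cp_mul hS hT)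
    (fun j _ hT => (good_z j).ad_mem_Cp hT) hS T hT

theorem Cp_mul_Wt {a p q : ℕ} {S T : 𝔸} (hS : S ∈ Q.Cp p) (hT : T ∈ Q.Wt (Q.Cp q) a) :
    S * T ∈ Q.Wt (Q.Cp (p + q)) a :=
  mul_mem_Wt_left (isLin_Cp _) (fun _ hT => Cp_mul hS hT) hT

end MagneticAlgebra

end

end MagneticSchrodinger

namespace MagneticSchrodinger

noncomputable section

variable {d : ℕ}

/-! ### The potential in the radial gauge -/

/-- Lebesgue measure on the unit interval. -/
def unitMeasure : Measure ℝ := volume.restrict (Ioc (0 : ℝ) 1)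

instance : IsFiniteMeasure unitMeasure := by unfold unitMeasure; infer_instance

theorem unitMeasure_ae : ∀ᵐ τ ∂unitMeasure, τ ∈ Icc (0 : ℝ) 1 :=
  (ae_restrict_mem measurableSet_Ioc).mono fun _ h => Ioc_subset_Icc_self h

theorem dirac_one_ae : ∀ᵐ τ ∂(Measure.dirac (1 : ℝ)), τ ∈ Icc (0 : ℝ) 1 := by
  exact (ae_dirac_iff (p := fun τ : ℝ => τ ∈ Icc (0 : ℝ) 1) measurableSet_Icc).2 (by simp)

theorem rayFun_dirac (G : Space d → ℂ) (q p : ℕ) (i : Space d × ℝ) (Z : Space d) :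
    rayFun (Measure.dirac 1) q p G i Z = (i.2 : ℂ) ^ q * G (i.1 + i.2 • Z) := by
  simp [rayFun, radialAvg]

/-- This is the integral of `d/dτ (τ² G(x₀ + τy))` over the unit interval. -/
theorem radialAvg_euler {G : Space d → ℂ} (hG : IsCbComplex G) (x₀ y : Space d) :
    2 * radialAvg unitMeasure 1 G x₀ y
      + ∑ k, coord k y * radialAvg unitMeasure 2 (partialDeriv k G) x₀ y = G (x₀ + y) := by
  have hd : ∀ τ : ℝ, HasDerivAt (fun τ : ℝ => ((τ ^ 2 : ℝ) : ℂ) * G (x₀ + τ • y))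
      (2 * (((τ ^ 1 : ℝ) : ℂ) * G (x₀ + τ • y))
        + ∑ k, coord k y * (((τ ^ 2 : ℝ) : ℂ) * partialDeriv k G (x₀ + τ • y))) τ := fun τ => by
    have h1 : HasDerivAt (fun τ : ℝ => ((τ ^ 2 : ℝ) : ℂ)) (2 * (τ : ℂ)) τ := by
      have := (hasDerivAt_pow 2 τ).ofReal_comp
      simpa using this
    have h2 : HasDerivAt (fun τ : ℝ => x₀ + τ • y) y τ := by
      simpa using ((hasDerivAt_id τ).smul_const y).const_add x₀
    have h3 := (hG.1.differentiable (by simp) (x₀ + τ • y)).hasFDerivAt.comp_hasDerivAt τ h2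
    refine (h1.mul h3).congr_deriv ?_
    rw [clm_apply_eq_sum (fderiv ℝ G _) y, Finset.mul_sum]
    simp only [Function.comp_apply, partialDeriv, coord, Complex.real_smul]
    congr 1
    · push_cast; ring
    · exact Finset.sum_congr rfl fun k _ => by ring
  have hint : ∀ (p : ℕ) (F : Space d → ℂ), IsCbComplex F →
      Integrable (fun τ : ℝ => ((τ ^ p : ℝ) : ℂ) * F (x₀ + τ • y)) unitMeasure :=
    fun p F hF => radialAvg_integrable unitMeasure_ae hF p x₀ y
  have h1 : Integrable (fun τ : ℝ => 2 * (((τ ^ 1 : ℝ) : ℂ) * G (x₀ + τ • y))) unitMeasure :=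
    (hint 1 G hG).const_mul _
  have h2 : ∀ k : Fin d, Integrable (fun τ : ℝ =>
      coord k y * (((τ ^ 2 : ℝ) : ℂ) * partialDeriv k G (x₀ + τ • y))) unitMeasure :=
    fun k => (hint 2 _ (hG.partialDeriv k)).const_mul _
  have h3 := intervalIntegral.integral_eq_sub_of_hasDerivAt (a := 0) (b := 1) (fun τ _ => hd τ)
    ((intervalIntegrable_iff_integrableOn_Ioc_of_le zero_le_one).2
      (h1.add (integrable_finsetSum _ fun k _ => h2 k)))
  rw [intervalIntegral.integral_of_le zero_le_one] at h3
  have h4 := integral_add h1 (integrable_finsetSum Finset.univ fun k _ => h2 k)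
  rw [integral_finsetSum _ fun k _ => h2 k] at h4
  simp only [integral_const_mul] at h4
  simp only [radialAvg]
  rw [← h4]
  refine h3.trans ?_
  simp

/-- The components of a real closed two-form with bounded derivatives, and a real function with
bounded derivatives. -/
structure FieldData (B : Fin d → Fin d → Space d → ℂ) (V : Space d → ℂ) : Prop where
  cb : ∀ j k, IsCbComplex (B j k)
  real : ∀ j k, IsRealFun (B j k)
  antisymm : ∀ j k x, B j k x = -B k j x
  closed : ∀ i j k x,
    partialDeriv i (B k j) x - partialDeriv j (B k i) x = partialDeriv k (B i j) x
  elec : IsCbComplex V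
  elec_real : IsRealFun V

/-- The rescaled potential in the radial gauge. -/
def rayPot (B : Fin d → Fin d → Space d → ℂ) (i : Space d × ℝ) (j : Fin d) (Z : Space d) : ℂ :=
  ∑ k, rayFun unitMeasure 0 1 (B k j) i Z * coord k Z

/-- The rescaled electric potential. -/
def rayElec (V : Space d → ℂ) (i : Space d × ℝ) (Z : Space d) : ℂ :=
  rayFun (Measure.dirac 1) 0 0 V i Z

namespace FieldData

variable {B : Fin d → Fin d → Space d → ℂ} {V : Space d → ℂ}

theorem rayFun_isCb {μ : Measure ℝ} [IsFiniteMeasure μ] {G : Space d → ℂ}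
    (hμ : ∀ᵐ τ ∂μ, τ ∈ Icc (0 : ℝ) 1) (hG : IsCbComplex G) (q p : ℕ) (i : Space d × ℝ) :
    IsCbComplex (rayFun μ q p G i) :=
  (rayFun_uCb hμ hG q p |i.2|).isCbComplex (i := i) (le_refl |i.2|)

theorem rayFun_isReal {μ : Measure ℝ} {G : Space d → ℂ} (hG : IsRealFun G) (q p : ℕ)
    (i : Space d × ℝ) : IsRealFun (rayFun μ q p G i) := fun Z => by
  simp only [rayFun, radialAvg, map_mul, map_pow, Complex.conj_ofReal]
  rw [← integral_conj]
  simp only [map_mul, Complex.conj_ofReal, hG _]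

theorem partialDeriv_rayPot (h : FieldData B V) (i : Space d × ℝ) (l j : Fin d) (Z : Space d) :
    partialDeriv l (rayPot B i j) Z = rayFun unitMeasure 0 1 (B l j) i Z
      + ∑ k, rayFun unitMeasure 1 2 (partialDeriv l (B k j)) i Z * coord k Z := by
  have hd : ∀ k, DifferentiableAt ℝ (rayFun unitMeasure 0 1 (B k j) i) Z := fun k =>
    (rayFun_isCb unitMeasure_ae (h.cb k j) 0 1 i).1.differentiable (by simp) Z
  have hc : ∀ k : Fin d, DifferentiableAt ℝ (coord k) Z := fun k =>
    (coord_hasTemperateGrowth k).1.differentiable (by simp) Z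
  have e : partialDeriv l (rayPot B i j) Z
      = ∑ k, partialDeriv l (fun Z => rayFun unitMeasure 0 1 (B k j) i Z * coord k Z) Z := by
    simp only [partialDeriv]
    unfold rayPot
    rw [fderiv_fun_sum (A := fun k Z => rayFun unitMeasure 0 1 (B k j) i Z * coord k Z)
      fun k _ => (hd k).mul (hc k)]
    simp
  rw [e]
  have e2 : ∀ k, partialDeriv l (fun Z => rayFun unitMeasure 0 1 (B k j) i Z * coord k Z) Z
      = (if l = k then rayFun unitMeasure 0 1 (B k j) i Z else 0)
        + rayFun unitMeasure 1 2 (partialDeriv l (B k j)) i Z * coord k Z := fun k => by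
    rw [partialDeriv_mul l (hd k) (hc k), partialDeriv_coord,
      partialDeriv_rayFun unitMeasure_ae (h.cb k j)]
    split_ifs <;> simp
  simp only [e2, Finset.sum_add_distrib, Finset.sum_ite_eq, Finset.mem_univ, if_true]

/-- This is the Poincaré lemma in the radial gauge. The terms without derivatives combine by
antisymmetry into `2B_{lj}`, closedness turns `∂_l B_{kj} - ∂_j B_{kl}` into `∂_k B_{lj}`, and
`radialAvg_euler` adds them up. The factor `t` from differentiating the rescaled argument is the one
missing in `tZ_k`. -/
theorem field_rayPot (h : FieldData B V) (i : Space d × ℝ) (l j : Fin d) (Z : Space d) :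
    partialDeriv l (rayPot B i j) Z - partialDeriv j (rayPot B i l) Z
      = rayFun (Measure.dirac 1) 0 0 (B l j) i Z := by
  have h1 := radialAvg_euler (h.cb l j) i.1 (i.2 • Z)
  rw [h.partialDeriv_rayPot, h.partialDeriv_rayPot, rayFun_dirac, pow_zero, one_mul, ← h1,
    add_sub_add_comm, ← Finset.sum_sub_distrib]
  have ha : rayFun unitMeasure 0 1 (B j l) i Z = -rayFun unitMeasure 0 1 (B l j) i Z := by
    simp only [rayFun, radialAvg, h.antisymm j l, mul_neg, integral_neg]
  rw [ha]
  congr 1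
  · simp only [rayFun]; ring
  · refine Finset.sum_congr rfl fun k _ => ?_
    have hint : ∀ a b c, Integrable (fun τ : ℝ => ((τ ^ 2 : ℝ) : ℂ) *
        partialDeriv a (B b c) (i.1 + τ • i.2 • Z)) unitMeasure := fun a b c =>
      radialAvg_integrable unitMeasure_ae ((h.cb b c).partialDeriv a) 2 _ _
    have e : radialAvg unitMeasure 2 (partialDeriv k (B l j)) i.1 (i.2 • Z)
        = radialAvg unitMeasure 2 (partialDeriv l (B k j)) i.1 (i.2 • Z)
          - radialAvg unitMeasure 2 (partialDeriv j (B k l)) i.1 (i.2 • Z) := by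
      simp only [radialAvg]
      rw [← integral_sub (hint _ _ _) (hint _ _ _)]
      congr 1; ext τ
      rw [← h.closed l j k]; ring
    rw [e]
    simp only [rayFun, coord, PiLp.smul_apply, smul_eq_mul, Complex.ofReal_mul]
    ring

theorem admissible (h : FieldData B V) (i : Space d × ℝ) :
    Admissible (rayPot B i) (rayElec V i) where
  linear := ⟨fun k j => rayFun unitMeasure 0 1 (B k j) i,
    fun k j => rayFun_isCb unitMeasure_ae (h.cb k j) 0 1 i, fun _ _ => rfl⟩
  real j Z := by
    simp only [rayPot, map_sum, map_mul]
    exact Finset.sum_congr rfl fun k _ => by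
      rw [rayFun_isReal (h.real k j) 0 1 i Z, coord, Complex.conj_ofReal]
  field k l := by
    simp only [h.field_rayPot]
    exact rayFun_isCb dirac_one_ae (h.cb k l) 0 0 i
  elec := rayFun_isCb dirac_one_ae h.elec 0 0 i
  elec_real := rayFun_isReal h.elec_real 0 0 i

end FieldData

theorem partialDeriv_ofReal {f : Space d → ℝ} {x : Space d} (hf : DifferentiableAt ℝ f x)
    (j : Fin d) : partialDeriv j (fun x => (f x : ℂ)) x = (partialDeriv j f x : ℝ) := by
  have h : HasFDerivAt (fun x => (f x : ℂ)) (Complex.ofRealCLM.comp (fderiv ℝ f x)) x :=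
    Complex.ofRealCLM.hasFDerivAt.comp x hf.hasFDerivAt
  rw [partialDeriv, h.fderiv]
  rfl

theorem contDiff_partialDeriv {f : Space d → ℝ} (hf : ContDiff ℝ ∞ f) (j : Fin d) :
    ContDiff ℝ ∞ (partialDeriv j f) :=
  (hf.fderiv_right (m := ∞) (by simp)).clm_apply contDiff_const

theorem partialDeriv_partialDeriv_comm {f : Space d → ℝ} (hf : ContDiff ℝ ∞ f) (j k : Fin d)
    (x : Space d) : partialDeriv j (partialDeriv k f) x = partialDeriv k (partialDeriv j f) x := by
  have h2 : ContDiff ℝ 2 f := contDiff_infty.1 hf 2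
  have hd : DifferentiableAt ℝ (fderiv ℝ f) x :=
    (h2.fderiv_right (m := 1) (by norm_num)).differentiable (by simp) x
  have key : ∀ k l : Fin d, partialDeriv k (partialDeriv l f) x
      = fderiv ℝ (fderiv ℝ f) x (EuclideanSpace.single k 1) (EuclideanSpace.single l 1) := by
    intro k l
    simp only [partialDeriv]
    rw [show partialDeriv l f = fun y => fderiv ℝ f y (EuclideanSpace.single l 1) from rfl,
      fderiv_clm_apply hd (differentiableAt_const _)]
    simp
  rw [key, key]
  exact (h2.contDiffAt.isSymmSndFDerivAt (by simp)).eq _ _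

/-- The complex-valued components of the magnetic field. -/
def cxField (A : Fin d → Space d → ℝ) (j k : Fin d) (x : Space d) : ℂ := magneticField A j k x

theorem fieldData {A : Fin d → Space d → ℝ} {V : Space d → ℝ} (hA : ∀ j, ContDiff ℝ ∞ (A j))
    (hB : ∀ j k, IsCbInfty (magneticField A j k)) (hV : IsCbInfty V) :
    FieldData (cxField A) (fun x => (V x : ℂ)) where
  cb j k := (hB j k).complex
  real j k x := Complex.conj_ofReal _
  antisymm j k x := by simp [cxField, magneticField]
  closed i j k x := by
    have hd : ∀ j k, DifferentiableAt ℝ (magneticField A j k) x := fun j k =>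
      (hB j k).1.differentiable (by simp) x
    have hp : ∀ j k, DifferentiableAt ℝ (partialDeriv j (A k)) x := fun j k =>
      (contDiff_partialDeriv (hA k) j).differentiable (by simp) x
    have e : ∀ i j k, partialDeriv i (magneticField A j k) x
        = partialDeriv i (partialDeriv j (A k)) x - partialDeriv i (partialDeriv k (A j)) x :=
      fun i j k => by
        have h := (hp j k).hasFDerivAt.sub (hp k j).hasFDerivAt
        rw [partialDeriv, show magneticField A j k
          = partialDeriv j (A k) - partialDeriv k (A j) from rfl, h.fderiv]
        rfl
    unfold cxField
    rw [partialDeriv_ofReal (hd _ _), partialDeriv_ofReal (hd _ _), partialDeriv_ofReal (hd _ _),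
      e, e, e, ← Complex.ofReal_sub, partialDeriv_partialDeriv_comm (hA j) i k,
      partialDeriv_partialDeriv_comm (hA i) j k, partialDeriv_partialDeriv_comm (hA k) j i]
    congr 1
    ring
  elec := hV.complex
  elec_real x := Complex.conj_ofReal _

theorem cxPot_rescaledPotential (A : Fin d → Space d → ℝ) (x₀ : Space d) {t : ℝ} (ht : t ≠ 0) :
    cxPot (rescaledPotential A x₀ t) = rayPot (cxField A) (x₀, t) := by
  ext j Z
  have ht' : (t : ℂ) ≠ 0 := by exact_mod_cast ht
  simp only [cxPot, rescaledPotential, radialPotential, rayPot, rayFun, radialAvg, unitMeasure,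
    cxField, coord]
  push_cast
  rw [Finset.mul_sum]
  refine Finset.sum_congr rfl fun k _ => ?_
  rw [intervalIntegral.integral_of_le zero_le_one, ← integral_complex_ofReal]
  simp only [PiLp.smul_apply, smul_eq_mul]
  push_cast
  rw [pow_zero, one_mul]
  have e : ∀ τ : ℝ, (magneticField A k j (x₀ + τ • t • Z) : ℂ) * (τ : ℂ)
      = (τ : ℂ) ^ 1 * (magneticField A k j (x₀ + τ • t • Z) : ℂ) := fun τ => by ring
  simp only [e]
  field_simp

theorem cxFun_rescaled (V : Space d → ℝ) (x₀ : Space d) (t : ℝ) :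
    cxFun (fun Z => V (x₀ + t • Z)) = rayElec (fun x => (V x : ℂ)) (x₀, t) := by
  ext Z
  simp [cxFun, rayElec, rayFun_dirac]

end

end MagneticSchrodinger

namespace MagneticSchrodinger

noncomputable section

variable {d : ℕ}

/-! ### Strong derivatives with respect to the parameter -/

/-- The operators are bounded in `L²`, locally uniformly in the parameter `t`. -/
def LocBdd (S : Space d × ℝ → Op d) : Prop := ∀ T : ℝ, UBdd {i : Space d × ℝ | |i.2| ≤ T} S

/-- `S'` is the strong derivative of `S` with respect to the parameter `t`. -/
def HasD (S S' : Space d × ℝ → Op d) : Prop :=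
  ∀ x₀ t u, HasDerivAt (fun s => toL2 (S (x₀, s) u)) (toL2 (S' (x₀, t) u)) t

variable {S S' T T' : Space d × ℝ → Op d}

theorem LocBdd.eventually (hS : LocBdd S) (x₀ : Space d) (t : ℝ) :
    ∃ C : ℝ, 0 ≤ C ∧ ∀ᶠ s in nhds t, ∀ u, ‖toL2 (S (x₀, s) u)‖ ≤ C * ‖toL2 u‖ := by
  obtain ⟨C, hC0, hC⟩ := hS (|t| + 1)
  refine ⟨C, hC0, ?_⟩
  have : ∀ᶠ s : ℝ in nhds t, |s| < |t| + 1 :=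
    continuous_abs.continuousAt.eventually_lt continuousAt_const (lt_add_one _)
  filter_upwards [this] with s hs u
  exact hC (x₀, s) hs.le u

theorem LocBdd.tendsto_sub (hS : LocBdd S) {x₀ : Space d} {t : ℝ} {f : ℝ → SpaceS d}
    (hf : ContinuousAt (fun s => toL2 (f s)) t) :
    Filter.Tendsto (fun s => toL2 (S (x₀, s) (f s - f t))) (nhds t) (nhds 0) := by
  obtain ⟨C, hC0, hC⟩ := hS.eventually x₀ t
  refine squeeze_zero_norm' (hC.mono fun s hs => hs (f s - f t)) ?_
  have h1 : Filter.Tendsto (fun s => ‖toL2 (f s) - toL2 (f t)‖) (nhds t) (nhds 0) := by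
    have := (hf.sub (continuousAt_const (y := toL2 (f t)))).norm
    simpa [ContinuousAt] using this
  simpa [map_sub] using h1.const_mul C

/-- Split `f(s) - f(t) = (s - t) f' + o(s - t)`. Local boundedness of `S` controls the remainder,
and the main term needs only continuity of `s ↦ S(s) f'`; differentiability of `S` plays no role. -/
theorem LocBdd.hasDerivAt_sub (hS : LocBdd S) {x₀ : Space d} {t : ℝ} {f : ℝ → SpaceS d}
    {f' : SpaceS d} (hf : HasDerivAt (fun s => toL2 (f s)) (toL2 f') t)
    (hc : ContinuousAt (fun s => toL2 (S (x₀, s) f')) t) :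
    HasDerivAt (fun s => toL2 (S (x₀, s) (f s - f t))) (toL2 (S (x₀, t) f')) t := by
  obtain ⟨C, hC0, hC⟩ := hS.eventually x₀ t
  rw [hasDerivAt_iff_isLittleO] at hf ⊢
  have h1 : (fun s : ℝ => toL2 (S (x₀, s) (f s - f t - ((s - t : ℝ) : ℂ) • f')))
      =o[nhds t] fun s => s - t := by
    refine Asymptotics.IsBigO.trans_isLittleO (Asymptotics.IsBigO.of_bound C ?_) hf
    filter_upwards [hC] with s hs
    refine (hs _).trans_eq ?_
    simp only [map_sub, map_smul]
    rfl
  have h2 : (fun s : ℝ => (s - t) • (toL2 (S (x₀, s) f') - toL2 (S (x₀, t) f')))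
      =o[nhds t] fun s => s - t := by
    have h3 : Filter.Tendsto (fun s => toL2 (S (x₀, s) f') - toL2 (S (x₀, t) f')) (nhds t)
        (nhds 0) := by
      simpa using hc.tendsto.sub_const (toL2 (S (x₀, t) f'))
    have h4 := (Asymptotics.isBigO_refl (fun s : ℝ => s - t) (nhds t)).smul_isLittleO
      ((Asymptotics.isLittleO_one_iff ℝ).2 h3)
    simpa using h4
  refine (h1.add h2).congr_left fun s => ?_
  have e : ∀ w : SpaceS d, toL2 (((s - t : ℝ) : ℂ) • w) = (s - t) • toL2 w := fun w => by
    rw [map_smul]; rfl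
  simp only [sub_self, map_zero, sub_zero]
  rw [map_sub (S (x₀, s)) (f s - f t), map_sub toL2, map_smul, e, smul_sub]
  abel

theorem HasD.continuousAt (h : HasD S S') (x₀ : Space d) (t : ℝ) (u : SpaceS d) :
    ContinuousAt (fun s => toL2 (S (x₀, s) u)) t := (h x₀ t u).continuousAt

theorem HasD.congr_deriv (h : HasD S S') (e : S' = T') : HasD S T' := e ▸ h

theorem HasD.add (hS : HasD S S') (hT : HasD T T') : HasD (S + T) (S' + T') := fun x₀ t u => by
  simpa using (hS x₀ t u).fun_add (hT x₀ t u)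

theorem HasD.sub (hS : HasD S S') (hT : HasD T T') : HasD (S - T) (S' - T') := fun x₀ t u => by
  simpa using (hS x₀ t u).fun_sub (hT x₀ t u)

theorem HasD.smul (c : ℂ) (hS : HasD S S') : HasD (c • S) (c • S') := fun x₀ t u => by
  simpa using (hS x₀ t u).fun_const_smul c

theorem HasD.const (S : Op d) : HasD (fun _ => S) 0 := fun x₀ t u => by
  simpa using hasDerivAt_const t (toL2 (S u))

theorem HasD.sum {κ : Type*} (s : Finset κ) {S S' : κ → Space d × ℝ → Op d}
    (h : ∀ k ∈ s, HasD (S k) (S' k)) : HasD (∑ k ∈ s, S k) (∑ k ∈ s, S' k) := by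
  classical
  induction s using Finset.induction_on with
  | empty => exact HasD.const (0 : Op d)
  | insert k s hk ih =>
    rw [Finset.sum_insert hk, Finset.sum_insert hk]
    exact (h k (by simp)).add (ih fun l hl => h l (by simp [hl]))

theorem HasD.mul_const (hS : HasD S S') (R : Op d) :
    HasD (S * fun _ => R) (S' * fun _ => R) := fun x₀ t u => hS x₀ t (R u)

/-- From `S(s)T(s)u = S(s)T(t)u + S(s)(T(s)u - T(t)u)`. Boundedness is required of the left factor
only, so the right factor may be a covariant derivative. -/
theorem HasD.mul (hb : LocBdd S) (hS : HasD S S') (hT : HasD T T') :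
    HasD (S * T) (S' * T + S * T') := fun x₀ t u => by
  have h1 := hb.hasDerivAt_sub (hT x₀ t u) (hS.continuousAt x₀ t _)
  have h2 := (hS x₀ t (T (x₀, t) u)).fun_add h1
  simpa [map_sub] using h2

/-- The strong derivative of `e r`, where `r` is the inverse of `∑ n_j² + v + c`. -/
theorem hasD_mul_inverse {κ : Type*} [Fintype κ] {n α : κ → Space d × ℝ → Op d}
    {v ν r e e' : Space d × ℝ → Op d} {c : ℂ} (hn : ∀ j, HasD (n j) (-α j)) (hv : HasD v ν)
    (he : HasD e e') (h1 : (∑ j, n j * n j + v + c • 1) * r = 1)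
    (h2 : r * (∑ j, n j * n j + v + c • 1) = 1) (hb : LocBdd (e * r))
    (hbn : ∀ j, LocBdd (e * r * n j)) :
    HasD (e * r) (e' * r + e * r * (∑ j, (n j * α j + α j * n j) - ν) * r) := by
  -- The resolvent identity `r(s) - r(t) = -r(s)(L(s) - L(t)) r(t)`, where `n(s)² - n(t)²` is split
  -- as `n(s)(n(s) - n(t)) + (n(s) - n(t)) n(t)`. The operators at `s` on the left are then `e r n`
  -- and `e r`, which are locally bounded, and the differences act on vectors independent of `s`.
  have key : ∀ x₀ s t u, e (x₀, s) (r (x₀, s) u) = e (x₀, s) (r (x₀, t) u)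
      - ∑ j, (e * r * n j) (x₀, s)
          (n j (x₀, s) (r (x₀, t) u) - n j (x₀, t) (r (x₀, t) u))
      - ∑ j, (e * r) (x₀, s) (n j (x₀, s) (n j (x₀, t) (r (x₀, t) u))
          - n j (x₀, t) (n j (x₀, t) (r (x₀, t) u)))
      - (e * r) (x₀, s) (v (x₀, s) (r (x₀, t) u) - v (x₀, t) (r (x₀, t) u)) := by
    intro x₀ s t u
    have e1 := congrArg (fun T : Op d => T u) (congrFun h1 (x₀, t))
    have e2 := congrArg (fun T : Op d => T (r (x₀, t) u)) (congrFun h2 (x₀, s))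
    simp only [Pi.mul_apply, Pi.add_apply, Finset.sum_apply, Pi.smul_apply, Pi.one_apply,
      Module.End.mul_apply, Module.End.one_apply, LinearMap.add_apply, LinearMap.sum_apply,
      LinearMap.smul_apply] at e1 e2 ⊢
    obtain ⟨y, hy⟩ : ∃ y, y = r (x₀, t) u := ⟨_, rfl⟩
    rw [← hy] at e1 e2 ⊢
    have e3 : r (x₀, s) u = y - ∑ j, r (x₀, s) (n j (x₀, s) (n j (x₀, s) y - n j (x₀, t) y))
        - ∑ j, r (x₀, s) (n j (x₀, s) (n j (x₀, t) y) - n j (x₀, t) (n j (x₀, t) y))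
        - r (x₀, s) (v (x₀, s) y - v (x₀, t) y) := by
      refine Eq.trans (congrArg (r (x₀, s)) e1.symm) (Eq.trans ?_ (congrArg (fun z => z
        - ∑ j, r (x₀, s) (n j (x₀, s) (n j (x₀, s) y - n j (x₀, t) y))
        - ∑ j, r (x₀, s) (n j (x₀, s) (n j (x₀, t) y) - n j (x₀, t) (n j (x₀, t) y))
        - r (x₀, s) (v (x₀, s) y - v (x₀, t) y)) e2))
      simp only [map_sub, map_add, map_sum, Finset.sum_sub_distrib]
      abel
    rw [e3]
    simp only [map_sub, map_sum]
  have hz : ∀ (X : Space d × ℝ → Op d), LocBdd X → ∀ x₀ t (f : ℝ → SpaceS d),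
      ContinuousAt (fun s => toL2 (f s)) t →
      ContinuousAt (fun s => toL2 (X (x₀, s) (f s - f t))) t := fun X hX x₀ t f hf => by
    have := hX.tendsto_sub (x₀ := x₀) hf
    simpa [ContinuousAt] using this
  -- The identity is used first for strong continuity of `e r`, from which that of `e r n` follows.
  -- `LocBdd.hasDerivAt_sub` needs both before anything can be differentiated.
  have hcE : ∀ x₀ t u, ContinuousAt (fun s => toL2 ((e * r) (x₀, s) u)) t := by
    intro x₀ t u
    have h0 : (fun s => toL2 ((e * r) (x₀, s) u)) = fun s => _ :=
      funext fun s => congrArg toL2 (key x₀ s t u)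
    rw [h0]
    simp only [map_sub, map_sum toL2]
    simp only [← map_sub]
    refine ContinuousAt.sub (ContinuousAt.sub (ContinuousAt.sub (he.continuousAt x₀ t _) ?_) ?_) ?_
    · exact tendsto_finsetSum _ fun j _ => hz _ (hbn j) x₀ t
        (fun s => n j (x₀, s) (r (x₀, t) u)) ((hn j).continuousAt x₀ t _)
    · exact tendsto_finsetSum _ fun j _ => hz _ hb x₀ t
        (fun s => n j (x₀, s) (n j (x₀, t) (r (x₀, t) u))) ((hn j).continuousAt x₀ t _)
    · exact hz _ hb x₀ t (fun s => v (x₀, s) (r (x₀, t) u)) (hv.continuousAt x₀ t _)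
  have hcN : ∀ j x₀ t u, ContinuousAt (fun s => toL2 ((e * r * n j) (x₀, s) u)) t := by
    intro j x₀ t u
    have h0 := (hz _ hb x₀ t (fun s => n j (x₀, s) u) ((hn j).continuousAt x₀ t u)).add
      (hcE x₀ t (n j (x₀, t) u))
    refine h0.congr (Filter.Eventually.of_forall fun s => ?_)
    simp [map_sub]
  intro x₀ t u
  have h0 : (fun s => toL2 ((e * r) (x₀, s) u)) = fun s => _ :=
    funext fun s => congrArg toL2 (key x₀ s t u)
  rw [h0]
  simp only [map_sub, map_sum toL2]
  simp only [← map_sub]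
  have d1 := he x₀ t (r (x₀, t) u)
  have d2 := HasDerivAt.fun_sum (u := Finset.univ) fun j _ => (hbn j).hasDerivAt_sub (x₀ := x₀)
    (f := fun s => n j (x₀, s) (r (x₀, t) u)) (hn j x₀ t _) (hcN j x₀ t _)
  have d3 := HasDerivAt.fun_sum (u := Finset.univ) fun j _ => hb.hasDerivAt_sub (x₀ := x₀)
    (f := fun s => n j (x₀, s) (n j (x₀, t) (r (x₀, t) u))) (hn j x₀ t _) (hcE x₀ t _)
  have d4 := hb.hasDerivAt_sub (x₀ := x₀) (f := fun s => v (x₀, s) (r (x₀, t) u)) (hv x₀ t _)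
    (hcE x₀ t _)
  refine (((d1.sub d2).sub d3).sub d4).congr_deriv ?_
  simp only [Pi.mul_apply, Pi.add_apply, Pi.sub_apply, Pi.neg_apply, Finset.sum_apply,
    Module.End.mul_apply, LinearMap.add_apply, LinearMap.sub_apply, LinearMap.neg_apply,
    LinearMap.sum_apply, map_add, map_sub, map_sum, map_neg, Finset.sum_neg_distrib,
    Finset.sum_add_distrib]
  abel

/-! ### Multiplication operators -/

/-- The weight `1 + |Z|²`. -/
def quadWeight (Z : Space d) : ℂ := 1 + ∑ j, coord j Z * coord j Z

theorem quadWeight_hasTemperateGrowth : (quadWeight (d := d)).HasTemperateGrowth :=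
  (Function.HasTemperateGrowth.const 1).add (Function.HasTemperateGrowth.sum fun j _ =>
    (coord_hasTemperateGrowth j).mul (coord_hasTemperateGrowth j))

theorem norm_quadWeight (Z : Space d) : ‖quadWeight Z‖ = 1 + ‖Z‖ ^ 2 := by
  have : quadWeight Z = ((1 + ‖Z‖ ^ 2 : ℝ) : ℂ) := by
    rw [EuclideanSpace.norm_sq_eq]
    simp only [quadWeight, coord, Real.norm_eq_abs, sq_abs]
    push_cast
    congr 1
    exact Finset.sum_congr rfl fun j _ => by ring
  rw [this, Complex.norm_real, Real.norm_of_nonneg (by positivity)]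

/-- The mean value inequality for `x ↦ g(x) - x g'(t)` bounds the Taylor remainder pointwise by `C(1
+ |Z|²)|s - t|²`. The weight falls on the Schwartz function, so the remainder is `O(|s - t|²)` in
`L²`. -/
theorem hasD_mulOp {g g' : Space d × ℝ → Space d → ℂ} (hg : ∀ i, (g i).HasTemperateGrowth)
    (hg' : ∀ i, (g' i).HasTemperateGrowth)
    (hd : ∀ x₀ t Z, HasDerivAt (fun s => g (x₀, s) Z) (g' (x₀, t) Z) t)
    (hlip : ∀ x₀ (T : ℝ), ∃ C : ℝ, 0 ≤ C ∧ ∀ s t, |s| ≤ T → |t| ≤ T → ∀ Z,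
      ‖g' (x₀, s) Z - g' (x₀, t) Z‖ ≤ C * (1 + ‖Z‖ ^ 2) * |s - t|) :
    HasD (fun i => mulOp (g i)) (fun i => mulOp (g' i)) := by
  intro x₀ t u
  obtain ⟨C, hC0, hC⟩ := hlip x₀ (|t| + 1)
  have hev : ∀ᶠ s : ℝ in nhds t, |s| ≤ |t| + 1 :=
    (continuous_abs.continuousAt.eventually_lt continuousAt_const (lt_add_one _)).mono
      fun _ h => h.le
  have hpt : ∀ s, |s| ≤ |t| + 1 → ∀ Z,
      ‖g (x₀, s) Z - g (x₀, t) Z - ((s - t : ℝ) : ℂ) * g' (x₀, t) Z‖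
        ≤ C * (1 + ‖Z‖ ^ 2) * |s - t| * |s - t| := by
    intro s hs Z
    have hsub : ∀ x ∈ uIcc t s, |x - t| ≤ |s - t| ∧ |x| ≤ |t| + 1 := fun x hx => by
      refine ⟨abs_sub_left_of_mem_uIcc hx, ?_⟩
      rcases mem_uIcc.1 hx with h | h
      · exact abs_le.2 ⟨by linarith [neg_abs_le t], by linarith [le_abs_self s]⟩
      · exact abs_le.2 ⟨by linarith [neg_abs_le s], by linarith [le_abs_self t]⟩
    have h := (convex_uIcc t s).norm_image_sub_le_of_norm_hasDerivWithin_le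
      (f := fun x => g (x₀, x) Z - ((x : ℝ) : ℂ) * g' (x₀, t) Z)
      (f' := fun x => g' (x₀, x) Z - g' (x₀, t) Z) (C := C * (1 + ‖Z‖ ^ 2) * |s - t|)
      (fun x _ => by
        have h1 := (hasDerivAt_id x).ofReal_comp.mul_const (g' (x₀, t) Z)
        have h2 := (hd x₀ x Z).fun_sub h1
        simpa using h2.hasDerivWithinAt)
      (fun x hx => by
        refine (hC x t (hsub x hx).2 (by linarith) Z).trans ?_
        exact mul_le_mul_of_nonneg_left (hsub x hx).1 (by positivity)) left_mem_uIcc right_mem_uIcc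
    rw [Real.norm_eq_abs] at h
    refine le_trans (le_of_eq ?_) h
    congr 1
    push_cast
    ring
  rw [hasDerivAt_iff_isLittleO]
  have h2 : (fun s : ℝ => (s - t) * (s - t)) =o[nhds t] fun s => s - t := by
    have h3 : Filter.Tendsto (fun s : ℝ => s - t) (nhds t) (nhds 0) := by
      simpa using (continuous_sub_right t).tendsto t
    have h4 := (Asymptotics.isBigO_refl (fun s : ℝ => s - t) (nhds t)).mul_isLittleO
      ((Asymptotics.isLittleO_one_iff ℝ).2 h3)
    simpa using h4
  refine Asymptotics.IsBigO.trans_isLittleO (Asymptotics.IsBigO.of_bound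
    (C * ‖toL2 (mulOp quadWeight u)‖) ?_) h2
  filter_upwards [hev] with s hs
  have e : toL2 (mulOp (g (x₀, s)) u) - toL2 (mulOp (g (x₀, t)) u)
      - (s - t) • toL2 (mulOp (g' (x₀, t)) u)
      = toL2 (mulOp (g (x₀, s)) u - mulOp (g (x₀, t)) u
        - ((s - t : ℝ) : ℂ) • mulOp (g' (x₀, t)) u) := by
    rw [map_sub, map_sub, map_smul]; rfl
  rw [e, norm_mul, Real.norm_eq_abs]
  have h5 := norm_toL2_le_of_le (f := mulOp (g (x₀, s)) u - mulOp (g (x₀, t)) u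
        - ((s - t : ℝ) : ℂ) • mulOp (g' (x₀, t)) u) (g := mulOp quadWeight u)
        (c := C * |s - t| * |s - t|) fun Z => by
    simp only [_root_.sub_apply, _root_.smul_apply]
    rw [mulOp_apply (hg _), mulOp_apply (hg _), mulOp_apply (hg' _),
      mulOp_apply quadWeight_hasTemperateGrowth, smul_eq_mul, ← mul_assoc, ← sub_mul, ← sub_mul,
      norm_mul, norm_mul, norm_quadWeight, ← mul_assoc]
    refine mul_le_mul_of_nonneg_right ((hpt s hs Z).trans_eq (by ring)) (norm_nonneg _)
  exact h5.trans_eq (by ring)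

/-- The strong derivative of the multiplication by `rayFun μ q p G`. -/
def rayDeriv (μ : Measure ℝ) (q p : ℕ) (G : Space d → ℂ) (i : Space d × ℝ) : Op d :=
  (q : ℂ) • mulOp (rayFun μ (q - 1) p G i)
    + ∑ j, mulOp (rayFun μ q (p + 1) (partialDeriv j G) i) * zOp j

section rayFun

variable {μ : Measure ℝ} [IsFiniteMeasure μ] {G : Space d → ℂ}

theorem norm_coord_le (j : Fin d) (Z : Space d) : ‖coord j Z‖ ≤ ‖Z‖ := by
  rw [coord, Complex.norm_real]; exact PiLp.norm_apply_le Z j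

theorem rayFun_lipschitz (hμ : ∀ᵐ τ ∂μ, τ ∈ Icc (0 : ℝ) 1) (hG : IsCbComplex G) (q p : ℕ) (T : ℝ) :
    ∃ C : ℝ, 0 ≤ C ∧ ∀ x₀ s t, |s| ≤ T → |t| ≤ T → ∀ Z,
      ‖rayFun μ q p G (x₀, s) Z - rayFun μ q p G (x₀, t) Z‖ ≤ C * (1 + ‖Z‖) * |s - t| := by
  obtain ⟨C₀, hC₀, h0⟩ := (rayFun_uCb hμ hG (q - 1) p T).bound
  choose C hC h using fun j => (rayFun_uCb hμ (hG.partialDeriv j) q (p + 1) T).bound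
  have hS : 0 ≤ ∑ j, C j := Finset.sum_nonneg fun j _ => hC j
  refine ⟨q * C₀ + ∑ j, C j, by positivity, fun x₀ s t hs ht Z => ?_⟩
  have := (convex_Icc (-T) T).norm_image_sub_le_of_norm_hasDerivWithin_le
    (f := fun x => rayFun μ q p G (x₀, x) Z) (C := (q * C₀ + ∑ j, C j) * (1 + ‖Z‖))
    (fun x _ => (hasDerivAt_rayFun hμ hG q p x₀ x Z).hasDerivWithinAt)
    (fun x hx => by
      have hx' : |x| ≤ T := abs_le.2 hx
      have h1 : ‖(q : ℂ) * rayFun μ (q - 1) p G (x₀, x) Z‖ ≤ q * C₀ := by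
        rw [norm_mul, Complex.norm_natCast]
        exact mul_le_mul_of_nonneg_left (h0 (x₀, x) hx' Z) (by positivity)
      have h2 : ‖∑ j, coord j Z * rayFun μ q (p + 1) (MagneticSchrodinger.partialDeriv j G) (x₀, x) Z‖
          ≤ (∑ j, C j) * ‖Z‖ := by
        rw [Finset.sum_mul]
        refine norm_sum_le_of_le _ fun j _ => ?_
        rw [norm_mul, mul_comm]
        exact mul_le_mul (h j (x₀, x) hx' Z) (norm_coord_le j Z) (norm_nonneg _) (hC j)
      refine (norm_add_le _ _).trans ((add_le_add h1 h2).trans ?_)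
      have : 0 ≤ (q : ℝ) * C₀ := by positivity
      nlinarith [mul_nonneg this (norm_nonneg Z)])
    (abs_le.1 ht) (abs_le.1 hs)
  simpa [Real.norm_eq_abs] using this

theorem rayFun_temperate (hμ : ∀ᵐ τ ∂μ, τ ∈ Icc (0 : ℝ) 1) (hG : IsCbComplex G) (q p : ℕ)
    (i : Space d × ℝ) : (rayFun μ q p G i).HasTemperateGrowth :=
  (rayFun_uCb hμ hG q p 0).temperate i

theorem hasD_rayFun (hμ : ∀ᵐ τ ∂μ, τ ∈ Icc (0 : ℝ) 1) (hG : IsCbComplex G) (q p : ℕ) :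
    HasD (fun i => mulOp (rayFun μ q p G i)) (rayDeriv μ q p G) := by
  have ht1 : ∀ i, (fun Z => (q : ℂ) * rayFun μ (q - 1) p G i Z).HasTemperateGrowth := fun i =>
    (Function.HasTemperateGrowth.const _).mul (rayFun_temperate hμ hG _ _ i)
  have ht2 : ∀ i j, (fun Z => rayFun μ q (p + 1) (partialDeriv j G) i Z * coord j Z).HasTemperateGrowth :=
    fun i j => (rayFun_temperate hμ (hG.partialDeriv j) _ _ i).mul (coord_hasTemperateGrowth j)
  have ht3 : ∀ i, (fun Z => ∑ j, rayFun μ q (p + 1) (partialDeriv j G) i Z * coord j Z).HasTemperateGrowth :=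
    fun i => Function.HasTemperateGrowth.sum fun j _ => ht2 i j
  have key := hasD_mulOp (g := rayFun μ q p G) (g' := fun i Z => (q : ℂ) * rayFun μ (q - 1) p G i Z
      + ∑ j, rayFun μ q (p + 1) (partialDeriv j G) i Z * coord j Z)
    (rayFun_temperate hμ hG q p) (fun i => (ht1 i).add (ht3 i))
    (fun x₀ t Z => by simpa only [mul_comm] using hasDerivAt_rayFun hμ hG q p x₀ t Z) ?_
  · refine key.congr_deriv (funext fun i => ?_)
    rw [rayDeriv, mulOp_smul _ (rayFun_temperate hμ hG _ _ i), ← mulOp_add (ht1 i) (ht3 i),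
      ← mulOp_sum _ fun j _ => ht2 i j]
    congr 1
    refine Finset.sum_congr rfl fun j _ => ?_
    rw [zOp, mulOp_mul (rayFun_temperate hμ (hG.partialDeriv j) _ _ i) (coord_hasTemperateGrowth j)]
  · intro x₀ T
    obtain ⟨C₀, hC₀, h0⟩ := rayFun_lipschitz hμ hG (q - 1) p T
    choose C hC h using fun j => rayFun_lipschitz hμ (hG.partialDeriv j) q (p + 1) T
    have hS : 0 ≤ ∑ j, C j := Finset.sum_nonneg fun j _ => hC j
    refine ⟨2 * (q * C₀ + ∑ j, C j), by positivity, fun s t hs ht Z => ?_⟩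
    rw [add_sub_add_comm, ← mul_sub, ← Finset.sum_sub_distrib]
    have h1 : ‖(q : ℂ) * (rayFun μ (q - 1) p G (x₀, s) Z - rayFun μ (q - 1) p G (x₀, t) Z)‖
        ≤ q * (C₀ * (1 + ‖Z‖) * |s - t|) := by
      rw [norm_mul, Complex.norm_natCast]
      exact mul_le_mul_of_nonneg_left (h0 x₀ s t hs ht Z) (by positivity)
    have h2 : ‖∑ j, (rayFun μ q (p + 1) (partialDeriv j G) (x₀, s) Z * coord j Z
        - rayFun μ q (p + 1) (partialDeriv j G) (x₀, t) Z * coord j Z)‖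
        ≤ (∑ j, C j) * ((1 + ‖Z‖) * |s - t| * ‖Z‖) := by
      rw [Finset.sum_mul]
      refine norm_sum_le_of_le _ fun j _ => ?_
      rw [← sub_mul, norm_mul, ← mul_assoc, ← mul_assoc]
      exact mul_le_mul (h j x₀ s t hs ht Z) (norm_coord_le j Z) (norm_nonneg _)
        (mul_nonneg (mul_nonneg (hC j) (by positivity)) (abs_nonneg _))
    refine (norm_add_le _ _).trans ((add_le_add h1 h2).trans ?_)
    have hz := norm_nonneg Z
    have h3 : 1 + ‖Z‖ ≤ 2 * (1 + ‖Z‖ ^ 2) := by nlinarith [sq_nonneg (‖Z‖ - 1)]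
    have h4 : (1 + ‖Z‖) * ‖Z‖ ≤ 2 * (1 + ‖Z‖ ^ 2) := by nlinarith [sq_nonneg (‖Z‖ - 1)]
    calc q * (C₀ * (1 + ‖Z‖) * |s - t|) + (∑ j, C j) * ((1 + ‖Z‖) * |s - t| * ‖Z‖)
        = (q * C₀ * |s - t|) * (1 + ‖Z‖) + ((∑ j, C j) * |s - t|) * ((1 + ‖Z‖) * ‖Z‖) := by ring
      _ ≤ (q * C₀ * |s - t|) * (2 * (1 + ‖Z‖ ^ 2))
          + ((∑ j, C j) * |s - t|) * (2 * (1 + ‖Z‖ ^ 2)) := by gcongr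
      _ = _ := by ring

end rayFun

end

end MagneticSchrodinger

namespace MagneticSchrodinger

noncomputable section

variable {d : ℕ}

/-! ### Bounds for the resolvents -/

section resolventBounds

variable {a : Fin d → Space d → ℂ} {v : Space d → ℂ} {σ : ℂ}

theorem norm_nabOp_resOp_le (h : Admissible a v) {C : ℝ} (hC : ∀ x, ‖v x‖ ≤ C) (hσ : σ.re = 0)
    (hσ' : |σ.im| = 1) (j : Fin d) (u : SpaceS d) :
    ‖toL2 (nabOp a j (resOp a v σ u))‖ ≤ (1 + C) * ‖toL2 u‖ := by
  have h1 := norm_nabOp_le h.temperate h.real h.elec.hasTemperateGrowth h.elec_real hC hσ hσ' j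
    (resOp a v σ u)
  rwa [hamOp_resOp_apply h hσ hσ'] at h1

/-- By duality: the formal adjoint of `R_σ ∇_j` is `∇_j R_{-σ}`, which has been bounded. -/
theorem norm_resOp_nabOp_le (h : Admissible a v) {C : ℝ} (hC : ∀ x, ‖v x‖ ≤ C) (hσ : σ.re = 0)
    (hσ' : |σ.im| = 1) (j : Fin d) (u : SpaceS d) :
    ‖toL2 (resOp a v σ (nabOp a j u))‖ ≤ (1 + C) * ‖toL2 u‖ := by
  obtain ⟨w, hw⟩ : ∃ w, w = resOp a v σ (nabOp a j u) := ⟨_, rfl⟩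
  have h0 : 0 ≤ C := (norm_nonneg _).trans (hC 0)
  have h1 : ‖toL2 w‖ ^ 2 ≤ ‖toL2 u‖ * ((1 + C) * ‖toL2 w‖) := by
    calc ‖toL2 w‖ ^ 2 = ‖inner ℂ (toL2 w) (toL2 w)‖ := by
          rw [inner_self_eq_norm_sq_to_K]; simp
      _ = ‖inner ℂ (toL2 u) (toL2 (nabOp a j (resOp a v (-σ) w)))‖ := by
          conv_lhs => rw [hw]
          rw [inner_resOp h hσ hσ', inner_nabOp h.temperate h.real, ← hw]
      _ ≤ ‖toL2 u‖ * ‖toL2 (nabOp a j (resOp a v (-σ) w))‖ := norm_inner_le_norm _ _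
      _ ≤ _ := by
          gcongr
          exact norm_nabOp_resOp_le h hC (by simp [hσ]) (by simpa using hσ') j w
  rw [← hw]
  rcases (norm_nonneg (toL2 w)).eq_or_lt with h2 | h2
  · rw [← h2]; positivity
  · nlinarith

/-- The energy estimate for `w = R ∇_j u`, with `∇_j` moved from `u` to `w`, reads `s² ≤ s‖u‖ +
D‖u‖²` for `s² = ∑ ‖∇_k w‖²`. This forces `s ≤ (1 + D)‖u‖`. -/
theorem norm_nabOp_resOp_nabOp_le (h : Admissible a v) {C : ℝ} (hC : ∀ x, ‖v x‖ ≤ C)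
    (hσ : σ.re = 0) (hσ' : |σ.im| = 1) (i j : Fin d) (u : SpaceS d) :
    ‖toL2 (nabOp a i (resOp a v σ (nabOp a j u)))‖ ≤ (1 + C * (1 + C) ^ 2) * ‖toL2 u‖ := by
  have h0 : 0 ≤ C := (norm_nonneg _).trans (hC 0)
  have hw2 := norm_resOp_nabOp_le h hC hσ hσ' j u
  have h1 := sum_norm_nabOp_sq_le h.temperate h.real h.elec.hasTemperateGrowth hC hσ
    (resOp a v σ (nabOp a j u))
  rw [hamOp_resOp_apply h hσ hσ', ← inner_nabOp h.temperate h.real] at h1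
  obtain ⟨w, hw⟩ : ∃ w, w = resOp a v σ (nabOp a j u) := ⟨_, rfl⟩
  rw [← hw] at h1 hw2 ⊢
  obtain ⟨s, hs⟩ : ∃ s, s = Real.sqrt (∑ j, ‖toL2 (nabOp a j w)‖ ^ 2) := ⟨_, rfl⟩
  have hs2 : s ^ 2 = ∑ j, ‖toL2 (nabOp a j w)‖ ^ 2 := by
    rw [hs, Real.sq_sqrt (Finset.sum_nonneg fun _ _ => by positivity)]
  have hs0 : 0 ≤ s := hs ▸ Real.sqrt_nonneg _
  have h3 : ∀ k, ‖toL2 (nabOp a k w)‖ ≤ s := fun k => by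
    refine abs_le_of_sq_le_sq' ?_ hs0 |>.2
    rw [hs2]
    exact Finset.single_le_sum (f := fun j => ‖toL2 (nabOp a j w)‖ ^ 2)
      (fun _ _ => by positivity) (Finset.mem_univ k)
  have h4 : (inner ℂ (toL2 (nabOp a j w)) (toL2 u)).re ≤ s * ‖toL2 u‖ :=
    ((le_abs_self _).trans (Complex.abs_re_le_norm _)).trans
      ((norm_inner_le_norm _ _).trans (mul_le_mul_of_nonneg_right (h3 j) (norm_nonneg _)))
  have hu := norm_nonneg (toL2 u)
  have h5 : C * ‖toL2 w‖ ^ 2 ≤ C * (1 + C) ^ 2 * ‖toL2 u‖ ^ 2 := by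
    rw [mul_assoc, ← mul_pow]
    gcongr
  refine (h3 i).trans ?_
  have hD : 0 ≤ C * (1 + C) ^ 2 := by positivity
  obtain ⟨D, hDe⟩ : ∃ D, D = C * (1 + C) ^ 2 := ⟨_, rfl⟩
  rw [← hDe] at h5 hD ⊢
  by_contra! hlt
  have h6 : ‖toL2 u‖ ≤ s := by nlinarith [mul_nonneg hD hu]
  have h7 : s ^ 2 ≤ s * ‖toL2 u‖ + D * ‖toL2 u‖ * s := by
    nlinarith [mul_le_mul_of_nonneg_left h6 (mul_nonneg hD hu)]
  have h8 : 0 < s := lt_of_le_of_lt (by positivity) hlt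
  nlinarith

/-- The Cayley transform maps `(H + σ)y` to `(H - σ)y`. Both have the same norm, since `⟨Hy, y⟩` is
real, `σ` is imaginary, and so the cross term has real part zero. -/
theorem norm_cayley_apply (h : Admissible a v) (hσ : σ.re = 0) (hσ' : |σ.im| = 1) (u : SpaceS d) :
    ‖toL2 ((1 - (2 * σ) • resOp a v σ : Op d) u)‖ = ‖toL2 u‖ := by
  obtain ⟨y, hy⟩ : ∃ y, y = resOp a v σ u := ⟨_, rfl⟩
  have hu : u = hamOp a v y + σ • y := by rw [hy, hamOp_resOp_apply h hσ hσ']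
  have e : (1 - (2 * σ) • resOp a v σ : Op d) u = hamOp a v y - σ • y := by
    rw [LinearMap.sub_apply, LinearMap.smul_apply, Module.End.one_apply, ← hy, hu, two_mul, add_smul]
    abel
  have h1 : (inner ℂ (toL2 (hamOp a v y)) (toL2 y)).im = 0 := by
    have h2 := inner_hamOp h.temperate h.real h.elec.hasTemperateGrowth h.elec_real y y
    have h3 : conj (inner ℂ (toL2 (hamOp a v y)) (toL2 y))
        = inner ℂ (toL2 (hamOp a v y)) (toL2 y) := by
      rw [inner_conj_symm, h2]
    exact Complex.conj_eq_iff_im.1 h3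
  have h4 : RCLike.re (inner ℂ (toL2 (hamOp a v y)) (toL2 (σ • y))) = 0 := by
    rw [map_smul, inner_smul_right]
    simp [hσ, h1]
  have h5 : ‖toL2 (hamOp a v y) - toL2 (σ • y)‖ ^ 2 = ‖toL2 (hamOp a v y) + toL2 (σ • y)‖ ^ 2 := by
    rw [@norm_sub_sq ℂ, @norm_add_sq ℂ, h4]; ring
  rw [e, map_sub, hu, map_add]
  exact (sq_eq_sq₀ (norm_nonneg _) (norm_nonneg _)).1 h5

end resolventBounds

/-! ### Power series of families of operators -/

/-- Families of operators with parameters `(x₀, t)`. -/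
abbrev Fam (d : ℕ) : Type := Space d × ℝ → Op d

/-- Power series, the coefficients of which are families of operators. -/
abbrev FamSeries (d : ℕ) : Type := PowerSeries (Fam d)

/-- The coefficients are bounded in `L²` with polynomially growing bounds. -/
def SerBdd (S : FamSeries d) : Prop :=
  ∀ T : ℝ, ∃ (C : ℝ) (q : ℕ), 0 ≤ C ∧ ∀ n : ℕ, ∀ i : Space d × ℝ, |i.2| ≤ T → ∀ u,
    ‖toL2 (PowerSeries.coeff n S i u)‖ ≤ C * (1 + n) ^ q * ‖toL2 u‖

/-- The coefficients of `S'` are the strong derivatives of those of `S`. -/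
def HasDSer (S S' : FamSeries d) : Prop :=
  ∀ n, HasD (PowerSeries.coeff n S) (PowerSeries.coeff n S')

theorem SerBdd.locBdd {S : FamSeries d} (hS : SerBdd S) (n : ℕ) :
    LocBdd (PowerSeries.coeff n S) := fun T => by
  obtain ⟨C, q, hC0, hC⟩ := hS T
  exact ⟨C * (1 + n) ^ q, by positivity, fun i hi u => hC n i hi u⟩

theorem LocBdd.serBdd {S : Fam d} (hS : LocBdd S) : SerBdd (PowerSeries.C S) := fun T => by
  obtain ⟨C, hC0, hC⟩ := hS T
  refine ⟨C, 0, hC0, fun n i hi u => ?_⟩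
  rw [PowerSeries.coeff_C]
  split_ifs
  · simpa using hC i hi u
  · simp only [Pi.zero_apply, LinearMap.zero_apply, map_zero, norm_zero]; positivity

theorem SerBdd.add {S T : FamSeries d} (hS : SerBdd S) (hT : SerBdd T) : SerBdd (S + T) :=
  fun T₀ => by
  obtain ⟨C, q, hC0, hC⟩ := hS T₀
  obtain ⟨C', q', hC0', hC'⟩ := hT T₀
  refine ⟨C + C', max q q', by positivity, fun n i hi u => ?_⟩
  have h1 : (1 : ℝ) ≤ 1 + n := by simp
  rw [map_add, Pi.add_apply, LinearMap.add_apply, map_add]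
  refine (norm_add_le _ _).trans ((add_le_add (hC n i hi u) (hC' n i hi u)).trans ?_)
  rw [add_mul, add_mul]
  gcongr
  · exact le_max_left _ _
  · exact le_max_right _ _

/-- The Cauchy product has `n + 1` terms, which accounts for the extra power in the exponent `q + q'
+ 1`. -/
theorem SerBdd.mul {S T : FamSeries d} (hS : SerBdd S) (hT : SerBdd T) : SerBdd (S * T) :=
  fun T₀ => by
  obtain ⟨C, q, hC0, hC⟩ := hS T₀
  obtain ⟨C', q', hC0', hC'⟩ := hT T₀
  refine ⟨C * C', q + q' + 1, by positivity, fun n i hi u => ?_⟩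
  rw [PowerSeries.coeff_mul, Finset.sum_apply, LinearMap.sum_apply, map_sum]
  have h1 : ∀ p ∈ Finset.HasAntidiagonal.antidiagonal n, ‖toL2 ((PowerSeries.coeff p.1 S
      * PowerSeries.coeff p.2 T) i u)‖ ≤ C * C' * (1 + n) ^ (q + q') * ‖toL2 u‖ := fun p hp => by
    have hp' := Finset.HasAntidiagonal.mem_antidiagonal.1 hp
    have hp1 : (p.1 : ℝ) ≤ n := by exact_mod_cast (by omega : p.1 ≤ n)
    have hp2 : (p.2 : ℝ) ≤ n := by exact_mod_cast (by omega : p.2 ≤ n)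
    calc ‖toL2 ((PowerSeries.coeff p.1 S * PowerSeries.coeff p.2 T) i u)‖
        ≤ C * (1 + p.1) ^ q * ‖toL2 (PowerSeries.coeff p.2 T i u)‖ := hC _ i hi _
      _ ≤ C * (1 + p.1) ^ q * (C' * (1 + p.2) ^ q' * ‖toL2 u‖) := by gcongr; exact hC' _ i hi u
      _ ≤ C * (1 + n) ^ q * (C' * (1 + n) ^ q' * ‖toL2 u‖) := by gcongr
      _ = _ := by ring
  refine (norm_sum_le_of_le _ h1).trans (le_of_eq ?_)
  rw [Finset.sum_const, Finset.Nat.card_antidiagonal, nsmul_eq_mul]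
  push_cast
  ring

theorem serBdd_algebraMap (c : ℂ) : SerBdd (algebraMap ℂ (FamSeries d) c) := by
  rw [PowerSeries.algebraMap_apply]
  refine LocBdd.serBdd fun T => ⟨‖c‖, norm_nonneg _, fun i _ u => ?_⟩
  rw [Pi.algebraMap_apply, Module.algebraMap_end_apply, map_smul, norm_smul]

theorem serBdd_X : SerBdd (PowerSeries.X : FamSeries d) := fun T => by
  refine ⟨1, 0, zero_le_one, fun n i _ u => ?_⟩
  rw [PowerSeries.coeff_X]
  split_ifs <;> simp

theorem HasDSer.C {S S' : Fam d} (h : HasD S S') : HasDSer (PowerSeries.C S) (PowerSeries.C S') :=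
  fun n => by
  rw [PowerSeries.coeff_C, PowerSeries.coeff_C]
  split_ifs
  · exact h
  · exact HasD.const 0

theorem HasDSer.add {S S' T T' : FamSeries d} (hS : HasDSer S S') (hT : HasDSer T T') :
    HasDSer (S + T) (S' + T') := fun n => by
  rw [map_add, map_add]; exact (hS n).add (hT n)

theorem HasDSer.sum {κ : Type*} (s : Finset κ) {S S' : κ → FamSeries d}
    (h : ∀ k ∈ s, HasDSer (S k) (S' k)) : HasDSer (∑ k ∈ s, S k) (∑ k ∈ s, S' k) := fun n => by
  rw [map_sum, map_sum]; exact HasD.sum s fun k hk => h k hk n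

theorem HasDSer.mul {S S' T T' : FamSeries d} (hb : SerBdd S) (hS : HasDSer S S')
    (hT : HasDSer T T') : HasDSer (S * T) (S' * T + S * T') := fun n => by
  rw [map_add, PowerSeries.coeff_mul, PowerSeries.coeff_mul, PowerSeries.coeff_mul,
    ← Finset.sum_add_distrib]
  exact HasD.sum _ fun p _ => HasD.mul (hb.locBdd p.1) (hS p.1) (hT p.2)

theorem HasDSer.mul_const {S S' : FamSeries d} (hS : HasDSer S S') (R : Op d) :
    HasDSer (S * PowerSeries.C fun _ => R) (S' * PowerSeries.C fun _ => R) := fun n => by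
  rw [PowerSeries.coeff_mul_C, PowerSeries.coeff_mul_C]
  exact (hS n).mul_const R

theorem HasDSer.algebraMap (c : ℂ) : HasDSer (algebraMap ℂ (FamSeries d) c) 0 := by
  rw [PowerSeries.algebraMap_apply, ← map_zero PowerSeries.C]
  exact HasDSer.C (HasD.const _)

theorem HasDSer.X : HasDSer (PowerSeries.X : FamSeries d) 0 := fun n => by
  rw [PowerSeries.coeff_X, map_zero]
  split_ifs
  · exact HasD.const 1
  · exact HasD.const 0

/-- The geometric series `∑ U^n X^n`. -/
def geomSeries (U : Fam d) : FamSeries d := PowerSeries.mk fun n => U ^ n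

theorem one_sub_X_mul_geomSeries (U : Fam d) :
    (1 - PowerSeries.X * PowerSeries.C U) * geomSeries U = 1 := by
  ext1 n
  rw [sub_mul, one_mul, mul_assoc, map_sub]
  cases n with
  | zero => simp [geomSeries]
  | succ n =>
    rw [PowerSeries.coeff_succ_X_mul, PowerSeries.coeff_C_mul, geomSeries, PowerSeries.coeff_mk,
      PowerSeries.coeff_mk, ← pow_succ', sub_self, PowerSeries.coeff_one, if_neg (Nat.succ_ne_zero n)]

theorem geomSeries_mul_one_sub_X (U : Fam d) :
    geomSeries U * (1 - PowerSeries.X * PowerSeries.C U) = 1 := by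
  ext1 n
  rw [mul_sub, mul_one, PowerSeries.X_mul, ← mul_assoc, map_sub]
  cases n with
  | zero => simp [geomSeries]
  | succ n =>
    rw [PowerSeries.coeff_succ_mul_X, PowerSeries.coeff_mul_C, geomSeries, PowerSeries.coeff_mk,
      PowerSeries.coeff_mk, ← pow_succ, sub_self, PowerSeries.coeff_one, if_neg (Nat.succ_ne_zero n)]

/-- This is the derivative of `(1 - XU)⁻¹`, checked coefficient by coefficient. The candidate `W`
satisfies `W = X U' G + X U W`, which is the recursion obtained by differentiating `U^{n+1} = U
U^n`. -/
theorem hasDSer_geomSeries {U U' : Fam d} (hb : LocBdd U) (hU : HasD U U') :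
    HasDSer (geomSeries U)
      (geomSeries U * (PowerSeries.X * PowerSeries.C U') * geomSeries U) := by
  obtain ⟨W, hW⟩ : ∃ W, W = geomSeries U * (PowerSeries.X * PowerSeries.C U') * geomSeries U :=
    ⟨_, rfl⟩
  have e : W = PowerSeries.X * (PowerSeries.C U' * geomSeries U)
      + PowerSeries.X * (PowerSeries.C U * W) := by
    have h1 : (1 - PowerSeries.X * PowerSeries.C U) * W
        = PowerSeries.X * (PowerSeries.C U' * geomSeries U) := by
      rw [hW, mul_assoc, ← mul_assoc (1 - _), one_sub_X_mul_geomSeries, one_mul, mul_assoc]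
    rw [← h1]; noncomm_ring
  rw [← hW]
  intro n
  induction n with
  | zero =>
    rw [e]
    have h1 : HasD (1 : Fam d) 0 := HasD.const (1 : Op d)
    simpa [geomSeries] using h1
  | succ n ih =>
    have h1 : PowerSeries.coeff (n + 1) (geomSeries U) = U * PowerSeries.coeff n (geomSeries U) := by
      rw [geomSeries, PowerSeries.coeff_mk, PowerSeries.coeff_mk, pow_succ']
    rw [h1, e, map_add, PowerSeries.coeff_succ_X_mul, PowerSeries.coeff_succ_X_mul,
      PowerSeries.coeff_C_mul, PowerSeries.coeff_C_mul]
    exact HasD.mul hb hU ih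

end

end MagneticSchrodinger

namespace MagneticSchrodinger

noncomputable section

variable {d : ℕ}

/-! ### The algebra of the rescaled operators -/

/-- Multiplications by averages of functions along rays. -/
def rayFams (d : ℕ) : Set (Fam d) :=
  {T | ∃ (μ : Measure ℝ) (_ : IsFiniteMeasure μ) (q p : ℕ) (G : Space d → ℂ),
    (∀ᵐ τ ∂μ, τ ∈ Icc (0 : ℝ) 1) ∧ IsCbComplex G ∧ T = fun i => mulOp (rayFun μ q p G i)}

/-- The spectral parameters `i` and `-i`. -/
def spectralPt (b : Bool) : ℂ := cond b Complex.I (-Complex.I)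

theorem spectralPt_re (b : Bool) : (spectralPt b).re = 0 := by cases b <;> simp [spectralPt]

theorem abs_spectralPt_im (b : Bool) : |(spectralPt b).im| = 1 := by
  cases b <;> simp [spectralPt]

section families

variable (B : Fin d → Fin d → Space d → ℂ) (V : Space d → ℂ)

/-- The covariant derivatives. -/
def nabFam (j : Fin d) : Fam d := fun i => nabOp (rayPot B i) j

/-- Multiplication by the electric potential. -/
def elecFam : Fam d := fun i => mulOp (rayElec V i)

/-- The resolvents. -/
def resFam (b : Bool) : Fam d := fun i => resOp (rayPot B i) (rayElec V i) (spectralPt b)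

/-- The Cayley transforms. -/
def cayleyFam (b : Bool) : Fam d := 1 - (2 * spectralPt b) • resFam B V b

/-- The strong derivative of the multiplication by the potential. -/
def potDeriv (j : Fin d) : Fam d :=
  ∑ k, rayDeriv unitMeasure 0 1 (B k j) * fun _ => zOp k

end families

theorem ad_C (S T : Fam d) :
    ad (PowerSeries.C S) (PowerSeries.C T) = PowerSeries.C (ad S T) := by
  simp only [ad, map_sub, map_mul]

theorem C_smul (c : ℂ) (S : Fam d) : PowerSeries.C (c • S) = c • PowerSeries.C S := by
  ext1 n
  rw [PowerSeries.coeff_C, PowerSeries.coeff_smul, PowerSeries.coeff_C]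
  split_ifs <;> simp

namespace FieldData

variable {B : Fin d → Fin d → Space d → ℂ} {V : Space d → ℂ}

theorem elecFam_mem (h : FieldData B V) : elecFam V ∈ rayFams d :=
  ⟨Measure.dirac 1, inferInstance, 0, 0, V, dirac_one_ae, h.elec, rfl⟩

theorem ham_mul_resFam (h : FieldData B V) (b : Bool) :
    (∑ j, nabFam B j * nabFam B j + elecFam V + spectralPt b • 1) * resFam B V b = 1 :=
  funext fun i => by
    have := hamOp_mul_resOp (h.admissible i) (spectralPt_re b) (abs_spectralPt_im b)
    simpa [hamOp, nabFam, elecFam, resFam, Finset.sum_apply] using this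

theorem resFam_mul_ham (h : FieldData B V) (b : Bool) :
    resFam B V b * (∑ j, nabFam B j * nabFam B j + elecFam V + spectralPt b • 1) = 1 :=
  funext fun i => by
    have := resOp_mul_hamOp (h.admissible i) (spectralPt_re b) (abs_spectralPt_im b)
    simpa [hamOp, nabFam, elecFam, resFam, Finset.sum_apply] using this

theorem ad_nabFam_nabFam (h : FieldData B V) (k l : Fin d) :
    ad (nabFam B k) (nabFam B l)
      = (-(1 / Complex.I)) • fun i => mulOp (rayFun (Measure.dirac 1) 0 0 (B k l) i) :=
  funext fun i => by
    have e := nabOp_mul_nabOp (h.admissible i).temperate k l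
    simp only [h.field_rayPot] at e
    simp only [ad, nabFam, Pi.sub_apply, Pi.mul_apply, Pi.smul_apply]
    rw [e, add_sub_cancel_left, mulOp_smul _ (rayFun_temperate dirac_one_ae (h.cb k l) 0 0 i)]

theorem ad_nabFam_rayFams (h : FieldData B V) (j : Fin d) {f : Fam d} (hf : f ∈ rayFams d) :
    ∃ f' ∈ rayFams d, ad (nabFam B j) f = (1 / Complex.I) • f' := by
  obtain ⟨μ, hμ, q, p, G, hμ1, hG, rfl⟩ := hf
  refine ⟨_, ⟨μ, hμ, q + 1, p + 1, _, hμ1, hG.partialDeriv j, rfl⟩, funext fun i => ?_⟩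
  have e := nabOp_mul_mulOp (h.admissible i).temperate (rayFun_temperate hμ1 hG q p i) j
  simp only [partialDeriv_rayFun hμ1 hG] at e
  simp only [ad, nabFam, Pi.sub_apply, Pi.mul_apply, Pi.smul_apply]
  rw [e, add_sub_cancel_left, mulOp_smul _ (rayFun_temperate hμ1 (hG.partialDeriv j) _ _ i)]

theorem ad_nabFam_zOp (h : FieldData B V) (k j : Fin d) :
    ad (nabFam B k) (fun _ => zOp j)
      = algebraMap ℂ (Fam d) (if k = j then (1 / Complex.I) else 0) :=
  funext fun i => by
    have e := nabOp_mul_zOp (h.admissible i).temperate k j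
    simp only [ad, nabFam, Pi.sub_apply, Pi.mul_apply]
    rw [e, add_sub_cancel_left, mulOp_const, Pi.algebraMap_apply, Algebra.algebraMap_eq_smul_one]

/-- The algebra generated by the rescaled operators. -/
def algebra (h : FieldData B V) : MagneticAlgebra (FamSeries d) (Fin d) where
  fn := PowerSeries.C '' rayFams d
  n j := PowerSeries.C (nabFam B j)
  z j := PowerSeries.C fun _ => zOp j
  v := PowerSeries.C (elecFam V)
  σ := spectralPt
  r b := PowerSeries.C (resFam B V b)
  x := PowerSeries.X
  g b := geomSeries (cayleyFam B V b)
  v_mem := ⟨_, h.elecFam_mem, rfl⟩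
  ad_n_n k l := ⟨_, _, ⟨_, ⟨Measure.dirac 1, inferInstance, 0, 0, B k l, dirac_one_ae, h.cb k l, rfl⟩,
    rfl⟩, by rw [ad_C, h.ad_nabFam_nabFam, C_smul]⟩
  ad_n_fn j := by
    rintro _ ⟨f, hf, rfl⟩
    obtain ⟨f', hf', e⟩ := h.ad_nabFam_rayFams j hf
    exact ⟨_, _, ⟨f', hf', rfl⟩, by rw [ad_C, e, C_smul]⟩
  ad_n_z k j := ⟨_, by rw [ad_C, h.ad_nabFam_zOp, PowerSeries.algebraMap_apply]⟩
  ad_z_fn j := by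
    rintro _ ⟨f, ⟨μ, hμ, q, p, G, hμ1, hG, rfl⟩, rfl⟩
    rw [ad_C, ← map_zero PowerSeries.C]
    congr 1
    funext i
    simp only [ad, Pi.sub_apply, Pi.mul_apply, zOp_mul_mulOp (rayFun_temperate hμ1 hG q p i),
      sub_self, Pi.zero_apply]
  ham_mul_r b := by
    rw [PowerSeries.algebraMap_apply, Algebra.algebraMap_eq_smul_one]
    simp only [← map_mul, ← map_sum, ← map_add, h.ham_mul_resFam, map_one]
  r_mul_ham b := by
    rw [PowerSeries.algebraMap_apply, Algebra.algebraMap_eq_smul_one]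
    simp only [← map_mul, ← map_sum, ← map_add, h.resFam_mul_ham, map_one]
  x_comm y := (PowerSeries.X_mul (φ := y)).symm
  cayley_mul_g b := by
    rw [← C_smul, ← map_one (PowerSeries.C (R := Fam d)), ← map_sub, map_one]
    exact one_sub_X_mul_geomSeries (cayleyFam B V b)
  g_mul_cayley b := by
    rw [← C_smul, ← map_one (PowerSeries.C (R := Fam d)), ← map_sub, map_one]
    exact geomSeries_mul_one_sub_X (cayleyFam B V b)

/-! ### Bounds -/

theorem exists_elec_bound (h : FieldData B V) : ∃ C : ℝ, 0 ≤ C ∧ ∀ i Z, ‖rayElec V i Z‖ ≤ C := by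
  obtain ⟨C, hC⟩ := h.elec.bound
  refine ⟨C, (norm_nonneg _).trans (hC 0), fun i Z => ?_⟩
  rw [rayElec, rayFun_dirac, pow_zero, one_mul]
  exact hC _

theorem locBdd_resFam (h : FieldData B V) (b : Bool) : LocBdd (resFam B V b) := fun _ =>
  ⟨1, zero_le_one, fun i _ u =>
    norm_resOp_le (h.admissible i) (spectralPt_re b) (abs_spectralPt_im b) u⟩

theorem locBdd_nabFam_resFam (h : FieldData B V) (j : Fin d) (b : Bool) :
    LocBdd (nabFam B j * resFam B V b) := fun _ => by
  obtain ⟨C, hC0, hC⟩ := h.exists_elec_bound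
  exact ⟨1 + C, by positivity, fun i _ u => norm_nabOp_resOp_le (h.admissible i) (hC i)
    (spectralPt_re b) (abs_spectralPt_im b) j u⟩

theorem locBdd_resFam_nabFam (h : FieldData B V) (b : Bool) (j : Fin d) :
    LocBdd (resFam B V b * nabFam B j) := fun _ => by
  obtain ⟨C, hC0, hC⟩ := h.exists_elec_bound
  exact ⟨1 + C, by positivity, fun i _ u => norm_resOp_nabOp_le (h.admissible i) (hC i)
    (spectralPt_re b) (abs_spectralPt_im b) j u⟩

theorem locBdd_nabFam_resFam_nabFam (h : FieldData B V) (k : Fin d) (b : Bool) (j : Fin d) :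
    LocBdd (nabFam B k * resFam B V b * nabFam B j) := fun _ => by
  obtain ⟨C, hC0, hC⟩ := h.exists_elec_bound
  exact ⟨_, by positivity, fun i _ u => norm_nabOp_resOp_nabOp_le (h.admissible i) (hC i)
    (spectralPt_re b) (abs_spectralPt_im b) k j u⟩

theorem norm_cayleyFam_pow (h : FieldData B V) (b : Bool) (n : ℕ) (i : Space d × ℝ) (u : SpaceS d) :
    ‖toL2 ((cayleyFam B V b ^ n) i u)‖ = ‖toL2 u‖ := by
  induction n with
  | zero => simp
  | succ n ih =>
    rw [pow_succ', ← ih]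
    exact norm_cayley_apply (h.admissible i) (spectralPt_re b) (abs_spectralPt_im b) _

theorem locBdd_cayleyFam (h : FieldData B V) (b : Bool) : LocBdd (cayleyFam B V b) := fun _ =>
  ⟨1, zero_le_one, fun i _ u => by
    simpa using (h.norm_cayleyFam_pow b 1 i u).le⟩

theorem locBdd_rayFams {f : Fam d} (hf : f ∈ rayFams d) : LocBdd f := fun T => by
  obtain ⟨μ, hμ, q, p, G, hμ1, hG, rfl⟩ := hf
  exact multFam_uBdd (mulOp_mem_multFam (rayFun_uCb hμ1 hG q p T))

theorem serBdd_of_gen (h : FieldData B V) {T : FamSeries d} (hT : h.algebra.Gen T) : SerBdd T := by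
  rcases hT with f | b | ⟨i, b⟩ | ⟨b, j⟩ | ⟨i, b, j⟩ | b | _
  case fn hf =>
    obtain ⟨f, hf, rfl⟩ := hf
    exact (locBdd_rayFams hf).serBdd
  · exact (h.locBdd_resFam b).serBdd
  · change SerBdd (PowerSeries.C (nabFam B i) * PowerSeries.C (resFam B V b))
    rw [← map_mul]; exact (h.locBdd_nabFam_resFam i b).serBdd
  · change SerBdd (PowerSeries.C (resFam B V b) * PowerSeries.C (nabFam B j))
    rw [← map_mul]; exact (h.locBdd_resFam_nabFam b j).serBdd
  · change SerBdd (PowerSeries.C (nabFam B i) * PowerSeries.C (resFam B V b)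
      * PowerSeries.C (nabFam B j))
    rw [← map_mul, ← map_mul]; exact (h.locBdd_nabFam_resFam_nabFam i b j).serBdd
  · refine fun T => ⟨1, 0, zero_le_one, fun n i _ u => ?_⟩
    change ‖toL2 (PowerSeries.coeff n (geomSeries (cayleyFam B V b)) i u)‖ ≤ _
    rw [geomSeries, PowerSeries.coeff_mk, h.norm_cayleyFam_pow]
    simp
  · exact serBdd_X

theorem serBdd (h : FieldData B V) {T : FamSeries d} (hT : T ∈ h.algebra.C) : SerBdd T := by
  induction hT using Algebra.adjoin_induction with
  | mem T hT => exact h.serBdd_of_gen hT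
  | algebraMap c => exact serBdd_algebraMap c
  | add S T _ _ ihS ihT => exact ihS.add ihT
  | mul S T _ _ ihS ihT => exact ihS.mul ihT

/-! ### Derivatives -/

open MagneticAlgebra in
theorem C_rayDeriv_mem (h : FieldData B V) {μ : Measure ℝ} [hm : IsFiniteMeasure μ]
    (hμ : ∀ᵐ τ ∂μ, τ ∈ Icc (0 : ℝ) 1) {G : Space d → ℂ} (hG : IsCbComplex G) (q p : ℕ) :
    PowerSeries.C (rayDeriv μ q p G) ∈ h.algebra.Wt (h.algebra.Cp 0) 1 := by
  have hf : ∀ q p G, IsCbComplex G →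
      PowerSeries.C (fun i => mulOp (rayFun μ q p G i)) ∈ h.algebra.Cp 0 := fun q p G hG =>
    mem_Cp_zero.2 (fn_mem ⟨_, ⟨μ, hm, q, p, G, hμ, hG, rfl⟩, rfl⟩)
  refine ⟨(q : ℂ) • PowerSeries.C (fun i => mulOp (rayFun μ (q - 1) p G i)),
    Cp_smul _ (hf _ _ _ hG), fun j => PowerSeries.C (fun i => mulOp (rayFun μ q (p + 1)
      (MagneticSchrodinger.partialDeriv j G) i)), fun j => hf _ _ _ (hG.partialDeriv j), ?_⟩
  have e : rayDeriv μ q p G = (q : ℂ) • (fun i => mulOp (rayFun μ (q - 1) p G i))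
      + ∑ j, (fun i => mulOp (rayFun μ q (p + 1) (MagneticSchrodinger.partialDeriv j G) i))
        * fun _ => zOp j := funext fun i => by
    simp [rayDeriv, Finset.sum_apply]
  rw [e, map_add, map_sum, C_smul]
  simp only [map_mul]
  rfl

theorem hasD_nabFam (h : FieldData B V) (j : Fin d) : HasD (nabFam B j) (-potDeriv B j) := by
  have e : nabFam B j = (fun _ => dOp j) - ∑ k, (fun i => mulOp (rayFun unitMeasure 0 1 (B k j) i))
      * fun _ => zOp k := funext fun i => by
    have ht : ∀ k, (rayFun unitMeasure 0 1 (B k j) i).HasTemperateGrowth := fun k =>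
      rayFun_temperate unitMeasure_ae (h.cb k j) 0 1 i
    simp only [nabFam, nabOp, Pi.sub_apply, Finset.sum_apply, Pi.mul_apply]
    congr 1
    simp only [zOp, mulOp_mul (ht _) (coord_hasTemperateGrowth _)]
    rw [mulOp_sum (f := fun k Z => rayFun unitMeasure 0 1 (B k j) i Z * coord k Z) _ fun k _ =>
      (ht k).mul (coord_hasTemperateGrowth k)]
    rfl
  rw [e, ← zero_sub]
  exact (HasD.const _).sub (HasD.sum _ fun k _ =>
    (hasD_rayFun unitMeasure_ae (h.cb k j) 0 1).mul_const _)

-- One degree comes from the linear growth of the potential in the radial gauge, the other from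
-- differentiating the argument `tZ`.
open MagneticAlgebra in
theorem C_potDeriv_mem (h : FieldData B V) (j : Fin d) :
    PowerSeries.C (potDeriv B j) ∈ h.algebra.Wt (h.algebra.Cp 0) 2 := by
  rw [potDeriv, map_sum]
  refine (isLin_Wt (isLin_Cp 0) 2).sum _ fun k _ => ?_
  rw [map_mul]
  exact mul_z_mem_Wt (isLin_Cp 0) (h.C_rayDeriv_mem unitMeasure_ae (h.cb k j) 0 1) k

theorem hasD_elecFam (h : FieldData B V) :
    HasD (elecFam V) (rayDeriv (Measure.dirac 1) 0 0 V) := hasD_rayFun dirac_one_ae h.elec 0 0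

/-- Minus the strong derivative of the Schrödinger operator. -/
def hamVar (B : Fin d → Fin d → Space d → ℂ) (V : Space d → ℂ) : Fam d :=
  ∑ j, (nabFam B j * potDeriv B j + potDeriv B j * nabFam B j) - rayDeriv (Measure.dirac 1) 0 0 V

theorem hasD_mul_resFam (h : FieldData B V) (b : Bool) {e e' : Fam d} (he : HasD e e')
    (hb : LocBdd (e * resFam B V b)) (hbn : ∀ j, LocBdd (e * resFam B V b * nabFam B j)) :
    HasD (e * resFam B V b)
      (e' * resFam B V b + e * resFam B V b * hamVar B V * resFam B V b) :=
  hasD_mul_inverse h.hasD_nabFam h.hasD_elecFam he (h.ham_mul_resFam b) (h.resFam_mul_ham b) hb hbn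

theorem hasD_resFam (h : FieldData B V) (b : Bool) :
    HasD (resFam B V b) (resFam B V b * hamVar B V * resFam B V b) := by
  have := h.hasD_mul_resFam b (e := 1) (e' := 0) (HasD.const 1)
    (by rw [one_mul]; exact h.locBdd_resFam b)
    fun j => by rw [one_mul]; exact h.locBdd_resFam_nabFam b j
  rwa [one_mul, zero_mul, zero_add] at this

-- Writing `n α + α n = 2 n α - [n, α]` puts the remaining covariant derivative next to `E`, which
-- absorbs it by hypothesis. The factor `R` absorbs nothing, so it may itself end with a covariant
-- derivative.
open MagneticAlgebra in
theorem mul_hamVar_mul_mem (h : FieldData B V) {E R : FamSeries d} {p : ℕ}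
    (hE : E ∈ h.algebra.C) (hEn : ∀ j, E * h.algebra.n j ∈ h.algebra.C)
    (hR : R ∈ h.algebra.Cp p) :
    E * PowerSeries.C (hamVar B V) * R ∈ h.algebra.Wt (h.algebra.Cp p) 2 := by
  have hlin := isLin_Wt (Q := h.algebra) (isLin_Cp (Q := h.algebra) p) 2
  have hα := h.C_potDeriv_mem
  have hν := Wt_succ (Q := h.algebra) (isLin_Cp (Q := h.algebra) 0) (h.C_rayDeriv_mem dirac_one_ae h.elec 0 0)
  have h1 : ∀ {E T R : FamSeries d}, E ∈ h.algebra.C → T ∈ h.algebra.Wt (h.algebra.Cp 0) 2 →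
      R ∈ h.algebra.Cp p → E * T * R ∈ h.algebra.Wt (h.algebra.Cp p) 2 := fun hE hT hR => by
    have := Wt_Cp_mul (Cp_mul_Wt (mem_Cp_zero.2 hE) hT) hR
    rwa [zero_add, zero_add] at this
  have e : E * PowerSeries.C (hamVar B V) * R
      = ∑ j, (((2 : ℂ) • (E * h.algebra.n j * PowerSeries.C (potDeriv B j) * R))
          + -(E * ad (h.algebra.n j) (PowerSeries.C (potDeriv B j)) * R))
        + -(E * PowerSeries.C (rayDeriv (Measure.dirac 1) 0 0 V) * R) := by
    rw [hamVar, map_sub, map_sum, mul_sub, sub_mul, Finset.mul_sum, Finset.sum_mul, sub_eq_add_neg]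
    congr 1
    refine Finset.sum_congr rfl fun j _ => ?_
    rw [map_add, map_mul, map_mul, two_smul, ad]
    change E * (h.algebra.n j * PowerSeries.C (potDeriv B j)
      + PowerSeries.C (potDeriv B j) * h.algebra.n j) * R = _
    noncomm_ring
  rw [e]
  exact hlin.add _ (hlin.sum _ fun j _ => hlin.add _ (hlin.smul _ _ (h1 (hEn j) (hα j) hR)) _
    (hlin.neg (h1 hE (ad_n_mem_Wt (isLin_Cp 0) j (fun _ hT => (good_n j).ad_mem_Cp hT) (hα j)) hR)))
    _ (hlin.neg (h1 hE hν hR))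

end FieldData

end

end MagneticSchrodinger

/-! ### Differentiation in the parameter inside the algebra, and weighted estimates. -/

namespace MagneticSchrodinger

noncomputable section

variable {d : ℕ}

namespace MagneticAlgebra

variable {𝔸 : Type*} [Ring 𝔸] [Algebra ℂ 𝔸] {κ : Type*} [Fintype κ] {Q : MagneticAlgebra 𝔸 κ}

theorem mem_C_of_mem_Cp {p : ℕ} {T : 𝔸} (hT : T ∈ Q.Cp p) : T ∈ Q.C := by
  obtain ⟨S, hS, rfl⟩ := hT
  exact Q.C.mul_mem hS (Q.C.pow_mem (r_mem true) p)

theorem list_prod_mul_mem_Cp (J : List κ) {p : ℕ} {T : 𝔸} (hT : T ∈ Q.Cp (p + J.length)) :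
    (J.map Q.n).prod * T ∈ Q.Cp p := by
  induction J generalizing p with
  | nil => simpa using hT
  | cons j J ih =>
    rw [List.map_cons, List.prod_cons, mul_assoc]
    exact n_mul_mem_Cp (ih (by rwa [List.length_cons, add_comm J.length, ← add_assoc] at hT)) j

end MagneticAlgebra

namespace FieldData

open MagneticAlgebra

variable {B : Fin d → Fin d → Space d → ℂ} {V : Space d → ℂ}

/-- Covariant derivatives, resolvents and geometric series are differentiated by the product rule
and the rule for inverses. Each term contains at most one factor `potDeriv` or `rayDeriv`, hence
degree at most two. The products are grouped so that the left factor is always bounded, as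
`HasD.mul` demands. -/
theorem exists_hasDSer_of_gen (h : FieldData B V) {T : FamSeries d} (hT : h.algebra.Gen T) :
    ∃ T' ∈ h.algebra.Wt (h.algebra.Cp 0) 2, HasDSer T T' := by
  have hlin := isLin_Wt (Q := h.algebra) (isLin_Cp (Q := h.algebra) 0) 2
  have hC : ∀ {S T : FamSeries d}, S ∈ h.algebra.C → T ∈ h.algebra.Wt (h.algebra.Cp 0) 2 →
      S * T ∈ h.algebra.Wt (h.algebra.Cp 0) 2 := fun hS hT => by
    have := Cp_mul_Wt (mem_Cp_zero.2 hS) hT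
    rwa [zero_add] at this
  have hC' : ∀ {S T : FamSeries d}, S ∈ h.algebra.Wt (h.algebra.Cp 0) 2 → T ∈ h.algebra.C →
      S * T ∈ h.algebra.Wt (h.algebra.Cp 0) 2 := fun hS hT => by
    have := Wt_Cp_mul hS (mem_Cp_zero.2 hT)
    rwa [zero_add] at this
  have hr : ∀ b, h.algebra.r b * PowerSeries.C (hamVar B V) * h.algebra.r b
      ∈ h.algebra.Wt (h.algebra.Cp 0) 2 := fun b =>
    h.mul_hamVar_mul_mem (r_mem b) (fun j => rn_mem b j) (mem_Cp_zero.2 (r_mem b))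
  have hnr : ∀ k b, HasD (nabFam B k * resFam B V b) (-potDeriv B k * resFam B V b
      + nabFam B k * resFam B V b * hamVar B V * resFam B V b) := fun k b =>
    h.hasD_mul_resFam b (h.hasD_nabFam k) (h.locBdd_nabFam_resFam k b)
      fun j => h.locBdd_nabFam_resFam_nabFam k b j
  have hα : ∀ k, -PowerSeries.C (potDeriv B k) ∈ h.algebra.Wt (h.algebra.Cp 0) 2 := fun k =>
    hlin.neg (h.C_potDeriv_mem k)
  rcases hT with f | b | ⟨k, b⟩ | ⟨b, j⟩ | ⟨k, b, j⟩ | b | _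
  case fn hf =>
    obtain ⟨f, ⟨μ, hμ, q, p, G, hμ1, hG, rfl⟩, rfl⟩ := hf
    exact ⟨_, Wt_succ (isLin_Cp 0) (h.C_rayDeriv_mem hμ1 hG q p), (hasD_rayFun hμ1 hG q p |> HasDSer.C)⟩
  · refine ⟨_, hr b, ?_⟩
    have := HasDSer.C (h.hasD_resFam b)
    rwa [map_mul, map_mul] at this
  · refine ⟨-PowerSeries.C (potDeriv B k) * h.algebra.r b
      + h.algebra.n k * h.algebra.r b * PowerSeries.C (hamVar B V) * h.algebra.r b,
      hlin.add _ (hC' (hα k) (r_mem b)) _ (h.mul_hamVar_mul_mem (nr_mem k b)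
        (fun j => nrn_mem k b j) (mem_Cp_zero.2 (r_mem b))), ?_⟩
    have := HasDSer.C (hnr k b)
    rwa [map_add, map_mul, map_mul, map_mul, map_mul, map_mul, map_neg] at this
  · refine ⟨h.algebra.r b * PowerSeries.C (hamVar B V) * (h.algebra.r b * h.algebra.n j)
      + h.algebra.r b * -PowerSeries.C (potDeriv B j),
      hlin.add _ (h.mul_hamVar_mul_mem (r_mem b) (fun j => rn_mem b j)
        (mem_Cp_zero.2 (rn_mem b j))) _ (hC (r_mem b) (hα j)), ?_⟩
    have := HasDSer.C ((h.hasD_resFam b).mul (h.locBdd_resFam b) (h.hasD_nabFam j))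
    rw [map_add, map_mul, map_mul, map_mul, map_mul, map_mul, map_neg] at this
    rw [← mul_assoc]
    exact this
  · refine ⟨-PowerSeries.C (potDeriv B k) * (h.algebra.r b * h.algebra.n j)
      + h.algebra.n k * h.algebra.r b * PowerSeries.C (hamVar B V) * (h.algebra.r b * h.algebra.n j)
      + h.algebra.n k * h.algebra.r b * -PowerSeries.C (potDeriv B j),
      hlin.add _ (hlin.add _ (hC' (hα k) (rn_mem b j)) _ (h.mul_hamVar_mul_mem (nr_mem k b)
        (fun j => nrn_mem k b j) (mem_Cp_zero.2 (rn_mem b j)))) _ (hC (nr_mem k b) (hα j)), ?_⟩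
    have := HasDSer.C ((hnr k b).mul (h.locBdd_nabFam_resFam k b) (h.hasD_nabFam j))
    simp only [add_mul, map_add, map_mul, map_neg] at this
    rw [← mul_assoc, ← mul_assoc]
    exact this
  · have hU : HasD (cayleyFam B V b)
        (-((2 * spectralPt b) • (resFam B V b * hamVar B V * resFam B V b))) := by
      rw [← zero_sub]
      exact (HasD.const 1).sub ((h.hasD_resFam b).smul _)
    refine ⟨_, ?_, hasDSer_geomSeries (h.locBdd_cayleyFam b) hU⟩
    refine hC' (hC (gen_mem (Gen.g b)) (hC (gen_mem Gen.x) ?_)) (gen_mem (Gen.g b))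
    rw [map_neg, C_smul, map_mul, map_mul]
    exact hlin.neg (hlin.smul _ _ (hr b))
  · exact ⟨0, hlin.zero, HasDSer.X⟩

theorem exists_hasDSer (h : FieldData B V) {T : FamSeries d} (hT : T ∈ h.algebra.C) :
    ∃ T' ∈ h.algebra.Wt (h.algebra.Cp 0) 2, HasDSer T T' := by
  have hlin := isLin_Wt (Q := h.algebra) (isLin_Cp (Q := h.algebra) 0) 2
  induction hT using Algebra.adjoin_induction with
  | mem T hT => exact h.exists_hasDSer_of_gen hT
  | algebraMap c => exact ⟨0, hlin.zero, HasDSer.algebraMap c⟩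
  | add S T _ _ ihS ihT =>
    obtain ⟨S', hS', eS⟩ := ihS
    obtain ⟨T', hT', eT⟩ := ihT
    exact ⟨S' + T', hlin.add _ hS' _ hT', eS.add eT⟩
  | mul S T hS hT ihS ihT =>
    obtain ⟨S', hS', eS⟩ := ihS
    obtain ⟨T', hT', eT⟩ := ihT
    refine ⟨_, hlin.add _ ?_ _ ?_, eS.mul (h.serBdd hS) eT⟩
    · have := Wt_Cp_mul hS' (mem_Cp_zero.2 hT)
      rwa [zero_add] at this
    · have := Cp_mul_Wt (mem_Cp_zero.2 hS) hT'
      rwa [zero_add] at this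

theorem exists_hasDSer_Cp (h : FieldData B V) {p : ℕ} {T : FamSeries d} (hT : T ∈ h.algebra.Cp p) :
    ∃ T' ∈ h.algebra.Wt (h.algebra.Cp p) 2, HasDSer T T' := by
  have hlin : ∀ p, IsLin (h.algebra.Wt (h.algebra.Cp p) 2) := fun p =>
    isLin_Wt (Q := h.algebra) (isLin_Cp (Q := h.algebra) p) 2
  have hp : ∀ p : ℕ, ∃ T' ∈ h.algebra.Wt (h.algebra.Cp p) 2, HasDSer (h.algebra.r true ^ p) T' := by
    intro p
    induction p with
    | zero =>
      refine ⟨0, (hlin 0).zero, ?_⟩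
      rw [pow_zero, ← map_one (algebraMap ℂ (FamSeries d))]
      exact HasDSer.algebraMap 1
    | succ p ih =>
      obtain ⟨S', hS', eS⟩ := ih
      have eT := HasDSer.C (h.hasD_resFam true)
      rw [map_mul, map_mul] at eT
      refine ⟨_, (hlin _).add _ (Wt_Cp_mul hS' r_mem_Cp) _ ?_,
        by rw [pow_succ]; exact eS.mul (h.serBdd (mem_C_of_mem_Cp (r_pow_mem_Cp p))) eT⟩
      exact Cp_mul_Wt (r_pow_mem_Cp p) (h.mul_hamVar_mul_mem (r_mem true) (fun j => rn_mem true j)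
        r_mem_Cp)
  obtain ⟨S, hS, rfl⟩ := hT
  obtain ⟨S', hS', eS⟩ := h.exists_hasDSer hS
  obtain ⟨T', hT', eT⟩ := hp p
  refine ⟨_, (hlin _).add _ ?_ _ ?_, eS.mul (h.serBdd hS) eT⟩
  · have := Wt_Cp_mul hS' (r_pow_mem_Cp (Q := h.algebra) p)
    rwa [zero_add] at this
  · have := Cp_mul_Wt (mem_Cp_zero.2 hS) hT'
    rwa [zero_add] at this

theorem exists_hasDSer_Wt (h : FieldData B V) {p a : ℕ} {T : FamSeries d}
    (hT : T ∈ h.algebra.Wt (h.algebra.Cp p) a) :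
    ∃ T' ∈ h.algebra.Wt (h.algebra.Cp p) (a + 2), HasDSer T T' := by
  induction a generalizing T with
  | zero => exact h.exists_hasDSer_Cp hT
  | succ a ih =>
    obtain ⟨T₀, hT₀, T₁, hT₁, rfl⟩ := hT
    obtain ⟨T₀', hT₀', e₀⟩ := ih hT₀
    choose T₁' hT₁' e₁ using fun j => ih (hT₁ j)
    refine ⟨T₀' + ∑ j, T₁' j * h.algebra.z j, ⟨T₀', hT₀', T₁', hT₁', rfl⟩,
      e₀.add (HasDSer.sum _ fun j _ => (e₁ j).mul_const (zOp j))⟩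

theorem exists_hasDSer_seq (h : FieldData B V) {p : ℕ} {T : FamSeries d} (hT : T ∈ h.algebra.Cp p) :
    ∃ S : ℕ → FamSeries d, S 0 = T ∧ ∀ r, S r ∈ h.algebra.Wt (h.algebra.Cp p) (2 * r) ∧
      HasDSer (S r) (S (r + 1)) := by
  choose! F hF e using fun (a : ℕ) (T : FamSeries d)
    (hT : T ∈ h.algebra.Wt (h.algebra.Cp p) a) => h.exists_hasDSer_Wt hT
  have hS : ∀ r, (fun r => Nat.rec T (fun r S => F (2 * r) S) r : ℕ → FamSeries d) r
      ∈ h.algebra.Wt (h.algebra.Cp p) (2 * r) := by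
    intro r
    induction r with
    | zero => exact hT
    | succ r ih => exact hF _ _ ih
  exact ⟨_, rfl, fun r => ⟨hS r, e _ _ (hS r)⟩⟩

end FieldData

/-! ### Weighted estimates -/

/-- The function `Z_j` or `Z_j - W_j`. -/
def letterFun (W : Space d) (c : Fin d ⊕ Fin d) (Z : Space d) : ℂ :=
  Sum.elim (fun j => coord j Z) (fun j => coord j Z - coord j W) c

/-- A product of functions `Z_j` and `Z_j - W_j`. -/
def wordFun (W : Space d) (l : List (Fin d ⊕ Fin d)) (Z : Space d) : ℂ :=
  (l.map fun c => letterFun W c Z).prod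

/-- The number of factors `Z_j`. -/
def leftCount (l : List (Fin d ⊕ Fin d)) : ℕ := l.countP Sum.isLeft

/-- The number of factors `Z_j - W_j`. -/
def rightCount (l : List (Fin d ⊕ Fin d)) : ℕ := l.countP Sum.isRight

theorem letterFun_temperate (W : Space d) (c : Fin d ⊕ Fin d) :
    (letterFun W c).HasTemperateGrowth := by
  rcases c with j | j
  · exact coord_hasTemperateGrowth j
  · exact (coord_hasTemperateGrowth j).sub (Function.HasTemperateGrowth.const _)

theorem wordFun_cons (W : Space d) (c : Fin d ⊕ Fin d) (l : List (Fin d ⊕ Fin d)) :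
    wordFun W (c :: l) = fun Z => wordFun W l Z * letterFun W c Z := by
  ext Z
  simp [wordFun, mul_comm]

theorem wordFun_temperate (W : Space d) (l : List (Fin d ⊕ Fin d)) :
    (wordFun W l).HasTemperateGrowth := by
  induction l with
  | nil => exact Function.HasTemperateGrowth.const 1
  | cons c l ih => rw [wordFun_cons]; exact ih.mul (letterFun_temperate W c)

theorem mulOp_wordFun_cons (W : Space d) (c : Fin d ⊕ Fin d) (l : List (Fin d ⊕ Fin d)) :
    mulOp (wordFun W (c :: l)) = mulOp (wordFun W l) * mulOp (letterFun W c) := by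
  rw [wordFun_cons, mulOp_mul (wordFun_temperate W l) (letterFun_temperate W c)]

theorem mulOp_wordFun_nil (W : Space d) : mulOp (wordFun W []) = 1 := by
  have : wordFun W [] = fun _ => (1 : ℂ) := rfl
  rw [this, mulOp_const, one_smul]

/-- The constant `W_j` is central and disappears from the commutator. All estimates are therefore
uniform in `W`. -/
theorem ad_letterFun (W : Space d) (c : Fin d ⊕ Fin d) (T : Op d) :
    ad (mulOp (letterFun W c)) T = ad (zOp (Sum.elim id id c)) T := by
  rcases c with j | j
  · rfl
  · have : mulOp (letterFun W (Sum.inr j)) = zOp j - coord j W • (1 : Op d) := by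
      rw [← mulOp_const, zOp, mulOp_sub (coord_hasTemperateGrowth j)
        (Function.HasTemperateGrowth.const _)]
      rfl
    rw [this]
    simp only [ad, sub_mul, mul_sub, smul_mul_assoc, mul_smul_comm, one_mul, mul_one, Sum.elim_inr,
      id]
    abel

/-- Products of covariant derivatives. -/
def nabWord (B : Fin d → Fin d → Space d → ℂ) (J : List (Fin d)) : Fam d :=
  (J.map (nabFam B)).prod

/-- The weighted bounds of the coefficients of a power series. -/
def WordBdd (B : Fin d → Fin d → Space d → ℂ) (V : Space d → ℂ) (T₀ : ℝ) (k : ℕ) (J : List (Fin d))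
    (a : ℕ) (l : List (Fin d ⊕ Fin d)) (T : FamSeries d) : Prop :=
  ∃ (C : ℝ) (q : ℕ), 0 ≤ C ∧ ∀ (n : ℕ) (i : Space d × ℝ), |i.2| ≤ T₀ → ∀ (W : Space d) (u : SpaceS d)
    (K : ℝ), (∀ l', leftCount l' ≤ leftCount l + a → rightCount l' ≤ rightCount l →
      ‖toL2 ((resFam B V true ^ k) i (mulOp (wordFun W l') u))‖ ≤ K) →
    ‖toL2 (nabWord B J i (mulOp (wordFun W l) (PowerSeries.coeff n T i u)))‖ ≤ C * (1 + n) ^ q * K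

namespace WordBdd

variable {B : Fin d → Fin d → Space d → ℂ} {V : Space d → ℂ} {T₀ : ℝ} {k : ℕ} {J : List (Fin d)}
  {a : ℕ} {l : List (Fin d ⊕ Fin d)} {S T : FamSeries d}

theorem add (hS : WordBdd B V T₀ k J a l S) (hT : WordBdd B V T₀ k J a l T) :
    WordBdd B V T₀ k J a l (S + T) := by
  obtain ⟨C, q, hC0, hC⟩ := hS
  obtain ⟨C', q', hC0', hC'⟩ := hT
  refine ⟨C + C', max q q', by positivity, fun n i hi W u K hK => ?_⟩
  have h1 : (1 : ℝ) ≤ 1 + n := by simp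
  have hK0 : 0 ≤ K := (norm_nonneg _).trans (hK [] (by simp [leftCount]) (by simp [rightCount]))
  rw [map_add, Pi.add_apply, LinearMap.add_apply, map_add, map_add, map_add]
  refine (norm_add_le _ _).trans ((add_le_add (hC n i hi W u K hK) (hC' n i hi W u K hK)).trans ?_)
  rw [add_mul, add_mul]
  gcongr
  · exact le_max_left _ _
  · exact le_max_right _ _

theorem zero : WordBdd B V T₀ k J a l 0 :=
  ⟨0, 0, le_rfl, fun n i _ W u K _ => by simp⟩

theorem sum {κ : Type*} (s : Finset κ) {T : κ → FamSeries d}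
    (h : ∀ j ∈ s, WordBdd B V T₀ k J a l (T j)) : WordBdd B V T₀ k J a l (∑ j ∈ s, T j) := by
  classical
  induction s using Finset.induction_on with
  | empty => simpa using zero
  | insert j s hj ih =>
    rw [Finset.sum_insert hj]
    exact (h j (by simp)).add (ih fun l hl => h l (by simp [hl]))

theorem succ (hT : WordBdd B V T₀ k J a l T) : WordBdd B V T₀ k J (a + 1) l T := by
  obtain ⟨C, q, hC0, hC⟩ := hT
  exact ⟨C, q, hC0, fun n i hi W u K hK => hC n i hi W u K fun l' h1 h2 => hK l' (by omega) h2⟩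

theorem mul_z (hT : WordBdd B V T₀ k J a l T) (j : Fin d) :
    WordBdd B V T₀ k J (a + 1) l (T * PowerSeries.C fun _ => zOp j) := by
  obtain ⟨C, q, hC0, hC⟩ := hT
  refine ⟨C, q, hC0, fun n i hi W u K hK => ?_⟩
  rw [PowerSeries.coeff_mul_C]
  refine hC n i hi W (zOp j u) K fun l' h1 h2 => ?_
  have := hK (Sum.inl j :: l') (by simp only [leftCount, List.countP_cons] at *; simp; omega)
    (by simpa [rightCount, List.countP_cons] using h2)
  rwa [mulOp_wordFun_cons] at this

/-- The letter next to the operator is moved across it. Either it reaches `u`, where it counts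
towards the weights allowed there, or it is consumed in a commutator, which by assumption satisfies
the bound for the shorter word. -/
theorem cons (c : Fin d ⊕ Fin d) (hT : WordBdd B V T₀ k J 0 l T)
    (hT' : WordBdd B V T₀ k J 0 l (ad (PowerSeries.C fun _ => zOp (Sum.elim id id c)) T)) :
    WordBdd B V T₀ k J 0 (c :: l) T := by
  obtain ⟨C, q, hC0, hC⟩ := hT
  obtain ⟨C', q', hC0', hC'⟩ := hT'
  refine ⟨C + C', max q q', by positivity, fun n i hi W u K hK => ?_⟩
  have h1 : (1 : ℝ) ≤ 1 + n := by simp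
  have hK0 : 0 ≤ K := (norm_nonneg _).trans (hK [] (by simp [leftCount]) (by simp [rightCount]))
  have hl : leftCount (c :: l) = leftCount l + (if c.isLeft then 1 else 0) := List.countP_cons
  have hr : rightCount (c :: l) = rightCount l + (if c.isRight then 1 else 0) := List.countP_cons
  have b1 := hC n i hi W (mulOp (letterFun W c) u) K fun l' h1 h2 => by
    have hl' : leftCount (c :: l') = leftCount l' + (if c.isLeft then 1 else 0) := List.countP_cons
    have hr' : rightCount (c :: l') = rightCount l' + (if c.isRight then 1 else 0) :=
      List.countP_cons
    have := hK (c :: l') (by omega) (by omega)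
    rwa [mulOp_wordFun_cons] at this
  have b2 := hC' n i hi W u K fun l' h1 h2 => hK l' (by omega) (by omega)
  have e : PowerSeries.coeff n (ad (PowerSeries.C fun _ => zOp (Sum.elim id id c)) T) i
      = ad (mulOp (letterFun W c)) (PowerSeries.coeff n T i) := by
    rw [ad_letterFun, ad, map_sub, PowerSeries.coeff_C_mul, PowerSeries.coeff_mul_C]
    rfl
  have e2 : mulOp (wordFun W (c :: l)) (PowerSeries.coeff n T i u)
      = mulOp (wordFun W l) (PowerSeries.coeff n T i (mulOp (letterFun W c) u))
        + mulOp (wordFun W l)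
          (PowerSeries.coeff n (ad (PowerSeries.C fun _ => zOp (Sum.elim id id c)) T) i u) := by
    rw [e, ← map_add, mulOp_wordFun_cons, Module.End.mul_apply, ad, LinearMap.sub_apply,
      Module.End.mul_apply, Module.End.mul_apply]
    congr 1
    abel
  rw [e2, map_add, map_add]
  refine (norm_add_le _ _).trans ((add_le_add b1 b2).trans ?_)
  rw [add_mul, add_mul]
  gcongr
  · exact le_max_left _ _
  · exact le_max_right _ _

end WordBdd

-- Once the weights are commuted away, the operator is `S r^p` with `p ≥ |J| + k`. The last `k`
-- resolvents are kept for `u`, and enough of the others remain to absorb the word `J` and leave an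
-- element of `C`, which has polynomially bounded coefficients. Positions on the right of the
-- operator only add weights on `u`.
open MagneticAlgebra in
theorem FieldData.wordBdd {B : Fin d → Fin d → Space d → ℂ} {V : Space d → ℂ} (h : FieldData B V)
    (T₀ : ℝ) {p k : ℕ} {J : List (Fin d)} (hp : J.length + k ≤ p) {a : ℕ}
    (l : List (Fin d ⊕ Fin d)) {T : FamSeries d} (hT : T ∈ h.algebra.Wt (h.algebra.Cp p) a) :
    WordBdd B V T₀ k J a l T := by
  induction a generalizing T with
  | zero =>
    induction l generalizing T with
    | nil =>
      obtain ⟨S, hS, hTe⟩ := hT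
      obtain ⟨m, rfl⟩ := Nat.exists_eq_add_of_le hp
      obtain ⟨Y, hY⟩ : ∃ Y, Y = (J.map h.algebra.n).prod * (S * h.algebra.r true ^ (m + J.length)) :=
        ⟨_, rfl⟩
      have hYC : Y ∈ h.algebra.C := by
        rw [hY]; exact mem_C_of_mem_Cp (list_prod_mul_mem_Cp J ⟨S, hS, rfl⟩)
      obtain ⟨C, q, hC0, hC⟩ := h.serBdd hYC T₀
      refine ⟨C, q, hC0, fun n i hi W u K hK => ?_⟩
      have e1 : (J.map h.algebra.n).prod = PowerSeries.C (nabWord B J) := by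
        rw [nabWord, map_list_prod, List.map_map]; rfl
      have e2 : PowerSeries.C (nabWord B J) * T = Y * PowerSeries.C (resFam B V true ^ k) := by
        rw [hY, hTe, ← e1, map_pow, mul_assoc, mul_assoc]
        change _ = _ * (S * (h.algebra.r true ^ _ * h.algebra.r true ^ k))
        rw [← pow_add]
        congr 3
        ring
      have e3 := congrArg (fun X : FamSeries d => PowerSeries.coeff n X i u) e2
      simp only [PowerSeries.coeff_C_mul, PowerSeries.coeff_mul_C, Pi.mul_apply,
        Module.End.mul_apply] at e3
      rw [mulOp_wordFun_nil, Module.End.one_apply, e3]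
      have h3 := hK [] (by simp) (by simp)
      rw [mulOp_wordFun_nil, Module.End.one_apply] at h3
      refine (hC n i hi _).trans ?_
      gcongr
    | cons c l ih => exact (ih hT).cons c (ih ((good_z _).ad_mem_Cp hT))
  | succ a ih =>
    obtain ⟨S, hS, T', hT', rfl⟩ := hT
    exact (ih hS).succ.add (WordBdd.sum _ fun j _ => (ih (hT' j)).mul_z j)

end

end MagneticSchrodinger

namespace MagneticSchrodinger

noncomputable section

variable {d : ℕ}

/-! ### The series for functions of the Schrödinger operator -/

/-- The coefficients of two power series as a family with indices in `ℤ`. -/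
def zCoeff (S T : FamSeries d) : ℤ → Fam d
  | Int.ofNat n => PowerSeries.coeff n S
  | Int.negSucc n => PowerSeries.coeff (n + 1) T

theorem HasDSer.zCoeff {S S' T T' : FamSeries d} (hS : HasDSer S S') (hT : HasDSer T T') (n : ℤ) :
    HasD (zCoeff S T n) (zCoeff S' T' n) := by
  cases n with
  | ofNat n => exact hS n
  | negSucc n => exact hT (n + 1)

theorem WordBdd.zCoeff {B : Fin d → Fin d → Space d → ℂ} {V : Space d → ℂ} {T₀ : ℝ} {k : ℕ}
    {J : List (Fin d)} {a : ℕ} {l : List (Fin d ⊕ Fin d)} {S T : FamSeries d}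
    (hS : WordBdd B V T₀ k J a l S) (hT : WordBdd B V T₀ k J a l T) :
    ∃ (C : ℝ) (q : ℕ), 0 ≤ C ∧ ∀ (n : ℤ) (i : Space d × ℝ), |i.2| ≤ T₀ → ∀ (W : Space d)
      (u : SpaceS d) (K : ℝ), (∀ l', leftCount l' ≤ leftCount l + a → rightCount l' ≤ rightCount l →
        ‖toL2 ((resFam B V true ^ k) i (mulOp (wordFun W l') u))‖ ≤ K) →
      ‖toL2 (nabWord B J i (mulOp (wordFun W l) (MagneticSchrodinger.zCoeff S T n i u)))‖
        ≤ C * (1 + |(n : ℝ)|) ^ q * K := by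
  obtain ⟨C, q, hC0, hC⟩ := hS
  obtain ⟨C', q', hC0', hC'⟩ := hT
  refine ⟨C + C', max q q', by positivity, fun n i hi W u K hK => ?_⟩
  have hK0 : 0 ≤ K := (norm_nonneg _).trans (hK [] (by simp [leftCount]) (by simp [rightCount]))
  cases n with
  | ofNat n =>
    have h1 : (1 : ℝ) ≤ 1 + n := by simp
    have e : |((Int.ofNat n : ℤ) : ℝ)| = n := by simp
    rw [e]
    refine (hC n i hi W u K hK).trans ?_
    gcongr
    · linarith
    · exact le_max_left _ _
  | negSucc n =>
    have h1 : (1 : ℝ) ≤ 1 + ((n + 1 : ℕ) : ℝ) := le_add_of_nonneg_right (Nat.cast_nonneg _)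
    have e : |((Int.negSucc n : ℤ) : ℝ)| = (n + 1 : ℕ) := by
      rw [Int.cast_negSucc, abs_neg, Nat.abs_cast]
    rw [e]
    refine (hC' (n + 1) i hi W u K hK).trans ?_
    gcongr
    · linarith
    · exact le_max_right _ _

theorem exists_word_bound (u : SpaceS d) (m : ℕ) : ∃ K : ℝ, ∀ l : List (Fin d ⊕ Fin d),
    leftCount l ≤ m → rightCount l ≤ 0 → ‖toL2 (mulOp (wordFun 0 l) u)‖ ≤ K := by
  have hf := List.finite_length_le (Fin d ⊕ Fin d) m
  refine ⟨∑ l ∈ hf.toFinset, ‖toL2 (mulOp (wordFun 0 l) u)‖, fun l h1 h2 => ?_⟩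
  refine Finset.single_le_sum (f := fun l => ‖toL2 (mulOp (wordFun 0 l) u)‖)
    (fun _ _ => norm_nonneg _) ?_
  have h3 : ∀ l : List (Fin d ⊕ Fin d), l.length = leftCount l + rightCount l := by
    intro l
    induction l with
    | nil => rfl
    | cons c l ih =>
      rw [leftCount, rightCount, List.countP_cons, List.countP_cons, List.length_cons, ih]
      rcases c with c | c <;> simp [leftCount, rightCount] <;> omega
  simp only [Set.Finite.mem_toFinset, mem_ofPred_eq]
  rw [h3]; omega

section series

variable {B : Fin d → Fin d → Space d → ℂ} {V : Space d → ℂ}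

/-- The sum of the series with coefficients `c`. -/
def zSum (c : ℤ → ℂ) (S T : FamSeries d) (x₀ : Space d) (u : SpaceS d) (t : ℝ) : L2 d :=
  ∑' n, c n • toL2 (zCoeff S T n (x₀, t) u)

theorem FieldData.exists_zCoeff_bound (h : FieldData B V) {p a : ℕ} {S T : FamSeries d}
    (hS : S ∈ h.algebra.Wt (h.algebra.Cp p) a) (hT : T ∈ h.algebra.Wt (h.algebra.Cp p) a)
    (T₀ : ℝ) (u : SpaceS d) : ∃ (C : ℝ) (q : ℕ), ∀ (n : ℤ) (i : Space d × ℝ), |i.2| ≤ T₀ →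
      ‖toL2 (zCoeff S T n i u)‖ ≤ C * (1 + |(n : ℝ)|) ^ q := by
  obtain ⟨K, hK⟩ := exists_word_bound u a
  obtain ⟨C, q, hC0, hC⟩ := WordBdd.zCoeff (k := 0) (J := []) (l := [])
    (h.wordBdd T₀ (by simp) [] hS) (h.wordBdd T₀ (by simp) [] hT)
  refine ⟨C * K, q, fun n i hi => ?_⟩
  have := hC n i hi 0 u K fun l h1 h2 => by
    rw [pow_zero, Pi.one_apply, Module.End.one_apply]
    exact hK l (by simpa [leftCount] using h1) (by simpa [rightCount] using h2)
  rw [mulOp_wordFun_nil] at this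
  refine le_trans (le_of_eq ?_) (this.trans_eq (by ring))
  simp [nabWord]

theorem FieldData.summable_zCoeff (h : FieldData B V) {p a : ℕ} {S T : FamSeries d}
    (hS : S ∈ h.algebra.Wt (h.algebra.Cp p) a) (hT : T ∈ h.algebra.Wt (h.algebra.Cp p) a)
    {c : ℤ → ℂ} (hc : ∀ k : ℕ, Summable fun n : ℤ => (1 + |(n : ℝ)|) ^ k * ‖c n‖) (x₀ : Space d)
    (u : SpaceS d) (t : ℝ) : Summable fun n => c n • toL2 (zCoeff S T n (x₀, t) u) := by
  obtain ⟨C, q, hC⟩ := h.exists_zCoeff_bound hS hT |t| u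
  refine Summable.of_norm_bounded ((hc q).mul_left C) fun n => ?_
  rw [norm_smul, mul_comm]
  refine (mul_le_mul_of_nonneg_right (hC n (x₀, t) le_rfl) (norm_nonneg _)).trans_eq (by ring)

/-- Termwise differentiation: the differentiated terms grow polynomially in `n`, locally uniformly
in `t`, while the coefficients decay faster than any power. -/
theorem FieldData.hasDerivAt_zSum (h : FieldData B V) {p a a' : ℕ} {S T S' T' : FamSeries d}
    (hS : S ∈ h.algebra.Wt (h.algebra.Cp p) a) (hT : T ∈ h.algebra.Wt (h.algebra.Cp p) a)
    (hS' : S' ∈ h.algebra.Wt (h.algebra.Cp p) a') (hT' : T' ∈ h.algebra.Wt (h.algebra.Cp p) a')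
    (hdS : HasDSer S S') (hdT : HasDSer T T')
    {c : ℤ → ℂ} (hc : ∀ k : ℕ, Summable fun n : ℤ => (1 + |(n : ℝ)|) ^ k * ‖c n‖) (x₀ : Space d)
    (u : SpaceS d) (t : ℝ) : HasDerivAt (zSum c S T x₀ u) (zSum c S' T' x₀ u t) t := by
  obtain ⟨C, q, hC⟩ := h.exists_zCoeff_bound hS' hT' (|t| + 1) u
  have hmem : t ∈ Ioo (-(|t| + 1)) (|t| + 1) :=
    ⟨by linarith [neg_abs_le t], by linarith [le_abs_self t]⟩
  refine hasDerivAt_tsum_of_isPreconnected ((hc q).mul_left C) isOpen_Ioo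
    isPreconnected_Ioo (g := fun n s => c n • toL2 (zCoeff S T n (x₀, s) u))
    (g' := fun n s => c n • toL2 (zCoeff S' T' n (x₀, s) u))
    (fun n s _ => (hdS.zCoeff hdT n x₀ s u).fun_const_smul (c n)) (fun n s hs => ?_) hmem
    (h.summable_zCoeff hS hT hc x₀ u t) hmem
  rw [norm_smul, mul_comm]
  refine (mul_le_mul_of_nonneg_right (hC n (x₀, s) (abs_le.2 ⟨hs.1.le, hs.2.le⟩))
    (norm_nonneg _)).trans_eq (by ring)

open MagneticAlgebra in
/-- Functions of the rescaled Schrödinger operator and their derivatives in `t` as series. -/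
theorem FieldData.exists_series (h : FieldData B V) (p : ℕ) : ∃ S T : ℕ → FamSeries d,
    (∀ r, S r ∈ h.algebra.Wt (h.algebra.Cp p) (2 * r)) ∧
    (∀ r, T r ∈ h.algebra.Wt (h.algebra.Cp p) (2 * r)) ∧
    (∀ r, HasDSer (S r) (S (r + 1))) ∧ (∀ r, HasDSer (T r) (T (r + 1))) ∧
    ∀ n i, zCoeff (S 0) (T 0) n i = cayleyTerm (resOp (rayPot B i) (rayElec V i) Complex.I)
      (resOp (rayPot B i) (rayElec V i) (-Complex.I)) n
        * resOp (rayPot B i) (rayElec V i) Complex.I ^ p := by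
  have hmem : ∀ b, h.algebra.g b * h.algebra.r true ^ p ∈ h.algebra.Cp p := fun b =>
    ⟨_, gen_mem (Gen.g b), rfl⟩
  obtain ⟨S, hS0, hS⟩ := h.exists_hasDSer_seq (hmem true)
  obtain ⟨T, hT0, hT⟩ := h.exists_hasDSer_seq (hmem false)
  refine ⟨S, T, fun r => (hS r).1, fun r => (hT r).1, fun r => (hS r).2, fun r => (hT r).2,
    fun n i => ?_⟩
  have key : ∀ b (n : ℕ), PowerSeries.coeff n (h.algebra.g b * h.algebra.r true ^ p)
      = cayleyFam B V b ^ n * resFam B V true ^ p := fun b n => by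
    change PowerSeries.coeff n (geomSeries (cayleyFam B V b) * PowerSeries.C (resFam B V true) ^ p) = _
    rw [← map_pow, PowerSeries.coeff_mul_C, geomSeries, PowerSeries.coeff_mk]
  cases n with
  | ofNat n =>
    simp only [zCoeff, hS0, key, cayleyTerm]
    rfl
  | negSucc n =>
    simp only [zCoeff, hT0, key, cayleyTerm, Pi.mul_apply, Pi.pow_apply]
    congr 2
    simp [cayleyFam, spectralPt, resFam]

end series

theorem iteratedDeriv_eq_of_hasDerivAt {E : Type*} [NormedAddCommGroup E] [NormedSpace ℝ E]
    {F : ℕ → ℝ → E} (h : ∀ r t, HasDerivAt (F r) (F (r + 1) t) t) (r : ℕ) :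
    iteratedDeriv r (F 0) = F r := by
  induction r with
  | zero => exact iteratedDeriv_zero
  | succ r ih =>
    rw [iteratedDeriv_succ, ih]
    exact funext fun t => (h r t).deriv

theorem contDiff_of_hasDerivAt {E : Type*} [NormedAddCommGroup E] [NormedSpace ℝ E]
    {F : ℕ → ℝ → E} (h : ∀ r t, HasDerivAt (F r) (F (r + 1) t) t) : ContDiff ℝ ∞ (F 0) :=
  contDiff_of_differentiable_iteratedDeriv fun r _ => by
    rw [iteratedDeriv_eq_of_hasDerivAt h]
    exact fun t => (h r t).differentiableAt

/-- The series makes sense and is smooth for all real `t`, including `0`. It represents the function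
of the operator when `t ≠ 0`, where the factor `t⁻¹` cancels the `t` from the linear factor of the
potential. -/
theorem functionOf_rescaledOp_eq {A : Fin d → Space d → ℝ} {V : Space d → ℝ}
    (h : FieldData (cxField A) (fun x => (V x : ℂ))) (φ : 𝓢(ℝ, ℂ)) {p : ℕ} {S T : FamSeries d}
    (hST : ∀ n i, zCoeff S T n i = cayleyTerm
      (resOp (rayPot (cxField A) i) (rayElec (fun x => (V x : ℂ)) i) Complex.I)
      (resOp (rayPot (cxField A) i) (rayElec (fun x => (V x : ℂ)) i) (-Complex.I)) n
        * resOp (rayPot (cxField A) i) (rayElec (fun x => (V x : ℂ)) i) Complex.I ^ p)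
    (x₀ : Space d) {t : ℝ} (ht : t ≠ 0) {u : Space d → ℂ} (hu : IsTest u) :
    functionOf φ (rescaledOp A V x₀ t) hu.toL2
      = zSum (angularCoeff (twist p φ)) S T x₀ hu.schwartz t := by
  have hadm := h.admissible (x₀, t)
  rw [← cxPot_rescaledPotential A x₀ ht, ← cxFun_rescaled V x₀ t] at hadm
  have h1 := (hasSum_functionOf_schrodingerOp hadm φ p hu.schwartz).tsum_eq
  rw [rescaledOp, ← toL2_schwartz, ← h1, zSum]
  congr 1
  ext1 n
  rw [hST, cxPot_rescaledPotential A x₀ ht, cxFun_rescaled V x₀ t, Module.End.mul_apply]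

end

end MagneticSchrodinger

namespace MagneticSchrodinger

noncomputable section

variable {d : ℕ}

/-! ### Weak derivatives and Sobolev norms -/

theorem inner_toL2_left (ψ : SpaceS d) (f : L2 d) :
    inner ℂ (toL2 ψ) f = ∫ Z, f Z * conj (ψ Z) := by
  rw [L2.inner_def]
  refine integral_congr_ae ?_
  filter_upwards [toL2_ae ψ] with Z hZ
  rw [hZ, RCLike.inner_apply]

theorem inner_toL2_test {v : Space d → ℂ} (hv : IsTest v) (f : L2 d) :
    inner ℂ (toL2 hv.schwartz) f = ∫ Z, f Z * conj (v Z) := inner_toL2_left hv.schwartz f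

theorem enorm_toL2 (u : SpaceS d) : ‖toL2 u‖ₑ = ENNReal.ofReal ‖toL2 u‖ :=
  (ofReal_norm _).symm

section potential

variable {B : Fin d → Fin d → Space d → ℂ} {V : Space d → ℂ} {a : Fin d → Space d → ℝ}
  {i : Space d × ℝ}

theorem FieldData.inner_nabWord (h : FieldData B V) (J : List (Fin d)) (u w : SpaceS d) :
    inner ℂ (toL2 (nabWord B J.reverse i u)) (toL2 w) = inner ℂ (toL2 u) (toL2 (nabWord B J i w)) := by
  induction J generalizing u with
  | nil => rfl
  | cons j J ih =>
    have e1 : nabWord B (j :: J).reverse i u = nabWord B J.reverse i (nabOp (rayPot B i) j u) := by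
      simp [nabWord, nabFam]
    have e2 : nabWord B (j :: J) i w = nabOp (rayPot B i) j (nabWord B J i w) := by
      simp [nabWord, nabFam]
    rw [e1, e2, ih, inner_nabOp (h.admissible i).temperate (h.admissible i).real]

theorem FieldData.coe_nabWord (h : FieldData B V) (ha : cxPot a = rayPot B i) (J : List (Fin d))
    (u : SpaceS d) : (nabWord B J i u : Space d → ℂ) = nablaList a J u := by
  have hat := (h.admissible i).temperate
  rw [← ha] at hat
  induction J with
  | nil => rfl
  | cons j J ih =>
    have e2 : nabWord B (j :: J) i u = nabOp (cxPot a) j (nabWord B J i u) := by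
      simp [nabWord, nabFam, ha]
    rw [e2, coe_nabOp hat, ih]
    rfl

/-- The weak derivative of a Schwartz function. -/
theorem FieldData.isWeakNabla (h : FieldData B V) (ha : cxPot a = rayPot B i) (J : List (Fin d))
    (u : SpaceS d) : IsWeakNabla a J u (toL2 (nabWord B J i u)) := fun v hv => by
  rw [← inner_toL2_test hv, ← h.inner_nabWord, inner_toL2_left]
  refine integral_congr_ae ?_
  filter_upwards [toL2_ae u] with Z hZ
  rw [hZ, h.coe_nabWord ha]
  rfl

theorem FieldData.nablaNorm_le (h : FieldData B V) (ha : cxPot a = rayPot B i) (J : List (Fin d))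
    (u : SpaceS d) : nablaNorm a J u ≤ ‖toL2 (nabWord B J i u)‖ₑ :=
  iInf₂_le _ (h.isWeakNabla ha J u)

end potential

variable {a : Fin d → Space d → ℝ}

/-- Any competitor `w` in the infimum, tested against `v` itself, satisfies `⟨v, v⟩ = ⟨v, w⟩`.
Cauchy–Schwarz suffices, without uniqueness of weak derivatives. -/
theorem enorm_le_nablaNorm_nil {v : Space d → ℂ} (hv : IsTest v) :
    ‖toL2 hv.schwartz‖ₑ ≤ nablaNorm a [] v := by
  refine le_iInf₂ fun w hw => ?_
  have h1 := hw v hv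
  rw [← inner_toL2_test hv] at h1
  have h2 : inner ℂ (toL2 hv.schwartz) (toL2 hv.schwartz) = inner ℂ (toL2 hv.schwartz) w := by
    rw [← h1, inner_toL2_test hv]
    refine integral_congr_ae ?_
    filter_upwards [toL2_ae hv.schwartz] with Z hZ
    rw [hZ]
    rfl
  have h3 : ‖toL2 hv.schwartz‖ * ‖toL2 hv.schwartz‖ ≤ ‖toL2 hv.schwartz‖ * ‖w‖ := by
    calc ‖toL2 hv.schwartz‖ * ‖toL2 hv.schwartz‖
        = ‖inner ℂ (toL2 hv.schwartz) (toL2 hv.schwartz)‖ := by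
          rw [inner_self_eq_norm_sq_to_K]; simp [sq]
      _ ≤ _ := by rw [h2]; exact norm_inner_le_norm _ _
  rcases (norm_nonneg (toL2 hv.schwartz)).eq_or_lt with h0 | h0
  · rw [← ofReal_norm, ← h0]; simp
  · rw [← ofReal_norm, ← ofReal_norm]
    exact ENNReal.ofReal_le_ofReal (le_of_mul_le_mul_left h3 h0)

theorem rpow_half_sq (x : ℝ≥0∞) : (x ^ 2) ^ (1 / 2 : ℝ) = x := by
  rw [← ENNReal.rpow_natCast, ← ENNReal.rpow_mul]; norm_num

theorem enorm_le_sobolevNormNat {v : Space d → ℂ} (hv : IsTest v) (m : ℕ) :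
    ‖toL2 hv.schwartz‖ₑ ≤ sobolevNormNat a m v := by
  rw [← rpow_half_sq ‖toL2 hv.schwartz‖ₑ, sobolevNormNat]
  refine ENNReal.rpow_le_rpow ?_ (by norm_num)
  calc ‖toL2 hv.schwartz‖ₑ ^ 2 ≤ nablaNorm a (List.ofFn (Fin.elim0 : Fin 0 → Fin d)) v ^ 2 := by
        gcongr
        exact enorm_le_nablaNorm_nil hv
    _ ≤ ∑ J : Fin 0 → Fin d, nablaNorm a (List.ofFn J) v ^ 2 :=
        Finset.single_le_sum (f := fun J : Fin 0 → Fin d => nablaNorm a (List.ofFn J) v ^ 2)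
          (fun _ _ => zero_le) (Finset.mem_univ _)
    _ ≤ _ := Finset.single_le_sum
          (f := fun ℓ => ∑ J : Fin ℓ → Fin d, nablaNorm a (List.ofFn J) v ^ 2)
          (fun _ _ => zero_le) (Finset.mem_range.2 (Nat.succ_pos m))

/-- The number of words of length at most `m`. -/
def wordCount (d m : ℕ) : ℕ := ∑ l ∈ Finset.range (m + 1), d ^ l

theorem sobolevNormNat_le {f : Space d → ℂ} {m : ℕ} {X : ℝ≥0∞}
    (h : ∀ J : List (Fin d), J.length ≤ m → nablaNorm a J f ≤ X) :
    sobolevNormNat a m f ≤ wordCount d m * X := by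
  rw [← rpow_half_sq (wordCount d m * X), sobolevNormNat]
  refine ENNReal.rpow_le_rpow ?_ (by norm_num)
  calc ∑ l ∈ Finset.range (m + 1), ∑ J : Fin l → Fin d, nablaNorm a (List.ofFn J) f ^ 2
      ≤ ∑ l ∈ Finset.range (m + 1), ∑ _J : Fin l → Fin d, X ^ 2 := by
        gcongr with l hl J
        refine h _ ?_
        rw [List.length_ofFn]
        exact Nat.lt_succ_iff.1 (Finset.mem_range.1 hl)
    _ = (wordCount d m : ℝ≥0∞) * X ^ 2 := by
        simp [wordCount, Finset.sum_mul]
    _ ≤ (wordCount d m : ℝ≥0∞) ^ 2 * X ^ 2 := by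
        gcongr
        exact_mod_cast Nat.le_self_pow two_ne_zero _
    _ = _ := (mul_pow _ _ _).symm

/-- For negative order only the empty word matters: the Sobolev norms of positive order dominate the
`L²` norm on test functions, so the dual norm is at most the `L²` norm. The added `1` keeps the
common constant at least one. -/
theorem sobolevNorm_le {f : Space d → ℂ} {m : ℤ} {X : ℝ≥0∞}
    (h : ∀ J : List (Fin d), J.length ≤ m.toNat → ∃ w : L2 d, IsWeakNabla a J f w ∧ ‖w‖ₑ ≤ X) :
    sobolevNorm a m f ≤ (wordCount d m.toNat + 1 : ℕ) * X := by
  cases m with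
  | ofNat m =>
    refine (sobolevNormNat_le fun J hJ => ?_).trans (mul_le_mul_left (by exact_mod_cast Nat.le_succ _) X)
    obtain ⟨w, hw, hX⟩ := h J hJ
    exact (iInf₂_le w hw).trans hX
  | negSucc m =>
    obtain ⟨w, hw, hX⟩ := h [] (by simp)
    have h1 : sobolevNorm a (Int.negSucc m) f ≤ X := by
      refine iSup₂_le fun v hv => ENNReal.div_le_of_le_mul ?_
      have h2 : ∫ Z, f Z * conj (v Z) = _ := hw v hv
      rw [h2, ← inner_toL2_test hv]
      calc ‖inner ℂ (toL2 hv.schwartz) w‖ₑ ≤ ‖w‖ₑ * ‖toL2 hv.schwartz‖ₑ := by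
            rw [← ofReal_norm, ← ofReal_norm, ← ofReal_norm, ← ENNReal.ofReal_mul (norm_nonneg _)]
            exact ENNReal.ofReal_le_ofReal ((norm_inner_le_norm _ _).trans_eq (mul_comm _ _))
        _ ≤ _ := by gcongr; exact enorm_le_sobolevNormNat hv (m + 1)
    refine h1.trans ?_
    calc X = 1 * X := (one_mul X).symm
      _ ≤ _ := by gcongr; exact_mod_cast Nat.succ_pos _

/-! ### Monomials -/

theorem leftCount_append (l l' : List (Fin d ⊕ Fin d)) :
    leftCount (l ++ l') = leftCount l + leftCount l' := List.countP_append

theorem rightCount_append (l l' : List (Fin d ⊕ Fin d)) :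
    rightCount (l ++ l') = rightCount l + rightCount l' := List.countP_append

theorem wordFun_append (W Z : Space d) (l l' : List (Fin d ⊕ Fin d)) :
    wordFun W (l ++ l') Z = wordFun W l Z * wordFun W l' Z := by
  simp [wordFun]

theorem leftCount_replicate (n : ℕ) (c : Fin d ⊕ Fin d) :
    leftCount (List.replicate n c) = if c.isLeft then n else 0 := by
  simp [leftCount, List.countP_replicate]

theorem rightCount_replicate (n : ℕ) (c : Fin d ⊕ Fin d) :
    rightCount (List.replicate n c) = if c.isRight then n else 0 := by
  simp [rightCount, List.countP_replicate]

theorem wordFun_replicate (W Z : Space d) (n : ℕ) (c : Fin d ⊕ Fin d) :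
    wordFun W (List.replicate n c) Z = letterFun W c Z ^ n := by
  simp [wordFun]

theorem exists_word_monomial (α β : Fin d → ℕ) : ∃ l : List (Fin d ⊕ Fin d),
    leftCount l = ∑ j, α j ∧ rightCount l = ∑ j, β j ∧
      ∀ W Z, wordFun W l Z = (monomial α Z : ℂ) * (monomial β (Z - W) : ℂ) := by
  have key : ∀ s : Finset (Fin d), ∃ l : List (Fin d ⊕ Fin d),
      leftCount l = ∑ j ∈ s, α j ∧ rightCount l = ∑ j ∈ s, β j ∧
      ∀ W Z, wordFun W l Z = (∏ j ∈ s, letterFun W (Sum.inl j) Z ^ α j)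
        * ∏ j ∈ s, letterFun W (Sum.inr j) Z ^ β j := by
    intro s
    classical
    induction s using Finset.induction_on with
    | empty => exact ⟨[], rfl, rfl, fun W Z => by simp [wordFun]⟩
    | insert j s hj ih =>
      obtain ⟨l, h1, h2, h3⟩ := ih
      refine ⟨List.replicate (α j) (Sum.inl j) ++ (List.replicate (β j) (Sum.inr j) ++ l), ?_, ?_,
        fun W Z => ?_⟩
      · simp [leftCount_append, leftCount_replicate, h1, Finset.sum_insert hj]
      · simp [rightCount_append, rightCount_replicate, h2, Finset.sum_insert hj]
      · rw [wordFun_append, wordFun_append, wordFun_replicate, wordFun_replicate, h3,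
          Finset.prod_insert hj, Finset.prod_insert hj]
        ring
  obtain ⟨l, h1, h2, h3⟩ := key Finset.univ
  refine ⟨l, h1, h2, fun W Z => ?_⟩
  rw [h3]
  simp [monomial, letterFun, coord]

theorem exists_monomial_word (l : List (Fin d ⊕ Fin d)) : ∃ α β : Fin d → ℕ,
    ∑ j, α j = leftCount l ∧ ∑ j, β j = rightCount l ∧
      ∀ W Z, wordFun W l Z = (monomial α Z : ℂ) * (monomial β (Z - W) : ℂ) := by
  induction l with
  | nil => exact ⟨0, 0, by simp [leftCount], by simp [rightCount], fun W Z => by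
      simp [wordFun, monomial]⟩
  | cons c l ih =>
    obtain ⟨α, β, h1, h2, h3⟩ := ih
    have hm : ∀ (α : Fin d → ℕ) (j : Fin d) (Z : Space d),
        monomial (α + Pi.single j 1) Z = monomial α Z * Z j := fun α j Z => by
      have : ∏ k, Z k ^ (Pi.single j 1 : Fin d → ℕ) k = Z j := by
        rw [Finset.prod_eq_single j]
        · simp
        · intro k _ hk; simp [hk]
        · simp
      simp only [monomial, Pi.add_apply, pow_add, Finset.prod_mul_distrib, this]
    have hs : ∀ (α : Fin d → ℕ) (j : Fin d), ∑ k, (α + Pi.single j 1 : Fin d → ℕ) k = ∑ k, α k + 1 :=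
      fun α j => by simp [Finset.sum_add_distrib]
    rcases c with j | j
    · refine ⟨α + Pi.single j 1, β, ?_, ?_, fun W Z => ?_⟩
      · rw [hs, h1]; simp [leftCount, List.countP_cons]
      · rw [h2]; simp [rightCount]
      · rw [wordFun_cons]
        simp only [h3, hm, letterFun, Sum.elim_inl, coord]
        push_cast
        ring
    · refine ⟨α, β + Pi.single j 1, ?_, ?_, fun W Z => ?_⟩
      · rw [h1]; simp [leftCount]
      · rw [hs, h2]; simp [rightCount, List.countP_cons]
      · rw [wordFun_cons]
        simp only [h3, hm, letterFun, Sum.elim_inr, coord, PiLp.sub_apply]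
        push_cast
        ring

theorem mem_multiIndices {M : ℕ} {α : Fin d → ℕ} : α ∈ multiIndices d M ↔ ∑ j, α j ≤ M := by
  simp only [multiIndices, Finset.mem_filter, Fintype.mem_piFinset, Finset.mem_range,
    and_iff_right_iff_imp]
  intro h j
  exact Nat.lt_succ_iff.2 ((Finset.single_le_sum (fun _ _ => Nat.zero_le _)
    (Finset.mem_univ j)).trans h)

/-- The weighted norms control the norms of the products with words. -/
theorem sobolevNorm_wordFun_le (m : ℤ) {M N : ℕ} (W : Space d) (u : Space d → ℂ)
    {l : List (Fin d ⊕ Fin d)} (h1 : leftCount l ≤ M) (h2 : rightCount l ≤ N) :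
    sobolevNorm a m (fun Z => wordFun W l Z * u Z) ≤ weightedNorm a m M N W u := by
  obtain ⟨α, β, hα, hβ, e⟩ := exists_monomial_word l
  simp only [e]
  refine le_trans ?_ (Finset.single_le_sum (f := fun α => ∑ β ∈ multiIndices d N,
    sobolevNorm a m (fun Z => (monomial α Z : ℂ) * (monomial β (Z - W) : ℂ) * u Z))
    (fun _ _ => zero_le) (mem_multiIndices.2 (hα.trans_le h1)))
  exact Finset.single_le_sum (f := fun β => sobolevNorm a m
    (fun Z => (monomial α Z : ℂ) * (monomial β (Z - W) : ℂ) * u Z))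
    (fun _ _ => zero_le) (mem_multiIndices.2 (hβ.trans_le h2))

theorem exists_weightedNorm_le {M N : ℕ} (Y : List (Fin d ⊕ Fin d) → ℝ≥0∞)
    (hY : ∀ l, Y l ≠ ⊤) : ∃ C : ℝ, 0 < C ∧ ∀ (a : Fin d → Space d → ℝ) (m : ℤ) (W : Space d)
      (f : Space d → ℂ) (X : ℝ≥0∞), (∀ l : List (Fin d ⊕ Fin d), leftCount l ≤ M → rightCount l ≤ N →
        sobolevNorm a m (fun Z => wordFun W l Z * f Z) ≤ Y l * X) →
      weightedNorm a m M N W f ≤ ENNReal.ofReal C * X := by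
  choose l hl1 hl2 hl using fun α β : Fin d → ℕ => exists_word_monomial α β
  obtain ⟨D, hD⟩ : ∃ D, D = ∑ α ∈ multiIndices d M, ∑ β ∈ multiIndices d N, Y (l α β) := ⟨_, rfl⟩
  have hDtop : D ≠ ⊤ := by
    rw [hD]
    exact ENNReal.sum_ne_top.2 fun α _ => ENNReal.sum_ne_top.2 fun β _ => hY _
  refine ⟨D.toReal + 1, by positivity, fun a m W f X h => ?_⟩
  have h1 : weightedNorm a m M N W f ≤ D * X := by
    rw [hD, weightedNorm, Finset.sum_mul]
    refine Finset.sum_le_sum fun α hα => ?_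
    rw [Finset.sum_mul]
    refine Finset.sum_le_sum fun β hβ => ?_
    have := h (l α β) ((hl1 α β).trans_le (mem_multiIndices.1 hα))
      ((hl2 α β).trans_le (mem_multiIndices.1 hβ))
    simpa only [hl] using this
  refine h1.trans ?_
  gcongr
  rw [ENNReal.ofReal_add ENNReal.toReal_nonneg zero_le_one, ENNReal.ofReal_toReal hDtop]
  exact le_self_add

end

end MagneticSchrodinger

namespace MagneticSchrodinger

noncomputable section

variable {d : ℕ}

/-! ### The dual norms -/

section lower

open MagneticAlgebra

variable {B : Fin d → Fin d → Space d → ℂ} {V : Space d → ℂ}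

theorem FieldData.norm_nabWord_resFam_pow_le (h : FieldData B V) (T₀ : ℝ) {J : List (Fin d)} {k : ℕ}
    (hJ : J.length ≤ k) : ∃ C : ℝ, 0 ≤ C ∧ ∀ i : Space d × ℝ, |i.2| ≤ T₀ → ∀ y,
      ‖toL2 (nabWord B J i ((resFam B V true ^ k) i y))‖ ≤ C * ‖toL2 y‖ := by
  obtain ⟨C, q, hC0, hC⟩ := (h.wordBdd T₀ (p := k) (k := 0) (J := J) (by simpa using hJ) []
    (r_pow_mem_Cp (Q := h.algebra) k) : WordBdd B V T₀ 0 J 0 [] _)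
  refine ⟨C, hC0, fun i hi y => ?_⟩
  have := hC 0 i hi 0 y ‖toL2 y‖ fun l h1 h2 => by
    have : l = [] := by
      cases l with
      | nil => rfl
      | cons c l => rcases c with c | c <;> simp [leftCount, rightCount] at h1 h2
    rw [this, mulOp_wordFun_nil]
    simp
  have e : PowerSeries.coeff 0 (h.algebra.r true ^ k) = resFam B V true ^ k := by
    change PowerSeries.coeff 0 (PowerSeries.C (resFam B V true) ^ k) = _
    rw [← map_pow, PowerSeries.coeff_zero_C]
  rw [mulOp_wordFun_nil, e] at this
  simpa using this

theorem wordNorm_le_of_nabWord (i : Space d × ℝ) (m : ℕ) {v : SpaceS d} {K : ℝ}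
    (h : ∀ J : List (Fin d), J.length ≤ m → ‖toL2 (nabWord B J i v)‖ ≤ K) :
    wordNorm (nabOp (rayPot B i)) m v ≤ (1 + d) ^ m * K := by
  induction m generalizing v with
  | zero =>
    have := h [] (by simp)
    simpa [nabWord, wordNorm_zero] using this
  | succ m ih =>
    rw [wordNorm_succ]
    have h1 := ih fun J hJ => h J (by omega)
    have h2 : ∀ j, wordNorm (nabOp (rayPot B i)) m (nabOp (rayPot B i) j v) ≤ (1 + d) ^ m * K :=
      fun j => ih fun J hJ => by
        have := h (J ++ [j]) (by simpa using hJ)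
        simpa [nabWord, nabFam] using this
    refine (add_le_add h1 (Finset.sum_le_sum fun j _ => h2 j)).trans (le_of_eq ?_)
    simp
    ring

theorem norm_nabWord_le_wordNorm (i : Space d × ℝ) (J : List (Fin d)) (v : SpaceS d) :
    ‖toL2 (nabWord B J i v)‖ ≤ wordNorm (nabOp (rayPot B i)) J.length v := by
  induction J using List.reverseRecOn generalizing v with
  | nil => simp [nabWord, wordNorm_zero]
  | append_singleton J j ih =>
    have e : nabWord B (J ++ [j]) i v = nabWord B J i (nabOp (rayPot B i) j v) := by
      simp [nabWord, nabFam]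
    rw [e, List.length_append, List.length_singleton]
    exact (ih _).trans (wordNorm_apply_le_succ _ _ _ _)

/-- By the resolvent identity `R_i = U R_{-i}`, where `U` is the Cayley transform. It is isometric
and commutes with the powers of `R_i`. -/
theorem FieldData.norm_resFam_pow_eq (h : FieldData B V) (k : ℕ) (i : Space d × ℝ) (g : SpaceS d) :
    ‖toL2 ((resFam B V true ^ k) i g)‖ = ‖toL2 ((resFam B V false ^ k) i g)‖ := by
  have hp : (Complex.I).re = 0 := Complex.I_re
  have hp' : |(Complex.I).im| = 1 := by simp
  have e1 : resFam B V true i = cayleyFam B V true i * resFam B V false i := by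
    have := resOp_sub_resOp (h.admissible i) hp hp' (τ := -Complex.I) (by simp) (by simp)
    have e : resFam B V true i = resFam B V false i
        + (resOp (rayPot B i) (rayElec V i) Complex.I
          - resOp (rayPot B i) (rayElec V i) (-Complex.I)) := by
      simp [resFam, spectralPt]
    rw [e, this]
    simp only [cayleyFam, resFam, spectralPt, cond_true, cond_false, Pi.sub_apply, Pi.smul_apply,
      Pi.one_apply, sub_mul, one_mul, smul_mul_assoc]
    rw [show -Complex.I - Complex.I = -(2 * Complex.I) by ring, neg_smul, sub_eq_add_neg]
  have e2 : ∀ k : ℕ, Commute (cayleyFam B V true) (resFam B V true ^ k) := fun k => by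
    refine Commute.pow_right ?_ k
    exact ((Commute.refl (resFam B V true)).smul_left _ |> (Commute.one_left _).sub_left)
  induction k generalizing g with
  | zero => simp
  | succ k ih =>
    have e3 : (resFam B V true ^ (k + 1)) i g
        = cayleyFam B V true i ((resFam B V true ^ k) i (resFam B V false i g)) := by
      have e4 := congrArg (fun T : Op d => T (resFam B V false i g)) (congrFun (e2 k).eq i)
      simp only [Pi.mul_apply, Module.End.mul_apply] at e4
      rw [e4, pow_succ, Pi.mul_apply, e1]
      rfl
    rw [e3, pow_succ, Pi.mul_apply, Module.End.mul_apply, ← ih]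
    exact norm_cayley_apply (h.admissible i) (spectralPt_re true) (abs_spectralPt_im true) _

theorem FieldData.inner_resFam_pow (h : FieldData B V) (k : ℕ) (i : Space d × ℝ) (u w : SpaceS d) :
    inner ℂ (toL2 ((resFam B V false ^ k) i u)) (toL2 w)
      = inner ℂ (toL2 u) (toL2 ((resFam B V true ^ k) i w)) := by
  induction k generalizing u with
  | zero => simp
  | succ k ih =>
    rw [pow_succ, Pi.mul_apply, Module.End.mul_apply, ih, pow_succ', Pi.mul_apply,
      Module.End.mul_apply]
    have := inner_resOp (h.admissible i) (spectralPt_re false) (abs_spectralPt_im false) u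
      ((resFam B V true ^ k) i w)
    rw [show -spectralPt false = spectralPt true by simp [spectralPt]] at this
    exact this

theorem FieldData.exists_norm_nabWord_resFam_pow_le (h : FieldData B V) (T₀ : ℝ) (k : ℕ) :
    ∃ C : ℝ, 0 ≤ C ∧ ∀ i : Space d × ℝ, |i.2| ≤ T₀ → ∀ y (J : List (Fin d)), J.length ≤ k →
      ‖toL2 (nabWord B J i ((resFam B V true ^ k) i y))‖ ≤ C * ‖toL2 y‖ := by
  have hfin := List.finite_length_le (Fin d) k
  have key : ∀ s : Finset (List (Fin d)), (∀ J ∈ s, J.length ≤ k) → ∃ C : ℝ, 0 ≤ C ∧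
      ∀ i : Space d × ℝ, |i.2| ≤ T₀ → ∀ y, ∀ J ∈ s,
      ‖toL2 (nabWord B J i ((resFam B V true ^ k) i y))‖ ≤ C * ‖toL2 y‖ := by
    classical
    intro s
    induction s using Finset.induction_on with
    | empty => exact fun _ => ⟨0, le_rfl, fun _ _ _ J hJ => absurd hJ (Finset.notMem_empty J)⟩
    | insert J s _ ih =>
      intro hs
      obtain ⟨C, hC0, hC⟩ := ih fun J hJ => hs J (Finset.mem_insert_of_mem hJ)
      obtain ⟨C', hC0', hC'⟩ := h.norm_nabWord_resFam_pow_le T₀ (hs J (Finset.mem_insert_self J s))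
      refine ⟨C + C', by positivity, fun i hi y K hK => ?_⟩
      rw [add_mul]
      rcases Finset.mem_insert.1 hK with rfl | hK
      · exact (hC' i hi y).trans (le_add_of_nonneg_left (by positivity))
      · exact (hC i hi y K hK).trans (le_add_of_nonneg_right (by positivity))
  obtain ⟨C, hC0, hC⟩ := key hfin.toFinset fun J hJ => by simpa using hJ
  exact ⟨C, hC0, fun i hi y J hJ => hC i hi y J (by simpa using hJ)⟩

/-- Commutators of covariant derivatives with multiplications do not involve the potential, so
truncation is bounded in these norms uniformly over all potentials and all `|ε| ≤ 1`. -/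
theorem exists_wordNorm_cutoff_le_of_temperate {ι : Type*} {b : ι → Fin d → Space d → ℂ}
    (hb : ∀ i j, (b i j).HasTemperateGrowth) (m : ℕ) :
    ∃ C : ℝ, 0 ≤ C ∧ ∀ j ∈ {j : ι × ℝ | |j.2| ≤ 1}, ∀ u,
      wordNorm (fun c => nabOp (b j.1) c) m (mulOp (cutoff j.2) u)
        ≤ C * wordNorm (fun c => nabOp (b j.1) c) m u := by
  have hc : ∀ f ∈ multFam (d := d) {j : ι × ℝ | |j.2| ≤ 1}, ∀ c : Fin d,
      (fun j : ι × ℝ => nabOp (b j.1) c * f j - f j * nabOp (b j.1) c)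
        ∈ multFam {j : ι × ℝ | |j.2| ≤ 1} := fun f hf c =>
    nabOp_commutator_multFam (a := fun j : ι × ℝ => b j.1) (fun j => hb j.1) hf c
  have hm : (fun j : ι × ℝ => mulOp (d := d) (cutoff j.2)) ∈ multFam {j : ι × ℝ | |j.2| ≤ 1} :=
    mulOp_mem_multFam (cutoff_uCb.comp (Q := {j : ι × ℝ | |j.2| ≤ 1}) Prod.snd fun j hj => hj)
  exact wordNorm_le_of_stable (X := fun c (j : ι × ℝ) => nabOp (b j.1) c)
    (fun f hf => multFam_uBdd hf) hc m _ hm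

theorem FieldData.exists_wordNorm_cutoff_le (h : FieldData B V) (k : ℕ) :
    ∃ C : ℝ, 0 ≤ C ∧ ∀ m ≤ k, ∀ (i : Space d × ℝ) (ε : ℝ), |ε| ≤ 1 → ∀ u,
      wordNorm (nabOp (rayPot B i)) m (mulOp (cutoff ε) u)
        ≤ C * wordNorm (nabOp (rayPot B i)) m u := by
  have hstab := exists_wordNorm_cutoff_le_of_temperate (b := fun i => rayPot B i)
    fun i => (h.admissible i).temperate
  choose E hE0 hE using hstab
  refine ⟨∑ m ∈ Finset.range (k + 1), E m, Finset.sum_nonneg fun m _ => hE0 m,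
    fun m hm i ε hε u => ?_⟩
  have h1 := hE m (i, ε) hε u
  refine h1.trans ?_
  exact mul_le_mul_of_nonneg_right (Finset.single_le_sum (f := E) (fun m _ => hE0 m)
    (Finset.mem_range.2 (Nat.lt_succ_iff.2 hm))) (apply_nonneg _ _)

/-- The Sobolev norms of a truncated function. -/
theorem FieldData.sobolevNormNat_cutoff_le (h : FieldData B V) (T₀ : ℝ) (k : ℕ) :
    ∃ C : ℝ, 0 ≤ C ∧ ∀ (i : Space d × ℝ), |i.2| ≤ T₀ → ∀ (a : Fin d → Space d → ℝ),
      cxPot a = rayPot B i → ∀ (ε : ℝ), |ε| ≤ 1 → ∀ y : SpaceS d,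
      sobolevNormNat a k (fun Z => cutoff ε Z * (resFam B V true ^ k) i y Z)
        ≤ ENNReal.ofReal (C * ‖toL2 y‖) := by
  obtain ⟨D, hD0, hD⟩ := h.exists_norm_nabWord_resFam_pow_le T₀ k
  obtain ⟨E, hE0, hE⟩ := h.exists_wordNorm_cutoff_le k
  refine ⟨wordCount d k * (E * ((1 + d) ^ k * D)), by positivity, fun i hi a ha ε hε y => ?_⟩
  have hD' := hD i hi y
  generalize (resFam B V true ^ k) i y = v at hD' ⊢
  have hcut : (fun Z => cutoff ε Z * v Z) = (mulOp (cutoff ε) v : SpaceS d) := by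
    ext Z
    rw [mulOp_apply (cutoff_uCb.temperate ε)]
  have hw : wordNorm (nabOp (rayPot B i)) k v ≤ (1 + d) ^ k * (D * ‖toL2 y‖) :=
    wordNorm_le_of_nabWord i k hD'
  rw [hcut]
  refine (sobolevNormNat_le (X := ENNReal.ofReal (E * ((1 + d) ^ k * D) * ‖toL2 y‖))
    fun J hJ => ?_).trans (le_of_eq ?_)
  · refine (h.nablaNorm_le ha J _).trans ?_
    rw [enorm_toL2]
    refine ENNReal.ofReal_le_ofReal ((norm_nabWord_le_wordNorm i J _).trans
      ((hE J.length hJ i ε hε v).trans ?_))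
    refine (mul_le_mul_of_nonneg_left ((wordNorm_mono _ hJ v).trans hw) hE0).trans_eq ?_
    ring
  · rw [← ENNReal.ofReal_natCast, ← ENNReal.ofReal_mul (Nat.cast_nonneg _)]
    congr 1
    ring

/-- The Sobolev norm of order `m` controls the norm of a power of the resolvent. -/
theorem FieldData.exists_resFam_le_sobolevNorm (h : FieldData B V) (T₀ : ℝ) (m : ℤ) :
    ∃ C : ℝ, 0 < C ∧ ∀ (i : Space d × ℝ), |i.2| ≤ T₀ → ∀ (a : Fin d → Space d → ℝ),
      cxPot a = rayPot B i → ∀ (g : SpaceS d), HasCompactSupport g →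
      ENNReal.ofReal ‖toL2 ((resFam B V true ^ (-m).toNat) i g)‖
        ≤ ENNReal.ofReal C * sobolevNorm a m g := by
  cases m with
  | ofNat m =>
    refine ⟨1, one_pos, fun i hi a ha g hg => ?_⟩
    have hgt : IsTest (g : Space d → ℂ) := ⟨contDiff_infty.2 fun n => g.smooth n, hg⟩
    have h0 : (-(Int.ofNat m)).toNat = 0 := by simp
    rw [h0, pow_zero, ENNReal.ofReal_one, one_mul]
    have := enorm_le_sobolevNormNat (a := a) hgt m
    rw [enorm_toL2] at this
    exact this
  | negSucc m =>
    obtain ⟨C, hC0, hC⟩ := h.sobolevNormNat_cutoff_le T₀ (m + 1)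
    refine ⟨C + 1, by positivity, fun i hi a ha g hg => ?_⟩
    have h0 : (-(Int.negSucc m)).toNat = m + 1 := rfl
    -- Passing to `y = R_{-i}^k g` makes the duality exact: with `v = R_i^k y` one has `⟨v, g⟩ =
    -- ‖y‖²`, while the Sobolev norm of order `k` of `v` is at most a constant times `‖y‖`. As `v`
    -- need not have compact support, it is truncated away from the support of `g`, which leaves the
    -- pairing unchanged.
    rw [h0, h.norm_resFam_pow_eq]
    obtain ⟨X, hX⟩ : ∃ X, X = sobolevNorm a (Int.negSucc m) g := ⟨_, rfl⟩
    rw [← hX]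
    obtain ⟨y, hy⟩ : ∃ y, y = (resFam B V false ^ (m + 1)) i g := ⟨_, rfl⟩
    rw [← hy]
    obtain ⟨v, hv⟩ : ∃ v, v = (resFam B V true ^ (m + 1)) i y := ⟨_, rfl⟩
    -- a cutoff function that is `1` on the support of `g`
    obtain ⟨R, hR⟩ := hg.isCompact.isBounded.exists_norm_le
    obtain ⟨ε, hε0, hε1, hεR⟩ : ∃ ε : ℝ, 0 < ε ∧ ε ≤ 1 ∧ ε * |R| ≤ 1 := by
      refine ⟨(1 + |R|)⁻¹, by positivity, inv_le_one_of_one_le₀ (by simp), ?_⟩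
      rw [inv_mul_le_iff₀ (by positivity)]; simp
    have hvt : IsTest (fun Z => cutoff ε Z * v Z) :=
      isTest_cutoff_mul hε0.ne' (contDiff_infty.2 fun n => v.smooth n)
    have hpair : ∫ Z, g Z * conj (cutoff ε Z * v Z) = inner ℂ (toL2 v) (toL2 g) := by
      rw [inner_toL2_left]
      refine integral_congr_ae ?_
      filter_upwards [toL2_ae g] with Z hZ
      rw [hZ]
      by_cases hZg : g Z = 0
      · simp [hZg]
      · have h1 : ‖Z‖ ≤ R := hR Z (subset_tsupport _ hZg)
        rw [cutoff_eq_one, one_mul]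
        rw [norm_smul, Real.norm_of_nonneg hε0.le]
        exact (mul_le_mul_of_nonneg_left (h1.trans (le_abs_self R)) hε0.le).trans hεR
    have hnorm : ‖∫ Z, g Z * conj (cutoff ε Z * v Z)‖ₑ = ENNReal.ofReal (‖toL2 y‖ ^ 2) := by
      rw [hpair, ← ofReal_norm]
      congr 1
      rw [← inner_conj_symm, RCLike.norm_conj, hv, ← h.inner_resFam_pow, ← hy,
        inner_self_eq_norm_sq_to_K]
      simp
    have hS := hC i hi a ha ε (by rwa [abs_of_pos hε0]) y
    rw [← hv] at hS
    obtain ⟨s, hs⟩ : ∃ s, s = sobolevNormNat a (m + 1) (fun Z => cutoff ε Z * v Z) := ⟨_, rfl⟩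
    have hdiv : ENNReal.ofReal (‖toL2 y‖ ^ 2) / s ≤ X := by
      rw [← hnorm, hX, hs]
      exact le_iSup₂ (f := fun (v : Space d → ℂ) (_ : IsTest v) =>
        ‖∫ Z, g Z * conj (v Z)‖ₑ / sobolevNormNat a (m + 1) v) _ hvt
    rw [← hs] at hS
    rcases (norm_nonneg (toL2 y)).eq_or_lt with hy0 | hy0
    · rw [← hy0]; simp
    by_cases hXt : X = ⊤
    · rw [hXt, ENNReal.mul_top (by simpa using by positivity)]; exact le_top
    have hmul : ENNReal.ofReal (‖toL2 y‖ ^ 2) ≤ X * ENNReal.ofReal (C * ‖toL2 y‖) := by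
      refine le_trans ?_ (mul_le_mul_right hS X)
      refine (ENNReal.div_le_iff_le_mul (Or.inr hXt) (Or.inl ?_)).1 hdiv
      exact ne_top_of_le_ne_top ENNReal.ofReal_ne_top hS
    rw [← ENNReal.ofReal_toReal hXt, ← ENNReal.ofReal_mul ENNReal.toReal_nonneg] at hmul
    have h1 := (ENNReal.ofReal_le_ofReal_iff (by positivity)).1 hmul
    have h2 : ‖toL2 y‖ ≤ C * X.toReal := by nlinarith
    rw [← ENNReal.ofReal_toReal hXt, ← ENNReal.ofReal_mul (by positivity)]
    refine ENNReal.ofReal_le_ofReal (h2.trans ?_)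
    have : 0 ≤ X.toReal := ENNReal.toReal_nonneg
    nlinarith

end lower

end

end MagneticSchrodinger

namespace MagneticSchrodinger

noncomputable section

variable {d : ℕ}


/-! ### The main estimate -/

theorem conj_wordFun (W : Space d) (l : List (Fin d ⊕ Fin d)) (Z : Space d) :
    conj (wordFun W l Z) = wordFun W l Z := by
  obtain ⟨α, β, -, -, e⟩ := exists_monomial_word l
  rw [e, map_mul, Complex.conj_ofReal, Complex.conj_ofReal]

section estimate

variable {B : Fin d → Fin d → Space d → ℂ} {V : Space d → ℂ}

/-- Both weights and derivatives are moved onto the test function. Each side of the weak identity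
then becomes a continuous functional on `L²`, which can be applied to the series term by term. -/
theorem FieldData.isWeakNabla_tsum (h : FieldData B V) {a : Fin d → Space d → ℝ} {i : Space d × ℝ}
    (ha : cxPot a = rayPot B i) (J : List (Fin d)) (l : List (Fin d ⊕ Fin d)) (W : Space d)
    {c : ℤ → ℂ} {y : ℤ → SpaceS d} (h1 : Summable fun n => c n • toL2 (y n))
    (h2 : Summable fun n => c n • toL2 (nabWord B J i (mulOp (wordFun W l) (y n)))) :
    IsWeakNabla a J (fun Z => wordFun W l Z * (∑' n, c n • toL2 (y n) : L2 d) Z)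
      (∑' n, c n • toL2 (nabWord B J i (mulOp (wordFun W l) (y n)))) := fun v hv => by
  rw [← inner_toL2_test hv]
  have e1 : ∫ Z, wordFun W l Z * (∑' n, c n • toL2 (y n) : L2 d) Z * conj (nablaList a J.reverse v Z)
      = inner ℂ (toL2 (mulOp (wordFun W l) (nabWord B J.reverse i hv.schwartz)))
        (∑' n, c n • toL2 (y n) : L2 d) := by
    rw [inner_toL2_left]
    congr 1
    ext Z
    rw [mulOp_apply (wordFun_temperate W l), map_mul, conj_wordFun, h.coe_nabWord ha,
      hv.coe_schwartz]
    ring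
  have s1 := h1.hasSum.mapL (innerSL ℂ (toL2 (mulOp (wordFun W l)
    (nabWord B J.reverse i hv.schwartz))))
  have s2 := h2.hasSum.mapL (innerSL ℂ (toL2 hv.schwartz))
  simp only [innerSL_apply_apply, inner_smul_right] at s1 s2
  rw [e1]
  refine s1.unique ?_
  convert s2 using 2 with n
  rw [inner_mulOp_real (wordFun_temperate W l) (conj_wordFun W l), h.inner_nabWord]

theorem FieldData.exists_isWeakNabla_zSum (h : FieldData B V) (T₀ : ℝ) {p k e : ℕ}
    {S T : FamSeries d} (hS : S ∈ h.algebra.Wt (h.algebra.Cp p) e)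
    (hT : T ∈ h.algebra.Wt (h.algebra.Cp p) e) {c : ℤ → ℂ}
    (hc : ∀ k : ℕ, Summable fun n : ℤ => (1 + |(n : ℝ)|) ^ k * ‖c n‖) {J : List (Fin d)}
    (hp : J.length + k ≤ p) (l : List (Fin d ⊕ Fin d)) :
    ∃ C : ℝ, 0 ≤ C ∧ ∀ (x₀ : Space d) (t : ℝ), |t| ≤ T₀ → ∀ a : Fin d → Space d → ℝ,
      cxPot a = rayPot B (x₀, t) → ∀ (W : Space d) (u : SpaceS d) (K : ℝ),
      (∀ l', leftCount l' ≤ leftCount l + e → rightCount l' ≤ rightCount l →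
        ‖toL2 ((resFam B V true ^ k) (x₀, t) (mulOp (wordFun W l') u))‖ ≤ K) →
      ∃ w : L2 d, IsWeakNabla a J (fun Z => wordFun W l Z * zSum c S T x₀ u t Z) w ∧
        ‖w‖ ≤ C * K := by
  obtain ⟨C, q, hC0, hC⟩ := (h.wordBdd T₀ hp l hS).zCoeff (h.wordBdd T₀ hp l hT)
  refine ⟨C * ∑' n : ℤ, (1 + |(n : ℝ)|) ^ q * ‖c n‖,
    mul_nonneg hC0 (tsum_nonneg fun n => by positivity), fun x₀ t ht a ha W u K hK => ?_⟩
  have hb : ∀ n : ℤ, ‖c n • toL2 (nabWord B J (x₀, t) (mulOp (wordFun W l)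
      (zCoeff S T n (x₀, t) u)))‖ ≤ C * K * ((1 + |(n : ℝ)|) ^ q * ‖c n‖) := fun n => by
    rw [norm_smul, mul_comm]
    refine (mul_le_mul_of_nonneg_right (hC n (x₀, t) ht W u K hK) (norm_nonneg _)).trans_eq ?_
    ring
  have hs := ((hc q).mul_left (C * K))
  refine ⟨_, h.isWeakNabla_tsum ha J l W (h.summable_zCoeff hS hT hc x₀ u t)
    (Summable.of_norm_bounded hs hb), ?_⟩
  refine (tsum_of_norm_bounded hs.hasSum hb).trans_eq ?_
  rw [tsum_mul_left]
  ring

theorem FieldData.exists_sobolevNorm_zSum_le (h : FieldData B V) (T₀ : ℝ) {p k e : ℕ}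
    {S T : FamSeries d} (hS : S ∈ h.algebra.Wt (h.algebra.Cp p) e)
    (hT : T ∈ h.algebra.Wt (h.algebra.Cp p) e) {c : ℤ → ℂ}
    (hc : ∀ k : ℕ, Summable fun n : ℤ => (1 + |(n : ℝ)|) ^ k * ‖c n‖) (m : ℤ)
    (hp : m.toNat + k ≤ p) (l : List (Fin d ⊕ Fin d)) :
    ∃ C : ℝ, 0 ≤ C ∧ ∀ (x₀ : Space d) (t : ℝ), |t| ≤ T₀ → ∀ a : Fin d → Space d → ℝ,
      cxPot a = rayPot B (x₀, t) → ∀ (W : Space d) (u : SpaceS d) (K : ℝ),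
      (∀ l', leftCount l' ≤ leftCount l + e → rightCount l' ≤ rightCount l →
        ‖toL2 ((resFam B V true ^ k) (x₀, t) (mulOp (wordFun W l') u))‖ ≤ K) →
      sobolevNorm a m (fun Z => wordFun W l Z * zSum c S T x₀ u t Z)
        ≤ ENNReal.ofReal (C * K) := by
  have hfin := List.finite_length_le (Fin d) m.toNat
  choose! C hC0 hC using fun (J : List (Fin d)) (hJ : J.length ≤ m.toNat) =>
    h.exists_isWeakNabla_zSum T₀ (k := k) (J := J) hS hT hc (by omega) l
  have hC0' : ∀ J ∈ hfin.toFinset, 0 ≤ C J := fun J hJ => hC0 J (by simpa using hJ)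
  have hsum := Finset.sum_nonneg hC0'
  refine ⟨(wordCount d m.toNat + 1 : ℕ) * ∑ J ∈ hfin.toFinset, C J, by positivity,
    fun x₀ t ht a ha W u K hK => ?_⟩
  have hK0 : 0 ≤ K := (norm_nonneg _).trans (hK [] (by simp [leftCount]) (by simp [rightCount]))
  rw [mul_assoc, ENNReal.ofReal_mul (Nat.cast_nonneg _), ENNReal.ofReal_natCast]
  refine sobolevNorm_le fun J hJ => ?_
  obtain ⟨w, hw, hwK⟩ := hC J hJ x₀ t ht a ha W u K hK
  refine ⟨w, hw, ?_⟩
  rw [← ofReal_norm]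
  refine ENNReal.ofReal_le_ofReal (hwK.trans (mul_le_mul_of_nonneg_right ?_ hK0))
  exact Finset.single_le_sum hC0' (by simpa using hJ)

/-- Weighted estimates for the sum of the series. -/
theorem FieldData.exists_weightedNorm_zSum_le (h : FieldData B V) (T₀ : ℝ) {p e : ℕ}
    {S T : FamSeries d} (hS : S ∈ h.algebra.Wt (h.algebra.Cp p) e)
    (hT : T ∈ h.algebra.Wt (h.algebra.Cp p) e) {c : ℤ → ℂ}
    (hc : ∀ k : ℕ, Summable fun n : ℤ => (1 + |(n : ℝ)|) ^ k * ‖c n‖) (m m' : ℤ)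
    (hp : m.toNat + (-m').toNat ≤ p) (M N : ℕ) :
    ∃ C : ℝ, 0 < C ∧ ∀ (x₀ : Space d) (t : ℝ), |t| ≤ T₀ → ∀ a : Fin d → Space d → ℝ,
      cxPot a = rayPot B (x₀, t) → ∀ (W : Space d) (u : SpaceS d), HasCompactSupport u →
      weightedNorm a m M N W (zSum c S T x₀ u t)
        ≤ ENNReal.ofReal C * weightedNorm a m' (M + e) N W u := by
  obtain ⟨C₁, hC₁0, hC₁⟩ := h.exists_resFam_le_sobolevNorm T₀ m'
  choose D hD0 hD using h.exists_sobolevNorm_zSum_le T₀ hS hT hc m hp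
  obtain ⟨C, hC0, hC⟩ := exists_weightedNorm_le (d := d) (M := M) (N := N)
    (fun l => ENNReal.ofReal (D l * C₁)) fun l => ENNReal.ofReal_ne_top
  refine ⟨C, hC0, fun x₀ t ht a ha W u hu => ?_⟩
  -- An infinite right-hand side makes the claim trivial. Otherwise its real value times `C₁` is the
  -- bound `K` for the weighted functions under the resolvent power.
  by_cases hX : weightedNorm a m' (M + e) N W u = ⊤
  · rw [hX, ENNReal.mul_top (by simpa using hC0)]
    exact le_top
  refine hC a m W _ _ fun l h1 h2 => ?_
  refine (hD l x₀ t ht a ha W u (C₁ * (weightedNorm a m' (M + e) N W u).toReal)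
    fun l' h1' h2' => ?_).trans (le_of_eq ?_)
  · have hcoe : (mulOp (wordFun W l') u : Space d → ℂ) = fun Z => wordFun W l' Z * u Z :=
      funext fun Z => mulOp_apply (wordFun_temperate W l') u Z
    have h3 := hC₁ (x₀, t) ht a ha (mulOp (wordFun W l') u) (by rw [hcoe]; exact hu.mul_left)
    rw [hcoe] at h3
    have h4 := h3.trans (mul_le_mul_right (sobolevNorm_wordFun_le (a := a) m' (M := M + e) (N := N)
      W u (l := l') (by omega) (by omega)) (ENNReal.ofReal C₁))
    rw [← ENNReal.ofReal_toReal hX, ← ENNReal.ofReal_mul hC₁0.le] at h4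
    exact (ENNReal.ofReal_le_ofReal_iff (by positivity)).1 h4
  · rw [← mul_assoc, ENNReal.ofReal_mul (mul_nonneg (hD0 l) hC₁0.le), ENNReal.ofReal_toReal hX]

end estimate

end

end MagneticSchrodinger

/-! ### Smoothness in the parameter and the weighted estimates. -/

open MagneticSchrodinger in
theorem theorem8 (d : ℕ) (A : Fin d → Space d → ℝ) (V : Space d → ℝ) (φ : 𝓢(ℝ, ℂ))
    (hA : ∀ j, ContDiff ℝ ∞ (A j))
    (hB : ∀ j k, IsCbInfty (magneticField A j k))
    (hV : IsCbInfty V) :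
    (∀ (x₀ : Space d) (u : Space d → ℂ) (hu : IsTest u),
      ContDiffOn ℝ ∞ (fun s : ℝ => functionOf φ (rescaledOp A V x₀ s) hu.toL2) (Ioi 0)) ∧
    ∀ t₀ : ℝ, 0 < t₀ → ∀ (r : ℕ) (m m' : ℤ) (M N : ℕ), ∃ C : ℝ, 0 < C ∧
      ∀ (x₀ : Space d) (t : ℝ), t ∈ Ioc 0 t₀ → ∀ (W : Space d) (u : Space d → ℂ) (hu : IsTest u),
        weightedNorm (rescaledPotential A x₀ t) m M N W
            (iteratedDeriv r
              (fun s : ℝ => functionOf φ (rescaledOp A V x₀ s) hu.toL2) t : L2 d) ≤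
          ENNReal.ofReal C *
            weightedNorm (rescaledPotential A x₀ t) m' (M + 2 * r) N W u := by
  have h := fieldData hA hB hV
  have hc : ∀ p k : ℕ, Summable fun n : ℤ => (1 + |(n : ℝ)|) ^ k * ‖angularCoeff (twist p φ) n‖ :=
    fun p => summable_angularCoeff (twist p φ)
  refine ⟨fun x₀ u hu => ?_, fun t₀ _ r m m' M N => ?_⟩
  -- Smoothness in `L²` requires no resolvent factors, so `p = 0`.
  · obtain ⟨S, T, hS, hT, hdS, hdT, hST⟩ := h.exists_series 0
    have hsmooth := contDiff_of_hasDerivAt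
      (F := fun r => zSum (angularCoeff (twist 0 φ)) (S r) (T r) x₀ hu.schwartz)
      fun r t => h.hasDerivAt_zSum (hS r) (hT r) (hS (r + 1)) (hT (r + 1)) (hdS r) (hdT r) (hc 0)
        x₀ hu.schwartz t
    exact hsmooth.contDiffOn.congr fun t ht =>
      functionOf_rescaledOp_eq h φ hST x₀ (ne_of_gt ht) hu
  -- The number of resolvents covers the at most `max m 0` covariant derivatives on the left and the
  -- `max (-m') 0` resolvents needed for the dual norm of `u`.
  · obtain ⟨S, T, hS, hT, hdS, hdT, hST⟩ := h.exists_series (m.toNat + (-m').toNat)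
    obtain ⟨C, hC0, hC⟩ := h.exists_weightedNorm_zSum_le t₀ (hS r) (hT r)
      (hc (m.toNat + (-m').toNat)) m m' le_rfl M N
    refine ⟨C, hC0, fun x₀ t ht W u hu => ?_⟩
    have hder := iteratedDeriv_eq_of_hasDerivAt
      (F := fun r => zSum (angularCoeff (twist (m.toNat + (-m').toNat) φ)) (S r) (T r) x₀ hu.schwartz)
      (fun r t => h.hasDerivAt_zSum (hS r) (hT r) (hS (r + 1)) (hT (r + 1)) (hdS r) (hdT r) (hc _)
        x₀ hu.schwartz t) r
    have heq : (fun s : ℝ => functionOf φ (rescaledOp A V x₀ s) hu.toL2) =ᶠ[nhds t]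
        zSum (angularCoeff (twist (m.toNat + (-m').toNat) φ)) (S 0) (T 0) x₀ hu.schwartz := by
      filter_upwards [Ioi_mem_nhds ht.1] with s hs
      exact functionOf_rescaledOp_eq h φ hST x₀ (ne_of_gt hs) hu
    rw [heq.iteratedDeriv_eq, hder]
    exact hC x₀ t (by rw [abs_of_pos ht.1]; exact ht.2) _ (cxPot_rescaledPotential A x₀ ht.1.ne') W
      hu.schwartz hu.2
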